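/- **Setting.** Let $\Omega\subset\mathbb R^d$, $d\in\{2,3\}$, be a Lipschitz polytopal domain whose boundary is partitioned into disjoint, relatively open, polytopal (possibly empty) parts $\Gamma_D,\Gamma_N,\Gamma_R$ with $\partial\Omega=\overline{\Gamma_D}\cup\overline{\Gamma_N}\cup\overline{\Gamma_R}$. Let $\mu>0$ and the symmetric positive definite matrix $A$ be constant on each member of a finite polytopal partition $\mathscr P$ of $\Omega$, let $\gamma>0$ be constant on each member of a finite polytopal partition $\mathscr Q$ of $\Gamma_R$, and let $\omega>0$. Functions are complex valued, $(\phi,v)_D=\int_D\phi\,\overline v$, $\|v\|_{w,D}^2=(wv,v)_D$, and $H^1_{\Gamma_D}(\Omega)$ is the space of $v\in H^1(\Omega)$ with zero trace on $\Gamma_D$. Put $$b(\phi,v)=-\omega^2(\mu\phi,v)_\Omega-i\omega(\gamma\phi,v)_{\Gamma_R}+(A\nabla\phi,\nabla v)_\Omega,\qquad \|v\|_{\omega,\Omega}^2=\omega^2\|v\|_{\mu,\Omega}^2+\omega\|v\|_{\gamma,\Gamma_R}^2+\|\nabla v\|_{A,\Omega}^2 .$$ Assume well-posedness: the minimum over $\phi\in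 H^1_{\Gamma_D}(\Omega)$, $\|\phi\|_{\omega,\Omega}=1$, of the maximum over $v\in H^1_{\Gamma_D}(\Omega)$, $\|v\|_{\omega,\Omega}=1$, of $\operatorname{Re}b(\phi,v)$ is positive. Let $f\in L^2(\Omega)$ and let $u\in H^1_{\Gamma_D}(\Omega)$ satisfy $b(u,v)=(f,v)_\Omega$ for all $v\in H^1_{\Gamma_D}(\Omega)$. Let $X_{\Gamma_N}(\operatorname{div},\Omega)$ be the space of $w\in H(\operatorname{div},\Omega)$ with $w\cdot n=0$ on $\Gamma_N$ and $w\cdot n\in L^2(\Gamma_R)$ on $\Gamma_R$ (normal traces in the weak sense). **Discretization.** Let $\mathcal T_h$ be a matching simplicial mesh of $\Omega$ such that each $K\in\mathcal T_h$ lies in the closure of one $P\in\mathscr P$, each boundary face lies in $\overline{\Gamma_D}$, $\overline{\Gamma_N}$ or $\overline{\Gamma_R}$, and each face in $\overline{\Gamma_R}$ lies in the closure of one $Q\in\mathscr Q$. Let $\mathcal F_h$ be the set of faces, $\mathcal F_h^R$ the set of faces in $\overline{\Gamma_R}$, and $n_F$ a fixed unit normal of $F$, pointing outside $\Omega$ on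 boundary faces. Let $h_K,h_F$ be the diameters of $K$ and $F$, $\mu_K$ the value of $\mu$ on $K$, $\alpha_K$ the smallest eigenvalue of $A$ on $K$, $\vartheta_K=\sqrt{\alpha_K/\mu_K}$, and for $F\in\mathcal F_h^R$ let $\gamma_F$ be the value of $\gamma$ on $F$, $\alpha_F=\alpha_K$ for the element $K$ having $F$ as a face, and $\vartheta_F=\alpha_F/\gamma_F$. Fix $p\ge1$; $\mathcal P_p(\mathcal T_h)$ is the space of functions that are polynomials of total degree at most $p$ on each element, $\boldsymbol{\mathcal P}_p(\mathcal T_h)=[\mathcal P_p(\mathcal T_h)]^d$, and $H^1(\mathcal T_h)$ is the broken Sobolev space, $\nabla$ being taken elementwise. The jump $[\![\phi]\!]_F$ is $\phi_+n_+\cdot n_F+\phi_-n_-\cdot n_F$ on interior faces, $\phi|_F$ on faces in $\overline{\Gamma_D}$, and $0$ on the other boundary faces; the average $\{\!\{w\}\!\}_F$ is $\frac12(w_++w_-)$ on interior faces and $w|_F$ on boundary faces. The lifting $\mathfrak L(\phi)\in\boldsymbol{\mathcal P}_p(\mathcal T_h)$ is defined by $$(\mathfrak L(\phi),w_h)_\Omega=\sum_{F\in\mathcal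 F_h}([\![\phi]\!]_F,\{\!\{w_h\}\!\}_F\cdot n_F)_F\qquad\forall w_h\in\boldsymbol{\mathcal P}_p(\mathcal T_h),$$ and $\mathfrak G(\phi)=\nabla\phi-\mathfrak L(\phi)$. Let $s_h$ be any sesquilinear form on $H^1(\mathcal T_h)$ with $s_h(\phi,v)=0$ whenever $\phi$ or $v$ belongs to $H^1_{\Gamma_D}(\Omega)$, and let $$b_h(\phi,v)=-\omega^2(\mu\phi,v)_\Omega-i\omega\sum_{F\in\mathcal F_h^R}(\gamma\phi,v)_F+(A\mathfrak G(\phi),\mathfrak G(v))_\Omega+s_h(\phi,v).$$ Let $u_h\in\mathcal P_p(\mathcal T_h)$ be any function with $b_h(u_h,v_h)=(f,v_h)_\Omega$ for all $v_h\in\mathcal P_p(\mathcal T_h)$; unique solvability of this problem is not assumed. **Norms.** Define $$\|v\|_{\omega,\mathcal T_h}^2=\omega^2\|v\|_{\mu,\Omega}^2+\omega\sum_{F\in\mathcal F_h^R}\|v\|_{\gamma,F}^2+\|\mathfrak G(v)\|_{A,\Omega}^2,$$ $$\|v\|_{\dagger,1,\mathcal T_h}^2=\sum_{K\in\mathcal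 T_h}\Big\{\max\Big(1,\frac{\omega^2h_K^2}{\vartheta_K^2}\Big)\frac{\alpha_K}{h_K^2}\|v\|_K^2+\|\mathfrak G(v)\|_{A,K}^2\Big\}+\sum_{F\in\mathcal F_h^R}\max\Big(1,\frac{\omega h_F}{\vartheta_F}\Big)\frac{\alpha_F}{h_F}\|v\|_F^2,$$ $$\|w\|_{\dagger,\operatorname{div},\mathcal T_h}^2=\sum_{K\in\mathcal T_h}\Big\{\|w\|_{A^{-1},K}^2+\frac{h_K^2}{\alpha_K}\|\operatorname{div}w\|_K^2\Big\}+\sum_{F\in\mathcal F_h^R}\frac{h_F}{\alpha_F}\|w\cdot n\|_F^2 .$$ Let $\pi^g v$ and $\pi_h^g v$ minimize $\|v-\cdot\|_{\dagger,1,\mathcal T_h}$ over $H^1_{\Gamma_D}(\Omega)$ and over $\mathcal P_p(\mathcal T_h)\cap H^1_{\Gamma_D}(\Omega)$ respectively, and let $\pi_h^d w$ minimize $\|w-\cdot\|_{\dagger,\operatorname{div},\mathcal T_h}$ over $\boldsymbol{\mathcal P}_p(\mathcal T_h)\cap X_{\Gamma_N}(\operatorname{div},\Omega)$. **Approximation factor.**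 For $\psi\in L^2(\Omega)$ and $\Psi\in L^2(\Gamma_R)$ let $u^\star_\psi,U^\star_\Psi\in H^1_{\Gamma_D}(\Omega)$ satisfy $b(w,u^\star_\psi)=\omega(\mu w,\psi)_\Omega$ and $b(w,U^\star_\Psi)=\omega^{1/2}(\gamma w,\Psi)_{\Gamma_R}$ for all $w\in H^1_{\Gamma_D}(\Omega)$. Let $$\check\gamma_g=\sup_{\|\psi\|_{\mu,\Omega}=1}\|u^\star_\psi-\pi_h^gu^\star_\psi\|_{\dagger,1,\mathcal T_h},\qquad \tilde\gamma_g=\sup_{\|\Psi\|_{\gamma,\Gamma_R}=1}\|U^\star_\Psi-\pi_h^gU^\star_\Psi\|_{\dagger,1,\mathcal T_h},$$ $$\check\gamma_d=\sup_{\|\psi\|_{\mu,\Omega}=1}\|A\nabla u^\star_\psi-\pi_h^d(A\nabla u^\star_\psi)\|_{\dagger,\operatorname{div},\mathcal T_h},\qquad \tilde\gamma_d=\sup_{\|\Psi\|_{\gamma,\Gamma_R}=1}\|A\nabla U^\star_\Psi-\pi_h^d(A\nabla U^\star_\Psi)\|_{\dagger,\operatorname{div},\mathcal T_h}$$ (suprema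 in $[0,\infty]$, with $\tilde\gamma_g=\tilde\gamma_d=0$ if $\Gamma_R=\emptyset$), and $\gamma_{ba}^2=(4\check\gamma_g^2+2\tilde\gamma_g^2)+(4\check\gamma_d^2+2\tilde\gamma_d^2)$. **Theorem 5.2 (Abstract reliability).** Let $$R_r=\sup_{v\in H^1_{\Gamma_D}(\Omega),\ \|\nabla v\|_{A,\Omega}=1}|b_h(u-u_h,v)|,\qquad R_c=\|u_h-\pi^gu_h\|_{\dagger,1,\mathcal T_h},\qquad R^2=R_r^2+R_c^2 .$$ Then $$\|u-u_h\|_{\omega,\mathcal T_h}\le\sqrt{1+\gamma_{ba}^2}\;R .$$ -/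

import Mathlib

open scoped MeasureTheory ENNReal NNReal Topology ComplexConjugate
open MeasureTheory Filter

noncomputable section

namespace IPDG

/-- The ambient space `ℝ^d` with its Euclidean norm. -/
abbrev Vec (d : ℕ) := EuclideanSpace ℝ (Fin d)

/-- Complex vectors, the values of gradients and fluxes. -/
abbrev CVec (d : ℕ) := EuclideanSpace ℂ (Fin d)

variable {d : ℕ}

/-! ### Linear algebra -/

/-- The sesquilinear form `B w · conj z`. -/
def sesq (B : Matrix (Fin d) (Fin d) ℝ) (w z : CVec d) : ℂ :=
  ∑ i, ∑ j, (B i j : ℂ) * w j * conj (z i)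

/-- The product `B w` of a real matrix and a complex vector. -/
def matVec (B : Matrix (Fin d) (Fin d) ℝ) (w : CVec d) : CVec d :=
  WithLp.toLp 2 (fun i => ∑ j, (B i j : ℂ) * w j)

/-- The smallest value of `B ξ · ξ` over real unit vectors `ξ`. -/
def minEig (B : Matrix (Fin d) (Fin d) ℝ) : ℝ :=
  ⨅ ξ : Metric.sphere (0 : Vec d) 1, ∑ i, ∑ j, B i j * ξ.1 j * ξ.1 i

/-! ### Weak derivatives, Sobolev functions and traces -/

/-- The `i`-th partial derivative. -/
def pderiv {G : Type*} [NormedAddCommGroup G] [NormedSpace ℝ G]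
    (η : Vec d → G) (i : Fin d) (x : Vec d) : G :=
  fderiv ℝ η x (EuclideanSpace.single i 1)

/-- Real-valued test functions, smooth and compactly supported in `D`. -/
def IsTest (D : Set (Vec d)) (η : Vec d → ℝ) : Prop :=
  ContDiff ℝ ((⊤ : ℕ∞) : WithTop ℕ∞) η ∧ HasCompactSupport η ∧ tsupport η ⊆ D

/-- `g ∈ L²(D)` is the gradient of `v` on `D` in the sense of distributions. -/
def HasWeakGrad (D : Set (Vec d)) (v : Vec d → ℂ) (g : Vec d → CVec d) : Prop :=
  MemLp g 2 (volume.restrict D) ∧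
    ∀ η, IsTest D η → ∀ i,
      ∫ x in D, v x * ((pderiv η i x : ℝ) : ℂ) = -∫ x in D, g x i * (η x : ℂ)

/-- `r ∈ L²(D)` is the divergence of `w` on `D` in the sense of distributions. -/
def HasWeakDiv (D : Set (Vec d)) (w : Vec d → CVec d) (r : Vec d → ℂ) : Prop :=
  MemLp r 2 (volume.restrict D) ∧
    ∀ η, IsTest D η →
      ∫ x in D, ∑ i, w x i * ((pderiv η i x : ℝ) : ℂ) = -∫ x in D, r x * (η x : ℂ)

/-- `v ∈ H¹(D)`. -/
def MemH1 (D : Set (Vec d)) (v : Vec d → ℂ) : Prop :=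
  MemLp v 2 (volume.restrict D) ∧ ∃ g, HasWeakGrad D v g

/-- The weak gradient of `v` on `D` (unique almost everywhere if it exists). -/
def weakGrad (D : Set (Vec d)) (v : Vec d → ℂ) : Vec d → CVec d :=
  Classical.epsilon (HasWeakGrad D v)

/-- The weak divergence of `w` on `D` (unique almost everywhere if it exists). -/
def weakDiv (D : Set (Vec d)) (w : Vec d → CVec d) : Vec d → ℂ :=
  Classical.epsilon (HasWeakDiv D w)

/-- The surface measure: the `(d-1)`-dimensional Hausdorff measure, in the Euclidean
normalisation (length of segments if `d = 2`, area of triangles if `d = 3`). -/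
def surf (d : ℕ) : Measure (Vec d) := μHE[d - 1]

/-- The classical gradient of a smooth function. -/
def classicalGrad (φ : Vec d → ℂ) (x : Vec d) : CVec d :=
  WithLp.toLp 2 (fun i => pderiv φ i x)

/-- `t ∈ L²(∂D)` is the trace of `v ∈ H¹(D)` on `∂D`: the trace operator is the continuous
extension of the restriction to `∂D` of functions that are smooth up to the boundary. -/
def IsTrace (D : Set (Vec d)) (v t : Vec d → ℂ) : Prop :=
  MemLp t 2 ((surf d).restrict (frontier D)) ∧
    ∃ φ : ℕ → Vec d → ℂ, (∀ n, ContDiff ℝ ((⊤ : ℕ∞) : WithTop ℕ∞) (φ n)) ∧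
      Tendsto (fun n => eLpNorm (φ n - v) 2 (volume.restrict D)) atTop (𝓝 0) ∧
      Tendsto (fun n => eLpNorm (classicalGrad (φ n) - weakGrad D v) 2 (volume.restrict D))
        atTop (𝓝 0) ∧
      Tendsto (fun n => eLpNorm (φ n - t) 2 ((surf d).restrict (frontier D))) atTop (𝓝 0)

/-- The trace of `v` on `∂D` (unique almost everywhere on the Lipschitz domains used here). -/
def trace (D : Set (Vec d)) (v : Vec d → ℂ) : Vec d → ℂ :=
  Classical.epsilon (IsTrace D v)

/-! ### Domains -/

/-- Bounded Lipschitz domain: bounded, open, connected, nonempty, and near each boundary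
point the set lies on one side of the graph of a Lipschitz function. Here `e` is the direction
of the last local coordinate, and `ζ` only depends on the other ones. -/
def IsLipschitzDomain (Ω : Set (Vec d)) : Prop :=
  IsOpen Ω ∧ IsConnected Ω ∧ Bornology.IsBounded Ω ∧
    ∀ x ∈ frontier Ω, ∃ e : Vec d, ‖e‖ = 1 ∧ ∃ (C : ℝ≥0) (ζ : Vec d → ℝ),
      LipschitzWith C ζ ∧ (∀ (y : Vec d) (s : ℝ), ζ (y + s • e) = ζ y) ∧
      ∃ r > 0, ∀ y ∈ Metric.ball x r, (y ∈ Ω ↔ ζ y < inner ℝ e y)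

/-- A (relatively) open set of dimension `k` is polytopal if the rest of its closure lies in
finitely many planes of dimension less than `k`. -/
def IsPolytopal (k : ℕ) (P : Set (Vec d)) : Prop :=
  ∃ H : Finset (AffineSubspace ℝ (Vec d)),
    (∀ L ∈ H, Module.finrank ℝ L.direction < k) ∧
      closure P \ P ⊆ ⋃ L ∈ H, (L : Set (Vec d))

/-- Relatively open polytopal subset of the boundary of `Ω`. -/
def IsBoundaryPart (Ω Γ : Set (Vec d)) : Prop :=
  (∃ U, IsOpen U ∧ Γ = frontier Ω ∩ U) ∧ IsPolytopal (d - 1) Γ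

/-! ### The Helmholtz problem -/

/-- Domain, boundary partition, piecewise constant coefficients and frequency. -/
structure HelmholtzData (d : ℕ) where
  Ω : Set (Vec d)
  ΓD : Set (Vec d)
  ΓN : Set (Vec d)
  ΓR : Set (Vec d)
  /-- the partition of `Ω` on which `μ` and `A` are constant -/
  pieces : Finset (Set (Vec d))
  /-- the partition of `ΓR` on which `γ` is constant -/
  facets : Finset (Set (Vec d))
  μP : Set (Vec d) → ℝ
  AP : Set (Vec d) → Matrix (Fin d) (Fin d) ℝ
  γQ : Set (Vec d) → ℝ
  ω : ℝ
  lipschitz : IsLipschitzDomain Ω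
  polytopal : IsPolytopal d Ω
  partD : IsBoundaryPart Ω ΓD
  partN : IsBoundaryPart Ω ΓN
  partR : IsBoundaryPart Ω ΓR
  disjDN : Disjoint ΓD ΓN
  disjDR : Disjoint ΓD ΓR
  disjNR : Disjoint ΓN ΓR
  boundary_cover : closure ΓD ∪ closure ΓN ∪ closure ΓR = frontier Ω
  piece_open : ∀ P ∈ pieces, IsOpen P
  piece_subset : ∀ P ∈ pieces, P ⊆ Ω
  piece_polytopal : ∀ P ∈ pieces, IsPolytopal d P
  piece_disjoint : ∀ P ∈ pieces, ∀ P' ∈ pieces, P ≠ P' → Disjoint P P'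
  piece_cover : ⋃ P ∈ pieces, closure P = closure Ω
  facet_part : ∀ Q ∈ facets, IsBoundaryPart Ω Q
  facet_subset : ∀ Q ∈ facets, Q ⊆ ΓR
  facet_disjoint : ∀ Q ∈ facets, ∀ Q' ∈ facets, Q ≠ Q' → Disjoint Q Q'
  facet_cover : ⋃ Q ∈ facets, closure Q = closure ΓR
  μ_pos : ∀ P ∈ pieces, 0 < μP P
  A_symm : ∀ P ∈ pieces, (AP P).IsSymm
  A_pos : ∀ P ∈ pieces, 0 < minEig (AP P)
  γ_pos : ∀ Q ∈ facets, 0 < γQ Q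
  ω_pos : 0 < ω

namespace HelmholtzData

variable (S : HelmholtzData d)

/-- The coefficient `μ`, equal to `μP P` on each `P`. -/
def μ (x : Vec d) : ℝ := ∑ P ∈ S.pieces, P.indicator (fun _ => S.μP P) x

/-- The coefficient `A`, equal to `AP P` on each `P`. -/
def A (x : Vec d) : Matrix (Fin d) (Fin d) ℝ :=
  ∑ P ∈ S.pieces, P.indicator (fun _ => S.AP P) x

/-- The coefficient `γ`, equal to `γQ Q` on each `Q`. -/
def γ (x : Vec d) : ℝ := ∑ Q ∈ S.facets, Q.indicator (fun _ => S.γQ Q) x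

/-- `v ∈ H¹(Ω)` with zero trace on `ΓD`. -/
def H1D (v : Vec d → ℂ) : Prop :=
  MemH1 S.Ω v ∧ ∃ t, IsTrace S.Ω v t ∧ ∀ᵐ x ∂((surf d).restrict S.ΓD), t x = 0

/-- `(μ φ, v)` over `Ω`. -/
def ipμ (φ v : Vec d → ℂ) : ℂ := ∫ x in S.Ω, (S.μ x : ℂ) * φ x * conj (v x)

/-- `(γ φ, v)` over `ΓR`, for functions given on `ΓR`. -/
def ipγ (φ v : Vec d → ℂ) : ℂ := ∫ x in S.ΓR, (S.γ x : ℂ) * φ x * conj (v x) ∂(surf d)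

/-- `(A w, z)` over `Ω`. -/
def ipA (w z : Vec d → CVec d) : ℂ := ∫ x in S.Ω, sesq (S.A x) (w x) (z x)

/-- The sesquilinear form of the weak formulation. -/
def b (φ v : Vec d → ℂ) : ℂ :=
  -(S.ω : ℂ) ^ 2 * S.ipμ φ v - Complex.I * S.ω * S.ipγ (trace S.Ω φ) (trace S.Ω v)
    + S.ipA (weakGrad S.Ω φ) (weakGrad S.Ω v)

/-- The energy norm on conforming functions. -/
def energyNorm (v : Vec d → ℂ) : ℝ :=
  Real.sqrt (S.ω ^ 2 * (S.ipμ v v).re + S.ω * (S.ipγ (trace S.Ω v) (trace S.Ω v)).re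
    + (S.ipA (weakGrad S.Ω v) (weakGrad S.Ω v)).re)

/-- Well-posedness: over energy-normalised conforming functions, the `min` over `φ` of the
`max` over `v` of `Re b(φ, v)` is positive. -/
def WellPosed : Prop :=
  ∃ γst > 0, ∀ φ, S.H1D φ → S.energyNorm φ = 1 →
    ∃ v, S.H1D v ∧ S.energyNorm v = 1 ∧ 1 / γst ≤ (S.b φ v).re

/-- `g` is the normal trace of `w` on `ΓR`, and the normal trace of `w` on `ΓN` is zero. Normal
traces are defined weakly, by Green's formula tested with functions vanishing on `ΓD`. -/
def HasNormalTrace (w : Vec d → CVec d) (g : Vec d → ℂ) : Prop :=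
  MemLp g 2 ((surf d).restrict S.ΓR) ∧
    ∀ v, S.H1D v →
      (∫ x in S.Ω, ∑ i, w x i * conj (weakGrad S.Ω v x i))
        + (∫ x in S.Ω, weakDiv S.Ω w x * conj (v x))
      = ∫ x in S.ΓR, g x * conj (trace S.Ω v x) ∂(surf d)

/-- The space of `w ∈ H(div, Ω)` with zero normal trace on `ΓN` and square integrable normal
trace on `ΓR`. -/
def XdivN (w : Vec d → CVec d) : Prop :=
  MemLp w 2 (volume.restrict S.Ω) ∧ (∃ r, HasWeakDiv S.Ω w r) ∧ ∃ g, S.HasNormalTrace w g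

/-- The normal trace on `ΓR` of an element of `XdivN` (unique almost everywhere). -/
def normalTrace (w : Vec d → CVec d) : Vec d → ℂ :=
  Classical.epsilon (S.HasNormalTrace w)

open scoped Classical in
/-- The solution `ξ` of the adjoint problem `b(w, ξ) = ℓ(w)` for all conforming `w`. -/
def adjointSol (ℓ : (Vec d → ℂ) → ℂ) : Vec d → ℂ :=
  if h : ∃ ξ, S.H1D ξ ∧ ∀ w, S.H1D w → S.b w ξ = ℓ w then h.choose else 0

/-- The adjoint solution with volume datum `ψ ∈ L²(Ω)`. -/
def uStar (ψ : Vec d → ℂ) : Vec d → ℂ :=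
  S.adjointSol (fun w => S.ω * S.ipμ w ψ)

/-- The adjoint solution with boundary datum `Ψ ∈ L²(ΓR)`. -/
def UStar (Ψ : Vec d → ℂ) : Vec d → ℂ :=
  S.adjointSol (fun w => (Real.sqrt S.ω : ℂ) * S.ipγ (trace S.Ω w) Ψ)

/-- The flux `A ∇v`. -/
def flux (v : Vec d → ℂ) (x : Vec d) : CVec d := matVec (S.A x) (weakGrad S.Ω v x)

end HelmholtzData

/-! ### Meshes -/

/-- The closed simplex with the given vertices. -/
def hull (K : Finset (Vec d)) : Set (Vec d) := convexHull ℝ (K : Set (Vec d))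

/-- The diameter of the simplex with the given vertices. -/
def diamS (K : Finset (Vec d)) : ℝ := Metric.diam (hull K)

/-- `n` is the unit normal of the face `F` of the simplex `K` pointing outside `K`. -/
def IsOutwardNormal (K F : Finset (Vec d)) (n : Vec d) : Prop :=
  ‖n‖ = 1 ∧ (∀ x ∈ F, ∀ y ∈ F, inner ℝ n (y - x) = 0) ∧
    ∀ x ∈ F, ∀ a ∈ K, a ∉ F → inner ℝ n (a - x) < 0

/-- The outward unit normal of `K` on its face `F`. -/
def outwardNormal (K F : Finset (Vec d)) : Vec d :=
  Classical.epsilon (IsOutwardNormal K F)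

open scoped Classical in
/-- The faces (of dimension `d - 1`) of a family of simplices. -/
def facesOf (T : Finset (Finset (Vec d))) : Finset (Finset (Vec d)) :=
  T.biUnion (fun K => K.powersetCard d)

/-- A matching simplicial mesh of `Ω`, conforming with the partitions of the boundary and of the
coefficients, with a choice of face normals. Simplices and faces are given by their vertices. -/
structure Mesh (S : HelmholtzData d) where
  T : Finset (Finset (Vec d))
  card_eq : ∀ K ∈ T, K.card = d + 1
  indep : ∀ K ∈ T, AffineIndependent ℝ ((↑) : K → Vec d)
  matching : ∀ K ∈ T, ∀ K' ∈ T,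
    hull K ∩ hull K' = convexHull ℝ ((K : Set (Vec d)) ∩ (K' : Set (Vec d)))
  cover : ⋃ K ∈ T, hull K = closure S.Ω
  conf_piece : ∀ K ∈ T, ∃ P ∈ S.pieces, hull K ⊆ closure P
  conf_boundary : ∀ F ∈ facesOf T, hull F ⊆ frontier S.Ω →
    hull F ⊆ closure S.ΓD ∨ hull F ⊆ closure S.ΓN ∨ hull F ⊆ closure S.ΓR
  conf_facet : ∀ F ∈ facesOf T, hull F ⊆ closure S.ΓR → ∃ Q ∈ S.facets, hull F ⊆ closure Q
  /-- the unit normal of each face; the orientation of interior faces is arbitrary, and an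
  exterior face belongs to a single element, so that its normal points outside `Ω` -/
  nF : Finset (Vec d) → Vec d
  normal : ∀ F ∈ facesOf T, ∃ K ∈ T, F ⊆ K ∧ IsOutwardNormal K F (nF F)

namespace Mesh

variable {S : HelmholtzData d} (M : Mesh S)

open scoped Classical in
def facesD : Finset (Finset (Vec d)) := (facesOf M.T).filter (fun F => hull F ⊆ closure S.ΓD)

open scoped Classical in
def facesN : Finset (Finset (Vec d)) := (facesOf M.T).filter (fun F => hull F ⊆ closure S.ΓN)

open scoped Classical in
def facesR : Finset (Finset (Vec d)) := (facesOf M.T).filter (fun F => hull F ⊆ closure S.ΓR)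

open scoped Classical in
/-- Exterior faces. -/
def facesExt : Finset (Finset (Vec d)) := M.facesD ∪ M.facesN ∪ M.facesR

open scoped Classical in
/-- Interior faces. -/
def facesInt : Finset (Finset (Vec d)) := facesOf M.T \ M.facesExt

open scoped Classical in
/-- The elements having `F` as a face (two for an interior face). -/
def cells (F : Finset (Vec d)) : Finset (Finset (Vec d)) := M.T.filter (fun K => F ⊆ K)

/-- The only element having the exterior face `F` as a face. -/
def owner (F : Finset (Vec d)) : Finset (Vec d) :=
  Classical.epsilon (fun K => K ∈ M.T ∧ F ⊆ K)

/-- The piece of the partition of `Ω` containing `K`. -/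
def pieceOf (_M : Mesh S) (K : Finset (Vec d)) : Set (Vec d) :=
  Classical.epsilon (fun P => P ∈ S.pieces ∧ hull K ⊆ closure P)

/-- The piece of the partition of `ΓR` containing `F`. -/
def facetOf (_M : Mesh S) (F : Finset (Vec d)) : Set (Vec d) :=
  Classical.epsilon (fun Q => Q ∈ S.facets ∧ hull F ⊆ closure Q)

def μK (K : Finset (Vec d)) : ℝ := S.μP (M.pieceOf K)

def αK (K : Finset (Vec d)) : ℝ := minEig (S.AP (M.pieceOf K))

def ϑK (K : Finset (Vec d)) : ℝ := Real.sqrt (M.αK K / M.μK K)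

def αF (F : Finset (Vec d)) : ℝ := M.αK (M.owner F)

def γF (F : Finset (Vec d)) : ℝ := S.γQ (M.facetOf F)

def ϑF (F : Finset (Vec d)) : ℝ := M.αF F / M.γF F

/-! ### Broken functions, jumps, averages and lifting -/

/-- `v ∈ H¹(T_h)`. -/
def BrokenH1 (v : Vec d → ℂ) : Prop :=
  MemLp v 2 (volume.restrict S.Ω) ∧ ∀ K ∈ M.T, MemH1 (interior (hull K)) v

/-- Evaluation of a complex polynomial at a real point. -/
def evalP (q : MvPolynomial (Fin d) ℂ) (x : Vec d) : ℂ :=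
  MvPolynomial.eval (fun i => (x i : ℂ)) q

/-- Evaluation of a vector of polynomials. -/
def evalV (q : Fin d → MvPolynomial (Fin d) ℂ) (x : Vec d) : CVec d :=
  WithLp.toLp 2 (fun i => evalP (q i) x)

/-- `v ∈ P_p(T_h)`: `v` is a polynomial of total degree at most `p` on each element. -/
def IsDiscrete (p : ℕ) (v : Vec d → ℂ) : Prop :=
  ∀ K ∈ M.T, ∃ q : MvPolynomial (Fin d) ℂ, q.totalDegree ≤ p ∧
    ∀ᵐ x ∂(volume.restrict (hull K)), v x = evalP q x

/-- `w ∈ P_p(T_h)^d`. -/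
def IsDiscreteVec (p : ℕ) (w : Vec d → CVec d) : Prop :=
  ∀ K ∈ M.T, ∃ q : Fin d → MvPolynomial (Fin d) ℂ, (∀ i, (q i).totalDegree ≤ p) ∧
    ∀ᵐ x ∂(volume.restrict (hull K)), w x = evalV q x

/-- Elements of `P_p(T_h)^d`, described by their polynomials on each element. -/
abbrev PolyVec (d : ℕ) := Finset (Vec d) → Fin d → MvPolynomial (Fin d) ℂ

def IsPolyVec (p : ℕ) (w : PolyVec d) : Prop :=
  ∀ K ∈ M.T, ∀ i, (w K i).totalDegree ≤ p

/-- The trace on `∂K` of the restriction of `v` to the element `K`. -/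
def traceK (_M : Mesh S) (K : Finset (Vec d)) (v : Vec d → ℂ) : Vec d → ℂ :=
  trace (interior (hull K)) v

/-- The trace of `v` on an exterior face. -/
def traceF (F : Finset (Vec d)) (v : Vec d → ℂ) : Vec d → ℂ := M.traceK (M.owner F) v

open scoped Classical in
/-- The jump of `v` through the face `F`. -/
def jump (v : Vec d → ℂ) (F : Finset (Vec d)) (x : Vec d) : ℂ :=
  if F ∈ M.facesInt then
    ∑ K ∈ M.cells F, M.traceK K v x * ((inner ℝ (outwardNormal K F) (M.nF F) : ℝ) : ℂ)
  else if F ∈ M.facesD then M.traceF F v x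
  else 0

open scoped Classical in
/-- The average of a piecewise polynomial vector field on the face `F`. -/
def avg (w : PolyVec d) (F : Finset (Vec d)) (x : Vec d) : CVec d :=
  if F ∈ M.facesInt then (1 / 2 : ℂ) • ∑ K ∈ M.cells F, evalV (w K) x
  else evalV (w (M.owner F)) x

/-- `L` is the lifting of `v`: the element of `P_p(T_h)^d` whose inner product with each
`w ∈ P_p(T_h)^d` equals that of the jump of `v` and the normal average of `w` on the faces. -/
def IsLifting (p : ℕ) (v : Vec d → ℂ) (L : PolyVec d) : Prop :=
  M.IsPolyVec p L ∧ ∀ w, M.IsPolyVec p w →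
    ∑ K ∈ M.T, ∫ x in hull K, ∑ i, evalV (L K) x i * conj (evalV (w K) x i)
      = ∑ F ∈ facesOf M.T, ∫ x in hull F,
          M.jump v F x * conj (∑ i, M.avg w F x i * ((M.nF F i : ℝ) : ℂ)) ∂(surf d)

/-- The lifting of `v` (unique on the elements of the mesh). -/
def lift (p : ℕ) (v : Vec d → ℂ) : PolyVec d := Classical.epsilon (M.IsLifting p v)

/-- The discrete gradient on the element `K`: elementwise weak gradient minus lifting. -/
def dgrad (p : ℕ) (K : Finset (Vec d)) (v : Vec d → ℂ) (x : Vec d) : CVec d :=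
  weakGrad (interior (hull K)) v x - evalV (M.lift p v K) x

/-! ### Broken norms and forms -/

/-- `(A G(φ), G(v))` over the element `K`, where `G` is the discrete gradient. -/
def ipG (p : ℕ) (K : Finset (Vec d)) (φ v : Vec d → ℂ) : ℂ :=
  ∫ x in hull K, sesq (S.A x) (M.dgrad p K φ x) (M.dgrad p K v x)

/-- `(γ φ, v)` over the Robin faces. -/
def ipγ (φ v : Vec d → ℂ) : ℂ :=
  ∑ F ∈ M.facesR, ∫ x in hull F,
    (S.γ x : ℂ) * M.traceF F φ x * conj (M.traceF F v x) ∂(surf d)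

/-- The broken energy norm. -/
def energyNorm (p : ℕ) (v : Vec d → ℂ) : ℝ :=
  Real.sqrt (S.ω ^ 2 * (S.ipμ v v).re + S.ω * (M.ipγ v v).re
    + ∑ K ∈ M.T, (M.ipG p K v v).re)

/-- The mesh-dependent norm on `H¹(T_h)`. -/
def dagNorm (p : ℕ) (v : Vec d → ℂ) : ℝ :=
  Real.sqrt (
    ∑ K ∈ M.T,
      (max 1 (S.ω ^ 2 * diamS K ^ 2 / M.ϑK K ^ 2) * (M.αK K / diamS K ^ 2)
          * (∫ x in hull K, ‖v x‖ ^ 2)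
        + (M.ipG p K v v).re)
    + ∑ F ∈ M.facesR,
        max 1 (S.ω * diamS F / M.ϑF F) * (M.αF F / diamS F)
          * (∫ x in hull F, ‖M.traceF F v x‖ ^ 2 ∂(surf d)))

/-- The mesh-dependent norm on `XdivN`. -/
def dagDivNorm (w : Vec d → CVec d) : ℝ :=
  Real.sqrt (
    ∑ K ∈ M.T,
      ((∫ x in hull K, sesq (S.A x)⁻¹ (w x) (w x)).re
        + diamS K ^ 2 / M.αK K * (∫ x in hull K, ‖weakDiv S.Ω w x‖ ^ 2))
    + ∑ F ∈ M.facesR,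
        diamS F / M.αF F * (∫ x in hull F, ‖S.normalTrace w x‖ ^ 2 ∂(surf d)))

/-- A stabilisation form: a sesquilinear form on `H¹(T_h)` that vanishes as soon as one of its
arguments is conforming. -/
structure Stabilization (M : Mesh S) where
  s : (Vec d → ℂ) → (Vec d → ℂ) → ℂ
  add_left : ∀ φ φ' v, M.BrokenH1 φ → M.BrokenH1 φ' → M.BrokenH1 v →
    s (φ + φ') v = s φ v + s φ' v
  add_right : ∀ φ v v', M.BrokenH1 φ → M.BrokenH1 v → M.BrokenH1 v' →
    s φ (v + v') = s φ v + s φ v'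
  smul_left : ∀ (c : ℂ) φ v, M.BrokenH1 φ → M.BrokenH1 v → s (c • φ) v = c * s φ v
  smul_right : ∀ (c : ℂ) φ v, M.BrokenH1 φ → M.BrokenH1 v → s φ (c • v) = conj c * s φ v
  conforming_left : ∀ φ v, S.H1D φ → M.BrokenH1 v → s φ v = 0
  conforming_right : ∀ φ v, M.BrokenH1 φ → S.H1D v → s φ v = 0

variable {M} in
/-- The IPDG discretisation of the second-order term. -/
def ah (p : ℕ) (st : Stabilization M) (φ v : Vec d → ℂ) : ℂ :=
  ∑ K ∈ M.T, M.ipG p K φ v + st.s φ v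

variable {M} in
/-- The IPDG form of the Helmholtz problem. -/
def bh (p : ℕ) (st : Stabilization M) (φ v : Vec d → ℂ) : ℂ :=
  -(S.ω : ℂ) ^ 2 * S.ipμ φ v - Complex.I * S.ω * M.ipγ φ v + ah p st φ v

/-! ### Projections, approximation factors and estimator -/

open scoped Classical in
/-- A minimiser of `J` over `V` (zero if there is none). -/
def argmin {X : Type*} [Zero X] (V : X → Prop) (J : X → ℝ) : X :=
  if h : ∃ a, V a ∧ ∀ c, V c → J a ≤ J c then h.choose else 0

/-- The projection onto conforming functions. -/
def πg (p : ℕ) (v : Vec d → ℂ) : Vec d → ℂ :=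
  argmin S.H1D (fun s => M.dagNorm p (v - s))

/-- The projection onto the Lagrange space of discrete conforming functions. -/
def πhg (p : ℕ) (v : Vec d → ℂ) : Vec d → ℂ :=
  argmin (fun vh => M.IsDiscrete p vh ∧ S.H1D vh) (fun vh => M.dagNorm p (v - vh))

/-- The projection onto the BDM space of discrete divergence-conforming fields. -/
def πhd (p : ℕ) (w : Vec d → CVec d) : Vec d → CVec d :=
  argmin (fun wh => M.IsDiscreteVec p wh ∧ S.XdivN wh) (fun wh => M.dagDivNorm (w - wh))

/-- Data `ψ ∈ L²(Ω)` with unit `μ`-weighted norm. -/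
def UnitΩ (_M : Mesh S) (ψ : Vec d → ℂ) : Prop :=
  MemLp ψ 2 (volume.restrict S.Ω) ∧ S.ipμ ψ ψ = 1

/-- Data `Ψ ∈ L²(ΓR)` with unit `γ`-weighted norm. -/
def UnitR (_M : Mesh S) (Ψ : Vec d → ℂ) : Prop :=
  MemLp Ψ 2 ((surf d).restrict S.ΓR) ∧ S.ipγ Ψ Ψ = 1

/-- Approximation factor of the Lagrange space for volume data. Suprema are taken in `[0, ∞]`;
those over boundary data are zero if `ΓR` is empty. -/
def gaΩg (p : ℕ) : ℝ≥0∞ :=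
  ⨆ (ψ : Vec d → ℂ) (_ : M.UnitΩ ψ),
    ENNReal.ofReal (M.dagNorm p (S.uStar ψ - M.πhg p (S.uStar ψ)))

/-- Approximation factor of the Lagrange space for boundary data. -/
def gaRg (p : ℕ) : ℝ≥0∞ :=
  ⨆ (Ψ : Vec d → ℂ) (_ : M.UnitR Ψ),
    ENNReal.ofReal (M.dagNorm p (S.UStar Ψ - M.πhg p (S.UStar Ψ)))

/-- Approximation factor of the BDM space for volume data. -/
def gaΩd (p : ℕ) : ℝ≥0∞ :=
  ⨆ (ψ : Vec d → ℂ) (_ : M.UnitΩ ψ),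
    ENNReal.ofReal (M.dagDivNorm (S.flux (S.uStar ψ) - M.πhd p (S.flux (S.uStar ψ))))

/-- Approximation factor of the BDM space for boundary data. -/
def gaRd (p : ℕ) : ℝ≥0∞ :=
  ⨆ (Ψ : Vec d → ℂ) (_ : M.UnitR Ψ),
    ENNReal.ofReal (M.dagDivNorm (S.flux (S.UStar Ψ) - M.πhd p (S.flux (S.UStar Ψ))))

/-- The square of the total approximation factor. -/
def γbaSq (p : ℕ) : ℝ≥0∞ :=
  (4 * M.gaΩg p ^ 2 + 2 * M.gaRg p ^ 2) + (4 * M.gaΩd p ^ 2 + 2 * M.gaRd p ^ 2)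

variable {M} in
/-- The dual norm of the conforming residual `v ↦ b_h(u - u_h, v)`. -/
def Rr (p : ℕ) (st : Stabilization M) (u uh : Vec d → ℂ) : ℝ≥0∞ :=
  ⨆ (v : Vec d → ℂ) (_ : S.H1D v ∧ S.ipA (weakGrad S.Ω v) (weakGrad S.Ω v) = 1),
    ENNReal.ofReal ‖bh p st (u - uh) v‖

/-- The non-conformity estimator. -/
def Rc (p : ℕ) (uh : Vec d → ℂ) : ℝ := M.dagNorm p (uh - M.πg p uh)

variable {M} in
/-- The square of the total estimator. -/
def RSq (p : ℕ) (st : Stabilization M) (u uh : Vec d → ℂ) : ℝ≥0∞ :=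
  Rr p st u uh ^ 2 + ENNReal.ofReal (M.Rc p uh) ^ 2

end Mesh

end IPDG

end

/-! ### Slicing of cones and the radial divergence theorem. -/

namespace IPDG
open Measure Set
variable {d : ℕ}

/-! Write `e = u - uh`, and compare it with the conforming function `y = u - πg uh`; the difference
`y - e = uh - πg uh` has energy norm at most `Rc`. The map `embed` sends a piecewise regular
function to its weighted mass, Robin trace and discrete gradient in a product of `L²` spaces. Its
norm is the broken energy norm, and both `b` and `bh` (with a conforming test function) become
restrictions of one bounded form `helmForm`. In a Hilbert space, `|(y, x)| ≤ D ‖y‖` implies `‖x‖² ≤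
‖x - y‖² + D²`, so it remains to bound the energy product of `e` with conforming functions.

That product is `helmForm` plus twice the mass product plus `1 + i` times the Robin product. The
first term is the residual and is at most `Rr` times the norm of the gradient. Cauchy–Schwarz then
gives `D² = Rr² + 4 ‖e‖_mass² + 2 ‖e‖_Robin²`, which is where the 4 and 2 of `γbaSq` come from.

The mass and Robin parts of `e` are estimated by duality (`norm_dataForm_le`). Let `ξ` solve the
adjoint problem with datum proportional to `e`. On the conforming part the datum is `b(·, ξ)`. This
splits it into two terms. One is `helmForm(e, ξ)`, from which Galerkin orthogonality subtracts a
discrete conforming function; this leaves `Rr` times the approximation error of `ξ`. The other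
measures how far `uh - πg uh` is from satisfying Green's formula with the flux of `ξ`; it is the
form `hdivForm`. By the definition of the lifting, `hdivForm` is zero on discrete `H(div)` fields,
so a discrete field can be subtracted from the flux; this leaves `Rc` times the approximation error
of the flux. A Cauchy–Schwarz inequality recombines both contributions into `Rr² + Rc²`.

Several foundations support this. The divergence theorem and the trace inequality on a simplex are
both derived from a radial identity on cones (`integral_cone_radial`). The combinatorics of matching
meshes shows that an interior face has exactly two elements with opposite normals
(`cells_of_mem_facesInt`). Traces on the whole skeleton make conforming functions free of jumps
(`jump_conforming`). Finally, the embedded conforming functions form a closed subspace, so that the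
inf-sup condition yields adjoint solutions (`exists_adjoint`), and the flux of such a solution lies
in `XdivN` with explicit divergence and normal trace (`flux_spec`). -/

theorem inner_sub_eq_of_mem_hull {F : Finset (Vec d)} {a n : Vec d} {h : ℝ}
    (hFn : ∀ y ∈ F, inner ℝ n (y - a) = h) : ∀ y ∈ hull F, inner ℝ n (y - a) = h := by
  intro y hy
  have hc : Convex ℝ {y : Vec d | inner ℝ n (y - a) = h} := by
    have : {y : Vec d | inner ℝ n (y - a) = h} = {y | (innerSL ℝ n) y = h + inner ℝ n a} := by
      ext y; simp [inner_sub_right, sub_eq_iff_eq_add]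
    rw [this]
    exact convex_hyperplane (innerSL ℝ n).toLinearMap.isLinear _
  exact convexHull_min (fun y hy => hFn y hy) hc hy

theorem isCompact_hull (F : Finset (Vec d)) : IsCompact (hull F) :=
  F.finite_toSet.isCompact_convexHull ℝ

theorem measurableSet_hull (F : Finset (Vec d)) : MeasurableSet (hull F) :=
  (isCompact_hull F).isClosed.measurableSet

/-- The slice of the cone at relative height `s` is the image of the base under the homothety of
ratio `s` centred at the apex, and this scales `(d-1)`-dimensional measure by `s ^ (d - 1)`. -/
theorem surf_slice_cone {F : Finset (Vec d)} (hF : F.Nonempty) {a n : Vec d} {h : ℝ}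
    (hh : 0 < h) (hn : ‖n‖ = 1) (hFn : ∀ y ∈ F, inner ℝ n (y - a) = h) (t : Set (Vec d))
    {s : ℝ} (hs : 0 < s) (hs1 : s ≤ 1) :
    μHE[d - 1] ((t ∩ convexHull ℝ (insert a (F : Set (Vec d)))) ∩
        AffineSubspace.mk' (s • (h • n) +ᵥ a) (ℝ ∙ (h • n))ᗮ)
      = ENNReal.ofReal (s ^ (d - 1)) *
        surf d (hull F ∩ AffineMap.homothety a s ⁻¹' t) := by
  have hFh := inner_sub_eq_of_mem_hull hFn
  have hset : (t ∩ convexHull ℝ (insert a (F : Set (Vec d)))) ∩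
        (AffineSubspace.mk' (s • (h • n) +ᵥ a) (ℝ ∙ (h • n))ᗮ : Set (Vec d))
      = AffineMap.homothety a s '' (hull F ∩ AffineMap.homothety a s ⁻¹' t) := by
    ext z
    have hnn : inner ℝ n n = (1 : ℝ) := by rw [real_inner_self_eq_norm_sq, hn]; norm_num
    have hmem : z ∈ (AffineSubspace.mk' (s • (h • n) +ᵥ a) (ℝ ∙ (h • n))ᗮ : Set (Vec d)) ↔
        inner ℝ n (z - a) = s * h := by
      rw [SetLike.mem_coe, AffineSubspace.mem_mk', Submodule.mem_orthogonal_singleton_iff_inner_right]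
      simp only [vsub_eq_sub, vadd_eq_add, inner_smul_left, inner_sub_right, inner_add_right,
        inner_smul_right, hnn, conj_trivial]
      constructor
      · intro h0
        have : h * (inner ℝ n z - inner ℝ n a - s * h) = 0 := by linarith
        linarith [(mul_eq_zero.mp this).resolve_left hh.ne']
      · intro h0
        linear_combination h * h0
    rw [mem_inter_iff, hmem, mem_inter_iff, convexHull_insert (by simpa using hF)]
    constructor
    · rintro ⟨⟨hzt, hz⟩, hzs⟩
      rw [convexJoin_singleton_left] at hz
      simp only [mem_iUnion] at hz
      obtain ⟨y, hy, hz⟩ := hz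
      rw [segment_eq_image'] at hz
      obtain ⟨θ, hθ, rfl⟩ := hz
      -- The base lies at height `h` above the apex, so the height of a point of the cone determines
      -- its parameter on the ray.
      have : θ = s := by
        simp only [add_sub_cancel_left, inner_smul_right, hFh y hy] at hzs
        exact mul_right_cancel₀ hh.ne' hzs
      subst this
      have e : AffineMap.homothety a θ y = a + θ • (y - a) := by
        simp [AffineMap.homothety_apply, add_comm]
      exact ⟨y, ⟨hy, by rw [mem_preimage, e]; exact hzt⟩, e⟩
    · rintro ⟨y, ⟨hy, hyt⟩, rfl⟩
      have e : AffineMap.homothety a s y = a + s • (y - a) := by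
        simp [AffineMap.homothety_apply, add_comm]
      refine ⟨⟨hyt, ?_⟩, ?_⟩
      · rw [convexJoin_singleton_left, mem_iUnion₂]
        exact ⟨y, hy, by rw [segment_eq_image']; exact ⟨s, ⟨hs.le, hs1⟩, e.symm⟩⟩
      · rw [e, add_sub_cancel_left, inner_smul_right, hFh y hy]
  rw [hset, euclideanHausdorffMeasure_homothety_image _ _ hs.ne']
  simp only [surf]
  rw [ENNReal.smul_def, smul_eq_mul]
  congr 1
  rw [ENNReal.ofReal_pow hs.le, ENNReal.coe_pow]
  congr 1
  rw [← enorm_eq_nnnorm, Real.enorm_eq_ofReal hs.le]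

/-- Slicing of a cone parallel to its base. -/
theorem volume_cone {F : Finset (Vec d)} (hF : F.Nonempty) {a n : Vec d} {h : ℝ}
    (hh : 0 < h) (hn : ‖n‖ = 1) (hFn : ∀ y ∈ F, inner ℝ n (y - a) = h) {t : Set (Vec d)}
    (ht : MeasurableSet t) :
    volume (t ∩ convexHull ℝ (insert a (F : Set (Vec d))))
      = ∫⁻ s in Ioc (0 : ℝ) 1, ENNReal.ofReal (h * s ^ (d - 1)) *
        surf d (hull F ∩ AffineMap.homothety a s ⁻¹' t) := by
  have hc : IsCompact (convexHull ℝ (insert a (F : Set (Vec d)))) :=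
    (F.finite_toSet.insert a).isCompact_convexHull ℝ
  have hFh := inner_sub_eq_of_mem_hull hFn
  have hn0 : n ≠ 0 := by rintro rfl; simp at hn
  have hv : h • n ≠ 0 := smul_ne_zero hh.ne' hn0
  -- Slicing along `h • n` measures heights in units of `h`: the cone occupies the parameters from 0
  -- to 1, and the norm of this vector gives the factor `h`.
  have key := EuclideanGeometry.euclideanHausdorffMeasure_eq_lintegral (V := Vec d) a hv
    (ht.inter hc.isClosed.measurableSet)
  rw [InnerProductSpace.euclideanHausdorffMeasure_eq_volume] at key
  simp only [finrank_euclideanSpace, Fintype.card_fin] at key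
  have hvn : ‖h • n‖ₑ = ENNReal.ofReal h := by
    rw [← ofReal_norm, norm_smul, hn, mul_one, Real.norm_of_nonneg hh.le]
  rw [key, hvn, ← lintegral_const_mul' _ _ ENNReal.ofReal_ne_top]
  have hout : ∀ s : ℝ, s ∉ Icc (0:ℝ) 1 → μHE[d - 1] ((t ∩ convexHull ℝ (insert a (F : Set (Vec d)))) ∩
        AffineSubspace.mk' (s • (h • n) +ᵥ a) (ℝ ∙ (h • n))ᗮ) = 0 := by
    intro s hs
    have : (t ∩ convexHull ℝ (insert a (F : Set (Vec d)))) ∩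
        (AffineSubspace.mk' (s • (h • n) +ᵥ a) (ℝ ∙ (h • n))ᗮ : Set (Vec d)) = ∅ := by
      rw [eq_empty_iff_forall_notMem]
      rintro z ⟨⟨-, hz⟩, hzs⟩
      rw [SetLike.mem_coe, AffineSubspace.mem_mk', Submodule.mem_orthogonal_singleton_iff_inner_right] at hzs
      rw [convexHull_insert (by simpa using hF), convexJoin_singleton_left, mem_iUnion₂] at hz
      obtain ⟨y, hy, hz⟩ := hz
      rw [segment_eq_image'] at hz
      obtain ⟨θ, hθ, rfl⟩ := hz
      have hy' := hFh y hy
      have hnn : inner ℝ n n = (1 : ℝ) := by rw [real_inner_self_eq_norm_sq, hn]; norm_num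
      rw [inner_sub_right] at hy'
      simp only [vsub_eq_sub, vadd_eq_add, inner_smul_left, inner_sub_right, inner_add_right,
        inner_smul_right, hnn, conj_trivial] at hzs
      have : h * ((θ - s) * h) = 0 := by linear_combination hzs - h * θ * hy'
      have : (θ - s) * h = 0 := (mul_eq_zero.mp this).resolve_left hh.ne'
      have : θ = s := by
        have := (mul_eq_zero.mp this).resolve_right hh.ne'
        linarith
      exact hs (this ▸ hθ)
    rw [this, measure_empty]
  rw [← lintegral_indicator measurableSet_Ioc]
  -- The slice through the apex is degenerate but concerns a single parameter.
  have hz : ∀ᵐ s : ℝ, s ≠ 0 := by simp [ae_iff]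
  refine lintegral_congr_ae ?_
  filter_upwards [hz] with s hs0
  by_cases hs : s ∈ Ioc (0:ℝ) 1
  · rw [indicator_of_mem hs, surf_slice_cone hF hh hn hFn t hs.1 hs.2, ← mul_assoc,
      ENNReal.ofReal_mul hh.le]
  · rw [indicator_of_notMem hs, hout s, mul_zero]
    exact fun hs' => hs ⟨lt_of_le_of_ne hs'.1 hs0.symm, hs'.2⟩

/-- If the base had infinite measure, so would every parallel slice with `s > 0`, and the compact
cone over it would have infinite volume. -/
theorem surf_hull_lt_top {F : Finset (Vec d)} (hF : F.Nonempty) {a n : Vec d} {h : ℝ}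
    (hh : 0 < h) (hn : ‖n‖ = 1) (hFn : ∀ y ∈ F, inner ℝ n (y - a) = h) :
    surf d (hull F) < ⊤ := by
  have key := volume_cone hF hh hn hFn MeasurableSet.univ
  simp only [univ_inter, preimage_univ, inter_univ] at key
  have hc : IsCompact (convexHull ℝ (insert a (F : Set (Vec d)))) :=
    (F.finite_toSet.insert a).isCompact_convexHull ℝ
  have hfin := hc.measure_lt_top (μ := volume)
  by_contra htop
  rw [not_lt, top_le_iff] at htop
  rw [key, htop] at hfin
  have : ∫⁻ s in Ioc (0 : ℝ) 1, ENNReal.ofReal (h * s ^ (d - 1)) * ⊤ = ⊤ := by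
    have : ∫⁻ s in Ioc (0 : ℝ) 1, ENNReal.ofReal (h * s ^ (d - 1)) * ⊤
        = ∫⁻ s in Ioc (0 : ℝ) 1, ⊤ := by
      refine setLIntegral_congr_fun measurableSet_Ioc fun s hs => ?_
      exact ENNReal.mul_top (by have := hs.1; simp; positivity)
    rw [this]; simp
  rw [this] at hfin
  exact lt_irrefl _ hfin

theorem measurable_homothety_prod (a : Vec d) :
    Measurable (fun q : ℝ × Vec d => AffineMap.homothety a q.1 q.2) := by
  have : (fun q : ℝ × Vec d => AffineMap.homothety a q.1 q.2) = fun q => q.1 • (q.2 - a) + a := by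
    ext q; simp [AffineMap.homothety_apply]
  rw [this]
  exact Continuous.measurable (by fun_prop)

/-- Integration over a cone. -/
theorem map_cone {F : Finset (Vec d)} (hF : F.Nonempty) {a n : Vec d} {h : ℝ}
    (hh : 0 < h) (hn : ‖n‖ = 1) (hFn : ∀ y ∈ F, inner ℝ n (y - a) = h) :
    volume.restrict (convexHull ℝ (insert a (F : Set (Vec d))))
      = (((volume.restrict (Ioc (0 : ℝ) 1)).withDensity
          (fun s => ENNReal.ofReal (h * s ^ (d - 1)))).prod ((surf d).restrict (hull F))).map
            (fun q => AffineMap.homothety a q.1 q.2) := by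
  have hfin := surf_hull_lt_top hF hh hn hFn
  have : IsFiniteMeasure ((surf d).restrict (hull F)) := ⟨by simpa using hfin⟩
  have hm : Measurable (fun s : ℝ => ENNReal.ofReal (h * s ^ (d - 1))) := by fun_prop
  ext t ht
  have hpre := (measurable_homothety_prod a) ht
  rw [restrict_apply ht, volume_cone hF hh hn hFn ht, map_apply (measurable_homothety_prod a) ht,
    prod_apply hpre, lintegral_withDensity_eq_lintegral_mul _ hm (measurable_measure_prodMk_left hpre)]
  refine lintegral_congr fun s => ?_
  simp only [Pi.mul_apply]
  rw [restrict_apply (measurable_prodMk_left hpre), inter_comm]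
  rfl

/-- The divergence theorem for a radial field on a cone. -/
theorem integral_cone_radial (hd : 1 ≤ d) {F : Finset (Vec d)} (hF : F.Nonempty) {a n : Vec d} {h : ℝ}
    (hh : 0 < h) (hn : ‖n‖ = 1) (hFn : ∀ y ∈ F, inner ℝ n (y - a) = h)
    {φ : Vec d → ℂ} (hφ : ContDiff ℝ 1 φ) :
    ∫ x in convexHull ℝ (insert a (F : Set (Vec d))), ((d : ℂ) * φ x + fderiv ℝ φ x (x - a))
      = h * ∫ y in hull F, φ y ∂(surf d) := by
  have hfin := surf_hull_lt_top hF hh hn hFn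
  have : IsFiniteMeasure ((surf d).restrict (hull F)) := ⟨by simpa using hfin⟩
  have hm : Measurable (fun s : ℝ => ENNReal.ofReal (h * s ^ (d - 1))) := by fun_prop
  have hm' : Measurable (fun s : ℝ => (h * s ^ (d - 1)).toNNReal) := by fun_prop
  have hc : IsCompact (convexHull ℝ (insert a (F : Set (Vec d)))) :=
    (F.finite_toSet.insert a).isCompact_convexHull ℝ
  have hcont : Continuous (fun x => ((d : ℂ) * φ x + fderiv ℝ φ x (x - a))) := by
    have := hφ.continuous
    have := hφ.continuous_fderiv one_ne_zero
    fun_prop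
  have hint : Integrable (fun x => ((d : ℂ) * φ x + fderiv ℝ φ x (x - a)))
      (volume.restrict (convexHull ℝ (insert a (F : Set (Vec d))))) :=
    hcont.continuousOn.integrableOn_compact hc
  have hmap := map_cone hF hh hn hFn
  rw [hmap] at hint ⊢
  rw [integral_map (measurable_homothety_prod a).aemeasurable hcont.aestronglyMeasurable]
  have hint' := (integrable_map_measure hcont.aestronglyMeasurable
    (measurable_homothety_prod a).aemeasurable).1 hint
  simp only [Function.comp_def] at hint'
  rw [integral_prod_symm _ hint', ← integral_const_mul]
  refine integral_congr_ae (ae_of_all _ fun y => ?_)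
  beta_reduce
  rw [integral_withDensity_eq_integral_toReal_smul hm (by simp), ← intervalIntegral.integral_of_le zero_le_one]
  -- On each ray from the apex, the integrand times the density `h * s ^ (d - 1)` is the derivative
  -- of `h * s ^ d * φ`, so the integral over the ray telescopes to the value on the base.
  have hder : ∀ s : ℝ, HasDerivAt (fun s : ℝ => (h : ℂ) * ((s : ℂ) ^ d * φ (s • (y - a) + a)))
      ((h : ℂ) * ((d * (s : ℂ) ^ (d - 1)) * φ (s • (y - a) + a)
        + (s : ℂ) ^ d * fderiv ℝ φ (s • (y - a) + a) (y - a))) s := by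
    intro s
    have h1 : HasDerivAt (fun s : ℝ => s • (y - a) + a) (y - a) s := by
      simpa using ((hasDerivAt_id s).smul_const (y - a)).add_const a
    have h2 := ((hφ.differentiable one_ne_zero) (s • (y - a) + a)).hasFDerivAt.comp_hasDerivAt s h1
    have h3 : HasDerivAt (fun s : ℝ => (s : ℂ) ^ d) (d * (s : ℂ) ^ (d - 1)) s := by
      exact (hasDerivAt_pow d (s : ℂ)).comp_ofReal
    exact (h3.mul h2).const_mul _
  have hcd : Continuous fun s : ℝ => ((h : ℂ) * ((d * (s : ℂ) ^ (d - 1)) * φ (s • (y - a) + a)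
        + (s : ℂ) ^ d * fderiv ℝ φ (s • (y - a) + a) (y - a))) := by
    have := hφ.continuous
    have := hφ.continuous_fderiv one_ne_zero
    fun_prop
  have hftc := intervalIntegral.integral_eq_sub_of_hasDerivAt (fun s _ => hder s)
    (hcd.intervalIntegrable 0 1)
  -- The contribution of the apex is `0 ^ d * φ a`, which vanishes only because `d` is positive.
  have hd0 : d ≠ 0 := by omega
  simp only [Complex.ofReal_one, one_pow, one_smul, sub_add_cancel, one_mul, Complex.ofReal_zero,
    zero_pow hd0, zero_mul, mul_zero, sub_zero] at hftc
  rw [← hftc]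
  refine intervalIntegral.integral_congr fun s hs => ?_
  rw [uIcc_of_le zero_le_one] at hs
  have hs0 := hs.1
  simp only [AffineMap.homothety_apply, vsub_eq_sub, vadd_eq_add, add_sub_cancel_right, map_smul]
  rw [ENNReal.toReal_ofReal (by positivity)]
  simp only [Complex.real_smul, Complex.ofReal_mul, Complex.ofReal_pow]
  have hp : (s : ℂ) ^ d = s ^ (d - 1) * s := by rw [← pow_succ, Nat.sub_add_cancel hd]
  rw [hp]
  ring

end IPDG

/-! ### Barycentric coordinates and the divergence theorem on a simplex. -/

namespace IPDG
open Measure Set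
open scoped Classical
variable {d : ℕ}

/-- The vertices of a nondegenerate `d`-simplex. -/
structure IsSimplex (K : Finset (Vec d)) : Prop where
  card_eq : K.card = d + 1
  indep : AffineIndependent ℝ ((↑) : K → Vec d)

variable {K : Finset (Vec d)}

/-- The vertices of a simplex as an affine basis. -/
noncomputable def IsSimplex.basis (hK : IsSimplex K) : AffineBasis K ℝ (Vec d) :=
  ⟨(↑), hK.indep, by
    rw [hK.indep.affineSpan_eq_top_iff_card_eq_finrank_add_one]; simp [hK.card_eq]⟩

@[simp] theorem IsSimplex.basis_apply (hK : IsSimplex K) (a : K) : hK.basis a = a := rfl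

/-- Barycentric coordinates. -/
noncomputable def IsSimplex.coord (hK : IsSimplex K) (a : K) (x : Vec d) : ℝ := hK.basis.coord a x

/-- Gradients of the barycentric coordinates. -/
noncomputable def IsSimplex.grad (hK : IsSimplex K) (a : K) : Vec d :=
  (InnerProductSpace.toDual ℝ (Vec d)).symm (hK.basis.coord a).linear.toContinuousLinearMap

namespace IsSimplex

theorem inner_grad (hK : IsSimplex K) (a : K) (w : Vec d) :
    inner ℝ (hK.grad a) w = (hK.basis.coord a).linear w := by
  simp [grad]

theorem inner_grad_sub (hK : IsSimplex K) (a : K) (x y : Vec d) :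
    inner ℝ (hK.grad a) (x - y) = hK.coord a x - hK.coord a y := by
  rw [inner_grad, ← vsub_eq_sub, AffineMap.linearMap_vsub]; rfl

theorem coord_self (hK : IsSimplex K) (a : K) : hK.coord a a = 1 := by
  have := hK.basis.coord_apply a a
  simpa [coord] using this

theorem coord_ne (hK : IsSimplex K) {a b : K} (h : a ≠ b) : hK.coord a b = 0 := by
  have := hK.basis.coord_apply a b
  simpa [coord, h] using this

theorem sum_coord (hK : IsSimplex K) (x : Vec d) : ∑ a, hK.coord a x = 1 :=
  hK.basis.sum_coord_apply_eq_one x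

theorem sum_coord_smul (hK : IsSimplex K) (x : Vec d) : ∑ a, hK.coord a x • (a : Vec d) = x :=
  hK.basis.linear_combination_coord_eq_self x

theorem sum_inner_grad (hK : IsSimplex K) (w : Vec d) : ∑ a, inner ℝ (hK.grad a) w = (0 : ℝ) := by
  have h : ∀ a, inner ℝ (hK.grad a) w = hK.coord a w - hK.coord a 0 := fun a => by
    rw [← inner_grad_sub, sub_zero]
  simp_rw [h, Finset.sum_sub_distrib, sum_coord, sub_self]

/-- This is the derivative of `x = ∑ λ_a(x) a` in the direction `w`. Together with `sum_inner_grad`,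
it recombines the radial identities of all vertices into the divergence theorem. -/
theorem sum_inner_grad_smul (hK : IsSimplex K) (w : Vec d) :
    ∑ a, (inner ℝ (hK.grad a) w : ℝ) • (a : Vec d) = w := by
  have h : ∀ a, inner ℝ (hK.grad a) w = hK.coord a w - hK.coord a 0 := fun a => by
    rw [← inner_grad_sub, sub_zero]
  simp_rw [h, sub_smul, Finset.sum_sub_distrib, sum_coord_smul, sub_zero]

theorem continuous_coord (hK : IsSimplex K) (a : K) : Continuous (hK.coord a) :=
  AffineMap.continuous_of_finiteDimensional _

theorem range_basis (hK : IsSimplex K) : Set.range hK.basis = (K : Set (Vec d)) :=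
  Subtype.range_coe

theorem mem_hull_iff (hK : IsSimplex K) {x : Vec d} : x ∈ hull K ↔ ∀ a, 0 ≤ hK.coord a x := by
  have := hK.basis.convexHull_eq_nonneg_coord
  rw [range_basis] at this
  rw [hull, this]; rfl

theorem mem_interior_hull_iff (hK : IsSimplex K) {x : Vec d} :
    x ∈ interior (hull K) ↔ ∀ a, 0 < hK.coord a x := by
  have := hK.basis.interior_convexHull
  rw [range_basis] at this
  rw [hull, this]; rfl

/-- The zero set of a coordinate is convex and contains every other vertex. Conversely, dropping the
zero coordinates of `x` leaves a convex combination of points of `s`. -/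
theorem mem_convexHull_iff (hK : IsSimplex K) {s : Set (Vec d)} (hs : s ⊆ K) {x : Vec d} :
    x ∈ convexHull ℝ s ↔ x ∈ hull K ∧ ∀ a : K, (a : Vec d) ∉ s → hK.coord a x = 0 := by
  constructor
  · intro hx
    refine ⟨convexHull_mono hs hx, fun a ha => ?_⟩
    have hc : Convex ℝ {y | hK.coord a y = 0} := by
      have : {y | hK.coord a y = 0} = (hK.basis.coord a) ⁻¹' {0} := rfl
      rw [this]
      exact (convex_singleton 0).affine_preimage _
    exact convexHull_min (fun y hy => hK.coord_ne (b := ⟨y, hs hy⟩)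
      (fun h => ha (by rw [h]; exact hy))) hc hx
  · rintro ⟨hx, h0⟩
    rw [hK.mem_hull_iff] at hx
    have e1 := hK.sum_coord x
    have e2 := hK.sum_coord_smul x
    set t : Finset K := Finset.univ.filter (fun a : K => (a : Vec d) ∈ s) with ht
    have hz : ∀ a ∉ t, hK.coord a x = 0 := fun a ha => h0 a (by simpa [ht] using ha)
    rw [← Finset.sum_subset (Finset.subset_univ t) (fun a _ ha => hz a ha)] at e1
    rw [← Finset.sum_subset (Finset.subset_univ t) (fun a _ ha => by rw [hz a ha, zero_smul])] at e2
    rw [← e2]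
    exact (convex_convexHull ℝ s).sum_mem (fun a _ => hx a) e1
      (fun a ha => subset_convexHull ℝ s (by simpa [ht] using ha))

theorem mem_face_iff (hK : IsSimplex K) (a : K) {x : Vec d} :
    x ∈ hull (K.erase a) ↔ x ∈ hull K ∧ hK.coord a x = 0 := by
  rw [hull, hK.mem_convexHull_iff (by exact_mod_cast Finset.erase_subset _ _)]
  refine and_congr_right fun _ => ⟨fun h => h a (by simp), fun h b hb => ?_⟩
  have : b = a := by
    by_contra hne
    exact hb (by simpa using fun h => hne (Subtype.ext h))
  rw [this, h]

theorem hull_diff_interior (hK : IsSimplex K) :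
    hull K \ interior (hull K) = ⋃ a : K, hull (K.erase a) := by
  ext x
  simp only [Set.mem_sdiff, mem_iUnion, hK.mem_face_iff, hK.mem_interior_hull_iff, not_forall, not_lt]
  constructor
  · rintro ⟨h, a, ha⟩
    exact ⟨a, h, le_antisymm ha (hK.mem_hull_iff.1 h a)⟩
  · rintro ⟨a, h, ha⟩
    exact ⟨h, a, ha.le⟩

theorem interior_nonempty (hK : IsSimplex K) : (interior (hull K)).Nonempty := by
  have := hK.basis.centroid_mem_interior_convexHull
  rw [range_basis] at this
  exact ⟨_, this⟩

theorem closure_interior (hK : IsSimplex K) : closure (interior (hull K)) = hull K := by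
  rw [Convex.closure_interior_eq_closure_of_nonempty_interior (𝕜 := ℝ) (s := hull K)
    (convex_convexHull ℝ _) hK.interior_nonempty]
  exact (isCompact_hull K).isClosed.closure_eq

theorem frontier_interior (hK : IsSimplex K) :
    frontier (interior (hull K)) = ⋃ a : K, hull (K.erase a) := by
  rw [frontier, hK.closure_interior, interior_interior, hK.hull_diff_interior]

theorem interior_ae_eq (K : Finset (Vec d)) : interior (hull K) =ᵐ[volume] hull K := by
  refine (ae_eq_set).2 ⟨by rw [sdiff_eq_empty.2 interior_subset, measure_empty], ?_⟩
  have : hull K \ interior (hull K) = frontier (hull K) := by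
    rw [frontier, (isCompact_hull K).isClosed.closure_eq]
  rw [this]
  exact (convex_convexHull ℝ _).addHaar_frontier _

theorem restrict_interior (K : Finset (Vec d)) :
    volume.restrict (interior (hull K)) = volume.restrict (hull K) :=
  Measure.restrict_congr_set (interior_ae_eq K)

theorem erase_nonempty (hK : IsSimplex K) (hd : 1 ≤ d) (a : K) : (K.erase (a : Vec d)).Nonempty := by
  rw [← Finset.card_pos, Finset.card_erase_of_mem a.2, hK.card_eq]; omega

theorem grad_ne_zero (hK : IsSimplex K) (hd : 1 ≤ d) (a : K) : hK.grad a ≠ 0 := by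
  intro h
  obtain ⟨b, hb⟩ := hK.erase_nonempty hd a
  rw [Finset.mem_erase] at hb
  have := hK.inner_grad_sub a a b
  rw [h, inner_zero_left, coord_self, hK.coord_ne (b := ⟨b, hb.2⟩) (fun h => hb.1 (by rw [h]))] at this
  norm_num at this

/-- A normal of the face opposite `a` annihilates `b - x` for every vertex `b` of that face, so only
the vertex `a` survives when a direction is expanded by `sum_inner_grad_smul`. -/
theorem eq_smul_grad (hK : IsSimplex K) (a : K) {n : Vec d}
    (h : ∀ x ∈ K.erase (a : Vec d), ∀ y ∈ K.erase (a : Vec d), inner ℝ n (y - x) = 0)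
    {x : Vec d} (hx : x ∈ K.erase (a : Vec d)) :
    n = (inner ℝ n ((a : Vec d) - x) : ℝ) • hK.grad a := by
  refine ext_inner_right ℝ fun w => ?_
  conv_lhs => rw [← hK.sum_inner_grad_smul w]
  -- The origin may be moved to `x` because the coefficients sum to zero.
  have : ∑ b : K, (inner ℝ (hK.grad b) w : ℝ) • (b : Vec d)
      = ∑ b : K, (inner ℝ (hK.grad b) w : ℝ) • ((b : Vec d) - x) := by
    simp_rw [smul_sub, Finset.sum_sub_distrib, ← Finset.sum_smul, sum_inner_grad]; simp
  rw [this, inner_sum, Finset.sum_eq_single a, inner_smul_right, inner_smul_left]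
  · simp [mul_comm]
  · intro b _ hb
    rw [inner_smul_right, h x hx b (Finset.mem_erase.2 ⟨fun h => hb (Subtype.ext h), b.2⟩),
      mul_zero]
  · simp

/-- Normals of the face are multiples of the gradient of the opposite coordinate; the unit length
fixes the modulus. This coordinate grows towards `a`, hence the minus sign. -/
theorem isOutwardNormal_iff (hK : IsSimplex K) (hd : 1 ≤ d) (a : K) {n : Vec d} :
    IsOutwardNormal K (K.erase a) n ↔ n = -(‖hK.grad a‖⁻¹ • hK.grad a) := by
  have hg := hK.grad_ne_zero hd a
  have hgp : 0 < ‖hK.grad a‖ := norm_pos_iff.2 hg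
  have hc : ∀ x ∈ K.erase (a : Vec d), hK.coord a x = 0 := fun x hx =>
    ((hK.mem_face_iff a).1 (subset_convexHull ℝ _ (by exact_mod_cast hx))).2
  constructor
  · rintro ⟨h1, h2, h3⟩
    obtain ⟨x, hx⟩ := hK.erase_nonempty hd a
    have hax := h3 x hx a a.2 (by simp)
    have key := hK.eq_smul_grad a h2 hx
    have hn := congrArg norm key
    rw [h1, norm_smul, Real.norm_of_nonpos hax.le] at hn
    have : inner ℝ n ((a : Vec d) - x) = -‖hK.grad a‖⁻¹ := by
      rw [eq_neg_iff_add_eq_zero, ← mul_right_inj' hgp.ne']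
      rw [mul_add, mul_inv_cancel₀ hgp.ne']; linarith
    rw [this] at key
    rw [key, neg_smul]
  · rintro rfl
    refine ⟨?_, fun x hx y hy => ?_, fun x hx b hb hbF => ?_⟩
    · rw [norm_neg, norm_smul, norm_inv, norm_norm, inv_mul_cancel₀ hgp.ne']
    · rw [inner_neg_left, inner_smul_left, inner_grad_sub, hc x hx, hc y hy]; simp
    · have hba : b = a := by
        by_contra h; exact hbF (Finset.mem_erase.2 ⟨h, hb⟩)
      subst hba
      rw [inner_neg_left, inner_smul_left, inner_grad_sub, hc x hx, coord_self]
      simp [hgp]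

theorem outwardNormal_eq (hK : IsSimplex K) (hd : 1 ≤ d) (a : K) :
    outwardNormal K (K.erase a) = -(‖hK.grad a‖⁻¹ • hK.grad a) :=
  (hK.isOutwardNormal_iff hd a).1 (Classical.epsilon_spec
    (p := IsOutwardNormal K (K.erase a)) ⟨_, (hK.isOutwardNormal_iff hd a).2 rfl⟩)

theorem isOutwardNormal_outwardNormal (hK : IsSimplex K) (hd : 1 ≤ d) (a : K) :
    IsOutwardNormal K (K.erase a) (outwardNormal K (K.erase a)) :=
  (hK.isOutwardNormal_iff hd a).2 (hK.outwardNormal_eq hd a)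

/-- The coordinate of `a` falls from 1 at `a` to 0 on the face with slope `‖hK.grad a‖`; the height
of the simplex over this face is therefore the inverse of the slope. This presents the simplex as a
cone with apex `a`. -/
theorem inner_outwardNormal_face (hK : IsSimplex K) (hd : 1 ≤ d) (a : K) :
    ∀ y ∈ K.erase (a : Vec d),
      inner ℝ (outwardNormal K (K.erase a)) (y - a) = ‖hK.grad a‖⁻¹ := by
  intro y hy
  have hc := ((hK.mem_face_iff a).1 (subset_convexHull ℝ _ (Finset.mem_coe.2 hy))).2
  rw [hK.outwardNormal_eq hd, inner_neg_left, inner_smul_left, inner_grad_sub, hc, coord_self]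
  simp

theorem integral_radial (hK : IsSimplex K) (hd : 1 ≤ d) (a : K)
    {φ : Vec d → ℂ} (hφ : ContDiff ℝ 1 φ) :
    ∫ x in hull K, ((d : ℂ) * φ x + fderiv ℝ φ x (x - a))
      = (‖hK.grad a‖⁻¹ : ℝ) * ∫ y in hull (K.erase a), φ y ∂(surf d) := by
  have hgp : 0 < ‖hK.grad a‖ := norm_pos_iff.2 (hK.grad_ne_zero hd a)
  have := integral_cone_radial hd (hK.erase_nonempty hd a) (inv_pos.2 hgp)
    (hK.isOutwardNormal_outwardNormal hd a).1 (hK.inner_outwardNormal_face hd a) hφ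
  rwa [← Finset.coe_insert, Finset.insert_erase a.2] at this

theorem surf_face_lt_top (hK : IsSimplex K) (hd : 1 ≤ d) (a : K) :
    surf d (hull (K.erase a)) < ⊤ :=
  surf_hull_lt_top (hK.erase_nonempty hd a)
    (inv_pos.2 (norm_pos_iff.2 (hK.grad_ne_zero hd a)))
    (hK.isOutwardNormal_outwardNormal hd a).1 (hK.inner_outwardNormal_face hd a)

/-- The divergence theorem on a simplex. -/
theorem integral_fderiv (hK : IsSimplex K) (hd : 1 ≤ d) {φ : Vec d → ℂ} (hφ : ContDiff ℝ 1 φ)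
    (w : Vec d) :
    ∫ x in hull K, fderiv ℝ φ x w
      = ∑ a ∈ K, (inner ℝ (outwardNormal K (K.erase a)) w : ℝ)
          * ∫ y in hull (K.erase a), φ y ∂(surf d) := by
  rw [← Finset.sum_coe_sort]
  -- The norm in the unit normal cancels the height in the radial identity from the opposite vertex,
  -- so every face term is a volume integral with weight `-(∇λ_a · w)`.
  have h1 : ∀ a : K, ((inner ℝ (outwardNormal K (K.erase a)) w : ℝ) : ℂ)
          * ∫ y in hull (K.erase (a : Vec d)), φ y ∂(surf d)
      = ∫ x in hull K, (-(inner ℝ (hK.grad a) w : ℝ) : ℂ) *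
          ((d : ℂ) * φ x + fderiv ℝ φ x (x - a)) := by
    intro a
    rw [integral_const_mul, hK.integral_radial hd a hφ, hK.outwardNormal_eq hd, inner_neg_left,
      inner_smul_left]
    simp only [conj_trivial, Complex.ofReal_neg, Complex.ofReal_mul]
    ring
  have hcφ := hφ.continuous
  have hcd := hφ.continuous_fderiv one_ne_zero
  have hint : ∀ a : K, Integrable (fun x => (-(inner ℝ (hK.grad a) w : ℝ) : ℂ) *
          ((d : ℂ) * φ x + fderiv ℝ φ x (x - a))) (volume.restrict (hull K)) := fun a =>
    ContinuousOn.integrableOn_compact (isCompact_hull K) (Continuous.continuousOn (by fun_prop))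
  simp_rw [h1]
  rw [← integral_finsetSum _ (fun a _ => hint a)]
  refine integral_congr_ae (ae_of_all _ fun x => ?_)
  beta_reduce
  -- After summation over `a`, the last term disappears since the gradients sum to zero, and the
  -- first one becomes the derivative in the direction `w`.
  have e : ∀ a : K, (-(inner ℝ (hK.grad a) w : ℝ) : ℂ) * ((d : ℂ) * φ x + fderiv ℝ φ x (x - a))
      = fderiv ℝ φ x ((inner ℝ (hK.grad a) w : ℝ) • (a : Vec d))
        - ((inner ℝ (hK.grad a) w : ℝ) : ℂ) * ((d : ℂ) * φ x + fderiv ℝ φ x x) := by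
    intro a
    rw [map_smul, map_sub, Complex.real_smul]; ring
  simp_rw [e]
  rw [Finset.sum_sub_distrib, ← _root_.map_sum, sum_inner_grad_smul, ← Finset.sum_mul,
    ← Complex.ofReal_sum, sum_inner_grad]
  simp

end IsSimplex

end IPDG

/-! ### The trace inequality on a simplex. -/

namespace IPDG
open Measure Set
open scoped Classical
variable {d : ℕ}

section SquareIntegrable

variable {α E : Type*} [MeasurableSpace α] {ν : Measure α} [NormedAddCommGroup E]

theorem eLpNorm_two_eq_ofReal_sqrt {f : α → E} (hf : MemLp f 2 ν) :
    eLpNorm f 2 ν = ENNReal.ofReal (Real.sqrt (∫ x, ‖f x‖ ^ 2 ∂ν)) := by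
  rw [hf.eLpNorm_eq_integral_rpow_norm (by norm_num) (by norm_num), Real.sqrt_eq_rpow]
  simp

theorem integrable_norm_sq {f : α → E} (hf : MemLp f 2 ν) : Integrable (fun x => ‖f x‖ ^ 2) ν := by
  simpa using hf.integrable_norm_pow (by norm_num)

end SquareIntegrable

theorem memLp_of_continuous_of_isCompact {E : Type*} [NormedAddCommGroup E] [SecondCountableTopology E]
    {ν : Measure (Vec d)}
    {s : Set (Vec d)} (hs : IsCompact s) (hν : ν s < ⊤) {f : Vec d → E} (hf : Continuous f)
    (p : ℝ≥0∞) : MemLp f p (ν.restrict s) := by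
  obtain ⟨C, hC⟩ := hs.exists_bound_of_continuousOn hf.continuousOn
  have : IsFiniteMeasure (ν.restrict s) := ⟨by simpa using hν⟩
  exact MemLp.of_bound hf.aestronglyMeasurable C
    ((ae_restrict_iff' hs.isClosed.measurableSet).2 (ae_of_all _ hC))

theorem fderiv_apply_eq_sum {G : Type*} [NormedAddCommGroup G] [NormedSpace ℝ G] (φ : Vec d → G)
    (x w : Vec d) : fderiv ℝ φ x w = ∑ i, w i • pderiv φ i x := by
  conv_lhs => rw [← (EuclideanSpace.basisFun (Fin d) ℝ).sum_repr w]
  simp [pderiv]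

theorem norm_fderiv_apply_le (φ : Vec d → ℂ) (x w : Vec d) :
    ‖fderiv ℝ φ x w‖ ≤ ‖classicalGrad φ x‖ * ‖w‖ := by
  rw [fderiv_apply_eq_sum, EuclideanSpace.norm_eq, EuclideanSpace.norm_eq, ← Real.sqrt_mul (by positivity)]
  refine Real.le_sqrt_of_sq_le ?_
  calc ‖∑ i, w i • pderiv φ i x‖ ^ 2 ≤ (∑ i, ‖pderiv φ i x‖ * ‖w i‖) ^ 2 := by
        gcongr
        refine (norm_sum_le _ _).trans (Finset.sum_le_sum fun i _ => ?_)
        rw [norm_smul, mul_comm]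
    _ ≤ _ := Finset.sum_mul_sq_le_sq_mul_sq _ _ _

theorem continuous_classicalGrad {φ : Vec d → ℂ} (hφ : ContDiff ℝ 1 φ) :
    Continuous (classicalGrad φ) := by
  have := hφ.continuous_fderiv one_ne_zero
  unfold classicalGrad pderiv
  fun_prop

/-- The radial identity from the opposite vertex, applied to `|φ|²`, expresses the face integral by
the volume integral of `d |φ|²` plus the radial derivative of `|φ|²`. Since `|x - a|` is at most the
diameter, the latter is controlled by `2 |φ| |∇φ|` and Young's inequality. -/
theorem IsSimplex.integral_norm_sq_face_le {K : Finset (Vec d)} (hK : IsSimplex K) (hd : 1 ≤ d) (a : K)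
    {φ : Vec d → ℂ} (hφ : ContDiff ℝ 1 φ) :
    ∫ x in hull (K.erase a), ‖φ x‖ ^ 2 ∂(surf d) ≤
      ‖hK.grad a‖ * (d + diamS K) *
        ((∫ x in hull K, ‖φ x‖ ^ 2) + ∫ x in hull K, ‖classicalGrad φ x‖ ^ 2) := by
  have hgp : 0 < ‖hK.grad a‖ := norm_pos_iff.2 (hK.grad_ne_zero hd a)
  have hψ : ContDiff ℝ 1 (fun x => φ x * conj (φ x)) :=
    hφ.mul (Complex.conjCLE.contDiff.comp hφ)
  have key := hK.integral_radial hd a hψ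
  have hc := hφ.continuous
  have hcg := continuous_classicalGrad hφ
  have hD : 0 ≤ diamS K := Metric.diam_nonneg
  have hfin : volume (hull K) < ⊤ := (isCompact_hull K).measure_lt_top
  have i1 : IntegrableOn (fun x => ‖φ x‖ ^ 2) (hull K) :=
    integrable_norm_sq (memLp_of_continuous_of_isCompact (isCompact_hull K) hfin hc 2)
  have i2 : IntegrableOn (fun x => ‖classicalGrad φ x‖ ^ 2) (hull K) :=
    integrable_norm_sq (memLp_of_continuous_of_isCompact (isCompact_hull K) hfin hcg 2)
  have h1 : ∫ y in hull (K.erase (a : Vec d)), φ y * conj (φ y) ∂(surf d)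
      = ((∫ x in hull (K.erase (a : Vec d)), ‖φ x‖ ^ 2 ∂(surf d) : ℝ) : ℂ) := by
    rw [← integral_complex_ofReal]
    refine integral_congr_ae (ae_of_all _ fun x => ?_)
    simp [Complex.mul_conj, Complex.normSq_eq_norm_sq]
  rw [h1, ← Complex.ofReal_mul] at key
  have h2 : ‖∫ x in hull K, ((d : ℂ) * (φ x * conj (φ x))
      + fderiv ℝ (fun x => φ x * conj (φ x)) x (x - a))‖
      ≤ ∫ x in hull K, (d + diamS K) * (‖φ x‖ ^ 2 + ‖classicalGrad φ x‖ ^ 2) := by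
    refine norm_integral_le_of_norm_le ((i1.add i2).const_mul _) ?_
    refine (ae_restrict_iff' (measurableSet_hull K)).2 (ae_of_all _ fun x hx => ?_)
    have hder : fderiv ℝ (fun x => φ x * conj (φ x)) x (x - a)
        = φ x * conj (fderiv ℝ φ x (x - a)) + conj (φ x) * fderiv ℝ φ x (x - a) := by
      have e1 := ((hφ.differentiable one_ne_zero) x).hasFDerivAt
      have e2 : HasFDerivAt (fun x => conj (φ x)) _ x := Complex.conjCLE.hasFDerivAt.comp x e1
      rw [show fderiv ℝ (fun x => φ x * conj (φ x)) x = _ from (e1.mul e2).fderiv]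
      simp
    have hxa : ‖x - a‖ ≤ diamS K := by
      rw [← dist_eq_norm]
      exact Metric.dist_le_diam_of_mem (isCompact_hull K).isBounded hx
        (subset_convexHull ℝ _ a.2)
    have hf : ‖fderiv ℝ φ x (x - a)‖ ≤ ‖classicalGrad φ x‖ * diamS K :=
      (norm_fderiv_apply_le φ x _).trans (by gcongr)
    rw [hder]
    have hfn := norm_nonneg (φ x)
    calc _ ≤ (d : ℝ) * ‖φ x‖ ^ 2 + (‖φ x‖ * (‖classicalGrad φ x‖ * diamS K)
          + ‖φ x‖ * (‖classicalGrad φ x‖ * diamS K)) := by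
          refine (norm_add_le _ _).trans (add_le_add ?_ ((norm_add_le _ _).trans (add_le_add ?_ ?_)))
          · simp [pow_two]
          · rw [norm_mul, RCLike.norm_conj]; gcongr
          · rw [norm_mul, RCLike.norm_conj]; gcongr
      _ ≤ _ := by
          have := two_mul_le_add_sq ‖φ x‖ ‖classicalGrad φ x‖
          have h5 := mul_le_mul_of_nonneg_left this hD
          have : 0 ≤ (d : ℝ) * ‖classicalGrad φ x‖ ^ 2 := by positivity
          nlinarith
  rw [key, integral_const_mul, integral_add i1 i2, Complex.norm_real, Real.norm_eq_abs] at h2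
  have h3 := (le_abs_self _).trans h2
  have h4 := mul_le_mul_of_nonneg_left h3 hgp.le
  rw [← mul_assoc, mul_inv_cancel₀ hgp.ne', one_mul, ← mul_assoc] at h4
  exact h4

/-- The trace inequality on a simplex. -/
theorem IsSimplex.eLpNorm_face_le {K : Finset (Vec d)} (hK : IsSimplex K) (hd : 1 ≤ d) (a : K) :
    ∃ C : ℝ≥0, ∀ φ : Vec d → ℂ, ContDiff ℝ 1 φ →
      eLpNorm φ 2 ((surf d).restrict (hull (K.erase a))) ≤
        C * (eLpNorm φ 2 (volume.restrict (hull K))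
          + eLpNorm (classicalGrad φ) 2 (volume.restrict (hull K))) := by
  refine ⟨(Real.sqrt (‖hK.grad a‖ * (d + diamS K))).toNNReal, fun φ hφ => ?_⟩
  have hfin : volume (hull K) < ⊤ := (isCompact_hull K).measure_lt_top
  have hD : 0 ≤ diamS K := Metric.diam_nonneg
  rw [eLpNorm_two_eq_ofReal_sqrt (memLp_of_continuous_of_isCompact (isCompact_hull _)
      (hK.surf_face_lt_top hd a) hφ.continuous 2),
    eLpNorm_two_eq_ofReal_sqrt (memLp_of_continuous_of_isCompact (isCompact_hull _) hfin
      hφ.continuous 2),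
    eLpNorm_two_eq_ofReal_sqrt (memLp_of_continuous_of_isCompact (isCompact_hull _) hfin
      (continuous_classicalGrad hφ) 2),
    ← ENNReal.ofReal_add (Real.sqrt_nonneg _) (Real.sqrt_nonneg _)]
  change _ ≤ ENNReal.ofReal (Real.sqrt (‖hK.grad a‖ * (d + diamS K))) * _
  rw [← ENNReal.ofReal_mul (Real.sqrt_nonneg _)]
  refine ENNReal.ofReal_le_ofReal ((Real.sqrt_le_sqrt
    (hK.integral_norm_sq_face_le hd a hφ)).trans ?_)
  rw [Real.sqrt_mul (by positivity)]
  gcongr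
  have hA : 0 ≤ ∫ x in hull K, ‖φ x‖ ^ 2 := integral_nonneg fun _ => by positivity
  have hB : 0 ≤ ∫ x in hull K, ‖classicalGrad φ x‖ ^ 2 := integral_nonneg fun _ => by positivity
  refine Real.sqrt_le_iff.2 ⟨by positivity, ?_⟩
  nlinarith [Real.sq_sqrt hA, Real.sq_sqrt hB,
    mul_nonneg (Real.sqrt_nonneg (∫ x in hull K, ‖φ x‖ ^ 2))
      (Real.sqrt_nonneg (∫ x in hull K, ‖classicalGrad φ x‖ ^ 2))]

end IPDG

/-! ### Null sets, relative interiors of faces and the combinatorics of a matching mesh. -/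

namespace IPDG
open Measure Set
open scoped Classical
variable {d : ℕ}

/-! ### Null sets -/

/-- The subspace is an isometric copy of its direction, so its Hausdorff dimension is less than `d -
1`. -/
theorem surf_affineSubspace (L : AffineSubspace ℝ (Vec d))
    (hL : Module.finrank ℝ L.direction < d - 1) : surf d (L : Set (Vec d)) = 0 := by
  rcases (L : Set (Vec d)).eq_empty_or_nonempty with h | ⟨p, hp⟩
  · rw [h, measure_empty]
  have hiso : Isometry (fun v : L.direction => (v : Vec d) + p) :=
    (IsometryEquiv.addRight p).isometry.comp isometry_subtype_coe
  have himg : (L : Set (Vec d)) = (fun v : L.direction => (v : Vec d) + p) '' univ := by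
    ext x
    simp only [SetLike.mem_coe, image_univ, mem_range, Subtype.exists, exists_prop]
    constructor
    · intro hx
      exact ⟨x - p, AffineSubspace.vsub_mem_direction hx hp, by abel⟩
    · rintro ⟨v, hv, rfl⟩
      exact AffineSubspace.vadd_mem_of_mem_direction hv hp
  have hdim : dimH (L : Set (Vec d)) = Module.finrank ℝ L.direction := by
    rw [himg, hiso.dimH_image, Real.dimH_univ_eq_finrank]
  have := hausdorffMeasure_of_dimH_lt (s := (L : Set (Vec d))) (d := ((d - 1 : ℕ) : NNReal))
    (by rw [hdim]; exact_mod_cast hL)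
  rw [surf, euclideanHausdorffMeasure_def, Measure.smul_apply]
  simp only [NNReal.coe_natCast] at this
  rw [this, smul_zero]

theorem surf_hull_eq_zero {s : Finset (Vec d)} (hs : s.card < d) : surf d (hull s) = 0 := by
  rcases s.eq_empty_or_nonempty with rfl | hne
  · simp [hull]
  have hp := Finset.card_pos.2 hne
  obtain ⟨n, hn⟩ : ∃ n, s.card = n + 1 := ⟨s.card - 1, by omega⟩
  have h := finrank_vectorSpan_image_finset_le ℝ (id : Vec d → Vec d) s hn
  rw [Finset.image_id] at h
  refine measure_mono_null (convexHull_subset_affineSpan (𝕜 := ℝ) (s : Set (Vec d)))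
    (surf_affineSubspace _ ?_)
  rw [direction_affineSpan]
  omega

theorem volume_affineSubspace (L : AffineSubspace ℝ (Vec d))
    (hL : Module.finrank ℝ L.direction < d) : volume (L : Set (Vec d)) = 0 := by
  refine addHaar_affineSubspace _ _ fun h => ?_
  rw [h, AffineSubspace.direction_top, finrank_top, finrank_euclideanSpace, Fintype.card_fin] at hL
  exact lt_irrefl _ hL

theorem volume_convexHull_eq_zero {s : Finset (Vec d)} (hs : s.card ≤ d) :
    volume (convexHull ℝ (s : Set (Vec d))) = 0 := by
  rcases s.eq_empty_or_nonempty with rfl | hne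
  · simp
  have hp := Finset.card_pos.2 hne
  obtain ⟨n, hn⟩ : ∃ n, s.card = n + 1 := ⟨s.card - 1, by omega⟩
  have h := finrank_vectorSpan_image_finset_le ℝ (id : Vec d → Vec d) s hn
  rw [Finset.image_id] at h
  refine measure_mono_null (convexHull_subset_affineSpan (𝕜 := ℝ) (s : Set (Vec d)))
    (volume_affineSubspace _ ?_)
  rw [direction_affineSpan]
  omega

theorem IsPolytopal.surf_closure_diff {P : Set (Vec d)} (h : IsPolytopal (d - 1) P) :
    surf d (closure P \ P) = 0 := by
  obtain ⟨H, hH, hsub⟩ := h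
  refine measure_mono_null hsub ((measure_biUnion_null_iff H.countable_toSet).2 fun L hL => ?_)
  exact surf_affineSubspace L (hH L hL)

theorem IsPolytopal.volume_closure_diff {P : Set (Vec d)} (h : IsPolytopal d P) :
    volume (closure P \ P) = 0 := by
  obtain ⟨H, hH, hsub⟩ := h
  refine measure_mono_null hsub ((measure_biUnion_null_iff H.countable_toSet).2 fun L hL => ?_)
  exact volume_affineSubspace L (hH L hL)

/-! ### Relative interior of faces -/

/-- `c` lies in the relative interior of the simplex with vertices `F`. -/
def IsInner (F : Finset (Vec d)) (c : Vec d) : Prop :=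
  c ∈ hull F ∧ ∀ b ∈ F, c ∉ hull (F.erase b)

/-- The exceptional points lie on subfaces with `d - 1` vertices. Hence whatever holds at inner
points of a face holds almost everywhere on it. -/
theorem surf_not_isInner {F : Finset (Vec d)} (hd : 1 ≤ d) (hF : F.card = d) :
    surf d {c | c ∈ hull F ∧ ¬ IsInner F c} = 0 := by
  have : {c | c ∈ hull F ∧ ¬ IsInner F c} ⊆ ⋃ b ∈ F, hull (F.erase b) := by
    rintro c ⟨hc, h⟩
    simp only [IsInner, hc, true_and, not_forall, not_not] at h
    obtain ⟨b, hb, h⟩ := h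
    exact mem_iUnion₂.2 ⟨b, hb, h⟩
  refine measure_mono_null this ((measure_biUnion_null_iff F.countable_toSet).2 fun b hb => ?_)
  exact surf_hull_eq_zero (by rw [Finset.card_erase_of_mem hb]; omega)

namespace IsSimplex

variable {K : Finset (Vec d)}

theorem isInner_iff (hK : IsSimplex K) (a : K) {c : Vec d} :
    IsInner (K.erase a) c ↔ hK.coord a c = 0 ∧ ∀ b, b ≠ a → 0 < hK.coord b c := by
  rw [IsInner, hK.mem_face_iff, hK.mem_hull_iff]
  have hsub : ∀ b : Vec d, (((K.erase (a : Vec d)).erase b : Finset (Vec d)) : Set (Vec d)) ⊆ K := by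
    intro b
    exact_mod_cast (Finset.erase_subset _ _).trans (Finset.erase_subset _ _)
  constructor
  · rintro ⟨⟨h1, h2⟩, h3⟩
    refine ⟨h2, fun b hb => lt_of_le_of_ne (h1 b) fun h0 => ?_⟩
    have hbF : (b : Vec d) ∈ K.erase (a : Vec d) :=
      Finset.mem_erase.2 ⟨fun h => hb (Subtype.ext h), b.2⟩
    refine h3 b hbF ((hK.mem_convexHull_iff (hsub b)).2 ⟨hK.mem_hull_iff.2 h1, fun e he => ?_⟩)
    by_cases hea : e = a
    · rw [hea, h2]
    by_cases heb : e = b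
    · rw [heb, h0]
    · refine absurd ?_ he
      simp [Subtype.coe_injective.ne hea, Subtype.coe_injective.ne heb]
  · rintro ⟨h1, h2⟩
    refine ⟨⟨fun b => ?_, h1⟩, fun b hb hc => ?_⟩
    · by_cases h : b = a
      · rw [h, h1]
      · exact (h2 b h).le
    · have hbK := Finset.mem_of_mem_erase hb
      have := ((hK.mem_convexHull_iff (hsub b)).1 hc).2 ⟨b, hbK⟩ (by simp)
      exact (h2 ⟨b, hbK⟩ (fun h => (Finset.mem_erase.1 hb).1 (congrArg Subtype.val h))).ne' this

theorem exists_isInner (hK : IsSimplex K) (hd : 1 ≤ d) (a : K) : ∃ c, IsInner (K.erase a) c := by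
  set s : Finset K := Finset.univ.erase a with hs
  have hcard : s.card = d := by
    rw [hs, Finset.card_erase_of_mem (Finset.mem_univ _)]; simp [hK.card_eq]
  refine ⟨Finset.centroid ℝ s hK.basis, (hK.isInner_iff a).2 ⟨?_, fun b hb => ?_⟩⟩
  · rw [Finset.centroid_def]
    exact hK.basis.coord_apply_combination_of_notMem (by simp [hs])
      (s.sum_centroidWeights_eq_one_of_card_ne_zero ℝ (by omega))
  · have : hK.coord b (Finset.centroid ℝ s hK.basis) = _ :=
      hK.basis.coord_apply_centroid (s := s) (i := b) (by simp [hs, hb])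
    rw [this, hcard]
    have : (0 : ℝ) < d := by exact_mod_cast hd
    positivity

/-- The coordinate of the opposite vertex is, up to a positive factor, minus the signed distance to
the plane of the face. -/
theorem coord_eq_of_isInner (hK : IsSimplex K) (hd : 1 ≤ d) {a : K} {c : Vec d}
    (hc : IsInner (K.erase a) c) (y : Vec d) :
    hK.coord a y = -(‖hK.grad a‖ * inner ℝ (outwardNormal K (K.erase a)) (y - c)) := by
  have hgp : 0 < ‖hK.grad a‖ := norm_pos_iff.2 (hK.grad_ne_zero hd a)
  rw [hK.outwardNormal_eq hd, inner_neg_left, inner_smul_left, inner_grad_sub,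
    ((hK.isInner_iff a).1 hc).1]
  simp only [conj_trivial, sub_zero]
  field_simp

theorem eventually_coord_pos (hK : IsSimplex K) {a : K} {c : Vec d}
    (hc : IsInner (K.erase a) c) : ∀ᶠ y in 𝓝 c, ∀ b, b ≠ a → 0 < hK.coord b y := by
  rw [eventually_all]
  intro b
  by_cases hb : b = a
  · simp [hb]
  filter_upwards [(hK.continuous_coord b).continuousAt.eventually
    (lt_mem_nhds (((hK.isInner_iff a).1 hc).2 b hb))] with y hy _ using hy

/-- Near an inner point of the face the other coordinates remain positive, so only the side of the
plane of the face decides membership. -/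
theorem eventually_mem_interior (hK : IsSimplex K) (hd : 1 ≤ d) {a : K} {c : Vec d}
    (hc : IsInner (K.erase a) c) :
    ∀ᶠ y in 𝓝 c, inner ℝ (outwardNormal K (K.erase a)) (y - c) < 0 → y ∈ interior (hull K) := by
  have hgp : 0 < ‖hK.grad a‖ := norm_pos_iff.2 (hK.grad_ne_zero hd a)
  filter_upwards [hK.eventually_coord_pos hc] with y hy hn
  refine hK.mem_interior_hull_iff.2 fun b => ?_
  by_cases hb : b = a
  · rw [hb, hK.coord_eq_of_isInner hd hc]; nlinarith
  · exact hy b hb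

theorem eventually_mem_hull (hK : IsSimplex K) (hd : 1 ≤ d) {a : K} {c : Vec d}
    (hc : IsInner (K.erase a) c) :
    ∀ᶠ y in 𝓝 c, inner ℝ (outwardNormal K (K.erase a)) (y - c) ≤ 0 → y ∈ hull K := by
  have hgp : 0 < ‖hK.grad a‖ := norm_pos_iff.2 (hK.grad_ne_zero hd a)
  filter_upwards [hK.eventually_coord_pos hc] with y hy hn
  refine hK.mem_hull_iff.2 fun b => ?_
  by_cases hb : b = a
  · rw [hb, hK.coord_eq_of_isInner hd hc]; nlinarith
  · exact (hy b hb).le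

end IsSimplex

theorem exists_eq_erase {F K : Finset (Vec d)} (hFK : F ⊆ K) (hF : F.card = d)
    (hK : K.card = d + 1) : ∃ a : K, F = K.erase a := by
  have h1 : (K \ F).card = 1 := by rw [Finset.card_sdiff_of_subset hFK]; omega
  obtain ⟨a, ha⟩ := Finset.card_eq_one.1 h1
  have haK : a ∈ K \ F := by rw [ha]; simp
  refine ⟨⟨a, (Finset.mem_sdiff.1 haK).1⟩, ?_⟩
  rw [Finset.erase_eq, ← ha, Finset.sdiff_sdiff_eq_self hFK]

/-- There are no slits: a boundary point is on or below the local graph, and moving it against `e`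
reaches points strictly below, which have a neighbourhood disjoint from `Ω`. Hence no boundary point
is interior to the closure. -/
theorem IsLipschitzDomain.interior_closure_subset {Ω : Set (Vec d)} (h : IsLipschitzDomain Ω) :
    interior (closure Ω) ⊆ Ω := by
  obtain ⟨ho, -, -, hl⟩ := h
  intro x hx
  by_contra hxΩ
  have hxf : x ∈ frontier Ω := by
    rw [ho.frontier_eq]; exact ⟨interior_subset hx, hxΩ⟩
  obtain ⟨e, he, C, ζ, hζ, hζe, r, hr, hball⟩ := hl x hxf
  have hle : inner ℝ e x ≤ ζ x := by
    by_contra hlt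
    exact hxΩ ((hball x (Metric.mem_ball_self hr)).2 (not_le.1 hlt))
  have hc : Continuous fun s : ℝ => x + (-s) • e := by fun_prop
  have hev : ∀ᶠ s in 𝓝[>] (0 : ℝ), x + (-s) • e ∈ interior (closure Ω) ∩ Metric.ball x r := by
    refine nhdsWithin_le_nhds (hc.continuousAt.eventually_mem ?_)
    rw [neg_zero, zero_smul, add_zero]
    exact (isOpen_interior.inter Metric.isOpen_ball).mem_nhds ⟨hx, Metric.mem_ball_self hr⟩
  obtain ⟨s, ⟨hs1, hs2⟩, hs0⟩ := (hev.and self_mem_nhdsWithin).exists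
  set y := x + (-s) • e with hy
  have hlt : inner ℝ e y < ζ y := by
    rw [hy, hζe, inner_add_right, inner_smul_right, real_inner_self_eq_norm_sq, he]
    have : (0 : ℝ) < s := hs0
    linarith
  have hopen : IsOpen ({z : Vec d | inner ℝ e z < ζ z} ∩ Metric.ball x r) :=
    (isOpen_lt (by fun_prop) hζ.continuous).inter Metric.isOpen_ball
  obtain ⟨z, ⟨hz1, hz2⟩, hzΩ⟩ := mem_closure_iff.1 (interior_subset hs1) _ hopen ⟨hlt, hs2⟩
  exact lt_asymm hz1 ((hball z hz2).1 hzΩ)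

theorem mem_facesOf {T : Finset (Finset (Vec d))} {F : Finset (Vec d)} :
    F ∈ facesOf T ↔ ∃ K ∈ T, F ⊆ K ∧ F.card = d := by
  simp [facesOf, Finset.mem_powersetCard]

namespace Mesh

variable {S : HelmholtzData d} (M : Mesh S)

theorem isSimplex {K : Finset (Vec d)} (hK : K ∈ M.T) : IsSimplex K :=
  ⟨M.card_eq K hK, M.indep K hK⟩

theorem hull_subset_closure {K : Finset (Vec d)} (hK : K ∈ M.T) : hull K ⊆ closure S.Ω := by
  rw [← M.cover]; exact subset_biUnion_of_mem (u := fun K => hull K) hK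

theorem interior_hull_subset {K : Finset (Vec d)} (hK : K ∈ M.T) : interior (hull K) ⊆ S.Ω :=
  (interior_mono (M.hull_subset_closure hK)).trans S.lipschitz.interior_closure_subset

theorem volume_hull_inter {K K' : Finset (Vec d)} (hK : K ∈ M.T) (hK' : K' ∈ M.T) (h : K ≠ K') :
    volume (hull K ∩ hull K') = 0 := by
  rw [M.matching K hK K' hK', ← Finset.coe_inter]
  refine volume_convexHull_eq_zero ?_
  have : (K ∩ K').card < K.card := by
    refine Finset.card_lt_card (Finset.ssubset_iff_subset_ne.2 ⟨Finset.inter_subset_left, fun he => h ?_⟩)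
    exact Finset.eq_of_subset_of_card_le (Finset.inter_eq_left.1 he)
      (by rw [M.card_eq K hK, M.card_eq K' hK'])
  rw [M.card_eq K hK] at this
  omega

theorem erase_mem_facesOf {K : Finset (Vec d)} (hK : K ∈ M.T) (a : K) :
    K.erase (a : Vec d) ∈ facesOf M.T := by
  refine mem_facesOf.2 ⟨K, hK, Finset.erase_subset _ _, ?_⟩
  rw [Finset.card_erase_of_mem a.2, M.card_eq K hK]; omega

theorem card_face {F : Finset (Vec d)} (hF : F ∈ facesOf M.T) : F.card = d := by
  obtain ⟨K, -, -, h⟩ := mem_facesOf.1 hF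
  exact h

theorem exists_eq_erase_of_mem {F K : Finset (Vec d)} (hF : F ∈ facesOf M.T) (hK : K ∈ M.T)
    (hFK : F ⊆ K) : ∃ a : K, F = K.erase a :=
  exists_eq_erase hFK (M.card_face hF) (M.card_eq K hK)

theorem surf_face_lt_top (hd : 1 ≤ d) {F : Finset (Vec d)} (hF : F ∈ facesOf M.T) :
    surf d (hull F) < ⊤ := by
  obtain ⟨K, hK, hFK, -⟩ := mem_facesOf.1 hF
  obtain ⟨a, rfl⟩ := M.exists_eq_erase_of_mem hF hK hFK
  exact (M.isSimplex hK).surf_face_lt_top hd a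

/-- By matching, the intersection is carried by common vertices, of which there are fewer than `d`.
The hypothesis on the mesh concerns elements, so it first yields `F ∩ K'`; if `F ⊆ K'`, then both
faces belong to the simplex `K'` and its coordinates finish the argument. -/
theorem surf_face_inter {F F' : Finset (Vec d)} (hF : F ∈ facesOf M.T)
    (hF' : F' ∈ facesOf M.T) (h : F ≠ F') : surf d (hull F ∩ hull F') = 0 := by
  obtain ⟨K, hK, hFK, hFc⟩ := mem_facesOf.1 hF
  obtain ⟨K', hK', hFK', hFc'⟩ := mem_facesOf.1 hF'
  have hsub : hull F ∩ hull F' ⊆ hull (F ∩ K') := by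
    rintro x ⟨hx, hx'⟩
    have hxi : x ∈ hull K ∩ hull K' := ⟨convexHull_mono (by exact_mod_cast hFK) hx,
      convexHull_mono (by exact_mod_cast hFK') hx'⟩
    rw [M.matching K hK K' hK', (M.isSimplex hK).mem_convexHull_iff inter_subset_left] at hxi
    have hxF := ((M.isSimplex hK).mem_convexHull_iff (by exact_mod_cast hFK)).1 hx
    refine ((M.isSimplex hK).mem_convexHull_iff
      (by exact_mod_cast Finset.inter_subset_left.trans hFK)).2 ⟨hxi.1, fun a ha => ?_⟩
    by_cases haF : (a : Vec d) ∈ F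
    · exact hxi.2 a fun h => ha (by simpa [haF] using h.2)
    · exact hxF.2 a (by simpa using haF)
  by_cases hF2 : F ⊆ K'
  · have hsub2 : hull F ∩ hull F' ⊆ hull (F ∩ F') := by
      rintro x ⟨hx, hx'⟩
      have h1 := ((M.isSimplex hK').mem_convexHull_iff (by exact_mod_cast hF2)).1 hx
      have h2 := ((M.isSimplex hK').mem_convexHull_iff (by exact_mod_cast hFK')).1 hx'
      refine ((M.isSimplex hK').mem_convexHull_iff
        (by exact_mod_cast Finset.inter_subset_left.trans hF2)).2 ⟨h1.1, fun a ha => ?_⟩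
      by_cases haF : (a : Vec d) ∈ F
      · exact h2.2 a (fun h => ha (by simpa [haF] using h))
      · exact h1.2 a (by simpa using haF)
    refine measure_mono_null hsub2 (surf_hull_eq_zero ?_)
    refine lt_of_lt_of_eq ?_ hFc
    refine Finset.card_lt_card (Finset.ssubset_iff_subset_ne.2 ⟨Finset.inter_subset_left, fun he => h ?_⟩)
    exact Finset.eq_of_subset_of_card_le (Finset.inter_eq_left.1 he) (by rw [hFc, hFc'])
  · refine measure_mono_null hsub (surf_hull_eq_zero ?_)
    refine lt_of_lt_of_eq ?_ hFc
    exact Finset.card_lt_card (Finset.ssubset_iff_subset_ne.2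
      ⟨Finset.inter_subset_left, fun he => hF2 (Finset.inter_eq_left.1 he)⟩)

theorem outwardNormal_spec (hd : 1 ≤ d) {F K : Finset (Vec d)} (hF : F ∈ facesOf M.T)
    (hK : K ∈ M.T) (hFK : F ⊆ K) : IsOutwardNormal K F (outwardNormal K F) := by
  obtain ⟨a, rfl⟩ := M.exists_eq_erase_of_mem hF hK hFK
  exact (M.isSimplex hK).isOutwardNormal_outwardNormal hd a

theorem eq_outwardNormal (hd : 1 ≤ d) {F K : Finset (Vec d)} (hF : F ∈ facesOf M.T)
    (hK : K ∈ M.T) (hFK : F ⊆ K) {n : Vec d} (h : IsOutwardNormal K F n) :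
    n = outwardNormal K F := by
  obtain ⟨a, rfl⟩ := M.exists_eq_erase_of_mem hF hK hFK
  rw [(M.isSimplex hK).outwardNormal_eq hd a]
  exact ((M.isSimplex hK).isOutwardNormal_iff hd a).1 h

theorem eventually_mem_interior (hd : 1 ≤ d) {F K : Finset (Vec d)} (hF : F ∈ facesOf M.T)
    (hK : K ∈ M.T) (hFK : F ⊆ K) {c : Vec d} (hc : IsInner F c) :
    ∀ᶠ y in 𝓝 c, inner ℝ (outwardNormal K F) (y - c) < 0 → y ∈ interior (hull K) := by
  obtain ⟨a, rfl⟩ := M.exists_eq_erase_of_mem hF hK hFK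
  exact (M.isSimplex hK).eventually_mem_interior hd hc

theorem eventually_mem_hull (hd : 1 ≤ d) {F K : Finset (Vec d)} (hF : F ∈ facesOf M.T)
    (hK : K ∈ M.T) (hFK : F ⊆ K) {c : Vec d} (hc : IsInner F c) :
    ∀ᶠ y in 𝓝 c, inner ℝ (outwardNormal K F) (y - c) ≤ 0 → y ∈ hull K := by
  obtain ⟨a, rfl⟩ := M.exists_eq_erase_of_mem hF hK hFK
  exact (M.isSimplex hK).eventually_mem_hull hd hc

theorem exists_isInner (hd : 1 ≤ d) {F : Finset (Vec d)} (hF : F ∈ facesOf M.T) :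
    ∃ c, IsInner F c := by
  obtain ⟨K, hK, hFK, -⟩ := mem_facesOf.1 hF
  obtain ⟨a, rfl⟩ := M.exists_eq_erase_of_mem hF hK hFK
  exact (M.isSimplex hK).exists_isInner hd a

/-- Two elements sharing a face lie on opposite sides of it. -/
theorem outwardNormal_eq_neg (hd : 1 ≤ d) {F K K' : Finset (Vec d)} (hF : F ∈ facesOf M.T)
    (hK : K ∈ M.T) (hFK : F ⊆ K) (hK' : K' ∈ M.T) (hFK' : F ⊆ K') (hne : K ≠ K') :
    outwardNormal K' F = -outwardNormal K F := by
  have hn := M.outwardNormal_spec hd hF hK hFK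
  have hn' := M.outwardNormal_spec hd hF hK' hFK'
  obtain ⟨a, hFa⟩ := M.exists_eq_erase_of_mem hF hK hFK
  have hFne : F.Nonempty := by rw [← Finset.card_pos, M.card_face hF]; omega
  obtain ⟨x, hx⟩ := hFne
  have hunique : ∀ b ∈ K, b ∉ F → b = a := by
    intro b hb hbF
    by_contra h
    exact hbF (hFa ▸ Finset.mem_erase.2 ⟨h, hb⟩)
  have hconst : ∀ n : Vec d, (∀ x ∈ F, ∀ y ∈ F, inner ℝ n (y - x) = 0) → ∀ y ∈ F,
      inner ℝ n ((a : Vec d) - y) = inner ℝ n ((a : Vec d) - x) := by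
    intro n h y hy
    have := h x hx y hy
    rw [show (a : Vec d) - x = (a - y) + (y - x) by abel, inner_add_right, this, add_zero]
  -- The sign tells on which side of the face `K` lies relative to `K'`. If it is negative, both
  -- elements fill the same side near an inner point of the face, and their interiors overlap in an
  -- open set of positive volume.
  rcases lt_trichotomy (inner ℝ (outwardNormal K' F) ((a : Vec d) - x)) 0 with h | h | h
  · exfalso
    have : outwardNormal K' F = outwardNormal K F :=
      M.eq_outwardNormal hd hF hK hFK ⟨hn'.1, hn'.2.1, fun y hy b hb hbF => by
        rw [hunique b hb hbF, hconst _ hn'.2.1 y hy]; exact h⟩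
    obtain ⟨c, hc⟩ := M.exists_isInner hd hF
    have hev := (M.eventually_mem_interior hd hF hK hFK hc).and
      (M.eventually_mem_interior hd hF hK' hFK' hc)
    rw [this] at hev
    have hcont : Continuous fun s : ℝ => c - s • outwardNormal K F := by fun_prop
    have htend : Tendsto (fun s : ℝ => c - s • outwardNormal K F) (𝓝 0) (𝓝 c) := by
      simpa using hcont.tendsto 0
    have hev2 := htend.eventually hev
    have hev2 := hev2.filter_mono (nhdsWithin_le_nhds (s := Ioi (0 : ℝ)))
    obtain ⟨s, hs, hs0⟩ := (hev2.and self_mem_nhdsWithin).exists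
    have hneg : inner ℝ (outwardNormal K F) (c - s • outwardNormal K F - c) < 0 := by
      rw [sub_sub_cancel_left, inner_neg_right, inner_smul_right, real_inner_self_eq_norm_sq, hn.1]
      have : (0 : ℝ) < s := hs0
      linarith
    have hopen : IsOpen (interior (hull K) ∩ interior (hull K')) :=
      isOpen_interior.inter isOpen_interior
    have hpos := hopen.measure_pos volume ⟨_, hs.1 hneg, hs.2 hneg⟩
    have := measure_mono_null (inter_subset_inter interior_subset interior_subset)
      (M.volume_hull_inter hK hK' hne)
    exact hpos.ne' this
  -- A normal of the face that also annihilates the opposite vertex direction is zero, hence not a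
  -- unit vector.
  · exfalso
    subst hFa
    have := (M.isSimplex hK).eq_smul_grad a hn'.2.1 hx
    rw [h, zero_smul] at this
    have h1 := hn'.1
    rw [this, norm_zero] at h1
    exact zero_ne_one h1
  · have : -outwardNormal K' F = outwardNormal K F :=
      M.eq_outwardNormal hd hF hK hFK ⟨by rw [norm_neg, hn'.1],
        fun y hy z hz => by rw [inner_neg_left, hn'.2.1 y hy z hz, neg_zero],
        fun y hy b hb hbF => by
          rw [hunique b hb hbF, inner_neg_left, hconst _ hn'.2.1 y hy]; linarith⟩
    rw [← this, neg_neg]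

/-- The two elements fill both sides of the face and thus a full neighbourhood of `c`; a point
interior to the closure of a Lipschitz domain belongs to the domain. -/
theorem isInner_mem_of_two_cells (hd : 1 ≤ d) {F K K' : Finset (Vec d)} (hF : F ∈ facesOf M.T)
    (hK : K ∈ M.T) (hFK : F ⊆ K) (hK' : K' ∈ M.T) (hFK' : F ⊆ K') (hne : K ≠ K')
    {c : Vec d} (hc : IsInner F c) : c ∈ S.Ω := by
  refine S.lipschitz.interior_closure_subset (mem_interior_iff_mem_nhds.2 ?_)
  filter_upwards [M.eventually_mem_hull hd hF hK hFK hc, M.eventually_mem_hull hd hF hK' hFK' hc]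
    with y h1 h2
  rw [M.outwardNormal_eq_neg hd hF hK hFK hK' hFK' hne, inner_neg_left] at h2
  rcases le_total (inner ℝ (outwardNormal K F) (y - c)) 0 with h | h
  · exact M.hull_subset_closure hK (h1 h)
  · exact M.hull_subset_closure hK' (h2 (by linarith))

theorem mem_cells {F K : Finset (Vec d)} : K ∈ M.cells F ↔ K ∈ M.T ∧ F ⊆ K := by
  simp [cells]

theorem owner_spec {F : Finset (Vec d)} (hF : F ∈ facesOf M.T) : M.owner F ∈ M.T ∧ F ⊆ M.owner F := by
  obtain ⟨K, hK, hFK, -⟩ := mem_facesOf.1 hF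
  exact Classical.epsilon_spec (p := fun K => K ∈ M.T ∧ F ⊆ K) ⟨K, hK, hFK⟩

theorem closure_parts_subset {F : Finset (Vec d)} (hF : F ∈ M.facesExt) : F ∈ facesOf M.T ∧ hull F ⊆ frontier S.Ω := by
  simp only [facesExt, facesD, facesN, facesR, Finset.mem_union, Finset.mem_filter] at hF
  rw [← S.boundary_cover]
  rcases hF with (⟨h1, h2⟩ | ⟨h1, h2⟩) | ⟨h1, h2⟩
  · exact ⟨h1, h2.trans fun x hx => Or.inl (Or.inl hx)⟩
  · exact ⟨h1, h2.trans fun x hx => Or.inl (Or.inr hx)⟩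
  · exact ⟨h1, h2.trans fun x hx => Or.inr hx⟩

/-- A second element would place inner points of the face in the open set `Ω`, whereas the face is
contained in its frontier. -/
theorem cells_of_mem_facesExt (hd : 1 ≤ d) {F : Finset (Vec d)} (hF : F ∈ M.facesExt) :
    M.cells F = {M.owner F} := by
  obtain ⟨hF1, hF2⟩ := M.closure_parts_subset hF
  have ho := M.owner_spec hF1
  ext K
  rw [mem_cells, Finset.mem_singleton]
  constructor
  · rintro ⟨hK, hFK⟩
    by_contra hne
    obtain ⟨c, hc⟩ := M.exists_isInner hd hF1
    have h1 := M.isInner_mem_of_two_cells hd hF1 hK hFK ho.1 ho.2 hne hc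
    have h2 := hF2 hc.1
    rw [S.lipschitz.1.frontier_eq] at h2
    exact h2.2 h1
  · rintro rfl
    exact ho

theorem nF_eq (hd : 1 ≤ d) {F : Finset (Vec d)} (hF : F ∈ facesOf M.T) :
    ∃ K ∈ M.cells F, M.nF F = outwardNormal K F := by
  obtain ⟨K, hK, hFK, hn⟩ := M.normal F hF
  exact ⟨K, M.mem_cells.2 ⟨hK, hFK⟩, M.eq_outwardNormal hd hF hK hFK hn⟩

theorem nF_of_mem_facesExt (hd : 1 ≤ d) {F : Finset (Vec d)} (hF : F ∈ M.facesExt) :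
    M.nF F = outwardNormal (M.owner F) F := by
  obtain ⟨K, hK, h⟩ := M.nF_eq hd (M.closure_parts_subset hF).1
  rw [M.cells_of_mem_facesExt hd hF, Finset.mem_singleton] at hK
  rw [h, hK]

theorem exists_isInner_mem (hd : 1 ≤ d) {F : Finset (Vec d)} (hF : F ∈ M.facesInt) :
    ∃ c ∈ S.Ω, IsInner F c := by
  simp only [facesInt, facesExt, facesD, facesN, facesR, Finset.mem_sdiff, Finset.mem_union,
    Finset.mem_filter] at hF
  obtain ⟨hF, hF'⟩ := hF
  have hnot : ¬ hull F ⊆ frontier S.Ω := by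
    intro h
    rcases M.conf_boundary F hF h with h | h | h <;> simp [hF, h] at hF'
  obtain ⟨x, hx, hxf⟩ := not_subset.1 hnot
  obtain ⟨K, hK, hFK, -⟩ := mem_facesOf.1 hF
  have hxΩ : x ∈ S.Ω := by
    by_contra h
    refine hxf ?_
    rw [S.lipschitz.1.frontier_eq]
    exact ⟨M.hull_subset_closure hK (convexHull_mono (by exact_mod_cast hFK) hx), h⟩
  obtain ⟨a, rfl⟩ := M.exists_eq_erase_of_mem hF hK hFK
  have hs := M.isSimplex hK
  -- The face has a point `x` in `Ω`, possibly on a subface. A short displacement towards the inner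
  -- point `m` makes the remaining coordinates positive and stays in the open set `Ω`.
  obtain ⟨m, hm⟩ := hs.exists_isInner hd a
  have hcont : Continuous fun s : ℝ => AffineMap.lineMap x m s := AffineMap.lineMap_continuous
  have hev : ∀ᶠ s in 𝓝[>] (0 : ℝ), AffineMap.lineMap x m s ∈ S.Ω :=
    nhdsWithin_le_nhds (hcont.continuousAt.eventually_mem
      (by simpa using S.lipschitz.1.mem_nhds hxΩ))
  have hlt : ∀ᶠ s in 𝓝[>] (0 : ℝ), s < 1 := nhdsWithin_le_nhds (gt_mem_nhds zero_lt_one)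
  obtain ⟨s, ⟨hs1, hs2⟩, hs0⟩ := ((hev.and hlt).and self_mem_nhdsWithin).exists
  have hs0 : (0 : ℝ) < s := hs0
  refine ⟨_, hs1, (hs.isInner_iff a).2 ?_⟩
  have hcoord : ∀ b, hs.coord b (AffineMap.lineMap x m s)
      = (1 - s) * hs.coord b x + s * hs.coord b m := by
    intro b
    have : hs.coord b (AffineMap.lineMap x m s) = AffineMap.lineMap (hs.coord b x) (hs.coord b m) s :=
      (hs.basis.coord b).apply_lineMap x m s
    rw [this, AffineMap.lineMap_apply_ring]
  have hxa := (hs.mem_face_iff a).1 hx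
  have hma := (hs.isInner_iff a).1 hm
  refine ⟨by rw [hcoord, hxa.2, hma.1]; ring, fun b hb => ?_⟩
  rw [hcoord]
  have h1 := hs.mem_hull_iff.1 hxa.1 b
  have h2 := hma.2 b hb
  have : 0 ≤ (1 - s) * hs.coord b x := mul_nonneg (by linarith) h1
  positivity

/-- An interior face is shared by exactly two elements. -/
theorem cells_of_mem_facesInt (hd : 1 ≤ d) {F : Finset (Vec d)} (hF : F ∈ M.facesInt) :
    ∃ K K', K ≠ K' ∧ M.cells F = {K, K'} ∧ outwardNormal K' F = -outwardNormal K F := by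
  obtain ⟨c, hcΩ, hc⟩ := M.exists_isInner_mem hd hF
  have hF1 : F ∈ facesOf M.T := (Finset.mem_sdiff.1 hF).1
  obtain ⟨K, hK, hFK, -⟩ := mem_facesOf.1 hF1
  have hn := M.outwardNormal_spec hd hF1 hK hFK
  set C : Set (Vec d) := ⋃ K' ∈ M.T.erase K, hull K' with hC
  have hCc : IsClosed C := (M.T.erase K).finite_toSet.isClosed_biUnion
    fun K' _ => (isCompact_hull K').isClosed
  -- Points just beyond the face lie in `Ω` and are covered by the mesh, but not by `K`, because
  -- their coordinate at `a` is negative. The union of the other elements is closed, so it contains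
  -- the limit `c`.
  have hcC : c ∈ C := by
    obtain ⟨a, rfl⟩ := M.exists_eq_erase_of_mem hF1 hK hFK
    have hs := M.isSimplex hK
    have hgp : 0 < ‖hs.grad a‖ := norm_pos_iff.2 (hs.grad_ne_zero hd a)
    have hcont : Continuous fun s : ℝ => c + s • outwardNormal K (K.erase a) := by fun_prop
    have htend : Tendsto (fun s : ℝ => c + s • outwardNormal K (K.erase a)) (𝓝[>] 0) (𝓝 c) := by
      have := hcont.tendsto 0
      simp only [zero_smul, add_zero] at this
      exact this.mono_left nhdsWithin_le_nhds
    refine hCc.mem_of_tendsto htend ?_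
    filter_upwards [htend.eventually_mem (S.lipschitz.1.mem_nhds hcΩ), self_mem_nhdsWithin]
      with s hsΩ hs0
    have hs0 : (0 : ℝ) < s := hs0
    have hmem := subset_closure hsΩ
    rw [← M.cover, mem_iUnion₂] at hmem
    obtain ⟨K', hK', hsK'⟩ := hmem
    refine mem_iUnion₂.2 ⟨K', Finset.mem_erase.2 ⟨?_, hK'⟩, hsK'⟩
    rintro rfl
    have h1 := hs.mem_hull_iff.1 hsK' a
    rw [hs.coord_eq_of_isInner hd hc, add_sub_cancel_left, inner_smul_right,
      real_inner_self_eq_norm_sq, hn.1] at h1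
    have : 0 < ‖hs.grad a‖ * (s * 1 ^ 2) := by positivity
    linarith
  obtain ⟨K', hK', hcK'⟩ := mem_iUnion₂.1 hcC
  obtain ⟨hne, hK'⟩ := Finset.mem_erase.1 hK'
  -- By matching, `c` is in the hull of the common vertices; since its coordinates at all vertices
  -- of `F` are positive, these vertices are all common.
  have hFK' : F ⊆ K' := by
    have hci : c ∈ hull K ∩ hull K' := ⟨convexHull_mono (by exact_mod_cast hFK) hc.1, hcK'⟩
    rw [M.matching K hK K' hK', (M.isSimplex hK).mem_convexHull_iff inter_subset_left] at hci
    intro b hb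
    by_contra hbK'
    obtain ⟨a, rfl⟩ := M.exists_eq_erase_of_mem hF1 hK hFK
    have hpos := (((M.isSimplex hK).isInner_iff a).1 hc).2 ⟨b, hFK hb⟩
      (fun h => (Finset.mem_erase.1 hb).1 (congrArg Subtype.val h))
    exact hpos.ne' (hci.2 ⟨b, hFK hb⟩ fun h => hbK' (by simpa using h.2))
  have hneg := M.outwardNormal_eq_neg hd hF1 hK hFK hK' hFK' hne.symm
  refine ⟨K, K', hne.symm, ?_, hneg⟩
  ext L
  rw [mem_cells, Finset.mem_insert, Finset.mem_singleton]
  constructor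
  · rintro ⟨hL, hFL⟩
    -- The normal of a third element would be opposite to each of two opposite unit vectors, hence
    -- zero.
    by_contra hcon
    rw [not_or] at hcon
    have h1 := M.outwardNormal_eq_neg hd hF1 hK hFK hL hFL (Ne.symm hcon.1)
    have h2 := M.outwardNormal_eq_neg hd hF1 hK' hFK' hL hFL (Ne.symm hcon.2)
    rw [hneg, neg_neg, h1, neg_eq_iff_add_eq_zero, ← two_smul ℝ] at h2
    have h0 : outwardNormal K F = 0 := (smul_eq_zero.1 h2).resolve_left two_ne_zero
    have := hn.1
    rw [h0, norm_zero] at this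
    exact zero_ne_one this
  · rintro (rfl | rfl)
    exacts [⟨hK, hFK⟩, ⟨hK', hFK'⟩]

theorem isInner_mem (hd : 1 ≤ d) {F : Finset (Vec d)} (hF : F ∈ M.facesInt) {c : Vec d}
    (hc : IsInner F c) : c ∈ S.Ω := by
  obtain ⟨K, K', hne, hcells, -⟩ := M.cells_of_mem_facesInt hd hF
  have h1 : K ∈ M.cells F := by simp [hcells]
  have h2 : K' ∈ M.cells F := by simp [hcells]
  rw [mem_cells] at h1 h2
  exact M.isInner_mem_of_two_cells hd (Finset.mem_sdiff.1 hF).1 h1.1 h1.2 h2.1 h2.2 hne hc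

end Mesh

end IPDG

/-! ### Decomposition of the measures over the mesh and values of the coefficients. -/

namespace IPDG
open Measure Set
open scoped Classical
variable {d : ℕ}

theorem restrict_biUnion_finset_ae {α ι : Type*} [MeasurableSpace α] {ν : Measure α} (s : Finset ι)
    {A : ι → Set α} (hm : ∀ i ∈ s, MeasurableSet (A i))
    (hd : ∀ i ∈ s, ∀ j ∈ s, i ≠ j → ν (A i ∩ A j) = 0) :
    ν.restrict (⋃ i ∈ s, A i) = ∑ i ∈ s, ν.restrict (A i) := by
  have h : (⋃ i ∈ s, A i) = ⋃ i : s, A i := by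
    ext x; simp
  rw [h, restrict_iUnion_ae]
  · rw [Measure.sum_fintype]
    exact Finset.sum_coe_sort s (fun i => ν.restrict (A i))
  · intro i j hij
    exact hd i i.2 j j.2 (fun h => hij (Subtype.ext h))
  · exact fun i => (hm i i.2).nullMeasurableSet

/-- Elements and faces are only known to lie in closures of pieces, whereas the coefficients are
prescribed on the pieces themselves; for polytopal pieces the difference is a null set. -/
theorem ae_mem_of_subset_closure {ν : Measure (Vec d)} {A P : Set (Vec d)} (hA : MeasurableSet A)
    (hAP : A ⊆ closure P) (h : ν (closure P \ P) = 0) : ∀ᵐ x ∂ν.restrict A, x ∈ P := by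
  rw [ae_restrict_iff' hA]
  have : ∀ᵐ x ∂ν, x ∉ closure P \ P := measure_eq_zero_iff_ae_notMem.1 h
  filter_upwards [this] with x hx hxA
  by_contra hxP
  exact hx ⟨hAP hxA, hxP⟩

theorem sum_indicator_eq {α ι E : Type*} [AddCommMonoid E] {s : Finset ι} {A : ι → Set α}
    (hd : ∀ i ∈ s, ∀ j ∈ s, i ≠ j → Disjoint (A i) (A j)) (f : ι → α → E) {i : ι} (hi : i ∈ s)
    {x : α} (hx : x ∈ A i) : ∑ j ∈ s, (A j).indicator (f j) x = f i x := by
  rw [Finset.sum_eq_single i, indicator_of_mem hx]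
  · intro j hj hji
    exact indicator_of_notMem (fun hxj => (disjoint_left.1 (hd j hj i hi hji)) hxj hx) _
  · exact fun h => absurd hi h

namespace HelmholtzData

variable (S : HelmholtzData d)

theorem measurableSet_Ω : MeasurableSet S.Ω := S.lipschitz.1.measurableSet

theorem measurableSet_of_isBoundaryPart {Ω Γ : Set (Vec d)} (h : IsBoundaryPart Ω Γ) :
    MeasurableSet Γ := by
  obtain ⟨⟨U, hU, rfl⟩, -⟩ := h
  exact isClosed_frontier.measurableSet.inter hU.measurableSet

theorem measurableSet_ΓR : MeasurableSet S.ΓR := measurableSet_of_isBoundaryPart S.partR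

theorem measurableSet_ΓD : MeasurableSet S.ΓD := measurableSet_of_isBoundaryPart S.partD

theorem ΓR_subset : S.ΓR ⊆ frontier S.Ω := by
  obtain ⟨⟨U, -, h⟩, -⟩ := S.partR
  rw [h]; exact inter_subset_left

theorem ΓD_subset : S.ΓD ⊆ frontier S.Ω := by
  obtain ⟨⟨U, -, h⟩, -⟩ := S.partD
  rw [h]; exact inter_subset_left

theorem restrict_closure_Ω : volume.restrict (closure S.Ω) = volume.restrict S.Ω := by
  refine Measure.restrict_congr_set (ae_eq_set.2 ⟨S.polytopal.volume_closure_diff, ?_⟩)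
  rw [sdiff_eq_empty.2 subset_closure, measure_empty]

theorem surf_closure_inter {Γ Γ' : Set (Vec d)} (h : IsBoundaryPart S.Ω Γ)
    (hd : Disjoint Γ Γ') : surf d (closure Γ ∩ Γ') = 0 := by
  refine measure_mono_null ?_ h.2.surf_closure_diff
  rintro x ⟨h1, h2⟩
  exact ⟨h1, fun h3 => disjoint_left.1 hd h3 h2⟩

theorem μ_eq {P : Set (Vec d)} (hP : P ∈ S.pieces) {x : Vec d} (hx : x ∈ P) : S.μ x = S.μP P :=
  sum_indicator_eq (A := id) S.piece_disjoint (fun P _ => S.μP P) hP hx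

theorem A_eq {P : Set (Vec d)} (hP : P ∈ S.pieces) {x : Vec d} (hx : x ∈ P) : S.A x = S.AP P :=
  sum_indicator_eq (A := id) S.piece_disjoint (fun P _ => S.AP P) hP hx

theorem γ_eq {Q : Set (Vec d)} (hQ : Q ∈ S.facets) {x : Vec d} (hx : x ∈ Q) : S.γ x = S.γQ Q :=
  sum_indicator_eq (A := id) S.facet_disjoint (fun Q _ => S.γQ Q) hQ hx

end HelmholtzData

namespace Mesh

variable {S : HelmholtzData d} (M : Mesh S)

/-- The union of the faces of the mesh. -/
def skel : Set (Vec d) := ⋃ F ∈ facesOf M.T, hull F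

theorem isCompact_skel : IsCompact M.skel :=
  (facesOf M.T).isCompact_biUnion fun F _ => isCompact_hull F

theorem hull_subset_skel {F : Finset (Vec d)} (hF : F ∈ facesOf M.T) : hull F ⊆ M.skel :=
  subset_biUnion_of_mem (u := fun F => hull F) hF

theorem surf_skel_lt_top (hd : 1 ≤ d) : surf d M.skel < ⊤ :=
  (measure_biUnion_finset_le _ _).trans_lt
    (ENNReal.sum_lt_top.2 fun _ hF => M.surf_face_lt_top hd hF)

theorem restrict_skel : (surf d).restrict M.skel = ∑ F ∈ facesOf M.T, (surf d).restrict (hull F) :=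
  restrict_biUnion_finset_ae _ (fun F _ => measurableSet_hull F)
    fun _ hF _ hF' h => M.surf_face_inter hF hF' h

theorem restrict_Ω : volume.restrict S.Ω = ∑ K ∈ M.T, volume.restrict (hull K) := by
  rw [← S.restrict_closure_Ω, ← M.cover]
  exact restrict_biUnion_finset_ae _ (fun F _ => measurableSet_hull F)
    fun _ hF _ hF' h => M.volume_hull_inter hF hF' h

theorem restrict_hull_le {K : Finset (Vec d)} (hK : K ∈ M.T) :
    volume.restrict (hull K) ≤ volume.restrict S.Ω := by
  rw [M.restrict_Ω]
  exact Finset.single_le_sum (f := fun K => volume.restrict (hull K)) (fun _ _ => Measure.zero_le _) hK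

theorem disjoint_interior {K K' : Finset (Vec d)} (hK : K ∈ M.T) (hK' : K' ∈ M.T) (h : K ≠ K') :
    Disjoint (interior (hull K)) (interior (hull K')) := by
  rw [disjoint_iff_inter_eq_empty]
  refine ((isOpen_interior.inter isOpen_interior).measure_eq_zero_iff volume).1 ?_
  exact measure_mono_null (inter_subset_inter interior_subset interior_subset)
    (M.volume_hull_inter hK hK' h)

theorem frontier_interior_subset {K : Finset (Vec d)} (hK : K ∈ M.T) :
    frontier (interior (hull K)) ⊆ M.skel := by
  rw [(M.isSimplex hK).frontier_interior]
  exact iUnion_subset fun a => M.hull_subset_skel (M.erase_mem_facesOf hK a)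

theorem frontier_subset : frontier S.Ω ⊆ M.skel := by
  intro x hx
  rw [S.lipschitz.1.frontier_eq] at hx
  have h1 := hx.1
  rw [← M.cover, mem_iUnion₂] at h1
  obtain ⟨K, hK, hxK⟩ := h1
  refine M.frontier_interior_subset hK ?_
  rw [(M.isSimplex hK).frontier_interior, ← (M.isSimplex hK).hull_diff_interior]
  exact ⟨hxK, fun h => hx.2 (M.interior_hull_subset hK h)⟩

theorem mem_facesR {F : Finset (Vec d)} : F ∈ M.facesR ↔ F ∈ facesOf M.T ∧ hull F ⊆ closure S.ΓR := by
  simp [facesR]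

theorem mem_facesD {F : Finset (Vec d)} : F ∈ M.facesD ↔ F ∈ facesOf M.T ∧ hull F ⊆ closure S.ΓD := by
  simp [facesD]

theorem mem_facesN {F : Finset (Vec d)} : F ∈ M.facesN ↔ F ∈ facesOf M.T ∧ hull F ⊆ closure S.ΓN := by
  simp [facesN]

theorem facesR_subset : M.facesR ⊆ facesOf M.T := Finset.filter_subset _ _

theorem facesR_subset_ext : M.facesR ⊆ M.facesExt := Finset.subset_union_right

theorem ae_mem_ΓR {F : Finset (Vec d)} (hF : F ∈ M.facesR) :
    ∀ᵐ x ∂(surf d).restrict (hull F), x ∈ S.ΓR :=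
  ae_mem_of_subset_closure (measurableSet_hull F) (M.mem_facesR.1 hF).2 S.partR.2.surf_closure_diff

theorem ae_mem_ΓD {F : Finset (Vec d)} (hF : F ∈ M.facesD) :
    ∀ᵐ x ∂(surf d).restrict (hull F), x ∈ S.ΓD :=
  ae_mem_of_subset_closure (measurableSet_hull F) (M.mem_facesD.1 hF).2 S.partD.2.surf_closure_diff

theorem ae_mem_ΓN {F : Finset (Vec d)} (hF : F ∈ M.facesN) :
    ∀ᵐ x ∂(surf d).restrict (hull F), x ∈ S.ΓN :=
  ae_mem_of_subset_closure (measurableSet_hull F) (M.mem_facesN.1 hF).2 S.partN.2.surf_closure_diff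

theorem ae_isInner (hd : 1 ≤ d) {F : Finset (Vec d)} (hF : F ∈ facesOf M.T) :
    ∀ᵐ x ∂(surf d).restrict (hull F), IsInner F x := by
  rw [ae_restrict_iff' (measurableSet_hull F), ae_iff]
  simpa using surf_not_isInner hd (M.card_face hF)

theorem ae_mem_Ω (hd : 1 ≤ d) {F : Finset (Vec d)} (hF : F ∈ M.facesInt) :
    ∀ᵐ x ∂(surf d).restrict (hull F), x ∈ S.Ω := by
  filter_upwards [M.ae_isInner hd (Finset.mem_sdiff.1 hF).1] with x hx
  exact M.isInner_mem hd hF hx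

/-- The Robin boundary is contained in the skeleton. Almost every point of a face that is not a
Robin face is in `Ω`, `ΓD` or `ΓN`, each disjoint from `ΓR`; the Robin faces in turn leave `ΓR` only
at its null rim. -/
theorem ΓR_ae_eq (hd : 1 ≤ d) : S.ΓR =ᵐ[surf d] ⋃ F ∈ M.facesR, hull F := by
  refine ae_eq_set.2 ⟨?_, ?_⟩
  · have hsub : S.ΓR \ ⋃ F ∈ M.facesR, hull F ⊆
        ⋃ F ∈ facesOf M.T \ M.facesR, (hull F ∩ S.ΓR) := by
      rintro x ⟨hx, hxn⟩
      obtain ⟨F, hF, hxF⟩ := mem_iUnion₂.1 (M.frontier_subset (S.ΓR_subset hx))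
      refine mem_iUnion₂.2 ⟨F, Finset.mem_sdiff.2 ⟨hF, fun h => hxn (mem_iUnion₂.2 ⟨F, h, hxF⟩)⟩,
        hxF, hx⟩
    refine measure_mono_null hsub ((measure_biUnion_null_iff (Finset.countable_toSet _)).2
      fun F hF => ?_)
    obtain ⟨hF1, hF2⟩ := Finset.mem_sdiff.1 hF
    have hae : ∀ {p : Vec d → Prop}, (∀ᵐ x ∂(surf d).restrict (hull F), p x) →
        (∀ x, p x → x ∉ S.ΓR) → surf d (hull F ∩ S.ΓR) = 0 := by
      intro p hp hpR
      rw [inter_comm, ← restrict_apply S.measurableSet_ΓR]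
      exact measure_mono_null (fun x hx hpx => hpR x hpx hx) hp
    by_cases hint : F ∈ M.facesInt
    · refine hae (M.ae_mem_Ω hd hint) fun x hx hxR => ?_
      have := S.ΓR_subset hxR
      rw [S.lipschitz.1.frontier_eq] at this
      exact this.2 hx
    · have hext : F ∈ M.facesExt := by
        by_contra h; exact hint (Finset.mem_sdiff.2 ⟨hF1, h⟩)
      rcases Finset.mem_union.1 hext with h | h
      · rcases Finset.mem_union.1 h with h | h
        · exact hae (M.ae_mem_ΓD h) fun x hx => disjoint_left.1 S.disjDR hx
        · exact hae (M.ae_mem_ΓN h) fun x hx => disjoint_left.1 S.disjNR hx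
      · exact absurd h hF2
  · have hsub : (⋃ F ∈ M.facesR, hull F) \ S.ΓR ⊆ closure S.ΓR \ S.ΓR := by
      rintro x ⟨hx, hxn⟩
      obtain ⟨F, hF, hxF⟩ := mem_iUnion₂.1 hx
      exact ⟨(M.mem_facesR.1 hF).2 hxF, hxn⟩
    exact measure_mono_null hsub S.partR.2.surf_closure_diff

theorem restrict_ΓR (hd : 1 ≤ d) :
    (surf d).restrict S.ΓR = ∑ F ∈ M.facesR, (surf d).restrict (hull F) := by
  rw [Measure.restrict_congr_set (M.ΓR_ae_eq hd)]
  exact restrict_biUnion_finset_ae _ (fun F _ => measurableSet_hull F)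
    fun _ hF _ hF' h => M.surf_face_inter (M.facesR_subset hF) (M.facesR_subset hF') h

theorem restrict_ΓR_le : (surf d).restrict S.ΓR ≤ (surf d).restrict M.skel :=
  Measure.restrict_mono (S.ΓR_subset.trans M.frontier_subset) le_rfl

/-! ### Coefficients -/

theorem pieceOf_spec {K : Finset (Vec d)} (hK : K ∈ M.T) :
    M.pieceOf K ∈ S.pieces ∧ hull K ⊆ closure (M.pieceOf K) :=
  Classical.epsilon_spec (p := fun P => P ∈ S.pieces ∧ hull K ⊆ closure P) (M.conf_piece K hK)

theorem facetOf_spec {F : Finset (Vec d)} (hF : F ∈ M.facesR) :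
    M.facetOf F ∈ S.facets ∧ hull F ⊆ closure (M.facetOf F) :=
  Classical.epsilon_spec (p := fun P => P ∈ S.facets ∧ hull F ⊆ closure P)
    (M.conf_facet F (M.mem_facesR.1 hF).1 (M.mem_facesR.1 hF).2)

theorem ae_mem_pieceOf {K : Finset (Vec d)} (hK : K ∈ M.T) :
    ∀ᵐ x ∂volume.restrict (hull K), x ∈ M.pieceOf K :=
  ae_mem_of_subset_closure (measurableSet_hull K) (M.pieceOf_spec hK).2
    (S.piece_polytopal _ (M.pieceOf_spec hK).1).volume_closure_diff

theorem ae_mem_facetOf {F : Finset (Vec d)} (hF : F ∈ M.facesR) :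
    ∀ᵐ x ∂(surf d).restrict (hull F), x ∈ M.facetOf F :=
  ae_mem_of_subset_closure (measurableSet_hull F) (M.facetOf_spec hF).2
    (S.facet_part _ (M.facetOf_spec hF).1).2.surf_closure_diff

theorem ae_μ_eq {K : Finset (Vec d)} (hK : K ∈ M.T) :
    ∀ᵐ x ∂volume.restrict (hull K), S.μ x = M.μK K := by
  filter_upwards [M.ae_mem_pieceOf hK] with x hx using S.μ_eq (M.pieceOf_spec hK).1 hx

theorem ae_A_eq {K : Finset (Vec d)} (hK : K ∈ M.T) :
    ∀ᵐ x ∂volume.restrict (hull K), S.A x = S.AP (M.pieceOf K) := by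
  filter_upwards [M.ae_mem_pieceOf hK] with x hx using S.A_eq (M.pieceOf_spec hK).1 hx

theorem ae_γ_eq {F : Finset (Vec d)} (hF : F ∈ M.facesR) :
    ∀ᵐ x ∂(surf d).restrict (hull F), S.γ x = M.γF F := by
  filter_upwards [M.ae_mem_facetOf hF] with x hx using S.γ_eq (M.facetOf_spec hF).1 hx

theorem μK_pos {K : Finset (Vec d)} (hK : K ∈ M.T) : 0 < M.μK K := S.μ_pos _ (M.pieceOf_spec hK).1

theorem αK_pos {K : Finset (Vec d)} (hK : K ∈ M.T) : 0 < M.αK K := S.A_pos _ (M.pieceOf_spec hK).1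

theorem γF_pos {F : Finset (Vec d)} (hF : F ∈ M.facesR) : 0 < M.γF F :=
  S.γ_pos _ (M.facetOf_spec hF).1

theorem αF_pos {F : Finset (Vec d)} (hF : F ∈ facesOf M.T) : 0 < M.αF F :=
  M.αK_pos (M.owner_spec hF).1

theorem ae_restrict_Ω_iff {p : Vec d → Prop} :
    (∀ᵐ x ∂volume.restrict S.Ω, p x) ↔ ∀ K ∈ M.T, ∀ᵐ x ∂volume.restrict (hull K), p x := by
  rw [M.restrict_Ω, ae_finsetSum_measure_iff]

theorem ae_restrict_ΓR_iff (hd : 1 ≤ d) {p : Vec d → Prop} :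
    (∀ᵐ x ∂(surf d).restrict S.ΓR, p x) ↔ ∀ F ∈ M.facesR, ∀ᵐ x ∂(surf d).restrict (hull F), p x := by
  rw [M.restrict_ΓR hd, ae_finsetSum_measure_iff]

end Mesh

end IPDG

/-! ### Weak gradients and traces. -/

namespace IPDG
open Measure Set
open scoped Classical
variable {d : ℕ}

/-- Hölder's inequality. This is the device by which identities for smooth functions pass to `H¹`
functions and their traces. -/
theorem tendsto_integral_mul {α : Type*} [MeasurableSpace α] {ν : Measure α} {f : ℕ → α → ℂ}
    {f0 h : α → ℂ} (hf : ∀ n, MemLp (f n) 2 ν) (hf0 : MemLp f0 2 ν) (hh : MemLp h 2 ν)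
    (ht : Tendsto (fun n => eLpNorm (f n - f0) 2 ν) atTop (𝓝 0)) :
    Tendsto (fun n => ∫ x, f n x * h x ∂ν) atTop (𝓝 (∫ x, f0 x * h x ∂ν)) := by
  refine tendsto_integral_of_L1' _ (hf0.1.mul hh.1)
    (Eventually.of_forall fun n => (hf n).integrable_mul hh) ?_
  have h1 : Tendsto (fun n => eLpNorm (f n - f0) 2 ν * eLpNorm h 2 ν) atTop (𝓝 0) := by
    simpa using ENNReal.Tendsto.mul_const ht (Or.inr hh.2.ne)
  refine tendsto_of_tendsto_of_tendsto_of_le_of_le tendsto_const_nhds h1 (fun _ => zero_le) fun n => ?_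
  have := eLpNorm_smul_le_mul_eLpNorm (p := 2) (q := 2) (r := 1) hh.1 ((hf n).1.sub hf0.1)
  refine le_trans (le_of_eq ?_) this
  congr 1
  ext x
  simp [sub_mul]

theorem integrable_mul_of_memLp {α : Type*} [MeasurableSpace α] {ν : Measure α} {f g : α → ℂ}
    (hf : MemLp f 2 ν) (hg : MemLp g 2 ν) : Integrable (fun x => f x * g x) ν :=
  hf.integrable_mul hg

theorem memLp_coord {α : Type*} [MeasurableSpace α] {ν : Measure α} {g : α → CVec d} {p : ℝ≥0∞}
    (hg : MemLp g p ν) (i : Fin d) : MemLp (fun x => g x i) p ν :=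
  (EuclideanSpace.proj (𝕜 := ℂ) i).comp_memLp' hg

theorem eLpNorm_coord_le {α : Type*} [MeasurableSpace α] {ν : Measure α} (g : α → CVec d) (p : ℝ≥0∞)
    (i : Fin d) : eLpNorm (fun x => g x i) p ν ≤ eLpNorm g p ν :=
  eLpNorm_mono fun x => PiLp.norm_apply_le (g x) i

/-! ### Test functions -/

namespace IsTest

variable {D : Set (Vec d)} {η : Vec d → ℝ}

theorem mono {D' : Set (Vec d)} (h : IsTest D η) (hD : D ⊆ D') : IsTest D' η :=
  ⟨h.1, h.2.1, h.2.2.trans hD⟩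

theorem continuous_pderiv (h : IsTest D η) (i : Fin d) : Continuous (pderiv η i) := by
  have := h.1.continuous_fderiv (by simp)
  unfold pderiv
  fun_prop

theorem hasCompactSupport_pderiv (h : IsTest D η) (i : Fin d) : HasCompactSupport (pderiv η i) :=
  h.2.1.fderiv_apply ℝ _

theorem tsupport_pderiv_subset (h : IsTest D η) (i : Fin d) : tsupport (pderiv η i) ⊆ D :=
  (tsupport_fderiv_apply_subset ℝ _).trans h.2.2

theorem memLp (h : IsTest D η) (p : ℝ≥0∞) (ν : Measure (Vec d)) [IsFiniteMeasureOnCompacts ν] :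
    MemLp (fun x => (η x : ℂ)) p ν :=
  (Complex.ofRealCLM.comp_memLp' (h.1.continuous.memLp_of_hasCompactSupport h.2.1))

theorem memLp_pderiv (h : IsTest D η) (i : Fin d) (p : ℝ≥0∞) (ν : Measure (Vec d))
    [IsFiniteMeasureOnCompacts ν] : MemLp (fun x => ((pderiv η i x : ℝ) : ℂ)) p ν :=
  (Complex.ofRealCLM.comp_memLp'
    ((h.continuous_pderiv i).memLp_of_hasCompactSupport (h.hasCompactSupport_pderiv i)))

theorem eq_zero (h : IsTest D η) {x : Vec d} (hx : x ∉ D) : η x = 0 :=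
  image_eq_zero_of_notMem_tsupport fun hx' => hx (h.2.2 hx')

theorem pderiv_eq_zero (h : IsTest D η) (i : Fin d) {x : Vec d} (hx : x ∉ D) : pderiv η i x = 0 :=
  image_eq_zero_of_notMem_tsupport fun hx' => hx (h.tsupport_pderiv_subset i hx')

end IsTest

/-- The fundamental lemma of the calculus of variations. -/
theorem ae_eq_zero_of_isTest {D : Set (Vec d)} (hD : IsOpen D) {f : Vec d → ℂ}
    (hf : MemLp f 2 (volume.restrict D))
    (h : ∀ η, IsTest D η → ∫ x in D, f x * (η x : ℂ) = 0) : f =ᵐ[volume.restrict D] 0 := by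
  have := hD.ae_eq_zero_of_integral_contDiff_smul_eq_zero (μ := volume.restrict D)
    ((hf.locallyIntegrable one_le_two).locallyIntegrableOn D) (fun η h1 h2 h3 => by
      rw [← h η ⟨h1, h2, h3⟩]
      refine integral_congr_ae (ae_of_all _ fun x => ?_)
      simp [mul_comm])
  filter_upwards [this, ae_restrict_mem hD.measurableSet] with x h1 h2 using h1 h2

/-! ### Weak gradients -/

section WeakGrad

variable {D : Set (Vec d)} {v v' : Vec d → ℂ} {g g' : Vec d → CVec d}

theorem HasWeakGrad.ae_eq (hD : IsOpen D) (h : HasWeakGrad D v g) (h' : HasWeakGrad D v g') :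
    g =ᵐ[volume.restrict D] g' := by
  have hc : ∀ i, (fun x => g x i - g' x i) =ᵐ[volume.restrict D] 0 := by
    intro i
    refine ae_eq_zero_of_isTest hD ((memLp_coord h.1 i).sub (memLp_coord h'.1 i)) fun η hη => ?_
    have e := h.2 η hη i
    rw [h'.2 η hη i, neg_inj] at e
    simp_rw [sub_mul]
    rw [integral_sub (integrable_mul_of_memLp (memLp_coord h.1 i) (hη.memLp 2 _))
      (integrable_mul_of_memLp (memLp_coord h'.1 i) (hη.memLp 2 _)), e, sub_self]
  have := ae_all_iff.2 hc
  filter_upwards [this] with x hx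
  ext i
  exact sub_eq_zero.1 (hx i)

theorem MemH1.hasWeakGrad (h : MemH1 D v) : HasWeakGrad D v (weakGrad D v) :=
  Classical.epsilon_spec h.2

theorem HasWeakGrad.weakGrad_ae_eq (hD : IsOpen D) (h : HasWeakGrad D v g) :
    weakGrad D v =ᵐ[volume.restrict D] g :=
  HasWeakGrad.ae_eq hD (Classical.epsilon_spec (⟨g, h⟩ : ∃ g, HasWeakGrad D v g)) h

theorem HasWeakGrad.add (hv : MemLp v 2 (volume.restrict D)) (hv' : MemLp v' 2 (volume.restrict D))
    (h : HasWeakGrad D v g) (h' : HasWeakGrad D v' g') : HasWeakGrad D (v + v') (g + g') := by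
  refine ⟨h.1.add h'.1, fun η hη i => ?_⟩
  simp only [Pi.add_apply, PiLp.add_apply, add_mul]
  rw [integral_add (integrable_mul_of_memLp hv (hη.memLp_pderiv i 2 _))
    (integrable_mul_of_memLp hv' (hη.memLp_pderiv i 2 _)), h.2 η hη i, h'.2 η hη i,
    integral_add (integrable_mul_of_memLp (memLp_coord h.1 i) (hη.memLp 2 _))
      (integrable_mul_of_memLp (memLp_coord h'.1 i) (hη.memLp 2 _))]
  ring

theorem HasWeakGrad.smul (c : ℂ) (h : HasWeakGrad D v g) : HasWeakGrad D (c • v) (c • g) := by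
  refine ⟨h.1.const_smul c, fun η hη i => ?_⟩
  simp only [Pi.smul_apply, PiLp.smul_apply, smul_eq_mul, mul_assoc]
  rw [integral_const_mul, h.2 η hη i, integral_const_mul, mul_neg]

theorem HasWeakGrad.congr (h : HasWeakGrad D v g) (hv : v =ᵐ[volume.restrict D] v') :
    HasWeakGrad D v' g := by
  refine ⟨h.1, fun η hη i => ?_⟩
  rw [← h.2 η hη i]
  refine integral_congr_ae ?_
  filter_upwards [hv] with x hx
  rw [hx]

theorem HasWeakGrad.mono {D' : Set (Vec d)} (hD : MeasurableSet D)
    (hsub : D' ⊆ D) (h : HasWeakGrad D v g) : HasWeakGrad D' v g := by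
  refine ⟨h.1.mono_measure (restrict_mono hsub le_rfl), fun η hη i => ?_⟩
  have e := h.2 η (hη.mono hsub) i
  rwa [← setIntegral_eq_of_subset_of_forall_sdiff_eq_zero hD hsub, 
    ← setIntegral_eq_of_subset_of_forall_sdiff_eq_zero hD hsub]
  · intro x hx; rw [hη.eq_zero hx.2]; simp
  · intro x hx; rw [hη.pderiv_eq_zero i hx.2]; simp

theorem hasWeakGrad_classicalGrad {φ : Vec d → ℂ} (hφ : ContDiff ℝ 1 φ)
    (hg : MemLp (classicalGrad φ) 2 (volume.restrict D)) : HasWeakGrad D φ (classicalGrad φ) := by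
  refine ⟨hg, fun η hη i => ?_⟩
  have hηd : Differentiable ℝ η := hη.1.differentiable (by simp)
  have hder : ∀ x w, fderiv ℝ (fun x => (η x : ℂ)) x w = ((fderiv ℝ η x w : ℝ) : ℂ) := by
    intro x w
    have := (Complex.ofRealCLM.hasFDerivAt.comp x (hηd x).hasFDerivAt).fderiv
    rw [show (fun x => (η x : ℂ)) = Complex.ofRealCLM ∘ η from rfl, this]
    simp
  have hpd : ∀ x, ((pderiv η i x : ℝ) : ℂ) = fderiv ℝ (fun x => (η x : ℂ)) x (EuclideanSpace.single i 1) :=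
    fun x => (hder x _).symm
  have hcφ := hφ.continuous
  have hcφ' := hφ.continuous_fderiv one_ne_zero
  have hcη := hη.1.continuous
  have hcη' := hη.continuous_pderiv i
  have hsη : HasCompactSupport (fun x => (η x : ℂ)) := hη.2.1.comp_left (g := ((↑) : ℝ → ℂ)) (by simp)
  have hsη' : HasCompactSupport (fun x => ((pderiv η i x : ℝ) : ℂ)) :=
    (hη.hasCompactSupport_pderiv i).comp_left (g := ((↑) : ℝ → ℂ)) (by simp)
  -- The test function vanishes outside `D`, so the integration by parts is carried out on the whole
  -- space and requires no regularity of `D`.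
  rw [setIntegral_eq_integral_of_forall_compl_eq_zero, setIntegral_eq_integral_of_forall_compl_eq_zero]
  · simp_rw [hpd, classicalGrad, pderiv]
    refine integral_mul_fderiv_eq_neg_fderiv_mul_of_integrable ?_ ?_ ?_ ?_ ?_
    · exact Continuous.integrable_of_hasCompactSupport (by fun_prop) (hsη.mul_left)
    · simp_rw [← hpd]
      exact Continuous.integrable_of_hasCompactSupport (by fun_prop) (hsη'.mul_left)
    · exact Continuous.integrable_of_hasCompactSupport (by fun_prop) (hsη.mul_left)
    · exact fun x _ => hφ.differentiable one_ne_zero x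
    · exact fun x _ => Complex.ofRealCLM.differentiableAt.comp x (hηd x)
  · intro x hx; rw [hη.eq_zero hx]; simp
  · intro x hx; rw [hη.pderiv_eq_zero i hx]; simp

/-- The weak gradient is a closed operator, because its defining identity tests against fixed square
integrable functions. -/
theorem HasWeakGrad.of_tendsto {w : ℕ → Vec d → ℂ} {q : ℕ → Vec d → CVec d}
    (hw : ∀ n, MemLp (w n) 2 (volume.restrict D)) (hwq : ∀ n, HasWeakGrad D (w n) (q n))
    (hv : MemLp v 2 (volume.restrict D)) (hg : MemLp g 2 (volume.restrict D))
    (h1 : Tendsto (fun n => eLpNorm (w n - v) 2 (volume.restrict D)) atTop (𝓝 0))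
    (h2 : Tendsto (fun n => eLpNorm (q n - g) 2 (volume.restrict D)) atTop (𝓝 0)) :
    HasWeakGrad D v g := by
  refine ⟨hg, fun η hη i => ?_⟩
  have t1 := tendsto_integral_mul hw hv (hη.memLp_pderiv i 2 _) h1
  have t2 := tendsto_integral_mul (fun n => memLp_coord (hwq n).1 i) (memLp_coord hg i)
    (hη.memLp 2 _) (tendsto_of_tendsto_of_tendsto_of_le_of_le tendsto_const_nhds h2
      (fun _ => zero_le) fun n => eLpNorm_coord_le (q n - g) 2 i)
  simp_rw [fun n => (hwq n).2 η hη i] at t1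
  exact tendsto_nhds_unique t1 t2.neg

theorem MemH1.add (h : MemH1 D v) (h' : MemH1 D v') : MemH1 D (v + v') :=
  ⟨h.1.add h'.1, _, h.hasWeakGrad.add h.1 h'.1 h'.hasWeakGrad⟩

theorem MemH1.smul (c : ℂ) (h : MemH1 D v) : MemH1 D (c • v) :=
  ⟨h.1.const_smul c, _, h.hasWeakGrad.smul c⟩

theorem weakGrad_add (hD : IsOpen D) (h : MemH1 D v) (h' : MemH1 D v') :
    weakGrad D (v + v') =ᵐ[volume.restrict D] weakGrad D v + weakGrad D v' :=
  (h.hasWeakGrad.add h.1 h'.1 h'.hasWeakGrad).weakGrad_ae_eq hD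

theorem weakGrad_smul (hD : IsOpen D) (c : ℂ) (h : MemH1 D v) :
    weakGrad D (c • v) =ᵐ[volume.restrict D] c • weakGrad D v :=
  (h.hasWeakGrad.smul c).weakGrad_ae_eq hD

end WeakGrad

/-! ### Traces -/

theorem memLp_of_continuous_of_isBounded {E : Type*} [NormedAddCommGroup E]
    [SecondCountableTopology E] {D : Set (Vec d)} (hD : Bornology.IsBounded D)
    {f : Vec d → E} (hf : Continuous f) (p : ℝ≥0∞) : MemLp f p (volume.restrict D) := by
  have hc : IsCompact (closure D) := hD.isCompact_closure
  exact (memLp_of_continuous_of_isCompact hc hc.measure_lt_top hf p).mono_measure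
    (restrict_mono subset_closure le_rfl)

/-- A trace inequality on `D` for functions that are smooth up to the boundary. -/
def TraceBound (D : Set (Vec d)) : Prop :=
  ∃ C : ℝ≥0, ∀ φ : Vec d → ℂ, ContDiff ℝ 1 φ →
    eLpNorm φ 2 ((surf d).restrict (frontier D)) ≤
      C * (eLpNorm φ 2 (volume.restrict D) + eLpNorm (classicalGrad φ) 2 (volume.restrict D))

theorem classicalGrad_sub {φ ψ : Vec d → ℂ} (hφ : ContDiff ℝ 1 φ) (hψ : ContDiff ℝ 1 ψ) :
    classicalGrad (φ - ψ) = classicalGrad φ - classicalGrad ψ := by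
  ext x i
  simp only [classicalGrad, pderiv, Pi.sub_apply, PiLp.sub_apply]
  rw [fderiv_sub (hφ.differentiable one_ne_zero x) (hψ.differentiable one_ne_zero x)]
  rfl

theorem classicalGrad_add {φ ψ : Vec d → ℂ} (hφ : ContDiff ℝ 1 φ) (hψ : ContDiff ℝ 1 ψ) :
    classicalGrad (φ + ψ) = classicalGrad φ + classicalGrad ψ := by
  ext x i
  simp only [classicalGrad, pderiv, Pi.add_apply, PiLp.add_apply]
  rw [fderiv_add (hφ.differentiable one_ne_zero x) (hψ.differentiable one_ne_zero x)]
  rfl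

theorem classicalGrad_smul (c : ℂ) {φ : Vec d → ℂ} (hφ : ContDiff ℝ 1 φ) :
    classicalGrad (c • φ) = c • classicalGrad φ := by
  ext x i
  simp only [classicalGrad, pderiv, Pi.smul_apply, PiLp.smul_apply]
  rw [fderiv_const_smul (hφ.differentiable one_ne_zero x)]
  rfl

theorem tendsto_eLpNorm_sub_sub {α E : Type*} [MeasurableSpace α] [NormedAddCommGroup E]
    {ν : Measure α} {ι : Type*} {l : Filter ι} {f f' : ι → α → E} {g g' : α → E}
    (hf : ∀ n, AEStronglyMeasurable (f n - g) ν) (hf' : ∀ n, AEStronglyMeasurable (f' n - g') ν)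
    (h : Tendsto (fun n => eLpNorm (f n - g) 2 ν) l (𝓝 0))
    (h' : Tendsto (fun n => eLpNorm (f' n - g') 2 ν) l (𝓝 0)) :
    Tendsto (fun n => eLpNorm ((f n - f' n) - (g - g')) 2 ν) l (𝓝 0) := by
  refine tendsto_of_tendsto_of_tendsto_of_le_of_le tendsto_const_nhds
    (by simpa using h.add h') (fun _ => zero_le) fun n => ?_
  rw [show f n - f' n - (g - g') = (f n - g) - (f' n - g') by abel]
  exact eLpNorm_sub_le (hf n) (hf' n) one_le_two

theorem tendsto_eLpNorm_add_sub {α E : Type*} [MeasurableSpace α] [NormedAddCommGroup E]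
    {ν : Measure α} {ι : Type*} {l : Filter ι} {f f' : ι → α → E} {g g' : α → E}
    (hf : ∀ n, AEStronglyMeasurable (f n - g) ν) (hf' : ∀ n, AEStronglyMeasurable (f' n - g') ν)
    (h : Tendsto (fun n => eLpNorm (f n - g) 2 ν) l (𝓝 0))
    (h' : Tendsto (fun n => eLpNorm (f' n - g') 2 ν) l (𝓝 0)) :
    Tendsto (fun n => eLpNorm ((f n + f' n) - (g + g')) 2 ν) l (𝓝 0) := by
  refine tendsto_of_tendsto_of_tendsto_of_le_of_le tendsto_const_nhds
    (by simpa using h.add h') (fun _ => zero_le) fun n => ?_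
  rw [show f n + f' n - (g + g') = (f n - g) + (f' n - g') by abel]
  exact eLpNorm_add_le (hf n) (hf' n) one_le_two

section Trace

variable {D : Set (Vec d)} {v v' t t' : Vec d → ℂ}

theorem IsTrace.add (hD : IsOpen D) (hv : MemH1 D v) (hv' : MemH1 D v')
    (h : IsTrace D v t) (h' : IsTrace D v' t') : IsTrace D (v + v') (t + t') := by
  obtain ⟨ht, φ, hφ, h1, h2, h3⟩ := h
  obtain ⟨ht', φ', hφ', h1', h2', h3'⟩ := h'
  have hφ1 : ∀ n, ContDiff ℝ 1 (φ n) := fun n => (hφ n).of_le (by simp)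
  have hφ1' : ∀ n, ContDiff ℝ 1 (φ' n) := fun n => (hφ' n).of_le (by simp)
  refine ⟨ht.add ht', fun n => φ n + φ' n, fun n => (hφ n).add (hφ' n),
    tendsto_eLpNorm_add_sub (fun n => (hφ n).continuous.aestronglyMeasurable.sub hv.1.1)
      (fun n => (hφ' n).continuous.aestronglyMeasurable.sub hv'.1.1) h1 h1', ?_,
    tendsto_eLpNorm_add_sub (fun n => (hφ n).continuous.aestronglyMeasurable.sub ht.1)
      (fun n => (hφ' n).continuous.aestronglyMeasurable.sub ht'.1) h3 h3'⟩
  have := tendsto_eLpNorm_add_sub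
    (fun n => (continuous_classicalGrad (hφ1 n)).aestronglyMeasurable.sub hv.hasWeakGrad.1.1)
    (fun n => (continuous_classicalGrad (hφ1' n)).aestronglyMeasurable.sub hv'.hasWeakGrad.1.1) h2 h2'
  refine this.congr fun n => eLpNorm_congr_ae ?_
  rw [classicalGrad_add (hφ1 n) (hφ1' n)]
  exact (ae_eq_refl _).sub (weakGrad_add hD hv hv').symm

theorem tendsto_eLpNorm_smul_sub {α E : Type*} [MeasurableSpace α] [NormedAddCommGroup E]
    [NormedSpace ℂ E] {ν : Measure α} {ι : Type*} {l : Filter ι} {f : ι → α → E} {g : α → E} (c : ℂ)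
    (h : Tendsto (fun n => eLpNorm (f n - g) 2 ν) l (𝓝 0)) :
    Tendsto (fun n => eLpNorm (c • f n - c • g) 2 ν) l (𝓝 0) := by
  simp_rw [← smul_sub, eLpNorm_const_smul]
  simpa using ENNReal.Tendsto.const_mul (a := ‖c‖ₑ) h (Or.inr enorm_ne_top)

theorem IsTrace.smul (hD : IsOpen D) (c : ℂ) (hv : MemH1 D v) (h : IsTrace D v t) :
    IsTrace D (c • v) (c • t) := by
  obtain ⟨ht, φ, hφ, h1, h2, h3⟩ := h
  have hφ1 : ∀ n, ContDiff ℝ 1 (φ n) := fun n => (hφ n).of_le (by simp)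
  refine ⟨ht.const_smul c, fun n => c • φ n, fun n => contDiff_const.smul (hφ n),
    tendsto_eLpNorm_smul_sub c h1, ?_, tendsto_eLpNorm_smul_sub c h3⟩
  refine (tendsto_eLpNorm_smul_sub c h2).congr fun n => eLpNorm_congr_ae ?_
  rw [classicalGrad_smul c (hφ1 n)]
  exact (ae_eq_refl _).sub (weakGrad_smul hD c hv).symm

/-- The difference of the two approximating sequences tends to zero together with its gradient; the
trace inequality makes its restriction to the boundary tend to zero as well, while that restriction
tends to `t - t'`. -/
theorem IsTrace.ae_eq (hC : TraceBound D) (hv : MemH1 D v)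
    (h : IsTrace D v t) (h' : IsTrace D v t') : t =ᵐ[(surf d).restrict (frontier D)] t' := by
  obtain ⟨ht, φ, hφ, h1, h2, h3⟩ := h
  obtain ⟨ht', φ', hφ', h1', h2', h3'⟩ := h'
  obtain ⟨C, hC⟩ := hC
  have hφ1 : ∀ n, ContDiff ℝ 1 (φ n) := fun n => (hφ n).of_le (by simp)
  have hφ1' : ∀ n, ContDiff ℝ 1 (φ' n) := fun n => (hφ' n).of_le (by simp)
  have k1 := tendsto_eLpNorm_sub_sub (fun n => (hφ n).continuous.aestronglyMeasurable.sub hv.1.1)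
      (fun n => (hφ' n).continuous.aestronglyMeasurable.sub hv.1.1) h1 h1'
  have k2 := tendsto_eLpNorm_sub_sub
    (fun n => (continuous_classicalGrad (hφ1 n)).aestronglyMeasurable.sub hv.hasWeakGrad.1.1)
    (fun n => (continuous_classicalGrad (hφ1' n)).aestronglyMeasurable.sub hv.hasWeakGrad.1.1) h2 h2'
  have k3 := tendsto_eLpNorm_sub_sub (fun n => (hφ n).continuous.aestronglyMeasurable.sub ht.1)
      (fun n => (hφ' n).continuous.aestronglyMeasurable.sub ht'.1) h3 h3'
  simp only [sub_self, sub_zero] at k1 k2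
  have k4 : Tendsto (fun n => eLpNorm (φ n - φ' n) 2 ((surf d).restrict (frontier D))) atTop (𝓝 0) := by
    refine tendsto_of_tendsto_of_tendsto_of_le_of_le tendsto_const_nhds
      (by simpa using ENNReal.Tendsto.const_mul (a := (C : ℝ≥0∞)) (k1.add k2) (Or.inr ENNReal.coe_ne_top))
      (fun _ => zero_le) fun n => ?_
    have := hC _ ((hφ1 n).sub (hφ1' n))
    rwa [show (fun x => φ n x - φ' n x) = φ n - φ' n from rfl,
      classicalGrad_sub (hφ1 n) (hφ1' n)] at this
  have k5 : eLpNorm (t - t') 2 ((surf d).restrict (frontier D)) ≤ 0 := by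
    refine ge_of_tendsto' (by simpa using k4.add k3) fun n => ?_
    have := eLpNorm_sub_le (μ := (surf d).restrict (frontier D)) (p := 2)
      ((hφ n).continuous.sub (hφ' n).continuous).aestronglyMeasurable
      (((hφ n).continuous.sub (hφ' n).continuous).aestronglyMeasurable.sub (ht.1.sub ht'.1)) one_le_two
    refine le_trans (le_of_eq ?_) this
    congr 1
    ext x
    simp
  have k6 := (eLpNorm_eq_zero_iff (ht.1.sub ht'.1) two_ne_zero).1 (le_antisymm k5 zero_le)
  filter_upwards [k6] with x hx
  exact sub_eq_zero.1 hx

theorem IsTrace.congr (hD : IsOpen D) (hv : MemH1 D v) (h : IsTrace D v t)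
    (hvv : v =ᵐ[volume.restrict D] v') : IsTrace D v' t := by
  obtain ⟨ht, φ, hφ, h1, h2, h3⟩ := h
  refine ⟨ht, φ, hφ, h1.congr fun n => eLpNorm_congr_ae ((ae_eq_refl _).sub hvv),
    h2.congr fun n => eLpNorm_congr_ae ((ae_eq_refl _).sub ?_), h3⟩
  exact ((hv.hasWeakGrad.congr hvv).weakGrad_ae_eq hD).symm

theorem IsTrace.trace_ae_eq (hC : TraceBound D) (hv : MemH1 D v) (h : IsTrace D v t) :
    trace D v =ᵐ[(surf d).restrict (frontier D)] t :=
  IsTrace.ae_eq hC hv (Classical.epsilon_spec (⟨t, h⟩ : ∃ t, IsTrace D v t)) h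

theorem isTrace_of_contDiff (hD : IsOpen D) (hb : Bornology.IsBounded D)
    (hfin : surf d (frontier D) < ⊤) {φ : Vec d → ℂ}
    (hφ : ContDiff ℝ ((⊤ : ℕ∞) : WithTop ℕ∞) φ) : MemH1 D φ ∧
      weakGrad D φ =ᵐ[volume.restrict D] classicalGrad φ ∧ IsTrace D φ φ := by
  have hφ1 : ContDiff ℝ 1 φ := hφ.of_le (by simp)
  have hw := hasWeakGrad_classicalGrad hφ1
    (memLp_of_continuous_of_isBounded hb (continuous_classicalGrad hφ1) 2)
  have he := hw.weakGrad_ae_eq hD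
  refine ⟨⟨memLp_of_continuous_of_isBounded hb hφ.continuous 2, _, hw⟩, he, ?_, fun _ => φ,
    fun _ => hφ, by simp, ?_, by simp⟩
  · exact memLp_of_continuous_of_isCompact (hb.isCompact_closure.of_isClosed_subset isClosed_frontier
      frontier_subset_closure) hfin hφ.continuous 2
  · have : eLpNorm (classicalGrad φ - weakGrad D φ) 2 (volume.restrict D) = 0 := by
      rw [eLpNorm_congr_ae ((ae_eq_refl _).sub he), sub_self, eLpNorm_zero]
    simp [this]

end Trace

end IPDG

/-! ### Traces on the skeleton and elementwise regular functions. -/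

namespace IPDG
open Measure Set
open scoped Classical
variable {d : ℕ}

/-- The squared norm is additive in the measure and the square root is subadditive. -/
theorem eLpNorm_finset_sum_measure_le {α ι E : Type*} [MeasurableSpace α] [NormedAddCommGroup E]
    (s : Finset ι) (ν : ι → Measure α) (f : α → E) :
    eLpNorm f 2 (∑ i ∈ s, ν i) ≤ ∑ i ∈ s, eLpNorm f 2 (ν i) := by
  simp_rw [eLpNorm_eq_lintegral_rpow_enorm_toReal (p := 2) two_ne_zero ENNReal.ofNat_ne_top,
    lintegral_finsetSum_measure]
  induction s using Finset.induction_on with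
  | empty => simp
  | insert a s ha ih =>
    rw [Finset.sum_insert ha, Finset.sum_insert ha]
    refine (ENNReal.rpow_add_le_add_rpow _ _ (by norm_num) (by norm_num)).trans ?_
    gcongr

namespace Mesh

variable {S : HelmholtzData d} (M : Mesh S)

theorem hull_face_subset_frontier {F K : Finset (Vec d)} (hF : F ∈ facesOf M.T) (hK : K ∈ M.T)
    (hFK : F ⊆ K) : hull F ⊆ frontier (interior (hull K)) := by
  obtain ⟨a, rfl⟩ := M.exists_eq_erase_of_mem hF hK hFK
  rw [(M.isSimplex hK).frontier_interior]
  exact subset_iUnion (fun a : K => hull (K.erase (a : Vec d))) a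

theorem exists_eLpNorm_face_le (hd : 1 ≤ d) {F K : Finset (Vec d)} (hF : F ∈ facesOf M.T) (hK : K ∈ M.T)
    (hFK : F ⊆ K) : ∃ C : ℝ≥0, ∀ φ : Vec d → ℂ, ContDiff ℝ 1 φ →
      eLpNorm φ 2 ((surf d).restrict (hull F)) ≤
        C * (eLpNorm φ 2 (volume.restrict (hull K))
          + eLpNorm (classicalGrad φ) 2 (volume.restrict (hull K))) := by
  obtain ⟨a, rfl⟩ := M.exists_eq_erase_of_mem hF hK hFK
  exact (M.isSimplex hK).eLpNorm_face_le hd a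

theorem traceBound_hull (hd : 1 ≤ d) {K : Finset (Vec d)} (hK : K ∈ M.T) :
    TraceBound (interior (hull K)) := by
  choose C hC using fun a : K => (M.isSimplex hK).eLpNorm_face_le hd a
  refine ⟨∑ a, C a, fun φ hφ => ?_⟩
  rw [(M.isSimplex hK).frontier_interior, IsSimplex.restrict_interior]
  refine (eLpNorm_mono_measure φ (restrict_iUnion_le)).trans ?_
  rw [Measure.sum_fintype]
  refine (eLpNorm_finset_sum_measure_le _ _ _).trans ?_
  rw [ENNReal.ofNNReal_finsetSum, Finset.sum_mul]
  exact Finset.sum_le_sum fun a _ => hC a φ hφ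

theorem exists_eLpNorm_skel_le (hd : 1 ≤ d) : ∃ C : ℝ≥0, ∀ φ : Vec d → ℂ, ContDiff ℝ 1 φ →
      eLpNorm φ 2 ((surf d).restrict M.skel) ≤
        C * (eLpNorm φ 2 (volume.restrict S.Ω) + eLpNorm (classicalGrad φ) 2 (volume.restrict S.Ω)) := by
  have h : ∀ F : facesOf M.T, ∃ C : ℝ≥0, ∀ φ : Vec d → ℂ, ContDiff ℝ 1 φ →
      eLpNorm φ 2 ((surf d).restrict (hull F.1)) ≤
        C * (eLpNorm φ 2 (volume.restrict S.Ω) + eLpNorm (classicalGrad φ) 2 (volume.restrict S.Ω)) := by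
    rintro ⟨F, hF⟩
    obtain ⟨K, hK, hFK, -⟩ := mem_facesOf.1 hF
    obtain ⟨C, hC⟩ := M.exists_eLpNorm_face_le hd hF hK hFK
    refine ⟨C, fun φ hφ => (hC φ hφ).trans ?_⟩
    refine mul_le_mul_right ?_ _
    exact (add_le_add (eLpNorm_mono_measure _ (M.restrict_hull_le hK))
      (eLpNorm_mono_measure _ (M.restrict_hull_le hK)))
  choose C hC using h
  refine ⟨∑ F, C F, fun φ hφ => ?_⟩
  rw [M.restrict_skel]
  refine (eLpNorm_finset_sum_measure_le _ _ _).trans ?_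
  rw [ENNReal.ofNNReal_finsetSum, Finset.sum_mul, ← Finset.sum_coe_sort]
  exact Finset.sum_le_sum fun a _ => hC a φ hφ

theorem traceBound_Ω {S : HelmholtzData d} (M : Mesh S) (hd : 1 ≤ d) : TraceBound S.Ω := by
  obtain ⟨C, hC⟩ := M.exists_eLpNorm_skel_le hd
  refine ⟨C, fun φ hφ => le_trans ?_ (hC φ hφ)⟩
  exact eLpNorm_mono_measure _ (restrict_mono M.frontier_subset le_rfl)

/-- `τ` is the trace of `v ∈ H¹(Ω)` on the union of all faces. -/
def SkelTrace (v τ : Vec d → ℂ) : Prop :=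
  MemLp τ 2 ((surf d).restrict M.skel) ∧
    ∃ φ : ℕ → Vec d → ℂ, (∀ n, ContDiff ℝ ((⊤ : ℕ∞) : WithTop ℕ∞) (φ n)) ∧
      Tendsto (fun n => eLpNorm (φ n - v) 2 (volume.restrict S.Ω)) atTop (𝓝 0) ∧
      Tendsto (fun n => eLpNorm (classicalGrad (φ n) - weakGrad S.Ω v) 2 (volume.restrict S.Ω))
        atTop (𝓝 0) ∧
      Tendsto (fun n => eLpNorm (φ n - τ) 2 ((surf d).restrict M.skel)) atTop (𝓝 0)

theorem frontier_restrict_le : (surf d).restrict (frontier S.Ω) ≤ (surf d).restrict M.skel :=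
  restrict_mono M.frontier_subset le_rfl

theorem memLp_skel (hd : 1 ≤ d) {E : Type*} [NormedAddCommGroup E] [SecondCountableTopology E]
    {φ : Vec d → E} (hφ : Continuous φ) (p : ℝ≥0∞) :
    MemLp φ p ((surf d).restrict M.skel) :=
  memLp_of_continuous_of_isCompact M.isCompact_skel (M.surf_skel_lt_top hd) hφ p

/-- A sequence of smooth functions converging in `H¹(Ω)` converges on the skeleton. -/
theorem exists_skelTrace_of_tendsto (hd : 1 ≤ d) {v : Vec d → ℂ} (hv : MemH1 S.Ω v)
    {φ : ℕ → Vec d → ℂ} (hφ : ∀ n, ContDiff ℝ ((⊤ : ℕ∞) : WithTop ℕ∞) (φ n))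
    (h1 : Tendsto (fun n => eLpNorm (φ n - v) 2 (volume.restrict S.Ω)) atTop (𝓝 0))
    (h2 : Tendsto (fun n => eLpNorm (classicalGrad (φ n) - weakGrad S.Ω v) 2 (volume.restrict S.Ω))
        atTop (𝓝 0)) :
    ∃ τ, MemLp τ 2 ((surf d).restrict M.skel) ∧
      Tendsto (fun n => eLpNorm (φ n - τ) 2 ((surf d).restrict M.skel)) atTop (𝓝 0) := by
  have hφ1 : ∀ n, ContDiff ℝ 1 (φ n) := fun n => (hφ n).of_le (by simp)
  obtain ⟨C, hC⟩ := M.exists_eLpNorm_skel_le hd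
  have hmem : ∀ n, MemLp (φ n) 2 ((surf d).restrict M.skel) := fun n =>
    M.memLp_skel hd (hφ n).continuous 2
  -- Summed over the faces, the trace inequality bounds differences on the skeleton by differences
  -- in `H¹(Ω)`; completeness of `L²` then provides the trace.
  have hcs : CauchySeq (fun n => (hmem n).toLp (φ n)) := by
    rw [Lp.cauchySeq_Lp_iff_cauchySeq_eLpNorm]
    have e1 : Tendsto (fun q : ℕ × ℕ => eLpNorm (φ q.1 - v) 2 (volume.restrict S.Ω)
        + eLpNorm (φ q.2 - v) 2 (volume.restrict S.Ω)) atTop (𝓝 0) := by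
      rw [← prod_atTop_atTop_eq]
      simpa using (h1.comp tendsto_fst).add (h1.comp tendsto_snd)
    have e2 : Tendsto (fun q : ℕ × ℕ =>
        eLpNorm (classicalGrad (φ q.1) - weakGrad S.Ω v) 2 (volume.restrict S.Ω)
        + eLpNorm (classicalGrad (φ q.2) - weakGrad S.Ω v) 2 (volume.restrict S.Ω)) atTop (𝓝 0) := by
      rw [← prod_atTop_atTop_eq]
      simpa using (h2.comp tendsto_fst).add (h2.comp tendsto_snd)
    have e3 := ENNReal.Tendsto.const_mul (a := (C : ℝ≥0∞)) (e1.add e2) (Or.inr ENNReal.coe_ne_top)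
    rw [add_zero, mul_zero] at e3
    refine tendsto_of_tendsto_of_tendsto_of_le_of_le tendsto_const_nhds e3
      (fun _ => zero_le) fun q => ?_
    have he : eLpNorm (((hmem q.1).toLp (φ q.1) : Vec d → ℂ) - ((hmem q.2).toLp (φ q.2) : Vec d → ℂ)) 2
        ((surf d).restrict M.skel) = eLpNorm (φ q.1 - φ q.2) 2 ((surf d).restrict M.skel) :=
      eLpNorm_congr_ae ((hmem q.1).coeFn_toLp.sub (hmem q.2).coeFn_toLp)
    rw [he]
    refine (hC _ ((hφ1 q.1).sub (hφ1 q.2))).trans ?_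
    rw [show (fun x => φ q.1 x - φ q.2 x) = φ q.1 - φ q.2 from rfl,
      classicalGrad_sub (hφ1 q.1) (hφ1 q.2)]
    have m1 : ∀ n, AEStronglyMeasurable (φ n - v) (volume.restrict S.Ω) := fun n =>
      (hφ n).continuous.aestronglyMeasurable.sub hv.1.1
    have m2 : ∀ n, AEStronglyMeasurable (classicalGrad (φ n) - weakGrad S.Ω v)
        (volume.restrict S.Ω) := fun n =>
      (continuous_classicalGrad (hφ1 n)).aestronglyMeasurable.sub hv.hasWeakGrad.1.1
    gcongr
    · rw [show φ q.1 - φ q.2 = (φ q.1 - v) - (φ q.2 - v) by abel]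
      exact eLpNorm_sub_le (m1 _) (m1 _) one_le_two
    · rw [show classicalGrad (φ q.1) - classicalGrad (φ q.2)
        = (classicalGrad (φ q.1) - weakGrad S.Ω v) - (classicalGrad (φ q.2) - weakGrad S.Ω v) by abel]
      exact eLpNorm_sub_le (m2 _) (m2 _) one_le_two
  obtain ⟨τ, hτ⟩ := cauchySeq_tendsto_of_complete hcs
  refine ⟨τ, Lp.memLp τ, ?_⟩
  have := (Lp.tendsto_Lp_iff_tendsto_eLpNorm'' _ hmem (τ : Vec d → ℂ) (Lp.memLp τ)).1
    (by rwa [Lp.toLp_coeFn])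
  exact this

theorem SkelTrace.isTrace {v τ : Vec d → ℂ} (h : M.SkelTrace v τ) : IsTrace S.Ω v τ := by
  obtain ⟨hτ, φ, hφ, h1, h2, h3⟩ := h
  refine ⟨hτ.mono_measure M.frontier_restrict_le, φ, hφ, h1, h2, ?_⟩
  exact tendsto_of_tendsto_of_tendsto_of_le_of_le tendsto_const_nhds h3 (fun _ => zero_le)
    fun n => eLpNorm_mono_measure _ M.frontier_restrict_le

theorem weakGrad_hull_ae_eq {K : Finset (Vec d)} (hK : K ∈ M.T) {v : Vec d → ℂ}
    (hv : MemH1 S.Ω v) : weakGrad (interior (hull K)) v =ᵐ[volume.restrict (hull K)] weakGrad S.Ω v := by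
  rw [← IsSimplex.restrict_interior]
  exact (hv.hasWeakGrad.mono S.measurableSet_Ω (M.interior_hull_subset hK)).weakGrad_ae_eq
    isOpen_interior

theorem memH1_hull {K : Finset (Vec d)} (hK : K ∈ M.T) {v : Vec d → ℂ}
    (hv : MemH1 S.Ω v) : MemH1 (interior (hull K)) v :=
  ⟨hv.1.mono_measure (restrict_mono (M.interior_hull_subset hK) le_rfl), _,
    hv.hasWeakGrad.mono S.measurableSet_Ω (M.interior_hull_subset hK)⟩

/-- The global approximating sequence also serves on every element. One function `τ` is thus the
trace from both sides of an interior face, which is the origin of the vanishing jumps. -/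
theorem SkelTrace.isTrace_hull {v τ : Vec d → ℂ} (h : M.SkelTrace v τ) (hv : MemH1 S.Ω v)
    {K : Finset (Vec d)} (hK : K ∈ M.T) : IsTrace (interior (hull K)) v τ := by
  obtain ⟨hτ, φ, hφ, h1, h2, h3⟩ := h
  have hle : (surf d).restrict (frontier (interior (hull K))) ≤ (surf d).restrict M.skel :=
    restrict_mono (M.frontier_interior_subset hK) le_rfl
  have hle' : volume.restrict (interior (hull K)) ≤ volume.restrict S.Ω :=
    restrict_mono (M.interior_hull_subset hK) le_rfl
  refine ⟨hτ.mono_measure hle, φ, hφ, ?_, ?_, ?_⟩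
  · exact tendsto_of_tendsto_of_tendsto_of_le_of_le tendsto_const_nhds h1 (fun _ => zero_le)
      fun n => eLpNorm_mono_measure _ hle'
  · refine tendsto_of_tendsto_of_tendsto_of_le_of_le tendsto_const_nhds h2 (fun _ => zero_le)
      fun n => le_trans (le_of_eq (eLpNorm_congr_ae ?_)) (eLpNorm_mono_measure _ hle')
    have := M.weakGrad_hull_ae_eq hK hv
    rw [← IsSimplex.restrict_interior] at this
    exact (ae_eq_refl _).sub this
  · exact tendsto_of_tendsto_of_tendsto_of_le_of_le tendsto_const_nhds h3 (fun _ => zero_le)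
      fun n => eLpNorm_mono_measure _ hle

/-- A sequence that realises the boundary trace converges on the whole skeleton. Its limit restricts
to a trace on the frontier, so uniqueness carries the Dirichlet condition over to it. -/
theorem exists_skelTrace (hd : 1 ≤ d) {v : Vec d → ℂ} (hv : S.H1D v) :
    ∃ τ, M.SkelTrace v τ ∧ ∀ᵐ x ∂((surf d).restrict S.ΓD), τ x = 0 := by
  obtain ⟨hv, t, ht, h0⟩ := hv
  obtain ⟨htm, φ, hφ, h1, h2, h3⟩ := id ht
  obtain ⟨τ, hτm, hτ⟩ := M.exists_skelTrace_of_tendsto hd hv hφ h1 h2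
  have hs : M.SkelTrace v τ := ⟨hτm, φ, hφ, h1, h2, hτ⟩
  refine ⟨τ, hs, ?_⟩
  have := IsTrace.ae_eq (M.traceBound_Ω hd) hv ht (SkelTrace.isTrace M hs)
  have := ae_restrict_of_ae_restrict_of_subset S.ΓD_subset this
  filter_upwards [this, h0] with x h1 h2
  rw [← h1, h2]

/-! ### Elementwise `H¹` functions with traces -/

/-- Square integrable functions that, on each element, are in `H¹` and have a trace. -/
def Traced (v : Vec d → ℂ) : Prop :=
  MemLp v 2 (volume.restrict S.Ω) ∧
    ∀ K ∈ M.T, MemH1 (interior (hull K)) v ∧ ∃ t, IsTrace (interior (hull K)) v t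

variable {M}

theorem Traced.brokenH1 {v : Vec d → ℂ} (h : M.Traced v) : M.BrokenH1 v :=
  ⟨h.1, fun K hK => (h.2 K hK).1⟩

theorem Traced.add {v w : Vec d → ℂ} (hv : M.Traced v) (hw : M.Traced w) : M.Traced (v + w) := by
  refine ⟨hv.1.add hw.1, fun K hK => ?_⟩
  obtain ⟨h1, t1, ht1⟩ := hv.2 K hK
  obtain ⟨h2, t2, ht2⟩ := hw.2 K hK
  exact ⟨h1.add h2, _, ht1.add isOpen_interior h1 h2 ht2⟩

theorem Traced.smul (c : ℂ) {v : Vec d → ℂ} (hv : M.Traced v) : M.Traced (c • v) := by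
  refine ⟨hv.1.const_smul c, fun K hK => ?_⟩
  obtain ⟨h1, t1, ht1⟩ := hv.2 K hK
  exact ⟨h1.smul c, _, ht1.smul isOpen_interior c h1⟩

theorem Traced.isTrace {v : Vec d → ℂ} (hv : M.Traced v) {K : Finset (Vec d)} (hK : K ∈ M.T) :
    IsTrace (interior (hull K)) v (M.traceK K v) :=
  Classical.epsilon_spec (hv.2 K hK).2

theorem traceK_ae_eq (hd : 1 ≤ d) {v t : Vec d → ℂ} {F K : Finset (Vec d)} (hF : F ∈ facesOf M.T)
    (hK : K ∈ M.T) (hFK : F ⊆ K) (hv : MemH1 (interior (hull K)) v)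
    (h : IsTrace (interior (hull K)) v t) : M.traceK K v =ᵐ[(surf d).restrict (hull F)] t :=
  ae_restrict_of_ae_restrict_of_subset (M.hull_face_subset_frontier hF hK hFK)
    (h.trace_ae_eq (M.traceBound_hull hd hK) hv)

theorem Traced.memLp_traceK {v : Vec d → ℂ} (hv : M.Traced v) {F K : Finset (Vec d)}
    (hF : F ∈ facesOf M.T) (hK : K ∈ M.T) (hFK : F ⊆ K) :
    MemLp (M.traceK K v) 2 ((surf d).restrict (hull F)) :=
  (hv.isTrace hK).1.mono_measure (restrict_mono (M.hull_face_subset_frontier hF hK hFK) le_rfl)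

theorem Traced.traceK_add (hd : 1 ≤ d) {v w : Vec d → ℂ} (hv : M.Traced v) (hw : M.Traced w)
    {F K : Finset (Vec d)} (hF : F ∈ facesOf M.T) (hK : K ∈ M.T) (hFK : F ⊆ K) :
    M.traceK K (v + w) =ᵐ[(surf d).restrict (hull F)] M.traceK K v + M.traceK K w :=
  traceK_ae_eq hd hF hK hFK ((hv.2 K hK).1.add (hw.2 K hK).1)
    ((hv.isTrace hK).add isOpen_interior (hv.2 K hK).1 (hw.2 K hK).1 (hw.isTrace hK))

theorem Traced.traceK_smul (hd : 1 ≤ d) (c : ℂ) {v : Vec d → ℂ} (hv : M.Traced v)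
    {F K : Finset (Vec d)} (hF : F ∈ facesOf M.T) (hK : K ∈ M.T) (hFK : F ⊆ K) :
    M.traceK K (c • v) =ᵐ[(surf d).restrict (hull F)] c • M.traceK K v :=
  traceK_ae_eq hd hF hK hFK ((hv.2 K hK).1.smul c)
    ((hv.isTrace hK).smul isOpen_interior c (hv.2 K hK).1)

theorem Traced.memLp_weakGrad {v : Vec d → ℂ} (hv : M.Traced v) {K : Finset (Vec d)} (hK : K ∈ M.T) :
    MemLp (weakGrad (interior (hull K)) v) 2 (volume.restrict (hull K)) := by
  rw [← IsSimplex.restrict_interior]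
  exact (hv.2 K hK).1.hasWeakGrad.1

theorem Traced.weakGrad_add {v w : Vec d → ℂ} (hv : M.Traced v) (hw : M.Traced w)
    {K : Finset (Vec d)} (hK : K ∈ M.T) :
    weakGrad (interior (hull K)) (v + w) =ᵐ[volume.restrict (hull K)]
      weakGrad (interior (hull K)) v + weakGrad (interior (hull K)) w := by
  rw [← IsSimplex.restrict_interior]
  exact IPDG.weakGrad_add isOpen_interior (hv.2 K hK).1 (hw.2 K hK).1

theorem Traced.weakGrad_smul (c : ℂ) {v : Vec d → ℂ} (hv : M.Traced v)
    {K : Finset (Vec d)} (hK : K ∈ M.T) :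
    weakGrad (interior (hull K)) (c • v) =ᵐ[volume.restrict (hull K)]
      c • weakGrad (interior (hull K)) v := by
  rw [← IsSimplex.restrict_interior]
  exact IPDG.weakGrad_smul isOpen_interior c (hv.2 K hK).1

variable (M)

theorem traced_of_H1D (hd : 1 ≤ d) {v : Vec d → ℂ} (hv : S.H1D v) : M.Traced v := by
  obtain ⟨τ, hτ, -⟩ := M.exists_skelTrace hd hv
  exact ⟨hv.1.1, fun K hK => ⟨M.memH1_hull hK hv.1, τ, SkelTrace.isTrace_hull M hτ hv.1 hK⟩⟩

theorem contDiff_evalP (q : MvPolynomial (Fin d) ℂ) {n : WithTop ℕ∞} : ContDiff ℝ n (evalP q) := by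
  have h : ∀ i : Fin d, ContDiff ℝ n (fun x : Vec d => (x i : ℂ)) := fun i =>
    (Complex.ofRealCLM.contDiff (n := n)).comp
      (EuclideanSpace.proj i : Vec d →L[ℝ] ℝ).contDiff
  induction q using MvPolynomial.induction_on with
  | C a =>
    have : evalP (d := d) (MvPolynomial.C a) = fun _ => a := by ext x; simp [evalP]
    rw [this]; exact contDiff_const
  | add p q hp hq =>
    have : evalP (d := d) (p + q) = fun x => evalP p x + evalP q x := by ext x; simp [evalP]
    rw [this]; exact hp.add hq
  | mul_X p i hp =>
    have : evalP (d := d) (p * MvPolynomial.X i) = fun x => evalP p x * (x i : ℂ) := by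
      ext x; simp [evalP]
    rw [this]; exact hp.mul (h i)

theorem surf_frontier_interior_lt_top (hd : 1 ≤ d) {K : Finset (Vec d)} (hK : K ∈ M.T) :
    surf d (frontier (interior (hull K))) < ⊤ :=
  (measure_mono (M.frontier_interior_subset hK)).trans_lt (M.surf_skel_lt_top hd)

/-- A function that is smooth on an element has the expected gradient and trace. -/
theorem hull_of_ae_eq_contDiff (hd : 1 ≤ d) {K : Finset (Vec d)} (hK : K ∈ M.T) {v φ : Vec d → ℂ}
    (hφ : ContDiff ℝ ((⊤ : ℕ∞) : WithTop ℕ∞) φ) (h : v =ᵐ[volume.restrict (hull K)] φ) :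
    MemH1 (interior (hull K)) v ∧
      weakGrad (interior (hull K)) v =ᵐ[volume.restrict (hull K)] classicalGrad φ ∧
      IsTrace (interior (hull K)) v φ := by
  rw [← IsSimplex.restrict_interior] at h ⊢
  obtain ⟨h1, h2, h3⟩ := isTrace_of_contDiff isOpen_interior
    ((isCompact_hull K).isBounded.subset interior_subset) (M.surf_frontier_interior_lt_top hd hK) hφ
  have hw := (h1.hasWeakGrad).congr h.symm
  exact ⟨⟨(memLp_congr_ae h).2 h1.1, _, hw⟩, (hw.weakGrad_ae_eq isOpen_interior).trans h2,
    h3.congr isOpen_interior h1 h.symm⟩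

theorem memLp_Ω_iff {E : Type*} [NormedAddCommGroup E] {f : Vec d → E} :
    MemLp f 2 (volume.restrict S.Ω) ↔ ∀ K ∈ M.T, MemLp f 2 (volume.restrict (hull K)) := by
  constructor
  · exact fun h K hK => h.mono_measure (M.restrict_hull_le hK)
  · intro h
    refine ⟨?_, ?_⟩
    · rw [M.restrict_Ω, ← Measure.sum_coe_finset]
      exact AEStronglyMeasurable.sum_measure fun K => (h K K.2).1
    · rw [M.restrict_Ω]
      exact (eLpNorm_finset_sum_measure_le _ _ _).trans_lt
        (ENNReal.sum_lt_top.2 fun K hK => (h K hK).2)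

theorem traced_of_isDiscrete (hd : 1 ≤ d) {p : ℕ} {v : Vec d → ℂ} (hv : M.IsDiscrete p v) :
    M.Traced v := by
  have h : ∀ K ∈ M.T, MemH1 (interior (hull K)) v ∧ ∃ t, IsTrace (interior (hull K)) v t := by
    intro K hK
    obtain ⟨q, -, hq⟩ := hv K hK
    obtain ⟨h1, h2, h3⟩ := M.hull_of_ae_eq_contDiff hd hK (contDiff_evalP q) hq
    exact ⟨h1, _, h3⟩
  refine ⟨M.memLp_Ω_iff.2 fun K hK => ?_, h⟩
  rw [← IsSimplex.restrict_interior]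
  exact (h K hK).1.1

end Mesh

end IPDG

/-! ### Square roots of the coefficient matrix and weighted `L²` spaces. -/

namespace IPDG
open Measure Set
open scoped Classical
variable {d : ℕ}

/-! ### Square roots of the matrix coefficient -/

section LinAlg

variable {B : Matrix (Fin d) (Fin d) ℝ}

theorem dotProduct_mulVec_pos_of_minEig (h : 0 < minEig B) {x : Fin d → ℝ} (hx : x ≠ 0) :
    0 < ∑ i, ∑ j, B i j * x j * x i := by
  -- An infimum of real numbers not bounded below is 0 by convention, so positivity of `minEig B`
  -- already contains boundedness.
  have hbdd : BddBelow (range fun ξ : Metric.sphere (0 : Vec d) 1 =>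
      ∑ i, ∑ j, B i j * ξ.1 j * ξ.1 i) := by
    by_contra hn
    rw [minEig, Real.iInf_of_not_bddBelow hn] at h
    exact lt_irrefl _ h
  set y : Vec d := WithLp.toLp 2 x with hy
  have hy0 : y ≠ 0 := fun h0 => hx (by ext i; simpa [hy] using congrArg (fun z : Vec d => z i) h0)
  have hn : 0 < ‖y‖ := norm_pos_iff.2 hy0
  have h1 := ciInf_le hbdd ⟨‖y‖⁻¹ • y, by simp [norm_smul, hn.ne']⟩
  have h2 : ∑ i, ∑ j, B i j * (‖y‖⁻¹ • y) j * (‖y‖⁻¹ • y) i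
      = ‖y‖⁻¹ ^ 2 * ∑ i, ∑ j, B i j * x j * x i := by
    rw [Finset.mul_sum]
    refine Finset.sum_congr rfl fun i _ => ?_
    rw [Finset.mul_sum]
    refine Finset.sum_congr rfl fun j _ => ?_
    change B i j * (‖y‖⁻¹ * x j) * (‖y‖⁻¹ * x i) = _
    ring
  have h3 : 0 < ‖y‖⁻¹ ^ 2 * ∑ i, ∑ j, B i j * x j * x i := by
    rw [← h2]; exact h.trans_le h1
  exact pos_of_mul_pos_right h3 (by positivity)

theorem posDef_of_minEig (hs : B.IsSymm) (h : 0 < minEig B) : B.PosDef := by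
  refine Matrix.PosDef.of_dotProduct_mulVec_pos ?_ fun x hx => ?_
  · rw [Matrix.IsHermitian, Matrix.conjTranspose_eq_transpose_of_trivial]; exact hs
  · have := dotProduct_mulVec_pos_of_minEig h hx
    refine this.trans_eq ?_
    simp only [dotProduct, Matrix.mulVec, Pi.star_apply, star_trivial, Finset.mul_sum]
    exact Finset.sum_congr rfl fun i _ => Finset.sum_congr rfl fun j _ => by ring

open scoped MatrixOrder Matrix.Norms.L2Operator in
-- With `B = Cᵀ C`, the form `B w · conj z` is the plain inner product of `C w` and `C z`, and the
-- `A`-weighted norm becomes an unweighted `L²` norm.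
theorem exists_transpose_mul_self (hs : B.IsSymm) (h : 0 < minEig B) :
    ∃ C : Matrix (Fin d) (Fin d) ℝ, IsUnit C ∧ B = C.transpose * C := by
  have hp := posDef_of_minEig hs h
  obtain ⟨C, hC⟩ := CStarAlgebra.nonneg_iff_eq_star_mul_self.mp hp.posSemidef.nonneg
  rw [Matrix.star_eq_conjTranspose, Matrix.conjTranspose_eq_transpose_of_trivial] at hC
  refine ⟨C, ?_, hC⟩
  have hu := hp.isUnit
  rw [Matrix.isUnit_iff_isUnit_det, hC, Matrix.det_mul] at hu
  exact (Matrix.isUnit_iff_isUnit_det _).2 (isUnit_of_mul_isUnit_right hu)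

theorem matVec_apply (w : CVec d) (i : Fin d) : matVec B w i = ∑ j, (B i j : ℂ) * w j := rfl

theorem matVec_add (w z : CVec d) : matVec B (w + z) = matVec B w + matVec B z := by
  ext i; simp [matVec_apply, mul_add, Finset.sum_add_distrib]

theorem matVec_smul (c : ℂ) (w : CVec d) : matVec B (c • w) = c • matVec B w := by
  ext i
  simp only [matVec_apply, PiLp.smul_apply, smul_eq_mul, Finset.mul_sum]
  exact Finset.sum_congr rfl fun j _ => by ring

theorem matVec_matVec (C : Matrix (Fin d) (Fin d) ℝ) (w : CVec d) :
    matVec B (matVec C w) = matVec (B * C) w := by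
  ext i
  simp only [matVec_apply, Matrix.mul_apply, Finset.mul_sum, Complex.ofReal_sum,
    Complex.ofReal_mul, Finset.sum_mul]
  rw [Finset.sum_comm]
  exact Finset.sum_congr rfl fun j _ => Finset.sum_congr rfl fun k _ => by ring

theorem matVec_one (w : CVec d) : matVec 1 w = w := by
  ext i
  simp only [matVec_apply, Matrix.one_apply]
  rw [Finset.sum_eq_single i] <;> simp +contextual [eq_comm]

theorem cinner_eq (w z : CVec d) : inner ℂ z w = ∑ i, w i * conj (z i) := by
  simp [PiLp.inner_apply]

theorem inner_matVec (w z : CVec d) :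
    inner ℂ z (matVec B.transpose w) = inner ℂ (matVec B z) w := by
  simp only [cinner_eq, matVec_apply, _root_.map_sum, map_mul, Complex.conj_ofReal,
    Finset.mul_sum, Finset.sum_mul, Matrix.transpose_apply]
  rw [Finset.sum_comm]
  exact Finset.sum_congr rfl fun j _ => Finset.sum_congr rfl fun k _ => by ring

theorem sesq_eq_inner (w z : CVec d) : sesq B w z = inner ℂ z (matVec B w) := by
  simp [cinner_eq, matVec_apply, sesq, Finset.sum_mul]

theorem sesq_transpose_mul (w z : CVec d) :
    sesq (B.transpose * B) w z = inner ℂ (matVec B z) (matVec B w) := by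
  rw [sesq_eq_inner, ← matVec_matVec, inner_matVec]

/-- Inserting `B` and its inverse transpose pairs the weighted norm of a gradient with the inversely
weighted norm of a flux in the Cauchy–Schwarz inequality. -/
theorem inner_eq_inner_matVec (hB : IsUnit B) (w z : CVec d) :
    inner ℂ z w = inner ℂ (matVec B z) (matVec B⁻¹.transpose w) := by
  rw [← inner_matVec, matVec_matVec, ← Matrix.transpose_mul,
    Matrix.nonsing_inv_mul _ ((Matrix.isUnit_iff_isUnit_det _).1 hB), Matrix.transpose_one,
    matVec_one]

theorem sesq_inv (w : CVec d) :
    sesq (B.transpose * B)⁻¹ w w = inner ℂ (matVec B⁻¹.transpose w) (matVec B⁻¹.transpose w) := by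
  rw [← sesq_transpose_mul, Matrix.transpose_transpose, Matrix.mul_inv_rev,
    Matrix.transpose_nonsing_inv]

theorem continuous_matVec (B : Matrix (Fin d) (Fin d) ℝ) : Continuous (matVec B) := by
  unfold matVec
  refine (PiLp.continuous_toLp 2 _).comp (continuous_pi fun i => ?_)
  fun_prop

/-- Multiplication by a real matrix as a continuous linear map. -/
noncomputable def matVecL (B : Matrix (Fin d) (Fin d) ℝ) : CVec d →L[ℂ] CVec d where
  toFun := matVec B
  map_add' := matVec_add
  map_smul' := matVec_smul
  cont := continuous_matVec B

@[simp] theorem matVecL_apply (w : CVec d) : matVecL B w = matVec B w := rfl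

end LinAlg

/-! ### Square integrable functions as elements of `L²` -/

section L2

variable {α E : Type*} [MeasurableSpace α] [NormedAddCommGroup E] {ν : Measure α}

/-- The class of `f` in `L²`, zero if `f` is not square integrable. -/
noncomputable def toL2 (ν : Measure α) (f : α → E) : Lp E 2 ν := if h : MemLp f 2 ν then h.toLp f else 0

theorem toL2_of_memLp {f : α → E} (h : MemLp f 2 ν) : toL2 ν f = h.toLp f := dif_pos h

theorem coeFn_toL2 {f : α → E} (h : MemLp f 2 ν) : toL2 ν f =ᵐ[ν] f := by
  rw [toL2_of_memLp h]; exact h.coeFn_toLp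

theorem toL2_congr {f g : α → E} (h : f =ᵐ[ν] g) : toL2 ν f = toL2 ν g := by
  by_cases hf : MemLp f 2 ν
  · rw [toL2_of_memLp hf, toL2_of_memLp ((memLp_congr_ae h).1 hf)]
    exact (MemLp.toLp_eq_toLp_iff _ _).2 h
  · rw [toL2, dif_neg hf, toL2, dif_neg fun hg => hf ((memLp_congr_ae h).2 hg)]

theorem toL2_add {f g : α → E} (hf : MemLp f 2 ν) (hg : MemLp g 2 ν) :
    toL2 ν (f + g) = toL2 ν f + toL2 ν g := by
  rw [toL2_of_memLp hf, toL2_of_memLp hg, toL2_of_memLp (hf.add hg), MemLp.toLp_add]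

theorem toL2_coeFn (f : Lp E 2 ν) : toL2 ν f = f := by
  rw [toL2_of_memLp (Lp.memLp f), Lp.toLp_coeFn]

variable [InnerProductSpace ℂ E]

theorem toL2_smul (c : ℂ) {f : α → E} (hf : MemLp f 2 ν) : toL2 ν (c • f) = c • toL2 ν f := by
  rw [toL2_of_memLp hf, toL2_of_memLp (hf.const_smul c), MemLp.toLp_const_smul]

theorem inner_toL2 {f g : α → E} (hf : MemLp f 2 ν) (hg : MemLp g 2 ν) :
    inner ℂ (toL2 ν f) (toL2 ν g) = ∫ x, inner ℂ (f x) (g x) ∂ν := by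
  rw [L2.inner_def]
  refine integral_congr_ae ?_
  filter_upwards [coeFn_toL2 hf, coeFn_toL2 hg] with x h1 h2
  rw [h1, h2]

theorem norm_toL2_sq {f : α → E} (hf : MemLp f 2 ν) : ‖toL2 ν f‖ ^ 2 = ∫ x, ‖f x‖ ^ 2 ∂ν := by
  have h := inner_toL2 hf hf
  rw [inner_self_eq_norm_sq_to_K] at h
  have h2 : ∫ x, inner ℂ (f x) (f x) ∂ν = ((∫ x, ‖f x‖ ^ 2 ∂ν : ℝ) : ℂ) := by
    rw [← integral_complex_ofReal]
    exact integral_congr_ae (Eventually.of_forall fun x => by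
      simp [inner_self_eq_norm_sq_to_K])
  rw [h2] at h
  apply Complex.ofReal_injective
  rw [← h]; norm_cast

theorem norm_integral_inner_le {f g : α → E} (hf : MemLp f 2 ν) (hg : MemLp g 2 ν) :
    ‖∫ x, inner ℂ (f x) (g x) ∂ν‖ ≤ √(∫ x, ‖f x‖ ^ 2 ∂ν) * √(∫ x, ‖g x‖ ^ 2 ∂ν) := by
  rw [← inner_toL2 hf hg, ← norm_toL2_sq hf, ← norm_toL2_sq hg, Real.sqrt_sq (norm_nonneg _),
    Real.sqrt_sq (norm_nonneg _)]
  exact norm_inner_le_norm _ _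

theorem integrable_inner_of_memLp {f g : α → E} (hf : MemLp f 2 ν) (hg : MemLp g 2 ν) :
    Integrable (fun x => inner ℂ (f x) (g x)) ν := by
  have := L2.integrable_inner (𝕜 := ℂ) (hf.toLp f) (hg.toLp g)
  refine this.congr ?_
  filter_upwards [hf.coeFn_toLp, hg.coeFn_toLp] with x h1 h2
  rw [h1, h2]

end L2

namespace HelmholtzData

variable (S : HelmholtzData d)

/-- An invertible `B` with `Bᵀ B` equal to the value of `A` on `P`. -/
noncomputable def rootP (P : Set (Vec d)) : Matrix (Fin d) (Fin d) ℝ :=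
  Classical.epsilon fun C => IsUnit C ∧ S.AP P = C.transpose * C

theorem rootP_spec {P : Set (Vec d)} (hP : P ∈ S.pieces) :
    IsUnit (S.rootP P) ∧ S.AP P = (S.rootP P).transpose * S.rootP P :=
  Classical.epsilon_spec (exists_transpose_mul_self (S.A_symm P hP) (S.A_pos P hP))

/-- An invertible `B` with `Bᵀ B = A`, equal to `rootP P` on each piece. -/
noncomputable def rootA (x : Vec d) : Matrix (Fin d) (Fin d) ℝ :=
  ∑ P ∈ S.pieces, P.indicator (fun _ => S.rootP P) x

theorem rootA_eq {P : Set (Vec d)} (hP : P ∈ S.pieces) {x : Vec d} (hx : x ∈ P) :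
    S.rootA x = S.rootP P :=
  sum_indicator_eq (A := id) S.piece_disjoint (fun P _ => S.rootP P) hP hx

end HelmholtzData

namespace Mesh

variable {S : HelmholtzData d} (M : Mesh S)

theorem ae_rootA_eq {K : Finset (Vec d)} (hK : K ∈ M.T) :
    ∀ᵐ x ∂volume.restrict (hull K), S.rootA x = S.rootP (M.pieceOf K) := by
  filter_upwards [M.ae_mem_pieceOf hK] with x hx using S.rootA_eq (M.pieceOf_spec hK).1 hx

theorem ae_A_eq_rootA {S : HelmholtzData d} (M : Mesh S) : ∀ᵐ x ∂volume.restrict S.Ω,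
    IsUnit (S.rootA x) ∧ S.A x = (S.rootA x).transpose * S.rootA x := by
  rw [M.ae_restrict_Ω_iff]
  intro K hK
  filter_upwards [M.ae_rootA_eq hK, M.ae_A_eq hK] with x h1 h2
  rw [h1, h2]
  exact S.rootP_spec (M.pieceOf_spec hK).1

/-- Multiplication by the root of `A` preserves square integrability. -/
theorem memLp_rootA {S : HelmholtzData d} (M : Mesh S) {g : Vec d → CVec d} (hg : MemLp g 2 (volume.restrict S.Ω)) :
    MemLp (fun x => matVec (S.rootA x) (g x)) 2 (volume.restrict S.Ω) := by
  rw [M.memLp_Ω_iff] at hg ⊢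
  intro K hK
  refine ((matVecL (S.rootP (M.pieceOf K))).comp_memLp' (hg K hK)).ae_eq ?_
  filter_upwards [M.ae_rootA_eq hK] with x hx
  simp [hx]

theorem memLp_A {S : HelmholtzData d} (M : Mesh S) {g : Vec d → CVec d} (hg : MemLp g 2 (volume.restrict S.Ω)) :
    MemLp (fun x => matVec (S.A x) (g x)) 2 (volume.restrict S.Ω) := by
  rw [M.memLp_Ω_iff] at hg ⊢
  intro K hK
  refine ((matVecL (S.AP (M.pieceOf K))).comp_memLp' (hg K hK)).ae_eq ?_
  filter_upwards [M.ae_A_eq hK] with x hx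
  simp [hx]

theorem memLp_of_rootA {S : HelmholtzData d} (M : Mesh S) {g : Vec d → CVec d}
    (hg : MemLp (fun x => matVec (S.rootA x) (g x)) 2 (volume.restrict S.Ω)) :
    MemLp g 2 (volume.restrict S.Ω) := by
  rw [M.memLp_Ω_iff] at hg ⊢
  intro K hK
  refine ((matVecL (S.rootP (M.pieceOf K))⁻¹).comp_memLp' (hg K hK)).ae_eq ?_
  filter_upwards [M.ae_rootA_eq hK] with x hx
  simp [hx, matVec_matVec, Matrix.nonsing_inv_mul _ ((Matrix.isUnit_iff_isUnit_det _).1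
    (S.rootP_spec (M.pieceOf_spec hK).1).1), matVec_one]

theorem memLp_ΓR_iff (hd : 1 ≤ d) {f : Vec d → ℂ} :
    MemLp f 2 ((surf d).restrict S.ΓR) ↔ ∀ F ∈ M.facesR, MemLp f 2 ((surf d).restrict (hull F)) := by
  rw [M.restrict_ΓR hd]
  constructor
  · exact fun h F hF => h.mono_measure
      (Finset.single_le_sum (f := fun K => (surf d).restrict (hull K)) (fun _ _ => Measure.zero_le _) hF)
  · intro h
    refine ⟨?_, ?_⟩
    · rw [← Measure.sum_coe_finset]
      exact AEStronglyMeasurable.sum_measure fun K => (h K K.2).1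
    · exact (eLpNorm_finset_sum_measure_le _ _ _).trans_lt
        (ENNReal.sum_lt_top.2 fun K hK => (h K hK).2)

theorem ae_μ_pos {S : HelmholtzData d} (M : Mesh S) : ∀ᵐ x ∂volume.restrict S.Ω, 0 < S.μ x := by
  rw [M.ae_restrict_Ω_iff]
  intro K hK
  filter_upwards [M.ae_μ_eq hK] with x hx
  rw [hx]; exact M.μK_pos hK

theorem ae_γ_pos {S : HelmholtzData d} (M : Mesh S) (hd : 1 ≤ d) : ∀ᵐ x ∂(surf d).restrict S.ΓR, 0 < S.γ x := by
  rw [M.ae_restrict_ΓR_iff hd]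
  intro F hF
  filter_upwards [M.ae_γ_eq hF] with x hx
  rw [hx]; exact M.γF_pos hF

/-- The coefficient is constant on each of finitely many elements, so an arbitrary function `c` of
it is harmless. It is applied with square roots and their inverses. -/
theorem memLp_μ {S : HelmholtzData d} (M : Mesh S) (c : ℝ → ℝ) {f : Vec d → ℂ} (hf : MemLp f 2 (volume.restrict S.Ω)) :
    MemLp (fun x => ((c (S.μ x) : ℝ) : ℂ) * f x) 2 (volume.restrict S.Ω) := by
  rw [M.memLp_Ω_iff] at hf ⊢
  intro K hK
  refine ((hf K hK).const_mul ((c (M.μK K) : ℝ) : ℂ)).ae_eq ?_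
  filter_upwards [M.ae_μ_eq hK] with x hx
  simp [hx]

theorem memLp_γ {S : HelmholtzData d} (M : Mesh S) (hd : 1 ≤ d) (c : ℝ → ℝ) {f : Vec d → ℂ}
    (hf : MemLp f 2 ((surf d).restrict S.ΓR)) :
    MemLp (fun x => ((c (S.γ x) : ℝ) : ℂ) * f x) 2 ((surf d).restrict S.ΓR) := by
  rw [M.memLp_ΓR_iff hd] at hf ⊢
  intro K hK
  refine ((hf K hK).const_mul ((c (M.γF K) : ℝ) : ℂ)).ae_eq ?_
  filter_upwards [M.ae_γ_eq hK] with x hx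
  simp [hx]

end Mesh

end IPDG

/-! ### Piecewise polynomials, jumps, the lifting and the discrete gradient. -/

namespace IPDG
open Measure Set
open scoped Classical
variable {d : ℕ}

namespace Mesh

/-! ### Polynomials -/

section Poly

variable {q r : MvPolynomial (Fin d) ℂ}

theorem evalP_add (q r : MvPolynomial (Fin d) ℂ) (x : Vec d) :
    evalP (q + r) x = evalP q x + evalP r x := by simp [evalP]

theorem evalP_smul (c : ℂ) (q : MvPolynomial (Fin d) ℂ) (x : Vec d) :
    evalP (c • q) x = c * evalP q x := by simp [evalP, MvPolynomial.smul_eval]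

theorem evalP_zero (x : Vec d) : evalP (0 : MvPolynomial (Fin d) ℂ) x = 0 := by simp [evalP]

theorem evalV_apply (q : Fin d → MvPolynomial (Fin d) ℂ) (x : Vec d) (i : Fin d) :
    evalV q x i = evalP (q i) x := rfl

/-- The polynomial with conjugate coefficients. -/
noncomputable def conjP (q : MvPolynomial (Fin d) ℂ) : MvPolynomial (Fin d) ℂ :=
  MvPolynomial.map (starRingEnd ℂ) q

theorem evalP_conjP (q : MvPolynomial (Fin d) ℂ) (x : Vec d) :
    evalP (conjP q) x = conj (evalP q x) := by
  rw [evalP, conjP, MvPolynomial.eval_map, evalP, MvPolynomial.eval, MvPolynomial.coe_eval₂Hom,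
    MvPolynomial.hom_eval₂]
  simp

theorem totalDegree_conjP_le (q : MvPolynomial (Fin d) ℂ) :
    (conjP q).totalDegree ≤ q.totalDegree := 
  Finset.sup_mono (MvPolynomial.support_map_subset _ _)

theorem continuous_evalP (q : MvPolynomial (Fin d) ℂ) : Continuous (evalP q) :=
  (contDiff_evalP q (n := 0)).continuous

theorem continuous_evalV (q : Fin d → MvPolynomial (Fin d) ℂ) : Continuous (evalV q) :=
  (PiLp.continuous_toLp 2 _).comp (continuous_pi fun i => continuous_evalP (q i))

/-- An open set contains a product of intervals, and a polynomial that vanishes on a product of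
infinite sets is zero. The real points suffice although the coefficients are complex. -/
theorem eq_zero_of_evalP_eq_zero {U : Set (Vec d)} (hU : IsOpen U) (hne : U.Nonempty)
    (h : ∀ x ∈ U, evalP q x = 0) : q = 0 := by
  obtain ⟨x0, hx0⟩ := hne
  have hV : IsOpen ((WithLp.toLp 2 : (Fin d → ℝ) → Vec d) ⁻¹' U) :=
    hU.preimage (PiLp.continuous_toLp 2 _)
  obtain ⟨δ, hδ, hsub⟩ := Metric.isOpen_iff.1 hV (fun i => x0 i) hx0
  refine MvPolynomial.funext_set (fun i => (fun t : ℝ => (t : ℂ)) '' Metric.ball (x0 i) δ) ?_ ?_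
  · intro i
    refine Set.Infinite.image Complex.ofReal_injective.injOn ?_
    rw [Real.ball_eq_Ioo]
    exact Ioo_infinite (by linarith)
  · intro y hy
    choose z hz hzy using fun i => hy i (mem_univ i)
    have hz' : z ∈ Metric.ball (fun i => x0 i) δ := by
      rw [ball_pi _ hδ]; exact fun i _ => hz i
    have := h _ (hsub hz')
    rw [evalP] at this
    rw [map_zero, ← this]
    congr 2
    ext i
    exact (hzy i).symm

end Poly

variable {S : HelmholtzData d} (M : Mesh S)

theorem eq_zero_of_ae_evalP {K : Finset (Vec d)} (hK : K ∈ M.T) {q : MvPolynomial (Fin d) ℂ}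
    (h : ∀ᵐ x ∂volume.restrict (hull K), evalP q x = 0) : q = 0 := by
  rw [← IsSimplex.restrict_interior] at h
  exact eq_zero_of_evalP_eq_zero isOpen_interior (M.isSimplex hK).interior_nonempty
    (Measure.eqOn_open_of_ae_eq h isOpen_interior (continuous_evalP q).continuousOn
      continuousOn_const)

theorem memLp_evalP (K : Finset (Vec d)) (q : MvPolynomial (Fin d) ℂ) (p : ℝ≥0∞) :
    MemLp (evalP q) p (volume.restrict (hull K)) :=
  memLp_of_continuous_of_isCompact (isCompact_hull K) (isCompact_hull K).measure_lt_top
    (continuous_evalP q) p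

theorem memLp_evalV (K : Finset (Vec d)) (q : Fin d → MvPolynomial (Fin d) ℂ) (p : ℝ≥0∞) :
    MemLp (evalV q) p (volume.restrict (hull K)) :=
  memLp_of_continuous_of_isCompact (isCompact_hull K) (isCompact_hull K).measure_lt_top
    (continuous_evalV q) p

/-! ### Jumps and averages -/

section Jump

variable {M}

theorem memLp_finset_sum_fun {α ι : Type*} [MeasurableSpace α] {ν : Measure α} (s : Finset ι)
    {f : ι → α → ℂ} {p : ℝ≥0∞} (h : ∀ i ∈ s, MemLp (f i) p ν) :
    MemLp (fun x => ∑ i ∈ s, f i x) p ν := memLp_finsetSum s h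

theorem Traced.memLp_jump {v : Vec d → ℂ} (hv : M.Traced v) {F : Finset (Vec d)}
    (hF : F ∈ facesOf M.T) : MemLp (M.jump v F) 2 ((surf d).restrict (hull F)) := by
  unfold jump
  split_ifs
  · refine memLp_finset_sum_fun _ fun K hK => ?_
    rw [mem_cells] at hK
    exact (hv.memLp_traceK hF hK.1 hK.2).mul_const _
  · exact hv.memLp_traceK hF (M.owner_spec hF).1 (M.owner_spec hF).2
  · exact MemLp.zero

theorem Traced.jump_add (hd : 1 ≤ d) {v w : Vec d → ℂ} (hv : M.Traced v) (hw : M.Traced w)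
    {F : Finset (Vec d)} (hF : F ∈ facesOf M.T) :
    M.jump (v + w) F =ᵐ[(surf d).restrict (hull F)] M.jump v F + M.jump w F := by
  have h : ∀ᵐ x ∂(surf d).restrict (hull F), ∀ K ∈ M.cells F,
      M.traceK K (v + w) x = M.traceK K v x + M.traceK K w x := by
    rw [Filter.eventually_all_finset]
    intro K hK
    rw [mem_cells] at hK
    exact hv.traceK_add hd hw hF hK.1 hK.2
  filter_upwards [h] with x hx
  have ho := hx _ ((M.mem_cells).2 (M.owner_spec hF))
  simp only [jump, Pi.add_apply, traceF]
  split_ifs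
  · rw [← Finset.sum_add_distrib]
    exact Finset.sum_congr rfl fun K hK => by rw [hx K hK, add_mul]
  · exact ho
  · simp

theorem Traced.jump_smul (hd : 1 ≤ d) (c : ℂ) {v : Vec d → ℂ} (hv : M.Traced v)
    {F : Finset (Vec d)} (hF : F ∈ facesOf M.T) :
    M.jump (c • v) F =ᵐ[(surf d).restrict (hull F)] c • M.jump v F := by
  have h : ∀ᵐ x ∂(surf d).restrict (hull F), ∀ K ∈ M.cells F,
      M.traceK K (c • v) x = c * M.traceK K v x := by
    rw [Filter.eventually_all_finset]
    intro K hK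
    rw [mem_cells] at hK
    exact hv.traceK_smul hd c hF hK.1 hK.2
  filter_upwards [h] with x hx
  have ho := hx _ ((M.mem_cells).2 (M.owner_spec hF))
  simp only [jump, Pi.smul_apply, traceF, smul_eq_mul]
  split_ifs
  · rw [Finset.mul_sum]
    exact Finset.sum_congr rfl fun K hK => by rw [hx K hK, mul_assoc]
  · exact ho
  · simp

/-- A conforming function has the same trace from each side of a face. -/
theorem traceK_ae_eq_skelTrace (hd : 1 ≤ d) {v τ : Vec d → ℂ} (hv : MemH1 S.Ω v)
    (hτ : M.SkelTrace v τ) {F K : Finset (Vec d)} (hF : F ∈ facesOf M.T) (hK : K ∈ M.T)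
    (hFK : F ⊆ K) : M.traceK K v =ᵐ[(surf d).restrict (hull F)] τ :=
  traceK_ae_eq hd hF hK hFK (M.memH1_hull hK hv) (SkelTrace.isTrace_hull M hτ hv hK)

/-- On an interior face the two traces agree and the normals are opposite; on a Dirichlet face the
trace is zero; on the other faces the jump is zero by definition. -/
theorem jump_conforming (hd : 1 ≤ d) {v : Vec d → ℂ} (hv : S.H1D v)
    {F : Finset (Vec d)} (hF : F ∈ facesOf M.T) :
    M.jump v F =ᵐ[(surf d).restrict (hull F)] 0 := by
  obtain ⟨τ, hτ, h0⟩ := M.exists_skelTrace hd hv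
  have h : ∀ᵐ x ∂(surf d).restrict (hull F), ∀ K ∈ M.cells F, M.traceK K v x = τ x := by
    rw [Filter.eventually_all_finset]
    intro K hK
    rw [mem_cells] at hK
    exact traceK_ae_eq_skelTrace hd hv.1 hτ hF hK.1 hK.2
  by_cases hI : F ∈ M.facesInt
  · filter_upwards [h] with x hx
    obtain ⟨K, K', hne, hc, hn⟩ := M.cells_of_mem_facesInt hd hI
    rw [hc] at hx
    simp only [jump, if_pos hI, hc, Finset.sum_pair hne, hn, inner_neg_left, Pi.zero_apply,
      hx K (by simp), hx K' (by simp)]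
    push_cast
    ring
  · by_cases hD : F ∈ M.facesD
    · have h1 := ae_imp_of_ae_restrict h0
      filter_upwards [h, M.ae_mem_ΓD hD, ae_restrict_of_ae h1] with x hx h2 h3
      simp only [jump, if_neg hI, if_pos hD, traceF, Pi.zero_apply]
      rw [hx _ ((M.mem_cells).2 (M.owner_spec hF)), h3 h2]
    · refine Eventually.of_forall fun x => ?_
      simp [jump, hI, hD]

variable (M)

/-- The normal component of the average. -/
noncomputable def avgN (w : PolyVec d) (F : Finset (Vec d)) (x : Vec d) : ℂ :=
  ∑ i, M.avg w F x i * ((M.nF F i : ℝ) : ℂ)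

theorem avg_apply (w : PolyVec d) (F : Finset (Vec d)) (x : Vec d) (i : Fin d) :
    M.avg w F x i = if F ∈ M.facesInt then (1 / 2 : ℂ) * ∑ K ∈ M.cells F, evalP (w K i) x
      else evalP (w (M.owner F) i) x := by
  unfold avg
  split_ifs
  · simp [evalV_apply]
  · rfl

theorem avgN_congr {w w' : PolyVec d} (h : ∀ K ∈ M.T, w K = w' K) {F : Finset (Vec d)}
    (hF : F ∈ facesOf M.T) (x : Vec d) : M.avgN w F x = M.avgN w' F x := by
  refine Finset.sum_congr rfl fun i _ => ?_
  rw [avg_apply, avg_apply, h _ (M.owner_spec hF).1]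
  congr 3
  exact Finset.sum_congr rfl fun K hK => by rw [h K (M.mem_cells.1 hK).1]

theorem avgN_add (w w' : PolyVec d) (F : Finset (Vec d)) (x : Vec d) :
    M.avgN (w + w') F x = M.avgN w F x + M.avgN w' F x := by
  rw [avgN, avgN, avgN, ← Finset.sum_add_distrib]
  refine Finset.sum_congr rfl fun i _ => ?_
  simp only [avg_apply, Pi.add_apply, evalP_add, Finset.sum_add_distrib]
  split_ifs <;> ring

theorem avgN_smul (c : ℂ) (w : PolyVec d) (F : Finset (Vec d)) (x : Vec d) :
    M.avgN (c • w) F x = c * M.avgN w F x := by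
  rw [avgN, avgN, Finset.mul_sum]
  refine Finset.sum_congr rfl fun i _ => ?_
  simp only [avg_apply, Pi.smul_apply, evalP_smul, ← Finset.mul_sum]
  split_ifs <;> ring

theorem avgN_conjP (w : PolyVec d) (F : Finset (Vec d)) (x : Vec d) :
    M.avgN (fun K i => conjP (w K i)) F x = conj (M.avgN w F x) := by
  simp only [avgN, _root_.map_sum, map_mul, Complex.conj_ofReal]
  refine Finset.sum_congr rfl fun i _ => ?_
  rw [avg_apply, avg_apply]
  split_ifs <;> simp [evalP_conjP, map_ofNat]

theorem continuous_avgN (w : PolyVec d) (F : Finset (Vec d)) : Continuous (M.avgN w F) := by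
  refine continuous_finsetSum _ fun i _ => Continuous.mul ?_ continuous_const
  simp only [avg_apply]
  split_ifs
  · exact continuous_const.mul (continuous_finsetSum _ fun K _ => continuous_evalP _)
  · exact continuous_evalP _

theorem memLp_avgN (hd : 1 ≤ d) (w : PolyVec d) {F : Finset (Vec d)} (hF : F ∈ facesOf M.T) :
    MemLp (M.avgN w F) 2 ((surf d).restrict (hull F)) :=
  memLp_of_continuous_of_isCompact (isCompact_hull F) (M.surf_face_lt_top hd hF)
    (M.continuous_avgN w F) 2

end Jump

/-! ### The lifting -/

/-- Extension by zero of a family of polynomial fields on the elements. -/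
noncomputable def extP {p : ℕ}
    (w : M.T → Fin d → MvPolynomial.restrictTotalDegree (Fin d) ℂ p) : PolyVec d :=
  fun K i => if h : K ∈ M.T then (w ⟨K, h⟩ i : MvPolynomial (Fin d) ℂ) else 0

theorem extP_mem {p : ℕ} (w : M.T → Fin d → MvPolynomial.restrictTotalDegree (Fin d) ℂ p)
    (K : M.T) (i : Fin d) : M.extP w K i = w K i := by simp [extP]

theorem isPolyVec_extP {p : ℕ} (w : M.T → Fin d → MvPolynomial.restrictTotalDegree (Fin d) ℂ p) :
    M.IsPolyVec p (M.extP w) := by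
  intro K hK i
  rw [M.extP_mem w ⟨K, hK⟩]
  exact (MvPolynomial.mem_restrictTotalDegree _ _ _).1 (w ⟨K, hK⟩ i).2

theorem extP_add {p : ℕ} (w w' : M.T → Fin d → MvPolynomial.restrictTotalDegree (Fin d) ℂ p) :
    M.extP (w + w') = M.extP w + M.extP w' := by
  ext1 K; ext1 i
  by_cases h : K ∈ M.T <;> simp [extP, h]

theorem extP_smul {p : ℕ} (c : ℂ)
    (w : M.T → Fin d → MvPolynomial.restrictTotalDegree (Fin d) ℂ p) :
    M.extP (c • w) = c • M.extP w := by
  ext1 K; ext1 i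
  by_cases h : K ∈ M.T <;> simp [extP, h]

/-- The product of polynomial fields, without conjugation. -/
noncomputable def polyForm (L w : PolyVec d) : ℂ :=
  ∑ K ∈ M.T, ∑ i, ∫ x in hull K, evalP (L K i) x * evalP (w K i) x

theorem integrable_evalP_mul (K : Finset (Vec d)) (q r : MvPolynomial (Fin d) ℂ) :
    Integrable (fun x => evalP q x * evalP r x) (volume.restrict (hull K)) :=
  integrable_mul_of_memLp (memLp_evalP K q 2) (memLp_evalP K r 2)

theorem polyForm_comm (L w : PolyVec d) : M.polyForm L w = M.polyForm w L := by
  simp only [polyForm, mul_comm]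

theorem polyForm_add (L w w' : PolyVec d) :
    M.polyForm L (w + w') = M.polyForm L w + M.polyForm L w' := by
  simp only [polyForm, ← Finset.sum_add_distrib]
  refine Finset.sum_congr rfl fun K _ => Finset.sum_congr rfl fun i _ => ?_
  rw [← integral_add (integrable_evalP_mul _ _ _) (integrable_evalP_mul _ _ _)]
  simp only [Pi.add_apply, evalP_add, mul_add]

theorem polyForm_smul (c : ℂ) (L w : PolyVec d) :
    M.polyForm L (c • w) = c * M.polyForm L w := by
  simp only [polyForm, Finset.mul_sum]
  refine Finset.sum_congr rfl fun K _ => Finset.sum_congr rfl fun i _ => ?_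
  rw [← integral_const_mul]
  simp only [Pi.smul_apply, evalP_smul]
  exact integral_congr_ae (Eventually.of_forall fun x => by ring)

theorem polyForm_conjP (L w : PolyVec d) :
    M.polyForm L (fun K i => conjP (w K i))
      = ∑ K ∈ M.T, ∫ x in hull K, ∑ i, evalV (L K) x i * conj (evalV (w K) x i) := by
  refine Finset.sum_congr rfl fun K _ => ?_
  rw [integral_finsetSum]
  · simp only [evalP_conjP, evalV_apply]
  · intro i _
    simp only [evalV_apply, ← evalP_conjP]
    exact integrable_evalP_mul _ _ _

/-- Paired with its own conjugate, `L` yields the sum of the squared `L²` norms of its components,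
and an element has nonempty interior. -/
theorem eq_zero_of_polyForm_self {L : PolyVec d}
    (h : M.polyForm L (fun K i => conjP (L K i)) = 0) {K : Finset (Vec d)} (hK : K ∈ M.T)
    (i : Fin d) : L K i = 0 := by
  have e : ∀ K i, ∫ x in hull K, evalP (L K i) x * evalP (conjP (L K i)) x
      = ((∫ x in hull K, ‖evalP (L K i) x‖ ^ 2 : ℝ) : ℂ) := by
    intro K i
    rw [← integral_complex_ofReal]
    refine integral_congr_ae (Eventually.of_forall fun x => ?_)
    simp only [evalP_conjP, Complex.mul_conj, Complex.normSq_eq_norm_sq]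
  simp only [polyForm, e] at h
  norm_cast at h
  have h0 : ∀ K i, 0 ≤ ∫ x in hull K, ‖evalP (L K i) x‖ ^ 2 := fun K i =>
    integral_nonneg fun x => by positivity
  rw [Finset.sum_eq_zero_iff_of_nonneg fun K _ => Finset.sum_nonneg fun i _ => h0 K i] at h
  have h1 := (Finset.sum_eq_zero_iff_of_nonneg fun i _ => h0 K i).1 (h K hK) i (Finset.mem_univ i)
  rw [integral_eq_zero_iff_of_nonneg (fun x => by positivity) (memLp_evalP K _ 2).norm.integrable_sq]
    at h1
  refine M.eq_zero_of_ae_evalP hK ?_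
  filter_upwards [h1] with x hx
  simpa using hx

/-- The right-hand side of the problem defining the lifting, without conjugation. -/
noncomputable def jumpForm (v : Vec d → ℂ) (w : PolyVec d) : ℂ :=
  ∑ F ∈ facesOf M.T, ∫ x in hull F, M.jump v F x * M.avgN w F x ∂(surf d)

variable {M}

theorem Traced.integrable_jump_mul (hd : 1 ≤ d) {v : Vec d → ℂ} (hv : M.Traced v) (w : PolyVec d)
    {F : Finset (Vec d)} (hF : F ∈ facesOf M.T) :
    Integrable (fun x => M.jump v F x * M.avgN w F x) ((surf d).restrict (hull F)) :=
  integrable_mul_of_memLp (hv.memLp_jump hF) (M.memLp_avgN hd w hF)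

theorem Traced.jumpForm_add (hd : 1 ≤ d) {v : Vec d → ℂ} (hv : M.Traced v) (w w' : PolyVec d) :
    M.jumpForm v (w + w') = M.jumpForm v w + M.jumpForm v w' := by
  simp only [jumpForm, ← Finset.sum_add_distrib]
  refine Finset.sum_congr rfl fun F hF => ?_
  rw [← integral_add (hv.integrable_jump_mul hd w hF) (hv.integrable_jump_mul hd w' hF)]
  simp only [avgN_add, mul_add]

variable (M) in
theorem jumpForm_smul (v : Vec d → ℂ) (c : ℂ) (w : PolyVec d) :
    M.jumpForm v (c • w) = c * M.jumpForm v w := by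
  simp only [jumpForm, Finset.mul_sum]
  refine Finset.sum_congr rfl fun F hF => ?_
  rw [← integral_const_mul]
  exact integral_congr_ae (Eventually.of_forall fun x => by simp only [avgN_smul]; ring)

variable (M) in
-- Moving the conjugation into the test polynomials turns the sesquilinear problem into a bilinear
-- one, to which duality of finite-dimensional spaces applies directly.
theorem isLifting_iff {p : ℕ} {v : Vec d → ℂ} {L : PolyVec d} :
    M.IsLifting p v L ↔ M.IsPolyVec p L ∧ ∀ w, M.IsPolyVec p w →
      M.polyForm L (fun K i => conjP (w K i)) = M.jumpForm v (fun K i => conjP (w K i)) := by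
  simp only [polyForm_conjP, jumpForm, avgN_conjP]
  rfl

theorem isPolyVec_conjP {p : ℕ} {w : PolyVec d} (h : M.IsPolyVec p w) :
    M.IsPolyVec p (fun K i => conjP (w K i)) :=
  fun K hK i => (totalDegree_conjP_le _).trans (h K hK i)

/-- The `L²` pairing on piecewise polynomials of bounded degree is nondegenerate, so the induced map
into the dual space is injective and, by equality of dimensions, surjective. The jump functional
then has a preimage. -/
theorem Traced.exists_isLifting (hd : 1 ≤ d) (p : ℕ) {v : Vec d → ℂ} (hv : M.Traced v) :
    ∃ L, M.IsLifting p v L := by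
  let V := M.T → Fin d → MvPolynomial.restrictTotalDegree (Fin d) ℂ p
  let Φ : V →ₗ[ℂ] V →ₗ[ℂ] ℂ := LinearMap.mk₂ ℂ (fun L w => M.polyForm (M.extP L) (M.extP w))
    (fun L L' w => by
      rw [extP_add, polyForm_comm, polyForm_add, polyForm_comm, M.polyForm_comm (M.extP w)])
    (fun c L w => by
      rw [extP_smul, polyForm_comm, polyForm_smul, polyForm_comm]; rfl)
    (fun L w w' => by rw [extP_add, polyForm_add])
    (fun c L w => by rw [extP_smul, polyForm_smul]; rfl)
  let ℓ : V →ₗ[ℂ] ℂ :=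
    { toFun := fun w => M.jumpForm v (M.extP w)
      map_add' := fun w w' => by rw [extP_add, hv.jumpForm_add hd]
      map_smul' := fun c w => by rw [extP_smul, jumpForm_smul]; rfl }
  have toV : ∀ w : PolyVec d, M.IsPolyVec p w → ∃ w' : V, ∀ K ∈ M.T, M.extP w' K = w K := by
    intro w hw
    refine ⟨fun K i => ⟨w K i, (MvPolynomial.mem_restrictTotalDegree _ _ _).2 (hw K K.2 i)⟩, ?_⟩
    intro K hK
    ext1 i
    rw [M.extP_mem _ ⟨K, hK⟩]
  have hinj : Function.Injective Φ := by
    rw [← LinearMap.ker_eq_bot, LinearMap.ker_eq_bot']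
    intro L hL
    obtain ⟨w', hw'⟩ := toV _ (isPolyVec_conjP (M.isPolyVec_extP L))
    have h1 : M.polyForm (M.extP L) (M.extP w') = 0 := by
      change Φ L w' = 0
      rw [hL]; rfl
    have h2 : M.polyForm (M.extP L) (fun K i => conjP (M.extP L K i)) = 0 := by
      rw [← h1]
      exact Finset.sum_congr rfl fun K hK => by rw [hw' K hK]
    ext1 K; ext1 i
    have := M.eq_zero_of_polyForm_self h2 K.2 i
    rw [M.extP_mem] at this
    exact Subtype.ext this
  have hsurj : Function.Surjective Φ :=
    (LinearMap.injective_iff_surjective_of_finrank_eq_finrank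
      (Subspace.dual_finrank_eq (K := ℂ) (V := V)).symm).1 hinj
  obtain ⟨L, hL⟩ := hsurj ℓ
  refine ⟨M.extP L, (M.isLifting_iff).2 ⟨M.isPolyVec_extP L, fun w hw => ?_⟩⟩
  obtain ⟨w', hw'⟩ := toV _ (isPolyVec_conjP hw)
  have h1 : M.polyForm (M.extP L) (M.extP w') = M.jumpForm v (M.extP w') := by
    change Φ L w' = ℓ w'
    rw [hL]
  convert h1 using 1
  · exact Finset.sum_congr rfl fun K hK => by rw [hw' K hK]
  · refine Finset.sum_congr rfl fun F hF => integral_congr_ae (Eventually.of_forall fun x => ?_)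
    simp only
    rw [M.avgN_congr (fun K hK => (hw' K hK).symm) hF]

theorem Traced.lift_spec (hd : 1 ≤ d) (p : ℕ) {v : Vec d → ℂ} (hv : M.Traced v) :
    M.IsLifting p v (M.lift p v) :=
  Classical.epsilon_spec (hv.exists_isLifting hd p)

/-- The difference of the two liftings, tested with itself, has norm zero. Linearity of the lifting
and its vanishing on conforming functions both follow from this uniqueness. -/
theorem IsLifting.unique {p : ℕ} {v v' : Vec d → ℂ} {L L' : PolyVec d}
    (h : M.IsLifting p v L) (h' : M.IsLifting p v' L')
    (hj : ∀ F ∈ facesOf M.T, M.jump v F =ᵐ[(surf d).restrict (hull F)] M.jump v' F)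
    {K : Finset (Vec d)} (hK : K ∈ M.T) (i : Fin d) : L K i = L' K i := by
  rw [isLifting_iff] at h h'
  have hD : M.IsPolyVec p (L + (-1 : ℂ) • L') := fun K hK i =>
    (MvPolynomial.mem_restrictTotalDegree _ _ _).1 (Submodule.add_mem _
      ((MvPolynomial.mem_restrictTotalDegree _ _ _).2 (h.1 K hK i))
      (Submodule.smul_mem _ _ ((MvPolynomial.mem_restrictTotalDegree _ _ _).2 (h'.1 K hK i))))
  have e : M.polyForm (L + (-1 : ℂ) • L') (fun K i => conjP ((L + (-1 : ℂ) • L') K i)) = 0 := by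
    rw [polyForm_comm, polyForm_add, polyForm_smul, polyForm_comm, h.2 _ hD, polyForm_comm,
      h'.2 _ hD]
    have : M.jumpForm v (fun K i => conjP ((L + (-1 : ℂ) • L') K i))
        = M.jumpForm v' (fun K i => conjP ((L + (-1 : ℂ) • L') K i)) := by
      refine Finset.sum_congr rfl fun F hF => integral_congr_ae ?_
      filter_upwards [hj F hF] with x hx
      rw [hx]
    rw [this]; ring
  have := M.eq_zero_of_polyForm_self e hK i
  simpa [← sub_eq_add_neg, sub_eq_zero] using this

theorem Traced.lift_add (hd : 1 ≤ d) (p : ℕ) {v w : Vec d → ℂ} (hv : M.Traced v)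
    (hw : M.Traced w) {K : Finset (Vec d)} (hK : K ∈ M.T) (i : Fin d) :
    M.lift p (v + w) K i = M.lift p v K i + M.lift p w K i := by
  refine IsLifting.unique ((hv.add hw).lift_spec hd p) (v' := v + w)
    (L' := M.lift p v + M.lift p w) ?_ (fun _ _ => ae_eq_refl _) hK i
  have h1 := M.isLifting_iff.1 (hv.lift_spec hd p)
  have h2 := M.isLifting_iff.1 (hw.lift_spec hd p)
  refine M.isLifting_iff.2 ⟨fun K hK i => ?_, fun z hz => ?_⟩
  · exact (MvPolynomial.mem_restrictTotalDegree _ _ _).1 (Submodule.add_mem _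
      ((MvPolynomial.mem_restrictTotalDegree _ _ _).2 (h1.1 K hK i))
      ((MvPolynomial.mem_restrictTotalDegree _ _ _).2 (h2.1 K hK i)))
  · rw [polyForm_comm, polyForm_add, polyForm_comm, h1.2 z hz, polyForm_comm, h2.2 z hz, jumpForm,
      jumpForm, jumpForm, ← Finset.sum_add_distrib]
    refine Finset.sum_congr rfl fun F hF => ?_
    rw [← integral_add (hv.integrable_jump_mul hd _ hF) (hw.integrable_jump_mul hd _ hF)]
    refine integral_congr_ae ?_
    filter_upwards [hv.jump_add hd hw hF] with x hx
    rw [hx, Pi.add_apply, add_mul]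

theorem Traced.lift_smul (hd : 1 ≤ d) (p : ℕ) (c : ℂ) {v : Vec d → ℂ} (hv : M.Traced v)
    {K : Finset (Vec d)} (hK : K ∈ M.T) (i : Fin d) :
    M.lift p (c • v) K i = c • M.lift p v K i := by
  refine IsLifting.unique ((hv.smul c).lift_spec hd p) (v' := c • v)
    (L' := c • M.lift p v) ?_ (fun _ _ => ae_eq_refl _) hK i
  have h1 := M.isLifting_iff.1 (hv.lift_spec hd p)
  refine M.isLifting_iff.2 ⟨fun K hK i => ?_, fun z hz => ?_⟩
  · exact (MvPolynomial.mem_restrictTotalDegree _ _ _).1 (Submodule.smul_mem _ _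
      ((MvPolynomial.mem_restrictTotalDegree _ _ _).2 (h1.1 K hK i)))
  · rw [polyForm_comm, polyForm_smul, polyForm_comm, h1.2 z hz, jumpForm,
      jumpForm, Finset.mul_sum]
    refine Finset.sum_congr rfl fun F hF => ?_
    rw [← integral_const_mul]
    refine integral_congr_ae ?_
    filter_upwards [hv.jump_smul hd c hF] with x hx
    rw [hx, Pi.smul_apply, smul_eq_mul, mul_assoc]

theorem lift_conforming (hd : 1 ≤ d) (p : ℕ) {v : Vec d → ℂ} (hv : S.H1D v)
    {K : Finset (Vec d)} (hK : K ∈ M.T) (i : Fin d) : M.lift p v K i = 0 := by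
  refine IsLifting.unique ((M.traced_of_H1D hd hv).lift_spec hd p) (v' := v)
    (L' := 0) ?_ (fun _ _ => ae_eq_refl _) hK i
  refine M.isLifting_iff.2 ⟨fun K hK i => by simp, fun z hz => ?_⟩
  rw [polyForm, jumpForm, Finset.sum_eq_zero, Finset.sum_eq_zero]
  · intro F hF
    refine integral_eq_zero_of_ae ?_
    filter_upwards [jump_conforming hd hv hF] with x hx
    rw [hx]; simp
  · intro K _
    simp [evalP_zero]

/-! ### The discrete gradient -/

theorem Traced.memLp_dgrad {v : Vec d → ℂ} (p : ℕ) (hv : M.Traced v)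
    {K : Finset (Vec d)} (hK : K ∈ M.T) : MemLp (M.dgrad p K v) 2 (volume.restrict (hull K)) :=
  (hv.memLp_weakGrad hK).sub (memLp_evalV K _ 2)

theorem Traced.dgrad_add (hd : 1 ≤ d) (p : ℕ) {v w : Vec d → ℂ} (hv : M.Traced v)
    (hw : M.Traced w) {K : Finset (Vec d)} (hK : K ∈ M.T) :
    M.dgrad p K (v + w) =ᵐ[volume.restrict (hull K)] M.dgrad p K v + M.dgrad p K w := by
  filter_upwards [hv.weakGrad_add hw hK] with x hx
  have : evalV (M.lift p (v + w) K) x = evalV (M.lift p v K) x + evalV (M.lift p w K) x := by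
    ext i
    simp only [PiLp.add_apply, evalV_apply, hv.lift_add hd p hw hK i, evalP_add]
  simp only [dgrad, Pi.add_apply, hx, this]
  abel

theorem Traced.dgrad_smul (hd : 1 ≤ d) (p : ℕ) (c : ℂ) {v : Vec d → ℂ} (hv : M.Traced v)
    {K : Finset (Vec d)} (hK : K ∈ M.T) :
    M.dgrad p K (c • v) =ᵐ[volume.restrict (hull K)] c • M.dgrad p K v := by
  filter_upwards [hv.weakGrad_smul c hK] with x hx
  have : evalV (M.lift p (c • v) K) x = c • evalV (M.lift p v K) x := by
    ext i
    simp only [PiLp.smul_apply, evalV_apply, hv.lift_smul hd p c hK i, evalP_smul, smul_eq_mul]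
  simp only [dgrad, Pi.smul_apply, hx, this, smul_sub]

theorem dgrad_conforming (hd : 1 ≤ d) (p : ℕ) {v : Vec d → ℂ} (hv : S.H1D v)
    {K : Finset (Vec d)} (hK : K ∈ M.T) :
    M.dgrad p K v =ᵐ[volume.restrict (hull K)] weakGrad S.Ω v := by
  filter_upwards [M.weakGrad_hull_ae_eq hK hv.1] with x hx
  have : evalV (M.lift p v K) x = 0 := by
    ext i
    simp only [evalV_apply, lift_conforming hd p hv hK i, evalP_zero]; rfl
  simp only [dgrad, hx, this, sub_zero]

end Mesh

end IPDG

/-! ### The Hilbert space of the broken energy norm. -/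

namespace IPDG
open Measure Set
open scoped Classical
variable {d : ℕ}

namespace HelmholtzData

variable (S : HelmholtzData d)

/-- The class of `ω √μ v` in `L²(Ω)`. -/
noncomputable def massL2 (v : Vec d → ℂ) : Lp ℂ 2 (volume.restrict S.Ω) :=
  toL2 _ fun x => ((S.ω * √(S.μ x) : ℝ) : ℂ) * v x

/-- The class of `√(ω γ) t` in `L²(ΓR)`. -/
noncomputable def robinL2 (t : Vec d → ℂ) : Lp ℂ 2 ((surf d).restrict S.ΓR) :=
  toL2 _ fun x => ((√(S.ω * S.γ x) : ℝ) : ℂ) * t x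

/-- The class of `B w` in `L²(Ω)`, where `Bᵀ B = A`. -/
noncomputable def gradL2 (w : Vec d → CVec d) : Lp (CVec d) 2 (volume.restrict S.Ω) :=
  toL2 _ fun x => matVec (S.rootA x) (w x)

end HelmholtzData

namespace Mesh

section Weights

variable {S : HelmholtzData d} (M : Mesh S) {v w : Vec d → ℂ} {g h : Vec d → CVec d}

theorem massL2_add {S : HelmholtzData d} (M : Mesh S) {v w : Vec d → ℂ}
    (hv : MemLp v 2 (volume.restrict S.Ω)) (hw : MemLp w 2 (volume.restrict S.Ω)) :
    S.massL2 (v + w) = S.massL2 v + S.massL2 w := by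
  rw [HelmholtzData.massL2, HelmholtzData.massL2, HelmholtzData.massL2,
    ← toL2_add (M.memLp_μ (fun m => S.ω * √m) hv) (M.memLp_μ (fun m => S.ω * √m) hw)]
  congr 1
  ext x
  simp [mul_add]

theorem massL2_smul {S : HelmholtzData d} (M : Mesh S) (c : ℂ) {v : Vec d → ℂ}
    (hv : MemLp v 2 (volume.restrict S.Ω)) : S.massL2 (c • v) = c • S.massL2 v := by
  rw [HelmholtzData.massL2, HelmholtzData.massL2,
    ← toL2_smul c (M.memLp_μ (fun m => S.ω * √m) hv)]
  congr 1
  ext x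
  simp only [Pi.smul_apply, smul_eq_mul]
  ring

theorem inner_massL2 {S : HelmholtzData d} (M : Mesh S) {v w : Vec d → ℂ}
    (hv : MemLp v 2 (volume.restrict S.Ω)) (hw : MemLp w 2 (volume.restrict S.Ω)) :
    inner ℂ (S.massL2 v) (S.massL2 w) = (S.ω : ℂ) ^ 2 * S.ipμ w v := by
  rw [HelmholtzData.massL2, HelmholtzData.massL2,
    inner_toL2 (M.memLp_μ (fun m => S.ω * √m) hv) (M.memLp_μ (fun m => S.ω * √m) hw),
    HelmholtzData.ipμ, ← integral_const_mul]
  refine integral_congr_ae ?_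
  filter_upwards [M.ae_μ_pos] with x hx
  simp only [RCLike.inner_apply, map_mul, Complex.conj_ofReal, Complex.ofReal_mul]
  have : ((√(S.μ x) : ℝ) : ℂ) * ((√(S.μ x) : ℝ) : ℂ) = S.μ x := by
    rw [← Complex.ofReal_mul, Real.mul_self_sqrt hx.le]
  linear_combination (S.ω : ℂ) ^ 2 * w x * conj (v x) * this

theorem robinL2_add {S : HelmholtzData d} (M : Mesh S) (hd : 1 ≤ d) {v w : Vec d → ℂ}
    (hv : MemLp v 2 ((surf d).restrict S.ΓR)) (hw : MemLp w 2 ((surf d).restrict S.ΓR)) :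
    S.robinL2 (v + w) = S.robinL2 v + S.robinL2 w := by
  rw [HelmholtzData.robinL2, HelmholtzData.robinL2, HelmholtzData.robinL2,
    ← toL2_add (M.memLp_γ hd (fun m => √(S.ω * m)) hv) (M.memLp_γ hd (fun m => √(S.ω * m)) hw)]
  congr 1
  ext x
  simp [mul_add]

theorem robinL2_smul {S : HelmholtzData d} (M : Mesh S) (hd : 1 ≤ d) (c : ℂ) {v : Vec d → ℂ}
    (hv : MemLp v 2 ((surf d).restrict S.ΓR)) : S.robinL2 (c • v) = c • S.robinL2 v := by
  rw [HelmholtzData.robinL2, HelmholtzData.robinL2,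
    ← toL2_smul c (M.memLp_γ hd (fun m => √(S.ω * m)) hv)]
  congr 1
  ext x
  simp only [Pi.smul_apply, smul_eq_mul]
  ring

theorem inner_robinL2 {S : HelmholtzData d} (M : Mesh S) (hd : 1 ≤ d) {v w : Vec d → ℂ}
    (hv : MemLp v 2 ((surf d).restrict S.ΓR)) (hw : MemLp w 2 ((surf d).restrict S.ΓR)) :
    inner ℂ (S.robinL2 v) (S.robinL2 w) = (S.ω : ℂ) * S.ipγ w v := by
  rw [HelmholtzData.robinL2, HelmholtzData.robinL2,
    inner_toL2 (M.memLp_γ hd (fun m => √(S.ω * m)) hv) (M.memLp_γ hd (fun m => √(S.ω * m)) hw),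
    HelmholtzData.ipγ, ← integral_const_mul]
  refine integral_congr_ae ?_
  filter_upwards [M.ae_γ_pos hd] with x hx
  simp only [RCLike.inner_apply, map_mul, Complex.conj_ofReal]
  have : ((√(S.ω * S.γ x) : ℝ) : ℂ) * ((√(S.ω * S.γ x) : ℝ) : ℂ) = S.ω * S.γ x := by
    rw [← Complex.ofReal_mul, Real.mul_self_sqrt (mul_pos S.ω_pos hx).le, Complex.ofReal_mul]
  linear_combination w x * conj (v x) * this

theorem robinL2_congr (h : v =ᵐ[(surf d).restrict S.ΓR] w) : S.robinL2 v = S.robinL2 w :=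
  toL2_congr (h.mono fun x hx => by simp only [hx])

theorem gradL2_congr (hgh : g =ᵐ[volume.restrict S.Ω] h) : S.gradL2 g = S.gradL2 h :=
  toL2_congr (hgh.mono fun x hx => by simp only [hx])

theorem gradL2_add {S : HelmholtzData d} (M : Mesh S) {g h : Vec d → CVec d}
    (hg : MemLp g 2 (volume.restrict S.Ω)) (hh : MemLp h 2 (volume.restrict S.Ω)) :
    S.gradL2 (g + h) = S.gradL2 g + S.gradL2 h := by
  rw [HelmholtzData.gradL2, HelmholtzData.gradL2, HelmholtzData.gradL2,
    ← toL2_add (M.memLp_rootA hg) (M.memLp_rootA hh)]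
  congr 1
  ext1 x
  simp [matVec_add]

theorem gradL2_smul {S : HelmholtzData d} (M : Mesh S) (c : ℂ) {g : Vec d → CVec d}
    (hg : MemLp g 2 (volume.restrict S.Ω)) : S.gradL2 (c • g) = c • S.gradL2 g := by
  rw [HelmholtzData.gradL2, HelmholtzData.gradL2, ← toL2_smul c (M.memLp_rootA hg)]
  congr 1
  ext1 x
  simp [matVec_smul]

theorem sesq_A_eq {S : HelmholtzData d} (M : Mesh S) (g h : Vec d → CVec d) :
    ∀ᵐ x ∂volume.restrict S.Ω, sesq (S.A x) (g x) (h x)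
      = inner ℂ (matVec (S.rootA x) (h x)) (matVec (S.rootA x) (g x)) := by
  filter_upwards [M.ae_A_eq_rootA] with _ hx
  rw [hx.2, sesq_transpose_mul]

theorem inner_gradL2 {S : HelmholtzData d} (M : Mesh S) {g h : Vec d → CVec d}
    (hg : MemLp g 2 (volume.restrict S.Ω)) (hh : MemLp h 2 (volume.restrict S.Ω)) :
    inner ℂ (S.gradL2 g) (S.gradL2 h) = S.ipA h g := by
  rw [HelmholtzData.gradL2, HelmholtzData.gradL2,
    inner_toL2 (M.memLp_rootA hg) (M.memLp_rootA hh), HelmholtzData.ipA]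
  exact integral_congr_ae ((M.sesq_A_eq h g).mono fun x hx => hx.symm)

theorem integrable_sesq {S : HelmholtzData d} (M : Mesh S) {g h : Vec d → CVec d}
    (hg : MemLp g 2 (volume.restrict S.Ω)) (hh : MemLp h 2 (volume.restrict S.Ω)) :
    Integrable (fun x => sesq (S.A x) (h x) (g x)) (volume.restrict S.Ω) :=
  (integrable_inner_of_memLp (M.memLp_rootA hg) (M.memLp_rootA hh)).congr
    ((M.sesq_A_eq h g).mono fun _ hx => hx.symm)

/-! ### Two-sided bounds for the weights -/

theorem exists_le_of_forall_cell {S : HelmholtzData d} (M : Mesh S) {X : Type*} (f g : Vec d → X → ℝ)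
    (hg : ∀ x w, 0 ≤ g x w)
    (h : ∀ K ∈ M.T, ∃ C : ℝ, ∀ᵐ x ∂volume.restrict (hull K), ∀ w, f x w ≤ C * g x w) :
    ∃ C : ℝ, ∀ᵐ x ∂volume.restrict S.Ω, ∀ w, f x w ≤ C * g x w := by
  choose! C hC using h
  refine ⟨∑ K ∈ M.T, |C K|, ?_⟩
  rw [M.ae_restrict_Ω_iff]
  intro K hK
  filter_upwards [hC K hK] with x hx w
  refine (hx w).trans (mul_le_mul_of_nonneg_right ?_ (hg x w))
  exact (le_abs_self _).trans (Finset.single_le_sum (f := fun K => |C K|)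
    (fun _ _ => abs_nonneg _) hK)

theorem exists_le_of_forall_face {S : HelmholtzData d} (M : Mesh S) (hd : 1 ≤ d) {X : Type*}
    (f g : Vec d → X → ℝ) (hg : ∀ x w, 0 ≤ g x w)
    (h : ∀ F ∈ M.facesR, ∃ C : ℝ, ∀ᵐ x ∂(surf d).restrict (hull F), ∀ w, f x w ≤ C * g x w) :
    ∃ C : ℝ, ∀ᵐ x ∂(surf d).restrict S.ΓR, ∀ w, f x w ≤ C * g x w := by
  choose! C hC using h
  refine ⟨∑ K ∈ M.facesR, |C K|, ?_⟩
  rw [M.ae_restrict_ΓR_iff hd]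
  intro K hK
  filter_upwards [hC K hK] with x hx w
  refine (hx w).trans (mul_le_mul_of_nonneg_right ?_ (hg x w))
  exact (le_abs_self _).trans (Finset.single_le_sum (f := fun K => |C K|)
    (fun _ _ => abs_nonneg _) hK)

theorem exists_le_mass {S : HelmholtzData d} (M : Mesh S) : ∃ C : ℝ,
    ∀ᵐ x ∂volume.restrict S.Ω, ∀ w : ℂ, ‖w‖ ≤ C * ‖((S.ω * √(S.μ x) : ℝ) : ℂ) * w‖ := by
  refine M.exists_le_of_forall_cell _ _ (fun _ _ => norm_nonneg _) fun K hK => ?_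
  refine ⟨‖((S.ω * √(M.μK K) : ℝ) : ℂ)‖⁻¹, ?_⟩
  filter_upwards [M.ae_μ_eq hK] with x hx w
  have : 0 < S.ω * √(M.μK K) := mul_pos S.ω_pos (Real.sqrt_pos.2 (M.μK_pos hK))
  rw [hx, norm_mul, inv_mul_cancel_left₀]
  simpa using this.ne'

theorem exists_robin_le {S : HelmholtzData d} (M : Mesh S) (hd : 1 ≤ d) : ∃ C : ℝ,
    ∀ᵐ x ∂(surf d).restrict S.ΓR, ∀ w : ℂ, ‖((√(S.ω * S.γ x) : ℝ) : ℂ) * w‖ ≤ C * ‖w‖ := by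
  refine M.exists_le_of_forall_face hd _ _ (fun _ _ => norm_nonneg _) fun F hF => ?_
  refine ⟨‖((√(S.ω * M.γF F) : ℝ) : ℂ)‖, ?_⟩
  filter_upwards [M.ae_γ_eq hF] with x hx w
  rw [hx, norm_mul]

theorem exists_le_grad {S : HelmholtzData d} (M : Mesh S) : ∃ C : ℝ,
    ∀ᵐ x ∂volume.restrict S.Ω, ∀ w : CVec d, ‖w‖ ≤ C * ‖matVec (S.rootA x) w‖ := by
  refine M.exists_le_of_forall_cell _ _ (fun _ _ => norm_nonneg _) fun K hK => ?_
  refine ⟨‖matVecL (S.rootP (M.pieceOf K))⁻¹‖, ?_⟩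
  filter_upwards [M.ae_rootA_eq hK] with x hx w
  rw [hx]
  have := (matVecL (S.rootP (M.pieceOf K))⁻¹).le_opNorm (matVec (S.rootP (M.pieceOf K)) w)
  rwa [matVecL_apply, matVec_matVec, Matrix.nonsing_inv_mul _ ((Matrix.isUnit_iff_isUnit_det _).1
    (S.rootP_spec (M.pieceOf_spec hK).1).1), matVec_one] at this

end Weights

variable {S : HelmholtzData d} (M : Mesh S)

/-! ### The global discrete gradient and the trace on the Robin boundary -/

/-- The discrete gradient on `Ω`. -/
noncomputable def gradG (p : ℕ) (v : Vec d → ℂ) (x : Vec d) : CVec d :=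
  ∑ K ∈ M.T, (interior (hull K)).indicator (M.dgrad p K v) x

theorem gradG_ae_eq (p : ℕ) (v : Vec d → ℂ) {K : Finset (Vec d)} (hK : K ∈ M.T) :
    M.gradG p v =ᵐ[volume.restrict (hull K)] M.dgrad p K v := by
  rw [← IsSimplex.restrict_interior]
  filter_upwards [ae_restrict_mem isOpen_interior.measurableSet] with x hx
  exact sum_indicator_eq (A := fun K => interior (hull K))
    (fun K hK K' hK' h => M.disjoint_interior hK hK' h) (fun K => M.dgrad p K v) hK hx

/-- The points of `F` that are on no other face. -/
def faceCore (F : Finset (Vec d)) : Set (Vec d) :=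
  hull F \ ⋃ F' ∈ (facesOf M.T).erase F, hull F'

theorem ae_mem_faceCore {F : Finset (Vec d)} (hF : F ∈ facesOf M.T) :
    ∀ᵐ x ∂(surf d).restrict (hull F), x ∈ M.faceCore F := by
  have h : ∀ᵐ x ∂(surf d).restrict (hull F), ∀ F' ∈ (facesOf M.T).erase F, x ∉ hull F' := by
    rw [Filter.eventually_all_finset]
    intro F' hF'
    rw [ae_iff, Measure.restrict_apply' (measurableSet_hull F)]
    refine measure_mono_null ?_ (M.surf_face_inter hF (Finset.mem_of_mem_erase hF')
      (Finset.ne_of_mem_erase hF').symm)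
    rintro x ⟨h1, h2⟩
    exact ⟨h2, by simpa using h1⟩
  filter_upwards [h, ae_restrict_mem (measurableSet_hull F)] with x hx hxF
  refine ⟨hxF, fun hx' => ?_⟩
  obtain ⟨F', hF', hxF'⟩ := mem_iUnion₂.1 hx'
  exact hx F' hF' hxF'

theorem disjoint_faceCore {F F' : Finset (Vec d)} (hF' : F' ∈ facesOf M.T)
    (h : F ≠ F') : Disjoint (M.faceCore F) (M.faceCore F') := by
  rw [disjoint_left]
  intro x hx hx'
  exact hx.2 (mem_iUnion₂.2 ⟨F', Finset.mem_erase.2 ⟨h.symm, hF'⟩, hx'.1⟩)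

/-- The trace of a piecewise regular function on `ΓR`. -/
noncomputable def trR (v : Vec d → ℂ) (x : Vec d) : ℂ :=
  ∑ F ∈ M.facesR, (M.faceCore F).indicator (M.traceF F v) x

theorem trR_ae_eq (v : Vec d → ℂ) {F : Finset (Vec d)} (hF : F ∈ M.facesR) :
    M.trR v =ᵐ[(surf d).restrict (hull F)] M.traceF F v := by
  filter_upwards [M.ae_mem_faceCore (M.facesR_subset hF)] with x hx
  exact sum_indicator_eq (A := M.faceCore)
    (fun F _ F' hF' h => M.disjoint_faceCore (M.facesR_subset hF') h) (fun F => M.traceF F v) hF hx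

variable {M}

theorem Traced.memLp_traceF {v : Vec d → ℂ} (hv : M.Traced v) {F : Finset (Vec d)}
    (hF : F ∈ facesOf M.T) : MemLp (M.traceF F v) 2 ((surf d).restrict (hull F)) :=
  hv.memLp_traceK hF (M.owner_spec hF).1 (M.owner_spec hF).2

theorem Traced.memLp_trR (hd : 1 ≤ d) {v : Vec d → ℂ} (hv : M.Traced v) :
    MemLp (M.trR v) 2 ((surf d).restrict S.ΓR) := by
  rw [M.memLp_ΓR_iff hd]
  exact fun F hF => (hv.memLp_traceF (M.facesR_subset hF)).ae_eq (M.trR_ae_eq v hF).symm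

theorem Traced.trR_add (hd : 1 ≤ d) {v w : Vec d → ℂ} (hv : M.Traced v) (hw : M.Traced w) :
    M.trR (v + w) =ᵐ[(surf d).restrict S.ΓR] M.trR v + M.trR w := by
  rw [Filter.EventuallyEq, M.ae_restrict_ΓR_iff hd]
  intro F hF
  have ho := M.owner_spec (M.facesR_subset hF)
  filter_upwards [M.trR_ae_eq v hF, M.trR_ae_eq w hF, M.trR_ae_eq (v + w) hF,
    hv.traceK_add hd hw (M.facesR_subset hF) ho.1 ho.2] with x h1 h2 h3 h4
  rw [h3, Pi.add_apply, h1, h2]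
  exact h4

theorem Traced.trR_smul (hd : 1 ≤ d) (c : ℂ) {v : Vec d → ℂ} (hv : M.Traced v) :
    M.trR (c • v) =ᵐ[(surf d).restrict S.ΓR] c • M.trR v := by
  rw [Filter.EventuallyEq, M.ae_restrict_ΓR_iff hd]
  intro F hF
  have ho := M.owner_spec (M.facesR_subset hF)
  filter_upwards [M.trR_ae_eq v hF, M.trR_ae_eq (c • v) hF,
    hv.traceK_smul hd c (M.facesR_subset hF) ho.1 ho.2] with x h1 h3 h4
  rw [h3, Pi.smul_apply, h1]
  exact h4

theorem Traced.memLp_gradG {p : ℕ} {v : Vec d → ℂ} (hv : M.Traced v) :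
    MemLp (M.gradG p v) 2 (volume.restrict S.Ω) := by
  rw [M.memLp_Ω_iff]
  exact fun K hK => (hv.memLp_dgrad p hK).ae_eq (M.gradG_ae_eq p v hK).symm

theorem Traced.gradG_add (hd : 1 ≤ d) {p : ℕ} {v w : Vec d → ℂ} (hv : M.Traced v)
    (hw : M.Traced w) :
    M.gradG p (v + w) =ᵐ[volume.restrict S.Ω] M.gradG p v + M.gradG p w := by
  rw [Filter.EventuallyEq, M.ae_restrict_Ω_iff]
  intro K hK
  filter_upwards [M.gradG_ae_eq p v hK, M.gradG_ae_eq p w hK, M.gradG_ae_eq p (v + w) hK,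
    hv.dgrad_add hd p hw hK] with x h1 h2 h3 h4
  rw [h3, Pi.add_apply, h1, h2]
  exact h4

theorem Traced.gradG_smul (hd : 1 ≤ d) {p : ℕ} (c : ℂ) {v : Vec d → ℂ} (hv : M.Traced v) :
    M.gradG p (c • v) =ᵐ[volume.restrict S.Ω] c • M.gradG p v := by
  rw [Filter.EventuallyEq, M.ae_restrict_Ω_iff]
  intro K hK
  filter_upwards [M.gradG_ae_eq p v hK, M.gradG_ae_eq p (c • v) hK,
    hv.dgrad_smul hd p c hK] with x h1 h3 h4
  rw [h3, Pi.smul_apply, h1]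
  exact h4

theorem gradG_conforming (hd : 1 ≤ d) (p : ℕ) {v : Vec d → ℂ} (hv : S.H1D v) :
    M.gradG p v =ᵐ[volume.restrict S.Ω] weakGrad S.Ω v := by
  rw [Filter.EventuallyEq, M.ae_restrict_Ω_iff]
  intro K hK
  filter_upwards [M.gradG_ae_eq p v hK, dgrad_conforming hd p hv hK] with x h1 h2
  rw [h1, h2]

variable (M) in
theorem trace_ae_eq_skelTrace (hd : 1 ≤ d) {v τ : Vec d → ℂ} (hv : MemH1 S.Ω v)
    (hτ : M.SkelTrace v τ) : trace S.Ω v =ᵐ[(surf d).restrict S.ΓR] τ :=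
  ae_restrict_of_ae_restrict_of_subset S.ΓR_subset
    (IsTrace.trace_ae_eq (M.traceBound_Ω hd) hv (SkelTrace.isTrace M hτ))

theorem trR_conforming (hd : 1 ≤ d) {v : Vec d → ℂ} (hv : S.H1D v) :
    M.trR v =ᵐ[(surf d).restrict S.ΓR] trace S.Ω v := by
  obtain ⟨τ, hτ, -⟩ := M.exists_skelTrace hd hv
  refine Filter.EventuallyEq.trans ?_ (M.trace_ae_eq_skelTrace hd hv.1 hτ).symm
  rw [Filter.EventuallyEq, M.ae_restrict_ΓR_iff hd]
  intro F hF
  have ho := M.owner_spec (M.facesR_subset hF)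
  filter_upwards [M.trR_ae_eq v hF,
    traceK_ae_eq_skelTrace hd hv.1 hτ (M.facesR_subset hF) ho.1 ho.2] with x h1 h2
  rw [h1, ← h2]; rfl

/-! ### The forms as inner products -/

theorem Traced.ipγ_eq (hd : 1 ≤ d) {v w : Vec d → ℂ} (hv : M.Traced v) (hw : M.Traced w) :
    M.ipγ v w = S.ipγ (M.trR v) (M.trR w) := by
  have hi : Integrable (fun x => (S.γ x : ℂ) * M.trR v x * conj (M.trR w x))
      ((surf d).restrict S.ΓR) := by
    have := integrable_inner_of_memLp (hw.memLp_trR hd)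
      (M.memLp_γ hd id (hv.memLp_trR hd))
    refine this.congr (Eventually.of_forall fun x => ?_)
    simp [RCLike.inner_apply]
  rw [M.restrict_ΓR hd] at hi
  rw [HelmholtzData.ipγ, M.restrict_ΓR hd, integral_finsetSum_measure]
  · refine Finset.sum_congr rfl fun F hF => integral_congr_ae ?_
    filter_upwards [M.trR_ae_eq v hF, M.trR_ae_eq w hF] with x h1 h2
    rw [h1, h2]
  · intro F hF
    exact hi.mono_measure
      (Finset.single_le_sum (f := fun K => (surf d).restrict (hull K)) (fun _ _ => Measure.zero_le _) hF)

theorem Traced.sum_ipG_eq {p : ℕ} {v w : Vec d → ℂ} (hv : M.Traced v) (hw : M.Traced w) :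
    ∑ K ∈ M.T, M.ipG p K v w = S.ipA (M.gradG p v) (M.gradG p w) := by
  have hi := M.integrable_sesq (hw.memLp_gradG (p := p)) (hv.memLp_gradG (p := p))
  rw [HelmholtzData.ipA, M.restrict_Ω, integral_finsetSum_measure]
  · refine Finset.sum_congr rfl fun K hK => integral_congr_ae ?_
    filter_upwards [M.gradG_ae_eq p v hK, M.gradG_ae_eq p w hK] with x h1 h2
    rw [h1, h2]
  · intro K hK
    exact hi.mono_measure (M.restrict_hull_le hK)

variable (S) in
/-- The product of the spaces of masses, Robin traces and gradients. -/
abbrev EnergySpace := WithLp 2 (Lp ℂ 2 (volume.restrict S.Ω) ×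
  WithLp 2 (Lp ℂ 2 ((surf d).restrict S.ΓR) × Lp (CVec d) 2 (volume.restrict S.Ω)))

variable (M) in
/-- The embedding whose norm is the broken energy norm. -/
noncomputable def embed (p : ℕ) (v : Vec d → ℂ) : EnergySpace S :=
  WithLp.toLp 2 (S.massL2 v, WithLp.toLp 2 (S.robinL2 (M.trR v), S.gradL2 (M.gradG p v)))

theorem Traced.embed_add (hd : 1 ≤ d) {p : ℕ} {v w : Vec d → ℂ} (hv : M.Traced v)
    (hw : M.Traced w) : M.embed p (v + w) = M.embed p v + M.embed p w := by
  rw [embed, embed, embed, massL2_add M hv.1 hw.1, robinL2_congr (hv.trR_add hd hw),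
    robinL2_add M hd (hv.memLp_trR hd) (hw.memLp_trR hd), gradL2_congr (hv.gradG_add hd hw),
    gradL2_add M hv.memLp_gradG hw.memLp_gradG]
  rfl

theorem Traced.embed_smul (hd : 1 ≤ d) {p : ℕ} (c : ℂ) {v : Vec d → ℂ} (hv : M.Traced v) :
    M.embed p (c • v) = c • M.embed p v := by
  rw [embed, embed, massL2_smul M c hv.1, robinL2_congr (hv.trR_smul hd c),
    robinL2_smul M hd c (hv.memLp_trR hd), gradL2_congr (hv.gradG_smul hd c),
    gradL2_smul M c hv.memLp_gradG]
  rfl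

theorem Traced.inner_embed (hd : 1 ≤ d) {p : ℕ} {v w : Vec d → ℂ} (hv : M.Traced v)
    (hw : M.Traced w) : inner ℂ (M.embed p v) (M.embed p w) =
      (S.ω : ℂ) ^ 2 * S.ipμ w v + S.ω * M.ipγ w v + ∑ K ∈ M.T, M.ipG p K w v := by
  rw [hw.ipγ_eq hd hv, hw.sum_ipG_eq hv, ← inner_massL2 M hv.1 hw.1,
    ← inner_robinL2 M hd (hv.memLp_trR hd) (hw.memLp_trR hd),
    ← inner_gradL2 M hv.memLp_gradG hw.memLp_gradG, add_assoc]
  rfl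

/-- The three weights are absorbed in the three components of the embedding, so that all later
estimates take place in a Hilbert space. -/
theorem Traced.energyNorm_eq (hd : 1 ≤ d) {p : ℕ} {v : Vec d → ℂ} (hv : M.Traced v) :
    M.energyNorm p v = ‖M.embed p v‖ := by
  have h := congrArg Complex.re (hv.inner_embed hd (p := p) hv)
  rw [energyNorm, ← Real.sqrt_sq (norm_nonneg (M.embed p v)), ← inner_self_eq_norm_sq (𝕜 := ℂ)]
  congr 1
  rw [RCLike.re_to_complex, h]
  simp only [Complex.add_re, Complex.re_sum, Complex.re_ofReal_mul]
  rw [← Complex.ofReal_pow, Complex.re_ofReal_mul]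

variable (M) in
theorem ipγ_conforming (hd : 1 ≤ d) {v w : Vec d → ℂ} (hv : S.H1D v) (hw : S.H1D w) :
    S.ipγ (trace S.Ω v) (trace S.Ω w) = S.ipγ (M.trR v) (M.trR w) := by
  refine integral_congr_ae ?_
  filter_upwards [trR_conforming (M := M) hd hv, trR_conforming (M := M) hd hw] with x h1 h2
  rw [h1, h2]

variable (M) in
theorem ipA_conforming (hd : 1 ≤ d) (p : ℕ) {v w : Vec d → ℂ} (hv : S.H1D v) (hw : S.H1D w) :
    S.ipA (weakGrad S.Ω v) (weakGrad S.Ω w) = S.ipA (M.gradG p v) (M.gradG p w) := by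
  refine integral_congr_ae ?_
  filter_upwards [gradG_conforming (M := M) hd p hv, gradG_conforming (M := M) hd p hw] with x h1 h2
  rw [h1, h2]

variable (M) in
theorem conforming_energyNorm_eq (hd : 1 ≤ d) (p : ℕ) {v : Vec d → ℂ} (hv : S.H1D v) :
    S.energyNorm v = ‖M.embed p v‖ := by
  have ht := M.traced_of_H1D hd hv
  rw [← ht.energyNorm_eq hd, energyNorm, HelmholtzData.energyNorm, ← Complex.re_sum,
    ht.ipγ_eq hd ht, ht.sum_ipG_eq ht, M.ipγ_conforming hd hv hv, M.ipA_conforming hd p hv hv]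

/-- The sesquilinear form with the signs of the Helmholtz problem. -/
noncomputable def helmForm (x y : EnergySpace S) : ℂ :=
  -inner ℂ y.fst x.fst - Complex.I * inner ℂ y.snd.fst x.snd.fst + inner ℂ y.snd.snd x.snd.snd

theorem Traced.bh_eq (hd : 1 ≤ d) {p : ℕ} (st : Stabilization M) {v w : Vec d → ℂ}
    (hv : M.Traced v) (hw : M.Traced w) :
    bh p st v w = helmForm (M.embed p v) (M.embed p w) + st.s v w := by
  rw [bh, ah, hv.ipγ_eq hd hw, hv.sum_ipG_eq hw]
  simp only [helmForm, embed, WithLp.toLp_fst, WithLp.toLp_snd]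
  rw [inner_massL2 M hw.1 hv.1, inner_robinL2 M hd (hw.memLp_trR hd) (hv.memLp_trR hd),
    inner_gradL2 M hw.memLp_gradG hv.memLp_gradG]
  ring

variable (M) in
-- For conforming functions the lifting vanishes and the traces from the elements agree with the
-- trace from `Ω`. The continuous and discrete forms are thus instances of the same form, whatever
-- the degree `p`.
theorem b_eq (hd : 1 ≤ d) (p : ℕ) {v w : Vec d → ℂ} (hv : S.H1D v) (hw : S.H1D w) :
    S.b v w = helmForm (M.embed p v) (M.embed p w) := by
  have hv' := M.traced_of_H1D hd hv
  have hw' := M.traced_of_H1D hd hw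
  rw [HelmholtzData.b, M.ipγ_conforming hd hv hw, M.ipA_conforming hd p hv hw]
  simp only [helmForm, embed, WithLp.toLp_fst, WithLp.toLp_snd]
  rw [inner_massL2 M hw'.1 hv'.1, inner_robinL2 M hd (hw'.memLp_trR hd) (hv'.memLp_trR hd),
    inner_gradL2 M hw'.memLp_gradG hv'.memLp_gradG]
  ring

end Mesh

end IPDG

/-! ### Solvability of the adjoint problem. -/

namespace IPDG
open Measure Set
open scoped Classical
variable {d : ℕ}

/-- An inf-sup condition on a complete subspace yields solvability of the adjoint problem. -/
theorem exists_adjoint_solution {H : Type*} [NormedAddCommGroup H] [InnerProductSpace ℂ H]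
    [CompleteSpace H] (Z : Submodule ℂ H) [CompleteSpace Z] (D : H →L[ℂ] H) {c : ℝ} (hc : 0 < c)
    (h : ∀ z ∈ Z, ‖z‖ = 1 → ∃ w ∈ Z, ‖w‖ = 1 ∧ c ≤ (inner ℂ w (D z)).re) (y : H) :
    ∃ ξ ∈ Z, ∀ z ∈ Z, inner ℂ ξ (D z) = inner ℂ y z := by
  -- `P` is the orthogonal projection and `T` the compression of `D` to `Z`. The inf-sup condition
  -- says that `T` is bounded below.
  let P : H →L[ℂ] Z := ContinuousLinearMap.adjoint Z.subtypeL
  let T : Z →L[ℂ] Z := P ∘L D ∘L Z.subtypeL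
  have hP : ∀ (w : Z) (x : H), inner ℂ w (P x) = inner ℂ (w : H) x := fun w x =>
    ContinuousLinearMap.adjoint_inner_right Z.subtypeL w x
  have h1 : ∀ z : Z, ‖z‖ = 1 → c ≤ ‖T z‖ := by
    intro z hz
    obtain ⟨w, hw, hw1, hcw⟩ := h z z.2 hz
    have e := hP ⟨w, hw⟩ (D z)
    have := norm_inner_le_norm (𝕜 := ℂ) (⟨w, hw⟩ : Z) (T z)
    rw [show ‖(⟨w, hw⟩ : Z)‖ = 1 from hw1, one_mul] at this
    refine hcw.trans (le_trans ?_ this)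
    rw [← e]
    exact Complex.re_le_norm _
  have h2 : ∀ z : Z, c * ‖z‖ ≤ ‖T z‖ := by
    intro z
    by_cases hz : z = 0
    · simp [hz]
    · have hn : 0 < ‖z‖ := norm_pos_iff.2 hz
      have := h1 ((‖z‖⁻¹ : ℂ) • z) (by
        rw [norm_smul, norm_inv, Complex.norm_real, norm_norm, inv_mul_cancel₀ hn.ne'])
      rw [map_smul, norm_smul, norm_inv] at this
      simp only [Complex.norm_real, norm_norm] at this
      rw [inv_mul_eq_div, le_div_iff₀ hn] at this
      exact this
  -- The composition of `T` with its adjoint is coercive, hence invertible. A solution `x` for the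
  -- right-hand side `P y` makes `T x` a preimage of `P y` under the adjoint of `T`; surjectivity of
  -- `T` itself is not needed.
  let A : Z →L[ℂ] Z := ContinuousLinearMap.adjoint T ∘L T
  have hA : IsUnit A := by
    refine ContinuousLinearMap.isUnit_of_forall_le_norm_inner_map A (c := ⟨c ^ 2, by positivity⟩)
      (by exact_mod_cast pow_pos hc 2) fun x => ?_
    have : inner ℂ (A x) x = inner ℂ (T x) (T x) := ContinuousLinearMap.adjoint_inner_left T x (T x)
    rw [this, inner_self_eq_norm_sq_to_K, norm_pow]
    have hx := h2 x
    have h0 : (0 : ℝ) ≤ c * ‖x‖ := by positivity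
    calc ‖x‖ ^ 2 * c ^ 2 = (c * ‖x‖) ^ 2 := by ring
      _ ≤ ‖T x‖ ^ 2 := pow_le_pow_left₀ h0 hx 2
      _ = _ := by simp
  obtain ⟨A', hA'⟩ := hA
  obtain ⟨x, hx⟩ : ∃ x, A x = P y := by
    refine ⟨(↑A'⁻¹ : Z →L[ℂ] Z) (P y), ?_⟩
    rw [← hA']
    have := congrArg (fun L : Z →L[ℂ] Z => L (P y)) (Units.mul_inv A')
    exact this
  refine ⟨T x, (T x).2, fun z hz => ?_⟩
  have e1 : inner ℂ ((T x : Z) : H) (D z) = inner ℂ (T x) (T ⟨z, hz⟩) := (hP (T x) (D z)).symm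
  have e2 : inner ℂ (T x) (T ⟨z, hz⟩) = inner ℂ (A x) (⟨z, hz⟩ : Z) :=
    (ContinuousLinearMap.adjoint_inner_left T ⟨z, hz⟩ (T x)).symm
  rw [e1, e2, hx]
  exact ContinuousLinearMap.adjoint_inner_left Z.subtypeL ⟨z, hz⟩ y

theorem tendsto_eLpNorm_sub_trans {α E : Type*} [MeasurableSpace α] [NormedAddCommGroup E]
    {ν : Measure α} {f g : ℕ → α → E} {h : α → E}
    (hf : ∀ n, AEStronglyMeasurable (f n - g n) ν) (hg : ∀ n, AEStronglyMeasurable (g n - h) ν)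
    (h1 : Tendsto (fun n => eLpNorm (f n - g n) 2 ν) atTop (𝓝 0))
    (h2 : Tendsto (fun n => eLpNorm (g n - h) 2 ν) atTop (𝓝 0)) :
    Tendsto (fun n => eLpNorm (f n - h) 2 ν) atTop (𝓝 0) := by
  refine tendsto_of_tendsto_of_tendsto_of_le_of_le tendsto_const_nhds
    (by simpa using h1.add h2) (fun _ => zero_le) fun n => ?_
  rw [show f n - h = (f n - g n) + (g n - h) by abel]
  exact eLpNorm_add_le (hf n) (hg n) one_le_two

theorem tendsto_eLpNorm_of_le {α β E F : Type*} [MeasurableSpace α] [MeasurableSpace β]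
    [NormedAddCommGroup E] [NormedAddCommGroup F] {ν : Measure α} {ν' : Measure β} {f : ℕ → α → E}
    {g : ℕ → β → F} (C : ℝ) (h : ∀ n, eLpNorm (f n) 2 ν ≤ ENNReal.ofReal C * eLpNorm (g n) 2 ν')
    (hg : Tendsto (fun n => eLpNorm (g n) 2 ν') atTop (𝓝 0)) :
    Tendsto (fun n => eLpNorm (f n) 2 ν) atTop (𝓝 0) := by
  have := ENNReal.Tendsto.const_mul (a := ENNReal.ofReal C) hg (Or.inr ENNReal.ofReal_ne_top)
  rw [mul_zero] at this
  exact tendsto_of_tendsto_of_tendsto_of_le_of_le tendsto_const_nhds this (fun _ => zero_le) h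

theorem tendsto_toL2_iff {α E : Type*} [MeasurableSpace α] [NormedAddCommGroup E]
    {ν : Measure α} {f : ℕ → α → E} {g : α → E} (hf : ∀ n, MemLp (f n) 2 ν) (hg : MemLp g 2 ν) :
    Tendsto (fun n => toL2 ν (f n)) atTop (𝓝 (toL2 ν g)) ↔
      Tendsto (fun n => eLpNorm (f n - g) 2 ν) atTop (𝓝 0) := by
  rw [toL2_of_memLp hg]
  simp_rw [fun n => toL2_of_memLp (hf n)]
  exact Lp.tendsto_Lp_iff_tendsto_eLpNorm'' _ hf _ hg

namespace HelmholtzData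

variable {S : HelmholtzData d}

theorem H1D.add {v w : Vec d → ℂ} (hv : S.H1D v) (hw : S.H1D w) : S.H1D (v + w) := by
  obtain ⟨hv, t, ht, h0⟩ := hv
  obtain ⟨hw, t', ht', h0'⟩ := hw
  refine ⟨hv.add hw, _, ht.add S.lipschitz.1 hv hw ht', ?_⟩
  filter_upwards [h0, h0'] with x h1 h2
  simp [h1, h2]

theorem H1D.smul (c : ℂ) {v : Vec d → ℂ} (hv : S.H1D v) : S.H1D (c • v) := by
  obtain ⟨hv, t, ht, h0⟩ := hv
  refine ⟨hv.smul c, _, ht.smul S.lipschitz.1 c hv, ?_⟩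
  filter_upwards [h0] with x h1
  simp [h1]

variable (S) in
theorem H1D_zero : S.H1D 0 := by
  have h : HasWeakGrad S.Ω 0 0 := ⟨MemLp.zero, fun η _ i => by simp⟩
  have hm : MemH1 S.Ω 0 := ⟨MemLp.zero, _, h⟩
  have hg : weakGrad S.Ω 0 =ᵐ[volume.restrict S.Ω] 0 := h.weakGrad_ae_eq S.lipschitz.1
  refine ⟨hm, 0, ⟨MemLp.zero, fun _ => 0, fun _ => contDiff_const, ?_, ?_, ?_⟩, by simp⟩
  · simp
  · have e : classicalGrad (0 : Vec d → ℂ) = 0 := by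
      ext x i
      simp [classicalGrad, pderiv]
    have : eLpNorm (classicalGrad (0 : Vec d → ℂ) - weakGrad S.Ω 0) 2 (volume.restrict S.Ω) = 0 := by
      rw [e, zero_sub, eLpNorm_neg, eLpNorm_congr_ae hg, eLpNorm_zero]
    simp [this]
  · simp

theorem H1D.sub {v w : Vec d → ℂ} (hv : S.H1D v) (hw : S.H1D w) : S.H1D (v - w) := by
  have := hv.add (hw.smul (-1))
  rwa [neg_one_smul, ← sub_eq_add_neg] at this

end HelmholtzData

namespace Mesh

variable {S : HelmholtzData d}

/-- The weight is bounded below by a positive constant, so it can be divided out of the limit and of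
the convergence. -/
theorem tendsto_of_tendsto_massL2 (M : Mesh S) {v : ℕ → Vec d → ℂ}
    (hv : ∀ n, MemLp (v n) 2 (volume.restrict S.Ω)) {z : Lp ℂ 2 (volume.restrict S.Ω)}
    (h : Tendsto (fun n => S.massL2 (v n)) atTop (𝓝 z)) :
    ∃ v0, MemLp v0 2 (volume.restrict S.Ω) ∧ S.massL2 v0 = z ∧
      Tendsto (fun n => eLpNorm (v n - v0) 2 (volume.restrict S.Ω)) atTop (𝓝 0) := by
  have hv0 := M.memLp_μ (fun m => (S.ω * √m)⁻¹) (Lp.memLp z)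
  have hz : S.massL2 (fun x => (((S.ω * √(S.μ x))⁻¹ : ℝ) : ℂ) * z x) = z := by
    rw [HelmholtzData.massL2, ← toL2_coeFn z]
    refine toL2_congr ?_
    rw [toL2_coeFn]
    filter_upwards [M.ae_μ_pos] with x hx
    have : ((S.ω * √(S.μ x) : ℝ) : ℂ) ≠ 0 := by
      exact_mod_cast (mul_pos S.ω_pos (Real.sqrt_pos.2 hx)).ne'
    rw [Complex.ofReal_inv, mul_inv_cancel_left₀ this]
  refine ⟨_, hv0, hz, ?_⟩
  rw [← hz] at h
  have h' := (tendsto_toL2_iff (fun n => M.memLp_μ (fun m => S.ω * √m) (hv n))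
    (M.memLp_μ (fun m => S.ω * √m) hv0)).1 h
  obtain ⟨C, hC⟩ := M.exists_le_mass
  refine tendsto_eLpNorm_of_le C (fun n => ?_) h'
  refine eLpNorm_le_mul_eLpNorm_of_ae_le_mul ?_ 2
  filter_upwards [hC] with x hx
  refine (hx _).trans_eq ?_
  rw [Pi.sub_apply, Pi.sub_apply, mul_sub]

theorem tendsto_of_tendsto_gradL2 (M : Mesh S) {g : ℕ → Vec d → CVec d}
    (hg : ∀ n, MemLp (g n) 2 (volume.restrict S.Ω)) {z : Lp (CVec d) 2 (volume.restrict S.Ω)}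
    (h : Tendsto (fun n => S.gradL2 (g n)) atTop (𝓝 z)) :
    ∃ g0, MemLp g0 2 (volume.restrict S.Ω) ∧ S.gradL2 g0 = z ∧
      Tendsto (fun n => eLpNorm (g n - g0) 2 (volume.restrict S.Ω)) atTop (𝓝 0) := by
  have hz1 : (fun x => matVec (S.rootA x) (matVec (S.rootA x)⁻¹ (z x)))
      =ᵐ[volume.restrict S.Ω] z := by
    filter_upwards [M.ae_A_eq_rootA] with x hx
    rw [matVec_matVec, Matrix.mul_nonsing_inv _ ((Matrix.isUnit_iff_isUnit_det _).1 hx.1),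
      matVec_one]
  have hv0 : MemLp (fun x => matVec (S.rootA x)⁻¹ (z x)) 2 (volume.restrict S.Ω) :=
    M.memLp_of_rootA ((Lp.memLp z).ae_eq hz1.symm)
  have hz : S.gradL2 (fun x => matVec (S.rootA x)⁻¹ (z x)) = z := by
    rw [HelmholtzData.gradL2, toL2_congr hz1, toL2_coeFn]
  refine ⟨_, hv0, hz, ?_⟩
  rw [← hz] at h
  have h' := (tendsto_toL2_iff (fun n => M.memLp_rootA (hg n)) (M.memLp_rootA hv0)).1 h
  obtain ⟨C, hC⟩ := M.exists_le_grad
  refine tendsto_eLpNorm_of_le C (fun n => ?_) h'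
  refine eLpNorm_le_mul_eLpNorm_of_ae_le_mul ?_ 2
  filter_upwards [hC] with x hx
  refine (hx _).trans_eq ?_
  simp only [Pi.sub_apply]
  rw [← matVecL_apply, map_sub]
  rfl

theorem tendsto_robinL2 (M : Mesh S) (hd : 1 ≤ d) {v : ℕ → Vec d → ℂ} {v0 : Vec d → ℂ}
    (hv : ∀ n, MemLp (v n) 2 ((surf d).restrict S.ΓR)) (hv0 : MemLp v0 2 ((surf d).restrict S.ΓR))
    (h : Tendsto (fun n => eLpNorm (v n - v0) 2 ((surf d).restrict S.ΓR)) atTop (𝓝 0)) :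
    Tendsto (fun n => S.robinL2 (v n)) atTop (𝓝 (S.robinL2 v0)) := by
  refine (tendsto_toL2_iff (fun n => M.memLp_γ hd (fun m => √(S.ω * m)) (hv n))
    (M.memLp_γ hd (fun m => √(S.ω * m)) hv0)).2 ?_
  obtain ⟨C, hC⟩ := M.exists_robin_le hd
  refine tendsto_eLpNorm_of_le C (fun n => ?_) h
  refine eLpNorm_le_mul_eLpNorm_of_ae_le_mul ?_ 2
  filter_upwards [hC] with x hx
  refine le_trans (le_of_eq ?_) (hx _)
  rw [Pi.sub_apply, Pi.sub_apply, mul_sub]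

variable (M : Mesh S)

/-- A sequence of conforming functions converging in `H¹(Ω)` has a conforming limit, and the
traces converge. -/
theorem exists_H1D_limit (hd : 1 ≤ d) {v : ℕ → Vec d → ℂ} (hv : ∀ n, S.H1D (v n))
    {v0 : Vec d → ℂ} {g0 : Vec d → CVec d} (hv0 : MemLp v0 2 (volume.restrict S.Ω))
    (hg0 : MemLp g0 2 (volume.restrict S.Ω))
    (h1 : Tendsto (fun n => eLpNorm (v n - v0) 2 (volume.restrict S.Ω)) atTop (𝓝 0))
    (h2 : Tendsto (fun n => eLpNorm (weakGrad S.Ω (v n) - g0) 2 (volume.restrict S.Ω)) atTop (𝓝 0)) :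
    S.H1D v0 ∧ weakGrad S.Ω v0 =ᵐ[volume.restrict S.Ω] g0 ∧
      Tendsto (fun n => eLpNorm (M.trR (v n) - M.trR v0) 2 ((surf d).restrict S.ΓR)) atTop (𝓝 0) := by
  have hsk : ∀ n, ∃ τ, M.SkelTrace (v n) τ ∧ ∀ᵐ x ∂((surf d).restrict S.ΓD), τ x = 0 := fun n =>
    M.exists_skelTrace hd (hv n)
  choose τ hτ hτ0 using hsk
  -- A diagonal argument: each `v n` is replaced by a smooth function within `1 / (n + 1)` of it in
  -- `L²`, in gradient and on the skeleton. The smooth functions then approximate the limit `v0`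
  -- directly.
  have happ : ∀ n : ℕ, ∃ φ : Vec d → ℂ, ContDiff ℝ ((⊤ : ℕ∞) : WithTop ℕ∞) φ ∧
      eLpNorm (φ - v n) 2 (volume.restrict S.Ω) < ENNReal.ofReal (1 / (n + 1)) ∧
      eLpNorm (classicalGrad φ - weakGrad S.Ω (v n)) 2 (volume.restrict S.Ω)
        < ENNReal.ofReal (1 / (n + 1)) ∧
      eLpNorm (φ - τ n) 2 ((surf d).restrict M.skel) < ENNReal.ofReal (1 / (n + 1)) := by
    intro n
    obtain ⟨-, φ, hφ, a1, a2, a3⟩ := hτ n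
    have hpos : (0 : ℝ≥0∞) < ENNReal.ofReal (1 / (n + 1)) :=
      ENNReal.ofReal_pos.2 (by positivity)
    obtain ⟨k, hk1, hk2, hk3⟩ := ((a1.eventually (gt_mem_nhds hpos)).and
      ((a2.eventually (gt_mem_nhds hpos)).and (a3.eventually (gt_mem_nhds hpos)))).exists
    exact ⟨φ k, hφ k, hk1, hk2, hk3⟩
  choose φ hφ e1 e2 e3 using happ
  have hz : Tendsto (fun n : ℕ => ENNReal.ofReal (1 / ((n : ℝ) + 1))) atTop (𝓝 0) := by
    simpa using ENNReal.tendsto_ofReal tendsto_one_div_add_atTop_nhds_zero_nat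
  have sq : ∀ {f : ℕ → ℝ≥0∞}, (∀ n, f n < ENNReal.ofReal (1 / ((n : ℝ) + 1))) →
      Tendsto f atTop (𝓝 0) := fun h =>
    tendsto_of_tendsto_of_tendsto_of_le_of_le tendsto_const_nhds hz (fun _ => zero_le)
      fun n => (h n).le
  have hφ1 : ∀ n, ContDiff ℝ 1 (φ n) := fun n => (hφ n).of_le (by simp)
  have mg : ∀ n, AEStronglyMeasurable (classicalGrad (φ n)) (volume.restrict S.Ω) := fun n =>
    (continuous_classicalGrad (hφ1 n)).aestronglyMeasurable
  have c1 : Tendsto (fun n => eLpNorm (φ n - v0) 2 (volume.restrict S.Ω)) atTop (𝓝 0) :=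
    tendsto_eLpNorm_sub_trans
      (fun n => (hφ n).continuous.aestronglyMeasurable.sub (hv n).1.1.1)
      (fun n => (hv n).1.1.1.sub hv0.1) (sq e1) h1
  have c2 : Tendsto (fun n => eLpNorm (classicalGrad (φ n) - g0) 2 (volume.restrict S.Ω))
      atTop (𝓝 0) :=
    tendsto_eLpNorm_sub_trans
      (fun n => (mg n).sub (hv n).1.hasWeakGrad.1.1)
      (fun n => (hv n).1.hasWeakGrad.1.1.sub hg0.1) (sq e2) h2
  have hb := S.lipschitz.2.2.1
  have hW : HasWeakGrad S.Ω v0 g0 := HasWeakGrad.of_tendsto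
    (fun n => (hv n).1.1) (fun n => (hv n).1.hasWeakGrad) hv0 hg0 h1 h2
  have hH : MemH1 S.Ω v0 := ⟨hv0, _, hW⟩
  have hgw := hW.weakGrad_ae_eq S.lipschitz.1
  have c2' : Tendsto (fun n => eLpNorm (classicalGrad (φ n) - weakGrad S.Ω v0) 2
      (volume.restrict S.Ω)) atTop (𝓝 0) :=
    c2.congr fun n => eLpNorm_congr_ae ((ae_eq_refl _).sub hgw.symm)
  obtain ⟨σ, hσ, hσφ⟩ := M.exists_skelTrace_of_tendsto hd hH hφ c1 c2'
  have hS : M.SkelTrace v0 σ := ⟨hσ, φ, hφ, c1, c2', hσφ⟩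
  have mφ : ∀ n, AEStronglyMeasurable (φ n) ((surf d).restrict M.skel) := fun n =>
    (hφ n).continuous.aestronglyMeasurable
  have c3 : Tendsto (fun n => eLpNorm (τ n - σ) 2 ((surf d).restrict M.skel)) atTop (𝓝 0) := by
    refine tendsto_eLpNorm_sub_trans (g := φ) (fun n => (hτ n).1.1.sub (mφ n))
      (fun n => (mφ n).sub hσ.1) ?_ hσφ
    refine (sq e3).congr fun n => ?_
    rw [← eLpNorm_neg, neg_sub]
  have hD : (surf d).restrict S.ΓD ≤ (surf d).restrict M.skel :=
    restrict_mono (S.ΓD_subset.trans M.frontier_subset) le_rfl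
  -- On `ΓD` the traces of the sequence are zero and converge in `L²` to `σ`.
  have hσ0 : ∀ᵐ x ∂((surf d).restrict S.ΓD), σ x = 0 := by
    have : eLpNorm σ 2 ((surf d).restrict S.ΓD) = 0 := by
      refine tendsto_nhds_unique (tendsto_const_nhds (f := atTop (α := ℕ))) ?_
      refine tendsto_of_tendsto_of_tendsto_of_le_of_le tendsto_const_nhds c3 (fun _ => zero_le)
        fun n => le_trans (le_of_eq ?_) (eLpNorm_mono_measure (τ n - σ) hD)
      rw [← eLpNorm_neg]
      refine eLpNorm_congr_ae ?_
      filter_upwards [hτ0 n] with x hx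
      simp [hx]
    exact (eLpNorm_eq_zero_iff (hσ.1.mono_measure hD) two_ne_zero).1 this
  have hH1 : S.H1D v0 := ⟨hH, σ, SkelTrace.isTrace M hS, hσ0⟩
  refine ⟨hH1, hgw, ?_⟩
  refine tendsto_of_tendsto_of_tendsto_of_le_of_le tendsto_const_nhds c3 (fun _ => zero_le)
    fun n => le_trans (le_of_eq (eLpNorm_congr_ae ?_)) (eLpNorm_mono_measure (τ n - σ) M.restrict_ΓR_le)
  exact ((trR_conforming hd (hv n)).trans (M.trace_ae_eq_skelTrace hd (hv n).1 (hτ n))).sub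
    ((trR_conforming hd hH1).trans (M.trace_ae_eq_skelTrace hd hH hS))

/-- The embedded conforming functions. -/
noncomputable def confSubmodule (hd : 1 ≤ d) (p : ℕ) : Submodule ℂ (EnergySpace S) where
  carrier := {z | ∃ v, S.H1D v ∧ M.embed p v = z}
  add_mem' := by
    rintro _ _ ⟨v, hv, rfl⟩ ⟨w, hw, rfl⟩
    exact ⟨v + w, hv.add hw, (M.traced_of_H1D hd hv).embed_add hd (M.traced_of_H1D hd hw)⟩
  zero_mem' := ⟨0, S.H1D_zero, by
    have := (M.traced_of_H1D hd S.H1D_zero).embed_smul hd (p := p) 0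
    simpa using this⟩
  smul_mem' := by
    rintro c _ ⟨v, hv, rfl⟩
    exact ⟨c • v, hv.smul c, (M.traced_of_H1D hd hv).embed_smul hd c⟩

/-- Convergence in energy is convergence in `H¹(Ω)`, since the weights are bounded below; the limit
is conforming, and its trace is the limit of the traces. -/
theorem isClosed_confSubmodule (hd : 1 ≤ d) (p : ℕ) :
    IsClosed (M.confSubmodule hd p : Set (EnergySpace S)) := by
  refine IsSeqClosed.isClosed ?_
  intro y z hy hz
  choose v hv hvy using hy
  have ht := fun n => M.traced_of_H1D hd (hv n)
  have z1 : Tendsto (fun n => S.massL2 (v n)) atTop (𝓝 z.fst) := by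
    have := (WithLp.continuous_fst 2 _ _).continuousAt.tendsto.comp hz
    refine this.congr fun n => ?_
    rw [Function.comp_apply, ← hvy n]; rfl
  have zs := (WithLp.continuous_snd 2 _ _).continuousAt.tendsto.comp hz
  have z2 : Tendsto (fun n => S.robinL2 (M.trR (v n))) atTop (𝓝 z.snd.fst) := by
    have := (WithLp.continuous_fst 2 _ _).continuousAt.tendsto.comp zs
    refine this.congr fun n => ?_
    rw [Function.comp_apply, Function.comp_apply, ← hvy n]; rfl
  have z3 : Tendsto (fun n => S.gradL2 (weakGrad S.Ω (v n))) atTop (𝓝 z.snd.snd) := by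
    have := (WithLp.continuous_snd 2 _ _).continuousAt.tendsto.comp zs
    refine this.congr fun n => ?_
    rw [Function.comp_apply, Function.comp_apply, ← hvy n,
      ← gradL2_congr (gradG_conforming (M := M) hd p (hv n))]; rfl
  obtain ⟨v0, hv0, hvz, t1⟩ := M.tendsto_of_tendsto_massL2 (fun n => (hv n).1.1) z1
  obtain ⟨g0, hg0, hgz, t2⟩ := M.tendsto_of_tendsto_gradL2 (fun n => (hv n).1.hasWeakGrad.1) z3
  obtain ⟨hH, hg, t3⟩ := M.exists_H1D_limit hd hv hv0 hg0 t1 t2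
  have hT := M.traced_of_H1D hd hH
  have t4 := M.tendsto_robinL2 hd (fun n => (ht n).memLp_trR hd) (hT.memLp_trR hd) t3
  refine ⟨v0, hH, ?_⟩
  -- The Robin component of the limit is not free: it has to be the trace of the function found from
  -- the mass and gradient components.
  have q2 := tendsto_nhds_unique z2 t4
  have q3 : S.gradL2 (M.gradG p v0) = z.snd.snd := by
    rw [gradL2_congr ((gradG_conforming (M := M) hd p hH).trans hg), hgz]
  rw [embed, hvz, ← q2, q3]
  rfl

/-- The operator with `helmForm x y = ⟪y, D x⟫`. -/
noncomputable def helmOp : EnergySpace S →L[ℂ] EnergySpace S :=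
  LinearMap.mkContinuous
    { toFun := fun x => WithLp.toLp 2 (-x.fst, WithLp.toLp 2 (-Complex.I • x.snd.fst, x.snd.snd))
      map_add' := fun x y => by
        change _ = WithLp.toLp 2 (-x.fst + -y.fst, WithLp.toLp 2
          (-Complex.I • x.snd.fst + -Complex.I • y.snd.fst, x.snd.snd + y.snd.snd))
        simp only [WithLp.add_fst, WithLp.add_snd, neg_add, smul_add]
      map_smul' := fun c x => by
        change _ = WithLp.toLp 2 (c • -x.fst, WithLp.toLp 2
          (c • -Complex.I • x.snd.fst, c • x.snd.snd))
        simp only [WithLp.smul_fst, WithLp.smul_snd]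
        rw [smul_neg, smul_comm c] }
    1 fun x => by
      rw [one_mul, ← sq_le_sq₀ (norm_nonneg _) (norm_nonneg _)]
      simp [WithLp.prod_norm_sq_eq_of_L2, norm_smul]

theorem inner_helmOp (x y : EnergySpace S) : inner ℂ y (helmOp x) = helmForm x y := by
  have : helmOp x = WithLp.toLp 2 (-x.fst, WithLp.toLp 2 (-Complex.I • x.snd.fst, x.snd.snd)) := rfl
  rw [this, WithLp.prod_inner_apply, WithLp.prod_inner_apply]
  simp only [helmForm, WithLp.ofLp_fst, WithLp.ofLp_snd,
    inner_neg_right, inner_smul_right]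
  ring

/-- Well-posedness implies solvability of the adjoint problem. -/
theorem exists_adjoint (hd : 1 ≤ d) (p : ℕ) (hS : S.WellPosed) (y : EnergySpace S) :
    ∃ ξ, S.H1D ξ ∧ ∀ w, S.H1D w → S.b w ξ = inner ℂ y (M.embed p w) := by
  obtain ⟨γst, hγ, h⟩ := hS
  have : CompleteSpace (M.confSubmodule hd p) :=
    (M.isClosed_confSubmodule hd p).completeSpace_coe
  obtain ⟨x, ⟨ξ, hξ, rfl⟩, hx⟩ := exists_adjoint_solution (M.confSubmodule hd p) helmOp
    (c := 1 / γst) (by positivity) (by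
      rintro _ ⟨φ, hφ, rfl⟩ hn
      rw [← M.conforming_energyNorm_eq hd p hφ] at hn
      obtain ⟨w, hw, hwn, hb⟩ := h φ hφ hn
      refine ⟨_, ⟨w, hw, rfl⟩, ?_, ?_⟩
      · rwa [← M.conforming_energyNorm_eq hd p hw]
      · rwa [inner_helmOp, ← M.b_eq hd p hφ hw]) y
  refine ⟨ξ, hξ, fun w hw => ?_⟩
  rw [M.b_eq hd p hw hξ, ← inner_helmOp]
  exact hx _ ⟨w, hw, rfl⟩

theorem uStar_spec {S : HelmholtzData d} (M : Mesh S) (hd : 1 ≤ d) (hS : S.WellPosed) {ψ : Vec d → ℂ}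
    (hψ : MemLp ψ 2 (volume.restrict S.Ω)) :
    S.H1D (S.uStar ψ) ∧ ∀ w, S.H1D w → S.b w (S.uStar ψ) = S.ω * S.ipμ w ψ := by
  have h : ∃ ξ, S.H1D ξ ∧ ∀ w, S.H1D w → S.b w ξ = S.ω * S.ipμ w ψ := by
    -- The datum has only a mass component. The product of two classes `massL2` carries `ω ^ 2`, one
    -- factor of which is divided out. The degree 0 is arbitrary, as conforming functions have no
    -- lifting.
    obtain ⟨ξ, hξ, h⟩ := M.exists_adjoint hd 0 hS
      (WithLp.toLp 2 ((S.ω : ℂ)⁻¹ • S.massL2 ψ, WithLp.toLp 2 (0, 0)))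
    refine ⟨ξ, hξ, fun w hw => ?_⟩
    rw [h w hw, WithLp.prod_inner_apply, WithLp.prod_inner_apply]
    simp only [embed,
      inner_zero_left, add_zero, inner_smul_left]
    rw [inner_massL2 M hψ hw.1.1]
    have : (S.ω : ℂ) ≠ 0 := by exact_mod_cast S.ω_pos.ne'
    simp only [map_inv₀, Complex.conj_ofReal]
    field_simp
  unfold HelmholtzData.uStar HelmholtzData.adjointSol
  rw [dif_pos h]
  exact h.choose_spec

theorem UStar_spec {S : HelmholtzData d} (M : Mesh S) (hd : 1 ≤ d) (hS : S.WellPosed) {Ψ : Vec d → ℂ}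
    (hΨ : MemLp Ψ 2 ((surf d).restrict S.ΓR)) :
    S.H1D (S.UStar Ψ) ∧ ∀ w, S.H1D w →
      S.b w (S.UStar Ψ) = (Real.sqrt S.ω : ℂ) * S.ipγ (trace S.Ω w) Ψ := by
  have h : ∃ ξ, S.H1D ξ ∧ ∀ w, S.H1D w →
      S.b w ξ = (Real.sqrt S.ω : ℂ) * S.ipγ (trace S.Ω w) Ψ := by
    -- The datum has only a Robin component; here the product carries `ω`, and dividing by its
    -- square root leaves the required factor.
    obtain ⟨ξ, hξ, h⟩ := M.exists_adjoint hd 0 hS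
      (WithLp.toLp 2 (0, WithLp.toLp 2 ((√S.ω : ℂ)⁻¹ • S.robinL2 Ψ, 0)))
    refine ⟨ξ, hξ, fun w hw => ?_⟩
    have ht := M.traced_of_H1D hd hw
    rw [h w hw, WithLp.prod_inner_apply, WithLp.prod_inner_apply]
    simp only [embed,
      inner_zero_left, add_zero, zero_add, inner_smul_left]
    rw [inner_robinL2 M hd hΨ (ht.memLp_trR hd)]
    have e : S.ipγ (M.trR w) Ψ = S.ipγ (trace S.Ω w) Ψ := by
      refine integral_congr_ae ?_
      filter_upwards [trR_conforming (M := M) hd hw] with x h1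
      rw [h1]
    have h0 : (√S.ω : ℂ) ≠ 0 := by exact_mod_cast (Real.sqrt_pos.2 S.ω_pos).ne'
    have h2 : (S.ω : ℂ) = (√S.ω : ℂ) * √S.ω := by
      rw [← Complex.ofReal_mul, Real.mul_self_sqrt S.ω_pos.le]
    rw [e]
    simp only [map_inv₀, Complex.conj_ofReal]
    rw [h2, mul_assoc, inv_mul_cancel_left₀ h0]
  unfold HelmholtzData.UStar HelmholtzData.adjointSol
  rw [dif_pos h]
  exact h.choose_spec

end Mesh

end IPDG

/-! ### Weak divergence, normal traces and fluxes of adjoint solutions. -/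

namespace IPDG
open Measure Set
open scoped Classical
variable {d : ℕ}

theorem classicalGrad_ofReal {η : Vec d → ℝ} (hη : Differentiable ℝ η) (x : Vec d) (i : Fin d) :
    classicalGrad (fun x => (η x : ℂ)) x i = ((pderiv η i x : ℝ) : ℂ) := by
  have := (Complex.ofRealCLM.hasFDerivAt.comp x (hη x).hasFDerivAt).fderiv
  change fderiv ℝ (fun x => (η x : ℂ)) x _ = _
  rw [show (fun x => (η x : ℂ)) = Complex.ofRealCLM ∘ η from rfl, this]
  simp [pderiv]

/-! ### The weak divergence -/

section WeakDiv

variable {D : Set (Vec d)} {w w' : Vec d → CVec d} {r r' : Vec d → ℂ}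

theorem HasWeakDiv.ae_eq (hD : IsOpen D) (h : HasWeakDiv D w r) (h' : HasWeakDiv D w r') :
    r =ᵐ[volume.restrict D] r' := by
  have : (fun x => r x - r' x) =ᵐ[volume.restrict D] 0 := by
    refine ae_eq_zero_of_isTest hD (h.1.sub h'.1) fun η hη => ?_
    simp only [sub_mul]
    rw [integral_sub (integrable_mul_of_memLp h.1 (hη.memLp 2 _))
      (integrable_mul_of_memLp h'.1 (hη.memLp 2 _))]
    have e := h.2 η hη
    rw [h'.2 η hη] at e
    linear_combination e
  filter_upwards [this] with x hx using sub_eq_zero.1 hx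

theorem HasWeakDiv.weakDiv_ae_eq (hD : IsOpen D) (h : HasWeakDiv D w r) :
    weakDiv D w =ᵐ[volume.restrict D] r :=
  HasWeakDiv.ae_eq hD (Classical.epsilon_spec (⟨r, h⟩ : ∃ r, HasWeakDiv D w r)) h

theorem integrable_sum_mul_of_memLp {α : Type*} [MeasurableSpace α] {ν : Measure α}
    {w : α → CVec d} {g : Fin d → α → ℂ} (hw : MemLp w 2 ν) (hg : ∀ i, MemLp (g i) 2 ν) :
    Integrable (fun x => ∑ i, w x i * g i x) ν :=
  integrable_finsetSum _ fun i _ => integrable_mul_of_memLp (memLp_coord hw i) (hg i)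

theorem HasWeakDiv.sub (hw : MemLp w 2 (volume.restrict D)) (hw' : MemLp w' 2 (volume.restrict D))
    (h : HasWeakDiv D w r) (h' : HasWeakDiv D w' r') : HasWeakDiv D (w - w') (r - r') := by
  refine ⟨h.1.sub h'.1, fun η hη => ?_⟩
  simp only [Pi.sub_apply, PiLp.sub_apply, sub_mul, Finset.sum_sub_distrib]
  rw [integral_sub (integrable_sum_mul_of_memLp hw fun i => hη.memLp_pderiv i 2 _)
    (integrable_sum_mul_of_memLp hw' fun i => hη.memLp_pderiv i 2 _), h.2 η hη, h'.2 η hη,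
    integral_sub (integrable_mul_of_memLp h.1 (hη.memLp 2 _))
      (integrable_mul_of_memLp h'.1 (hη.memLp 2 _))]
  ring

theorem HasWeakDiv.mono {D' : Set (Vec d)} (hD : MeasurableSet D)
    (hsub : D' ⊆ D) (h : HasWeakDiv D w r) : HasWeakDiv D' w r := by
  refine ⟨h.1.mono_measure (restrict_mono hsub le_rfl), fun η hη => ?_⟩
  have e := h.2 η (hη.mono hsub)
  rwa [← setIntegral_eq_of_subset_of_forall_sdiff_eq_zero hD hsub,
    ← setIntegral_eq_of_subset_of_forall_sdiff_eq_zero hD hsub]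
  · intro x hx
    rw [hη.eq_zero hx.2]; simp
  · intro x hx
    simp [hη.pderiv_eq_zero _ hx.2]

end WeakDiv

/-! ### Smooth test functions up to the boundary -/

namespace Mesh

variable {S : HelmholtzData d}

theorem smooth_conforming (M : Mesh S) (hd : 1 ≤ d) {φ : Vec d → ℂ}
    (hφ : ContDiff ℝ ((⊤ : ℕ∞) : WithTop ℕ∞) φ) (h0 : ∀ x ∈ S.ΓD, φ x = 0) :
    S.H1D φ ∧ weakGrad S.Ω φ =ᵐ[volume.restrict S.Ω] classicalGrad φ ∧
      trace S.Ω φ =ᵐ[(surf d).restrict S.ΓR] φ := by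
  obtain ⟨h1, h2, h3⟩ := isTrace_of_contDiff S.lipschitz.1 S.lipschitz.2.2.1
    ((measure_mono M.frontier_subset).trans_lt (M.surf_skel_lt_top hd)) hφ
  refine ⟨⟨h1, φ, h3, ?_⟩, h2, ?_⟩
  · filter_upwards [ae_restrict_mem S.measurableSet_ΓD] with x hx using h0 x hx
  · exact ae_restrict_of_ae_restrict_of_subset S.ΓR_subset (h3.trace_ae_eq (M.traceBound_Ω hd) h1)

theorem contDiff_ofReal_comp {η : Vec d → ℝ} {n : WithTop ℕ∞} (hη : ContDiff ℝ n η) :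
    ContDiff ℝ n (fun x => (η x : ℂ)) :=
  (Complex.ofRealCLM.contDiff (n := n)).comp hη

/-- A square integrable function on part of the skeleton is zero outside the closure of `ΓD` if it
is orthogonal to smooth functions vanishing on the Dirichlet boundary. -/
theorem ae_eq_zero_off_ΓD {A : Set (Vec d)} (hA : surf d A < ⊤) {h : Vec d → ℂ}
    (hh : MemLp h 2 ((surf d).restrict A))
    (H : ∀ η : Vec d → ℝ, ContDiff ℝ ((⊤ : ℕ∞) : WithTop ℕ∞) η → HasCompactSupport η →
      tsupport η ⊆ (closure S.ΓD)ᶜ → ∫ x in A, h x * (η x : ℂ) ∂(surf d) = 0) :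
    ∀ᵐ x ∂(surf d).restrict A, x ∉ closure S.ΓD → h x = 0 := by
  have : IsFiniteMeasure ((surf d).restrict A) := isFiniteMeasure_restrict.2 hA.ne
  refine isClosed_closure.isOpen_compl.ae_eq_zero_of_integral_contDiff_smul_eq_zero
    ((hh.locallyIntegrable one_le_two).locallyIntegrableOn _) fun η h1 h2 h3 => ?_
  rw [← H η h1 h2 h3]
  refine integral_congr_ae (Eventually.of_forall fun x => ?_)
  simp only [Complex.real_smul]
  ring

theorem eq_zero_of_tsupport_subset {η : Vec d → ℝ} (h3 : tsupport η ⊆ (closure S.ΓD)ᶜ)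
    {x : Vec d} (hx : x ∈ S.ΓD) : (η x : ℂ) = 0 := by
  rw [image_eq_zero_of_notMem_tsupport fun h => h3 h (subset_closure hx), Complex.ofReal_zero]

/-- The closure of `ΓD` meets a disjoint part of the boundary only in the null rim of `ΓD`. Test
functions supported away from that closure therefore see almost all of `Γ`. -/
theorem ae_notMem_closure_ΓD (S : HelmholtzData d) {ν : Measure (Vec d)} {Γ : Set (Vec d)}
    (hν : ∀ᵐ x ∂ν, x ∈ Γ) (hac : ν ≪ surf d) (hdis : Disjoint S.ΓD Γ) :
    ∀ᵐ x ∂ν, x ∉ closure S.ΓD := by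
  have := S.surf_closure_inter S.partD hdis
  have h2 : ∀ᵐ x ∂ν, x ∉ closure S.ΓD ∩ Γ := hac (measure_eq_zero_iff_ae_notMem.1 this)
  filter_upwards [hν, h2] with x h1 h2 h3 using h2 ⟨h3, h1⟩

/-! ### Normal traces -/

variable {w w' : Vec d → CVec d} {g g' : Vec d → ℂ}

/-- Green's formula may be tested with smooth functions supported away from the closure of `ΓD`,
which determines the normal trace almost everywhere on `ΓR`. -/
theorem normalTrace_unique (M : Mesh S) (hd : 1 ≤ d) (h : S.HasNormalTrace w g)
    (h' : S.HasNormalTrace w g') : g =ᵐ[(surf d).restrict S.ΓR] g' := by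
  have hfin : surf d S.ΓR < ⊤ := (measure_mono (S.ΓR_subset.trans M.frontier_subset)).trans_lt
    (M.surf_skel_lt_top hd)
  have h0 := ae_eq_zero_off_ΓD (S := S) hfin (h.1.sub h'.1) fun η h1 h2 h3 => by
    obtain ⟨c1, -, c3⟩ := M.smooth_conforming hd (contDiff_ofReal_comp h1)
      (fun x hx => eq_zero_of_tsupport_subset h3 hx)
    have e := (h.2 _ c1).symm.trans (h'.2 _ c1)
    have hη : MemLp (fun x => (η x : ℂ)) 2 ((surf d).restrict S.ΓR) :=
      (M.memLp_skel hd (contDiff_ofReal_comp h1).continuous 2).mono_measure M.restrict_ΓR_le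
    have e1 : ∀ g : Vec d → ℂ, ∫ x in S.ΓR, g x * conj (trace S.Ω (fun x => (η x : ℂ)) x) ∂(surf d)
        = ∫ x in S.ΓR, g x * (η x : ℂ) ∂(surf d) := fun g => by
      refine integral_congr_ae ?_
      filter_upwards [c3] with x hx
      rw [hx, Complex.conj_ofReal]
    rw [e1, e1] at e
    simp only [Pi.sub_apply, sub_mul]
    rw [integral_sub (integrable_mul_of_memLp h.1 hη) (integrable_mul_of_memLp h'.1 hη), e, sub_self]
  filter_upwards [h0, ae_notMem_closure_ΓD S (ae_restrict_mem S.measurableSet_ΓR)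
    restrict_le_self.absolutelyContinuous S.disjDR] with x h1 h2
  exact sub_eq_zero.1 (h1 h2)

theorem normalTrace_ae_eq (M : Mesh S) (hd : 1 ≤ d) (h : S.HasNormalTrace w g) :
    S.normalTrace w =ᵐ[(surf d).restrict S.ΓR] g :=
  M.normalTrace_unique hd (Classical.epsilon_spec (⟨g, h⟩ : ∃ g, S.HasNormalTrace w g)) h

theorem XdivN.hasNormalTrace (hw : S.XdivN w) : S.HasNormalTrace w (S.normalTrace w) :=
  Classical.epsilon_spec hw.2.2

theorem XdivN.hasWeakDiv (hw : S.XdivN w) : HasWeakDiv S.Ω w (weakDiv S.Ω w) :=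
  Classical.epsilon_spec hw.2.1

theorem integrable_conj_mul {α : Type*} [MeasurableSpace α] {ν : Measure α} {f g : α → ℂ}
    (hf : MemLp f 2 ν) (hg : MemLp g 2 ν) : Integrable (fun x => f x * conj (g x)) ν :=
  (integrable_inner_of_memLp hg hf).congr (Eventually.of_forall fun x => by
    simp [RCLike.inner_apply])

theorem integrable_sum_conj_mul {α : Type*} [MeasurableSpace α] {ν : Measure α} {f g : α → CVec d}
    (hf : MemLp f 2 ν) (hg : MemLp g 2 ν) : Integrable (fun x => ∑ i, f x i * conj (g x i)) ν :=
  (integrable_inner_of_memLp hg hf).congr (Eventually.of_forall fun _ => cinner_eq _ _)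

theorem memLp_trace (M : Mesh S) (hd : 1 ≤ d) {v : Vec d → ℂ} (hv : S.H1D v) :
    MemLp (trace S.Ω v) 2 ((surf d).restrict S.ΓR) :=
  ((M.traced_of_H1D hd hv).memLp_trR hd).ae_eq (trR_conforming hd hv)

/-- `weakDiv` and `normalTrace` select arbitrary representatives, so their linearity rests on almost
everywhere uniqueness. -/
theorem XdivN.sub_spec (M : Mesh S) (hd : 1 ≤ d) (hw : S.XdivN w) (hw' : S.XdivN w') :
    S.XdivN (w - w') ∧
      weakDiv S.Ω (w - w') =ᵐ[volume.restrict S.Ω] weakDiv S.Ω w - weakDiv S.Ω w' ∧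
      S.normalTrace (w - w') =ᵐ[(surf d).restrict S.ΓR] S.normalTrace w - S.normalTrace w' := by
  have hD := (XdivN.hasWeakDiv hw).sub hw.1 hw'.1 (XdivN.hasWeakDiv hw')
  have hDe := hD.weakDiv_ae_eq S.lipschitz.1
  have hN : S.HasNormalTrace (w - w') (S.normalTrace w - S.normalTrace w') := by
    have n1 := XdivN.hasNormalTrace hw
    have n2 := XdivN.hasNormalTrace hw'
    refine ⟨n1.1.sub n2.1, fun v hv => ?_⟩
    have e1 := n1.2 v hv
    have e2 := n2.2 v hv
    have hg := hv.1.hasWeakGrad.1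
    have ht := M.memLp_trace hd hv
    have d1 : ∫ x in S.Ω, weakDiv S.Ω (w - w') x * conj (v x)
        = ∫ x in S.Ω, (weakDiv S.Ω w x * conj (v x) - weakDiv S.Ω w' x * conj (v x)) := by
      refine integral_congr_ae ?_
      filter_upwards [hDe] with x hx
      rw [hx, Pi.sub_apply, sub_mul]
    rw [d1, integral_sub (integrable_conj_mul (XdivN.hasWeakDiv hw).1 hv.1.1)
      (integrable_conj_mul (XdivN.hasWeakDiv hw').1 hv.1.1)]
    simp only [Pi.sub_apply, PiLp.sub_apply, sub_mul, Finset.sum_sub_distrib]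
    rw [integral_sub (integrable_sum_conj_mul hw.1 hg) (integrable_sum_conj_mul hw'.1 hg),
      integral_sub (integrable_conj_mul n1.1 ht) (integrable_conj_mul n2.1 ht), ← e1, ← e2]
    ring
  exact ⟨⟨hw.1.sub hw'.1, ⟨_, hD⟩, _, hN⟩, hDe, M.normalTrace_ae_eq hd hN⟩

theorem XdivN_zero (S : HelmholtzData d) : S.XdivN 0 := by
  have h : HasWeakDiv S.Ω 0 0 := ⟨MemLp.zero, fun η _ => by simp⟩
  refine ⟨MemLp.zero, ⟨_, h⟩, 0, MemLp.zero, fun v _ => ?_⟩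
  have : ∫ x in S.Ω, weakDiv S.Ω 0 x * conj (v x) = 0 := by
    refine integral_eq_zero_of_ae ?_
    filter_upwards [h.weakDiv_ae_eq S.lipschitz.1] with x hx
    simp [hx]
  rw [this]
  simp

/-! ### Fluxes of adjoint solutions -/

theorem sesq_conj_symm {B : Matrix (Fin d) (Fin d) ℝ} (hB : B.IsSymm) (w z : CVec d) :
    conj (sesq B w z) = ∑ i, matVec B z i * conj (w i) := by
  rw [sesq_eq_inner, ← inner_conj_symm, Complex.conj_conj, ← inner_matVec, hB, cinner_eq]

theorem ae_A_symm (M : Mesh S) : ∀ᵐ x ∂volume.restrict S.Ω, (S.A x).IsSymm := by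
  rw [M.ae_restrict_Ω_iff]
  intro K hK
  filter_upwards [M.ae_A_eq hK] with x hx
  rw [hx]; exact S.A_symm _ (M.pieceOf_spec hK).1

/-- The adjoint equation is Green's formula for the flux: compactly supported test functions
identify the divergence, and all conforming ones then identify the normal trace, including its
vanishing on `ΓN`. Volume and Robin data are treated together, so both adjoint problems are covered.
-/
theorem flux_spec (M : Mesh S) (hd : 1 ≤ d) {ξ F0 F1 : Vec d → ℂ} (hξ : S.H1D ξ)
    (hF0 : MemLp F0 2 (volume.restrict S.Ω)) (hF1 : MemLp F1 2 ((surf d).restrict S.ΓR))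
    (h : ∀ w, S.H1D w → S.b w ξ = (∫ x in S.Ω, w x * conj (F0 x))
      + ∫ x in S.ΓR, trace S.Ω w x * conj (F1 x) ∂(surf d)) :
    S.XdivN (S.flux ξ) ∧
      weakDiv S.Ω (S.flux ξ) =ᵐ[volume.restrict S.Ω]
        (fun x => -(F0 x + (S.ω : ℂ) ^ 2 * ((S.μ x : ℂ) * ξ x))) ∧
      S.normalTrace (S.flux ξ) =ᵐ[(surf d).restrict S.ΓR]
        (fun x => F1 x - Complex.I * S.ω * ((S.γ x : ℂ) * trace S.Ω ξ x)) := by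
  have hflux : MemLp (S.flux ξ) 2 (volume.restrict S.Ω) := M.memLp_A hξ.1.hasWeakGrad.1
  have hμξ : MemLp (fun x => (S.ω : ℂ) ^ 2 * ((S.μ x : ℂ) * ξ x)) 2 (volume.restrict S.Ω) :=
    (M.memLp_μ id hξ.1.1).const_mul _
  have htξ := M.memLp_trace hd hξ
  have hγξ : MemLp (fun x => Complex.I * S.ω * ((S.γ x : ℂ) * trace S.Ω ξ x)) 2
      ((surf d).restrict S.ΓR) := (M.memLp_γ hd id htξ).const_mul _
  -- The adjoint solution is in the conjugated argument of `b`, so the equation is conjugated; this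
  -- gives the Robin term its factor `-i ω`.
  have key : ∀ w, S.H1D w →
      ∫ x in S.Ω, ∑ i, S.flux ξ x i * conj (weakGrad S.Ω w x i)
        = (∫ x in S.Ω, (F0 x + (S.ω : ℂ) ^ 2 * ((S.μ x : ℂ) * ξ x)) * conj (w x))
        + ∫ x in S.ΓR, (F1 x - Complex.I * S.ω * ((S.γ x : ℂ) * trace S.Ω ξ x))
            * conj (trace S.Ω w x) ∂(surf d) := by
    intro w hw
    have htw := M.memLp_trace hd hw
    have e1 : ∫ x in S.Ω, ∑ i, S.flux ξ x i * conj (weakGrad S.Ω w x i)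
        = conj (S.ipA (weakGrad S.Ω w) (weakGrad S.Ω ξ)) := by
      rw [HelmholtzData.ipA, ← integral_conj]
      refine integral_congr_ae ?_
      filter_upwards [M.ae_A_symm] with x hx
      rw [sesq_conj_symm hx]; rfl
    have e2 : S.ipA (weakGrad S.Ω w) (weakGrad S.Ω ξ) = (∫ x in S.Ω, w x * conj (F0 x))
        + (∫ x in S.ΓR, trace S.Ω w x * conj (F1 x) ∂(surf d)) + (S.ω : ℂ) ^ 2 * S.ipμ w ξ
        + Complex.I * S.ω * S.ipγ (trace S.Ω w) (trace S.Ω ξ) := by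
      rw [← h w hw, HelmholtzData.b]; ring
    rw [e1, e2]
    simp only [map_add, map_mul, map_pow, Complex.conj_ofReal, Complex.conj_I,
      HelmholtzData.ipμ, HelmholtzData.ipγ, ← integral_conj, Complex.conj_conj, add_mul, sub_mul]
    rw [integral_add (integrable_conj_mul hF0 hw.1.1) (integrable_conj_mul hμξ hw.1.1),
      integral_sub (integrable_conj_mul hF1 htw) (integrable_conj_mul hγξ htw)]
    have q1 : ∀ x, (S.ω : ℂ) ^ 2 * ((S.μ x : ℂ) * ξ x) * conj (w x)
        = (S.ω : ℂ) ^ 2 * ((S.μ x : ℂ) * conj (w x) * ξ x) := fun x => by ring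
    have q2 : ∀ x, Complex.I * S.ω * ((S.γ x : ℂ) * trace S.Ω ξ x) * conj (trace S.Ω w x)
        = Complex.I * S.ω * ((S.γ x : ℂ) * conj (trace S.Ω w x) * trace S.Ω ξ x) := fun x => by ring
    simp only [q1, q2, integral_const_mul, mul_comm (conj (w _)) (F0 _),
      mul_comm (conj (trace S.Ω w _)) (F1 _)]
    ring
  have hD : HasWeakDiv S.Ω (S.flux ξ) (fun x => -(F0 x + (S.ω : ℂ) ^ 2 * ((S.μ x : ℂ) * ξ x))) := by
    refine ⟨(hF0.add hμξ).neg, fun η hη => ?_⟩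
    have hnΓ : ∀ x ∈ frontier S.Ω, η x = 0 := fun x hx => hη.eq_zero fun hx' => by
      rw [S.lipschitz.1.frontier_eq] at hx
      exact hx.2 hx'
    obtain ⟨c1, c2, c3⟩ := M.smooth_conforming hd (contDiff_ofReal_comp hη.1)
      (fun x hx => by rw [hnΓ x (S.ΓD_subset hx), Complex.ofReal_zero])
    have k := key _ c1
    have k1 : ∫ x in S.Ω, ∑ i, S.flux ξ x i * conj (weakGrad S.Ω (fun x => (η x : ℂ)) x i)
        = ∫ x in S.Ω, ∑ i, S.flux ξ x i * ((pderiv η i x : ℝ) : ℂ) := by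
      refine integral_congr_ae ?_
      filter_upwards [c2] with x hx
      simp only [hx, classicalGrad_ofReal (hη.1.differentiable (by simp)), Complex.conj_ofReal]
    have k2 : ∫ x in S.ΓR, (F1 x - Complex.I * S.ω * ((S.γ x : ℂ) * trace S.Ω ξ x))
            * conj (trace S.Ω (fun x => (η x : ℂ)) x) ∂(surf d) = 0 := by
      refine integral_eq_zero_of_ae ?_
      filter_upwards [c3, ae_restrict_mem S.measurableSet_ΓR] with x hx hxR
      simp [hx, hnΓ x (S.ΓR_subset hxR)]
    rw [← k1, k, k2, add_zero]
    simp only [Complex.conj_ofReal, neg_mul, integral_neg, neg_neg]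
  have hDe := hD.weakDiv_ae_eq S.lipschitz.1
  have hN : S.HasNormalTrace (S.flux ξ)
      (fun x => F1 x - Complex.I * S.ω * ((S.γ x : ℂ) * trace S.Ω ξ x)) := by
    refine ⟨hF1.sub hγξ, fun v hv => ?_⟩
    rw [key v hv]
    have : ∫ x in S.Ω, weakDiv S.Ω (S.flux ξ) x * conj (v x)
        = -∫ x in S.Ω, (F0 x + (S.ω : ℂ) ^ 2 * ((S.μ x : ℂ) * ξ x)) * conj (v x) := by
      rw [← integral_neg]
      refine integral_congr_ae ?_
      filter_upwards [hDe] with x hx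
      rw [hx, neg_mul]
    rw [this]
    ring
  exact ⟨⟨hflux, ⟨_, hD⟩, _, hN⟩, hDe, M.normalTrace_ae_eq hd hN⟩

end Mesh

end IPDG

/-! ### Green's formula on elements and discrete `H(div)` fields. -/

namespace IPDG
open Measure Set
open scoped Classical
variable {d : ℕ}

/-! ### Green's formula for polynomial fields -/

/-- The divergence of a polynomial field. -/
noncomputable def divP (q : Fin d → MvPolynomial (Fin d) ℂ) (x : Vec d) : ℂ :=
  ∑ i, pderiv (Mesh.evalP (q i)) i x

/-- The component of a polynomial field in the direction `n`. -/
noncomputable def normalP (q : Fin d → MvPolynomial (Fin d) ℂ) (n : Vec d) (x : Vec d) : ℂ :=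
  ∑ i, Mesh.evalP (q i) x * ((n i : ℝ) : ℂ)

theorem continuous_divP (q : Fin d → MvPolynomial (Fin d) ℂ) : Continuous (divP q) := by
  refine continuous_finsetSum _ fun i _ => ?_
  have h := (Mesh.contDiff_evalP (q i) (n := 1)).continuous_fderiv one_ne_zero
  unfold pderiv
  fun_prop

theorem continuous_normalP (q : Fin d → MvPolynomial (Fin d) ℂ) (n : Vec d) :
    Continuous (normalP q n) :=
  continuous_finsetSum _ fun i _ => (Mesh.continuous_evalP (q i)).mul continuous_const

theorem pderiv_conjP (q : MvPolynomial (Fin d) ℂ) (i : Fin d) (x : Vec d) :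
    pderiv (Mesh.evalP (Mesh.conjP q)) i x = conj (pderiv (Mesh.evalP q) i x) := by
  have h := ((Mesh.contDiff_evalP q (n := 1)).differentiable one_ne_zero x).hasFDerivAt
  have h2 := (Complex.conjCLE.toContinuousLinearMap.hasFDerivAt.comp x h).fderiv
  have e : Mesh.evalP (Mesh.conjP q) = Complex.conjCLE.toContinuousLinearMap ∘ Mesh.evalP q := by
    ext y; simp [Mesh.evalP_conjP]
  rw [pderiv, e, h2]
  simp [pderiv]

theorem divP_conjP (q : Fin d → MvPolynomial (Fin d) ℂ) (x : Vec d) :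
    divP (fun i => Mesh.conjP (q i)) x = conj (divP q x) := by
  simp only [divP, pderiv_conjP, _root_.map_sum]

theorem normalP_conjP (q : Fin d → MvPolynomial (Fin d) ℂ) (n x : Vec d) :
    normalP (fun i => Mesh.conjP (q i)) n x = conj (normalP q n x) := by
  simp only [normalP, Mesh.evalP_conjP, _root_.map_sum, map_mul, Complex.conj_ofReal]

theorem normalP_neg (q : Fin d → MvPolynomial (Fin d) ℂ) (n x : Vec d) :
    normalP q (-n) x = -normalP q n x := by
  simp [normalP]

theorem memLp_hull_of_continuous {E : Type*} [NormedAddCommGroup E] [SecondCountableTopology E]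
    (K : Finset (Vec d)) {f : Vec d → E} (hf : Continuous f) (p : ℝ≥0∞) :
    MemLp f p (volume.restrict (hull K)) :=
  memLp_of_continuous_of_isCompact (isCompact_hull K) (isCompact_hull K).measure_lt_top hf p

theorem integrable_hull_of_continuous (K : Finset (Vec d)) {f : Vec d → ℂ} (hf : Continuous f) :
    Integrable f (volume.restrict (hull K)) :=
  hf.continuousOn.integrableOn_compact (isCompact_hull K)

namespace IsSimplex

variable {K : Finset (Vec d)}

theorem memLp_face (hK : IsSimplex K) (hd : 1 ≤ d) (a : K) {f : Vec d → ℂ} (hf : Continuous f)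
    (p : ℝ≥0∞) : MemLp f p ((surf d).restrict (hull (K.erase (a : Vec d)))) :=
  memLp_of_continuous_of_isCompact (isCompact_hull _) (hK.surf_face_lt_top hd a) hf p

theorem green_smooth (hK : IsSimplex K) (hd : 1 ≤ d) (q : Fin d → MvPolynomial (Fin d) ℂ)
    {φ : Vec d → ℂ} (hφ : ContDiff ℝ 1 φ) :
    (∫ x in hull K, φ x * divP q x) + ∑ i, ∫ x in hull K, classicalGrad φ x i * Mesh.evalP (q i) x
      = ∑ a : K, ∫ x in hull (K.erase (a : Vec d)),
          φ x * normalP q (outwardNormal K (K.erase (a : Vec d))) x ∂(surf d) := by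
  have hs : ∀ i, ContDiff ℝ 1 (Mesh.evalP (q i)) := fun i => Mesh.contDiff_evalP (q i)
  have hcd : ∀ i, Continuous (pderiv (Mesh.evalP (q i)) i) := fun i => by
    have h := (hs i).continuous_fderiv one_ne_zero
    unfold pderiv
    fun_prop
  have hcg : ∀ i, Continuous fun x => classicalGrad φ x i := fun i =>
    (EuclideanSpace.proj (𝕜 := ℂ) i).continuous.comp (continuous_classicalGrad hφ)
  have e1 : ∀ i, (∫ x in hull K, φ x * pderiv (Mesh.evalP (q i)) i x)
      + (∫ x in hull K, classicalGrad φ x i * Mesh.evalP (q i) x)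
      = ∑ a ∈ K, ((outwardNormal K (K.erase a) i : ℝ) : ℂ) *
        ∫ x in hull (K.erase a), φ x * Mesh.evalP (q i) x ∂(surf d) := by
    intro i
    have h := hK.integral_fderiv hd (hφ.mul (hs i)) (EuclideanSpace.single i 1)
    have i1 : Integrable (fun x => φ x * pderiv (Mesh.evalP (q i)) i x)
      (volume.restrict (hull K)) := integrable_hull_of_continuous K (hφ.continuous.mul (hcd i))
    have i2 : Integrable (fun x => classicalGrad φ x i * Mesh.evalP (q i) x)
      (volume.restrict (hull K)) := integrable_hull_of_continuous K ((hcg i).mul (hs i).continuous)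
    rw [← integral_add i1 i2]
    convert h using 1
    · refine integral_congr_ae (Eventually.of_forall fun x => ?_)
      have hm := fderiv_mul (hφ.differentiable one_ne_zero x) ((hs i).differentiable one_ne_zero x)
      simp only
      rw [show (fun x => φ x * Mesh.evalP (q i) x) = φ * Mesh.evalP (q i) from rfl, hm]
      simp [classicalGrad, pderiv]
      ring
    · refine Finset.sum_congr rfl fun a _ => ?_
      congr 2
      simp [PiLp.inner_apply]
  have e2 : ∫ x in hull K, φ x * divP q x
      = ∑ i, ∫ x in hull K, φ x * pderiv (Mesh.evalP (q i)) i x := by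
    rw [← integral_finsetSum]
    · simp only [divP, Finset.mul_sum]
    · exact fun i _ => integrable_hull_of_continuous K (hφ.continuous.mul (hcd i))
  rw [e2, ← Finset.sum_add_distrib, Finset.sum_congr rfl fun i _ => e1 i, Finset.sum_comm,
    ← Finset.sum_coe_sort]
  refine Finset.sum_congr rfl fun a _ => ?_
  simp only [normalP, Finset.mul_sum]
  rw [integral_finsetSum]
  · refine Finset.sum_congr rfl fun i _ => ?_
    rw [← integral_const_mul]
    exact integral_congr_ae (Eventually.of_forall fun x => by ring)
  · intro i _
    exact integrable_mul_of_memLp (hK.memLp_face hd a hφ.continuous 2)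
      (hK.memLp_face hd a ((hs i).continuous.mul continuous_const) 2)

/-- Each term of the formula for smooth functions is continuous along a sequence realising the trace
`t`, the polynomial factors being fixed and bounded on the element. -/
theorem green (hK : IsSimplex K) (hd : 1 ≤ d) (q : Fin d → MvPolynomial (Fin d) ℂ)
    {v t : Vec d → ℂ} (hv : MemH1 (interior (hull K)) v) (ht : IsTrace (interior (hull K)) v t) :
    (∫ x in hull K, v x * divP q x)
      + ∑ i, ∫ x in hull K, weakGrad (interior (hull K)) v x i * Mesh.evalP (q i) x
      = ∑ a : K, ∫ x in hull (K.erase (a : Vec d)),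
          t x * normalP q (outwardNormal K (K.erase (a : Vec d))) x ∂(surf d) := by
  obtain ⟨htm, φ, hφ, h1, h2, h3⟩ := ht
  have hφ1 : ∀ n, ContDiff ℝ 1 (φ n) := fun n => (hφ n).of_le (by simp)
  have hvm := hv.1
  have hgm := hv.hasWeakGrad.1
  rw [IsSimplex.restrict_interior] at h1 h2 hvm hgm
  have l1 := tendsto_integral_mul (fun n => memLp_hull_of_continuous K (hφ n).continuous 2) hvm
    (memLp_hull_of_continuous K (continuous_divP q) 2) h1
  have l2 : ∀ i, Tendsto (fun n => ∫ x in hull K, classicalGrad (φ n) x i * Mesh.evalP (q i) x)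
      atTop (𝓝 (∫ x in hull K, weakGrad (interior (hull K)) v x i * Mesh.evalP (q i) x)) := by
    intro i
    refine tendsto_integral_mul
      (fun n => memLp_coord (memLp_hull_of_continuous K (continuous_classicalGrad (hφ1 n)) 2) i)
      (memLp_coord hgm i) (memLp_hull_of_continuous K (Mesh.continuous_evalP (q i)) 2) ?_
    exact tendsto_of_tendsto_of_tendsto_of_le_of_le tendsto_const_nhds h2 (fun _ => zero_le)
      fun n => eLpNorm_coord_le (classicalGrad (φ n) - weakGrad (interior (hull K)) v) 2 i
  have l3 : ∀ a : K, Tendsto (fun n => ∫ x in hull (K.erase (a : Vec d)),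
      φ n x * normalP q (outwardNormal K (K.erase (a : Vec d))) x ∂(surf d)) atTop
      (𝓝 (∫ x in hull (K.erase (a : Vec d)),
        t x * normalP q (outwardNormal K (K.erase (a : Vec d))) x ∂(surf d))) := by
    intro a
    have hle : (surf d).restrict (hull (K.erase (a : Vec d)))
        ≤ (surf d).restrict (frontier (interior (hull K))) := by
      rw [hK.frontier_interior]
      exact restrict_mono (subset_iUnion (fun a : K => hull (K.erase (a : Vec d))) a) le_rfl
    refine tendsto_integral_mul (fun n => hK.memLp_face hd a (hφ n).continuous 2)
      (htm.mono_measure hle) (hK.memLp_face hd a (continuous_normalP q _) 2) ?_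
    exact tendsto_of_tendsto_of_tendsto_of_le_of_le tendsto_const_nhds h3 (fun _ => zero_le)
      fun n => eLpNorm_mono_measure _ hle
  refine tendsto_nhds_unique (l1.add (tendsto_finsetSum _ fun i _ => l2 i)) ?_
  have l4 := tendsto_finsetSum Finset.univ fun a (_ : a ∈ Finset.univ) => l3 a
  exact l4.congr fun n => (hK.green_smooth hd q (hφ1 n)).symm

end IsSimplex

namespace Mesh

variable {S : HelmholtzData d} (M : Mesh S)

theorem sum_erase_eq {K : Finset (Vec d)} (hK : K ∈ M.T) (f : Finset (Vec d) → ℂ) :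
    ∑ a : K, f (K.erase (a : Vec d)) = ∑ F ∈ K.powersetCard d, f F := by
  rw [Finset.sum_coe_sort K (fun a => f (K.erase a))]
  refine Finset.sum_nbij (fun a => K.erase a) ?_ ?_ ?_ (fun _ _ => rfl)
  · intro a ha
    rw [Finset.mem_powersetCard, Finset.card_erase_of_mem ha, M.card_eq K hK]
    exact ⟨Finset.erase_subset _ _, by omega⟩
  · intro a ha b _ hab
    by_contra hne
    have : a ∈ K.erase b := Finset.mem_erase.2 ⟨hne, ha⟩
    rw [← show K.erase a = K.erase b from hab] at this
    exact Finset.notMem_erase a K this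
  · intro F hF
    rw [Finset.mem_coe, Finset.mem_powersetCard] at hF
    obtain ⟨a, ha⟩ := M.exists_eq_erase_of_mem (mem_facesOf.2 ⟨K, hK, hF.1, hF.2⟩) hK hF.1
    exact ⟨a, a.2, ha.symm⟩

/-- A face of an element is specified by its opposite vertex. This converts the elementwise boundary
terms of Green's formula into sums over the two sides of each face. -/
theorem sum_cells_comm (f : Finset (Vec d) → Finset (Vec d) → ℂ) :
    ∑ K ∈ M.T, ∑ a : K, f K (K.erase (a : Vec d)) = ∑ F ∈ facesOf M.T, ∑ K ∈ M.cells F, f K F := by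
  rw [Finset.sum_congr rfl fun K hK => M.sum_erase_eq hK (f K)]
  refine Finset.sum_comm' fun K F => ?_
  rw [mem_cells, Finset.mem_powersetCard, mem_facesOf]
  exact ⟨fun ⟨h1, h2, h3⟩ => ⟨⟨h1, h2⟩, ⟨K, h1, h2, h3⟩⟩, fun ⟨⟨h1, h2⟩, ⟨_, _, _, h3⟩⟩ => ⟨h1, h2, h3⟩⟩

variable {M}

theorem Traced.sum_green (hd : 1 ≤ d) {v : Vec d → ℂ} (hv : M.Traced v) (Q : PolyVec d) :
    ∑ K ∈ M.T, ((∫ x in hull K, v x * divP (Q K) x)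
      + ∑ i, ∫ x in hull K, weakGrad (interior (hull K)) v x i * evalP (Q K i) x)
      = ∑ F ∈ facesOf M.T, ∑ K ∈ M.cells F,
        ∫ x in hull F, M.traceK K v x * normalP (Q K) (outwardNormal K F) x ∂(surf d) := by
  rw [← M.sum_cells_comm fun K F =>
    ∫ x in hull F, M.traceK K v x * normalP (Q K) (outwardNormal K F) x ∂(surf d)]
  exact Finset.sum_congr rfl fun K hK =>
    (M.isSimplex hK).green hd (Q K) (hv.2 K hK).1 (hv.isTrace hK)

variable (M)

/-! ### Discrete fields in `H(div)` -/

theorem hasWeakDiv_divP {K : Finset (Vec d)} {w : Vec d → CVec d}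
    {q : Fin d → MvPolynomial (Fin d) ℂ}
    (h : w =ᵐ[volume.restrict (interior (hull K))] evalV q) :
    HasWeakDiv (interior (hull K)) w (divP q) := by
  have hb : Bornology.IsBounded (interior (hull K)) :=
    (isCompact_hull K).isBounded.subset interior_subset
  refine ⟨memLp_of_continuous_of_isBounded hb (continuous_divP q) 2, fun η hη => ?_⟩
  have e : ∫ x in interior (hull K), ∑ i, w x i * ((pderiv η i x : ℝ) : ℂ)
      = ∑ i, ∫ x in interior (hull K), evalP (q i) x * ((pderiv η i x : ℝ) : ℂ) := by
    rw [← integral_finsetSum]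
    · refine integral_congr_ae ?_
      filter_upwards [h] with x hx
      rw [hx]; rfl
    · exact fun i _ => integrable_mul_of_memLp
        (memLp_of_continuous_of_isBounded hb (continuous_evalP _) 2) (hη.memLp_pderiv i 2 _)
  have hg : ∀ i, HasWeakGrad (interior (hull K)) (evalP (q i)) (classicalGrad (evalP (q i))) :=
    fun i => hasWeakGrad_classicalGrad (contDiff_evalP _)
      (memLp_of_continuous_of_isBounded hb (continuous_classicalGrad (contDiff_evalP _)) 2)
  rw [e, Finset.sum_congr rfl fun i _ => (hg i).2 η hη i, Finset.sum_neg_distrib,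
    ← integral_finsetSum]
  · simp only [divP, Finset.sum_mul]; rfl
  · exact fun i _ => integrable_mul_of_memLp
      (memLp_coord (hg i).1 i) (hη.memLp 2 _)

/-- The polynomials `Q` represent the field `w`. -/
def Represents (Q : PolyVec d) (w : Vec d → CVec d) : Prop :=
  ∀ K ∈ M.T, w =ᵐ[volume.restrict (hull K)] evalV (Q K)

theorem exists_represents {p : ℕ} {w : Vec d → CVec d} (hw : M.IsDiscreteVec p w) :
    ∃ Q : PolyVec d, M.IsPolyVec p Q ∧ M.Represents Q w := by
  choose! Q hQ using hw
  exact ⟨Q, fun K hK => (hQ K hK).1, fun K hK => (hQ K hK).2⟩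

variable {M}

theorem Represents.weakDiv_ae_eq {Q : PolyVec d} {w : Vec d → CVec d} (h : M.Represents Q w)
    (hw : S.XdivN w) {K : Finset (Vec d)} (hK : K ∈ M.T) :
    weakDiv S.Ω w =ᵐ[volume.restrict (hull K)] divP (Q K) := by
  have h1 := (XdivN.hasWeakDiv hw).mono S.measurableSet_Ω (M.interior_hull_subset hK)
  have h2 := h K hK
  rw [← IsSimplex.restrict_interior] at h2 ⊢
  exact h1.ae_eq isOpen_interior (hasWeakDiv_divP h2)

variable (M) in
/-- The sum over the elements sharing a face of the outward normal components. -/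
noncomputable def normalJump (Q : PolyVec d) (F : Finset (Vec d)) (x : Vec d) : ℂ :=
  ∑ K ∈ M.cells F, normalP (Q K) (outwardNormal K F) x

variable (M) in
theorem continuous_normalJump (Q : PolyVec d) (F : Finset (Vec d)) :
    Continuous (M.normalJump Q F) :=
  continuous_finsetSum _ fun _ _ => continuous_normalP _ _

variable (M) in
theorem memLp_face (hd : 1 ≤ d) {F : Finset (Vec d)} (hF : F ∈ facesOf M.T) {f : Vec d → ℂ}
    (hf : Continuous f) (p : ℝ≥0∞) : MemLp f p ((surf d).restrict (hull F)) :=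
  memLp_of_continuous_of_isCompact (isCompact_hull F) (M.surf_face_lt_top hd hF) hf p

variable (M) in
/-- The normal jumps as a function on the skeleton. -/
noncomputable def skelJump (Q : PolyVec d) (x : Vec d) : ℂ :=
  ∑ F ∈ facesOf M.T, (M.faceCore F).indicator (M.normalJump Q F) x

variable (M) in
theorem skelJump_ae_eq (Q : PolyVec d) {F : Finset (Vec d)} (hF : F ∈ facesOf M.T) :
    M.skelJump Q =ᵐ[(surf d).restrict (hull F)] M.normalJump Q F := by
  filter_upwards [M.ae_mem_faceCore hF] with x hx
  exact sum_indicator_eq (A := M.faceCore)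
    (fun F _ F' hF' h => M.disjoint_faceCore hF' h) (fun F => M.normalJump Q F) hF hx

variable (M) in
theorem memLp_skelJump (hd : 1 ≤ d) (Q : PolyVec d) :
    MemLp (M.skelJump Q) 2 ((surf d).restrict M.skel) := by
  rw [M.restrict_skel]
  have h : ∀ F ∈ facesOf M.T, MemLp (M.skelJump Q) 2 ((surf d).restrict (hull F)) := fun F hF =>
    (M.memLp_face hd hF (M.continuous_normalJump Q F) 2).ae_eq (M.skelJump_ae_eq Q hF).symm
  refine ⟨?_, ?_⟩
  · rw [← Measure.sum_coe_finset]
    exact AEStronglyMeasurable.sum_measure fun K => (h K K.2).1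
  · exact (eLpNorm_finset_sum_measure_le _ _ _).trans_lt
      (ENNReal.sum_lt_top.2 fun K hK => (h K hK).2)

/-- Off the Dirichlet boundary, the normal jumps of a field in `XdivN` are zero on interior and
Neumann faces, and equal to the normal trace on Robin faces. -/
theorem Represents.skelJump_eq (hd : 1 ≤ d) {Q : PolyVec d} {w : Vec d → CVec d}
    (h : M.Represents Q w) (hw : S.XdivN w) : ∀ᵐ x ∂(surf d).restrict M.skel,
      x ∉ closure S.ΓD → M.skelJump Q x - S.ΓR.indicator (S.normalTrace w) x = 0 := by
  have hn := XdivN.hasNormalTrace hw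
  have hres : ((surf d).restrict M.skel).restrict S.ΓR = (surf d).restrict S.ΓR := by
    rw [Measure.restrict_restrict S.measurableSet_ΓR, inter_eq_left.2]
    exact S.ΓR_subset.trans M.frontier_subset
  have hind : MemLp (S.ΓR.indicator (S.normalTrace w)) 2 ((surf d).restrict M.skel) := by
    rw [memLp_indicator_iff_restrict S.measurableSet_ΓR, hres]
    exact hn.1
  refine ae_eq_zero_off_ΓD (S := S) (M.surf_skel_lt_top hd) ((M.memLp_skelJump hd Q).sub hind)
    fun η h1 h2 h3 => ?_
  have hc := contDiff_ofReal_comp h1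
  have hc1 : ContDiff ℝ 1 (fun x => (η x : ℂ)) := hc.of_le (by simp)
  have hη := M.memLp_skel hd hc.continuous 2
  obtain ⟨c1, c2, c3⟩ := M.smooth_conforming hd hc (fun x hx => eq_zero_of_tsupport_subset h3 hx)
  have hT := M.traced_of_H1D hd c1
  simp only [sub_mul]
  rw [integral_sub (integrable_mul_of_memLp (M.memLp_skelJump hd Q) hη)
    (integrable_mul_of_memLp hind hη), sub_eq_zero]
  have r1 : ∫ x in M.skel, S.ΓR.indicator (S.normalTrace w) x * (η x : ℂ) ∂(surf d)
      = ∫ x in S.ΓR, S.normalTrace w x * conj (trace S.Ω (fun x => (η x : ℂ)) x) ∂(surf d) := by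
    have : ∀ x, S.ΓR.indicator (S.normalTrace w) x * (η x : ℂ)
        = S.ΓR.indicator (fun x => S.normalTrace w x * (η x : ℂ)) x := fun x => by
      by_cases hx : x ∈ S.ΓR <;> simp [hx]
    simp only [this]
    rw [integral_indicator S.measurableSet_ΓR, hres]
    refine integral_congr_ae ?_
    filter_upwards [c3] with x hx
    rw [hx, Complex.conj_ofReal]
  have r2 : ∫ x in M.skel, M.skelJump Q x * (η x : ℂ) ∂(surf d)
      = ∑ F ∈ facesOf M.T, ∑ K ∈ M.cells F,
        ∫ x in hull F, (η x : ℂ) * normalP (Q K) (outwardNormal K F) x ∂(surf d) := by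
    have hi := integrable_mul_of_memLp (M.memLp_skelJump hd Q) hη
    rw [M.restrict_skel] at hi ⊢
    rw [integral_finsetSum_measure]
    · refine Finset.sum_congr rfl fun F hF => ?_
      rw [← integral_finsetSum]
      · refine integral_congr_ae ?_
        filter_upwards [M.skelJump_ae_eq Q hF] with x hx
        rw [hx, normalJump, Finset.sum_mul]
        exact Finset.sum_congr rfl fun K _ => mul_comm _ _
      · exact fun K _ => integrable_mul_of_memLp (M.memLp_face hd hF hc.continuous 2)
          (M.memLp_face hd hF (continuous_normalP _ _) 2)
    · intro F hF
      exact hi.mono_measure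
        (Finset.single_le_sum (f := fun K => (surf d).restrict (hull K))
          (fun _ _ => Measure.zero_le _) hF)
  -- The same volume terms are expressed in two ways: by the global Green formula that defines the
  -- normal trace, and by the sum of the formulas on the elements. Hence the skeleton and Robin
  -- integrals agree for every admissible test function.
  rw [r1, r2, ← hn.2 _ c1, ← M.sum_cells_comm fun K F =>
    ∫ x in hull F, (η x : ℂ) * normalP (Q K) (outwardNormal K F) x ∂(surf d)]
  have i1 := integrable_sum_conj_mul hw.1 c1.1.hasWeakGrad.1
  have i2 := integrable_conj_mul (XdivN.hasWeakDiv hw).1 c1.1.1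
  rw [M.restrict_Ω] at i1 i2 ⊢
  have le : ∀ K ∈ M.T, volume.restrict (hull K) ≤ ∑ K ∈ M.T, volume.restrict (hull K) :=
    fun K hK => Finset.single_le_sum (f := fun K => volume.restrict (hull K))
      (fun _ _ => Measure.zero_le _) hK
  rw [integral_finsetSum_measure fun K hK => i1.mono_measure (le K hK),
    integral_finsetSum_measure fun K hK => i2.mono_measure (le K hK), ← Finset.sum_add_distrib]
  refine Finset.sum_congr rfl fun K hK => ?_
  have g := (M.isSimplex hK).green_smooth hd (Q K) hc1
  have j1 : ∫ x in hull K, weakDiv S.Ω w x * conj (η x : ℂ)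
      = ∫ x in hull K, (η x : ℂ) * divP (Q K) x := by
    refine integral_congr_ae ?_
    filter_upwards [h.weakDiv_ae_eq hw hK] with x hx
    rw [hx, Complex.conj_ofReal, mul_comm]
  have j2 : ∫ x in hull K, ∑ i, w x i * conj (weakGrad S.Ω (fun x => (η x : ℂ)) x i)
      = ∑ i, ∫ x in hull K, classicalGrad (fun x => (η x : ℂ)) x i * evalP (Q K i) x := by
    rw [← integral_finsetSum]
    · refine integral_congr_ae ?_
      filter_upwards [h K hK, MeasureTheory.ae_mono (M.restrict_hull_le hK) c2] with x hx hx'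
      rw [hx, hx']
      refine Finset.sum_congr rfl fun i _ => ?_
      rw [classicalGrad_ofReal (h1.differentiable (by simp)), Complex.conj_ofReal, mul_comm]
      rfl
    · exact fun i _ => integrable_mul_of_memLp (memLp_coord
        (memLp_hull_of_continuous K (continuous_classicalGrad hc1) 2) i)
        (memLp_hull_of_continuous K (continuous_evalP _) 2)
  rw [← g, j1, j2, add_comm]

end Mesh

end IPDG

/-! ### Exact integration by parts for the discrete gradient. -/

namespace IPDG
open Measure Set
open scoped Classical
variable {d : ℕ}

namespace Mesh

variable {S : HelmholtzData d} (M : Mesh S)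

/-! ### Discrete fields against the discrete gradient -/

theorem avgN_eq (Q : PolyVec d) (F : Finset (Vec d)) (x : Vec d) :
    M.avgN Q F x = if F ∈ M.facesInt then (1 / 2 : ℂ) * ∑ K ∈ M.cells F, normalP (Q K) (M.nF F) x
      else normalP (Q (M.owner F)) (M.nF F) x := by
  simp only [avgN, avg_apply, normalP]
  split_ifs
  · rw [Finset.sum_comm, Finset.mul_sum]
    refine Finset.sum_congr rfl fun i _ => ?_
    rw [← Finset.sum_mul, mul_assoc]
  · rfl

theorem notMem_facesInt {F : Finset (Vec d)} (hF : F ∈ M.facesExt) : F ∉ M.facesInt :=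
  fun h => (Finset.mem_sdiff.1 h).2 hF

variable {M}

/-- The sum over the sides of a face of the traces times the normal components of a discrete field
of `XdivN` is the jump times the average, up to the Robin contribution. -/
theorem Represents.sum_traceK_mul_normalP (hd : 1 ≤ d) {Q : PolyVec d} {w : Vec d → CVec d}
    (h : M.Represents Q w) (hw : S.XdivN w) (v : Vec d → ℂ) {F : Finset (Vec d)}
    (hF : F ∈ facesOf M.T) : ∀ᵐ x ∂(surf d).restrict (hull F),
      ∑ K ∈ M.cells F, M.traceK K v x * conj (normalP (Q K) (outwardNormal K F) x)
        = M.jump v F x * conj (M.avgN Q F x)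
          + if F ∈ M.facesR then M.traceF F v x * conj (S.normalTrace w x) else 0 := by
  have hsk : ∀ᵐ x ∂(surf d).restrict (hull F), x ∉ closure S.ΓD →
      M.normalJump Q F x = S.ΓR.indicator (S.normalTrace w) x := by
    filter_upwards [ae_restrict_of_ae_restrict_of_subset (M.hull_subset_skel hF)
      (h.skelJump_eq hd hw), M.skelJump_ae_eq Q hF] with x h1 h2 h3
    rw [← h2]
    exact sub_eq_zero.1 (h1 h3)
  have hac : (surf d).restrict (hull F) ≪ surf d := restrict_le_self.absolutelyContinuous
  by_cases hI : F ∈ M.facesInt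
  · have hR : F ∉ M.facesR := fun hR => M.notMem_facesInt (M.facesR_subset_ext hR) hI
    obtain ⟨K, K', hne, hc, hn⟩ := M.cells_of_mem_facesInt hd hI
    have hnorm : ‖outwardNormal K F‖ = 1 := by
      have hK : K ∈ M.cells F := by simp [hc]
      rw [mem_cells] at hK
      exact (M.outwardNormal_spec hd hF hK.1 hK.2).1
    filter_upwards [hsk, M.ae_mem_Ω hd hI] with x hx hxΩ
    have hxf : x ∉ frontier S.Ω := fun hx' => by
      rw [S.lipschitz.1.frontier_eq] at hx'
      exact hx'.2 hxΩ
    have hxD : x ∉ closure S.ΓD := fun hx' => hxf (isClosed_frontier.closure_subset_iff.2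
      S.ΓD_subset hx')
    have h0 := hx hxD
    rw [indicator_of_notMem fun hx' => hxf (S.ΓR_subset hx'), normalJump, hc,
      Finset.sum_pair hne, hn, normalP_neg] at h0
    -- Inside the domain the normal component is single-valued, so it equals the normal component of
    -- the average, and the two traces combine into the jump.
    have hab : normalP (Q K') (outwardNormal K F) x = normalP (Q K) (outwardNormal K F) x := by
      linear_combination -h0
    -- Reversing the face normal changes the sign of both the jump and the normal average, and
    -- leaves their product unchanged.
    have hs : M.nF F = outwardNormal K F ∨ M.nF F = -outwardNormal K F := by
      obtain ⟨K₀, hK₀, h⟩ := M.nF_eq hd hF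
      rw [hc, Finset.mem_insert, Finset.mem_singleton] at hK₀
      rcases hK₀ with rfl | rfl
      · exact Or.inl h
      · exact Or.inr (h.trans hn)
    rw [if_neg hR, jump, if_pos hI, avgN_eq, if_pos hI, hc]
    simp only [Finset.sum_pair hne, hn, normalP_neg, inner_neg_left]
    rcases hs with hs | hs <;>
    · rw [hs]
      simp only [normalP_neg, inner_neg_right, hab, real_inner_self_eq_norm_sq, hnorm]
      simp only [map_mul, map_add, map_neg, _root_.map_div₀, map_one, map_ofNat]
      push_cast
      ring
  · have hE : F ∈ M.facesExt := by
      by_contra hE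
      exact hI (Finset.mem_sdiff.2 ⟨hF, hE⟩)
    have hc := M.cells_of_mem_facesExt hd hE
    have hn := M.nF_of_mem_facesExt hd hE
    have hj : ∀ x, M.normalJump Q F x = normalP (Q (M.owner F)) (M.nF F) x := fun x => by
      rw [normalJump, hc, Finset.sum_singleton, hn]
    simp only [hc, Finset.sum_singleton, jump, if_neg hI, avgN_eq, ← hn]
    by_cases hD : F ∈ M.facesD
    · by_cases hR : F ∈ M.facesR
      · filter_upwards [M.ae_mem_ΓD hD, M.ae_mem_ΓR hR] with x h1 h2
        exact absurd h2 (disjoint_left.1 S.disjDR h1)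
      -- On a Dirichlet face the jump is the trace and the average is the one-sided value; nothing
      -- about the normal component is needed.
      · simp only [if_pos hD, if_neg hR, add_zero]
        exact Eventually.of_forall fun x => rfl
    · by_cases hR : F ∈ M.facesR
      · filter_upwards [hsk, M.ae_mem_ΓR hR,
          ae_notMem_closure_ΓD S (M.ae_mem_ΓR hR) hac S.disjDR] with x hx h1 h2
        have h3 := hx h2
        rw [indicator_of_mem h1, hj] at h3
        rw [if_neg hD, if_pos hR, h3, zero_mul, zero_add]
        rfl
      -- On a Neumann face the jump is zero by definition, and the normal component of the field
      -- vanishes.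
      · have hN : F ∈ M.facesN := by
          simp only [facesExt, Finset.mem_union] at hE
          tauto
        filter_upwards [hsk, M.ae_mem_ΓN hN,
          ae_notMem_closure_ΓD S (M.ae_mem_ΓN hN) hac S.disjDN] with x hx h1 h2
        have h3 := hx h2
        rw [indicator_of_notMem (disjoint_left.1 S.disjNR h1), hj] at h3
        rw [if_neg hD, if_neg hR, h3, map_zero, mul_zero, zero_mul, zero_add]

variable (M)

/-- The sesquilinear form of the integration by parts formula, for the discrete gradient. It is zero
if the first argument is conforming. -/
noncomputable def hdivForm (p : ℕ) (v : Vec d → ℂ) (σ : Vec d → CVec d) : ℂ :=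
  (∫ x in S.Ω, v x * conj (weakDiv S.Ω σ x))
    + (∫ x in S.Ω, ∑ i, M.gradG p v x i * conj (σ x i))
    - ∫ x in S.ΓR, M.trR v x * conj (S.normalTrace σ x) ∂(surf d)

variable {M}

theorem Traced.hdivForm_sub (hd : 1 ≤ d) (p : ℕ) {v : Vec d → ℂ} (hv : M.Traced v)
    {σ τ : Vec d → CVec d} (hσ : S.XdivN σ) (hτ : S.XdivN τ) :
    M.hdivForm p v (σ - τ) = M.hdivForm p v σ - M.hdivForm p v τ := by
  obtain ⟨-, h1, h2⟩ := XdivN.sub_spec M hd hσ hτ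
  have dσ := (XdivN.hasWeakDiv hσ).1
  have dτ := (XdivN.hasWeakDiv hτ).1
  have nσ := (XdivN.hasNormalTrace hσ).1
  have nτ := (XdivN.hasNormalTrace hτ).1
  have e1 : ∫ x in S.Ω, v x * conj (weakDiv S.Ω (σ - τ) x)
      = (∫ x in S.Ω, v x * conj (weakDiv S.Ω σ x)) - ∫ x in S.Ω, v x * conj (weakDiv S.Ω τ x) := by
    rw [← integral_sub (integrable_conj_mul hv.1 dσ) (integrable_conj_mul hv.1 dτ)]
    refine integral_congr_ae ?_
    filter_upwards [h1] with x hx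
    rw [hx, Pi.sub_apply, map_sub, mul_sub]
  have e2 : ∫ x in S.ΓR, M.trR v x * conj (S.normalTrace (σ - τ) x) ∂(surf d)
      = (∫ x in S.ΓR, M.trR v x * conj (S.normalTrace σ x) ∂(surf d))
        - ∫ x in S.ΓR, M.trR v x * conj (S.normalTrace τ x) ∂(surf d) := by
    rw [← integral_sub (integrable_conj_mul (hv.memLp_trR hd) nσ)
      (integrable_conj_mul (hv.memLp_trR hd) nτ)]
    refine integral_congr_ae ?_
    filter_upwards [h2] with x hx
    rw [hx, Pi.sub_apply, map_sub, mul_sub]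
  have e3 : ∫ x in S.Ω, ∑ i, M.gradG p v x i * conj ((σ - τ) x i)
      = (∫ x in S.Ω, ∑ i, M.gradG p v x i * conj (σ x i))
        - ∫ x in S.Ω, ∑ i, M.gradG p v x i * conj (τ x i) := by
    rw [← integral_sub (integrable_sum_conj_mul hv.memLp_gradG hσ.1)
      (integrable_sum_conj_mul hv.memLp_gradG hτ.1)]
    simp only [Pi.sub_apply, PiLp.sub_apply, map_sub, mul_sub, Finset.sum_sub_distrib]
  rw [hdivForm, hdivForm, hdivForm, e1, e2, e3]
  ring

/-- Integration by parts is exact for discrete fields. -/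
theorem Traced.hdivForm_discrete (hd : 1 ≤ d) {p : ℕ} {v : Vec d → ℂ} (hv : M.Traced v)
    {σ : Vec d → CVec d} (hσ : S.XdivN σ) (hσd : M.IsDiscreteVec p σ) :
    M.hdivForm p v σ = 0 := by
  obtain ⟨Q, hQ, hrep⟩ := M.exists_represents hσd
  -- `hdivForm` is antilinear in the field, hence the conjugated polynomials. The elementwise
  -- gradient produces jumps times averages on the faces, which the lifting in the discrete gradient
  -- cancels, using `hlift` with test field `Q`.
  have green := hv.sum_green hd (fun K i => conjP (Q K i))
  have hlift := (hv.lift_spec hd p).2 Q hQ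
  have le : ∀ K ∈ M.T, volume.restrict (hull K) ≤ volume.restrict S.Ω := fun K hK =>
    M.restrict_hull_le hK
  have i1 := integrable_conj_mul hv.1 (XdivN.hasWeakDiv hσ).1
  have i2 := integrable_sum_conj_mul (hv.memLp_gradG (p := p)) hσ.1
  have nt := (XdivN.hasNormalTrace hσ).1
  have i3 := integrable_conj_mul (hv.memLp_trR hd) nt
  have e1 : ∫ x in S.Ω, v x * conj (weakDiv S.Ω σ x)
      = ∑ K ∈ M.T, ∫ x in hull K, v x * divP (fun i => conjP (Q K i)) x := by
    have i1' := fun K hK => i1.mono_measure (le K hK)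
    rw [M.restrict_Ω, integral_finsetSum_measure i1']
    refine Finset.sum_congr rfl fun K hK => integral_congr_ae ?_
    filter_upwards [hrep.weakDiv_ae_eq hσ hK] with x hx
    rw [hx, divP_conjP]
  have e2 : ∫ x in S.Ω, ∑ i, M.gradG p v x i * conj (σ x i)
      = ∑ K ∈ M.T, ((∑ i, ∫ x in hull K, weakGrad (interior (hull K)) v x i * evalP (conjP (Q K i)) x)
        - ∫ x in hull K, ∑ i, evalV (M.lift p v K) x i * conj (evalV (Q K) x i)) := by
    have i2' := fun K hK => i2.mono_measure (le K hK)
    rw [M.restrict_Ω, integral_finsetSum_measure i2']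
    refine Finset.sum_congr rfl fun K hK => ?_
    rw [← integral_finsetSum _ fun i _ => integrable_mul_of_memLp
      (memLp_coord (hv.memLp_weakGrad hK) i) (memLp_evalP K (conjP (Q K i)) 2), ← integral_sub
      (integrable_finsetSum _ fun i _ => integrable_mul_of_memLp
      (memLp_coord (hv.memLp_weakGrad hK) i) (memLp_evalP K (conjP (Q K i)) 2))
      (integrable_sum_conj_mul (memLp_evalV K _ 2) (memLp_evalV K _ 2))]
    refine integral_congr_ae ?_
    filter_upwards [M.gradG_ae_eq p v hK, hrep K hK] with x h1 h2
    rw [h1, h2, ← Finset.sum_sub_distrib]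
    refine Finset.sum_congr rfl fun i _ => ?_
    simp only [dgrad, PiLp.sub_apply, evalP_conjP, evalV_apply]
    ring
  have e3 : ∫ x in S.ΓR, M.trR v x * conj (S.normalTrace σ x) ∂(surf d)
      = ∑ F ∈ facesOf M.T, if F ∈ M.facesR then
        ∫ x in hull F, M.traceF F v x * conj (S.normalTrace σ x) ∂(surf d) else 0 := by
    rw [M.restrict_ΓR hd] at i3 ⊢
    rw [← Finset.sum_filter, Finset.filter_mem_eq_inter,
      Finset.inter_eq_right.2 M.facesR_subset, integral_finsetSum_measure]
    · refine Finset.sum_congr rfl fun F hF => integral_congr_ae ?_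
      filter_upwards [M.trR_ae_eq v hF] with x hx
      rw [hx]
    · exact fun F hF => i3.mono_measure (Finset.single_le_sum
        (f := fun K => (surf d).restrict (hull K)) (fun _ _ => Measure.zero_le _) hF)
  have face : ∀ F ∈ facesOf M.T, ∑ K ∈ M.cells F, ∫ x in hull F, M.traceK K v x *
      normalP (fun i => conjP (Q K i)) (outwardNormal K F) x ∂(surf d)
      = (∫ x in hull F, M.jump v F x * conj (M.avgN Q F x) ∂(surf d))
        + if F ∈ M.facesR then
          ∫ x in hull F, M.traceF F v x * conj (S.normalTrace σ x) ∂(surf d) else 0 := by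
    intro F hF
    rw [← integral_finsetSum _ fun K hK => integrable_mul_of_memLp
      (hv.memLp_traceK hF (M.mem_cells.1 hK).1 (M.mem_cells.1 hK).2)
      (M.memLp_face hd hF (continuous_normalP _ _) 2)]
    have ij := integrable_conj_mul (hv.memLp_jump hF) (M.memLp_avgN hd Q hF)
    have hid := hrep.sum_traceK_mul_normalP hd hσ v hF
    simp only [normalP_conjP]
    rw [integral_congr_ae hid]
    split_ifs with hR
    · exact integral_add ij (integrable_conj_mul (hv.memLp_traceF hF)
        ((M.memLp_ΓR_iff hd).1 nt F hR))
    · simp only [add_zero]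
  rw [Finset.sum_congr rfl face, Finset.sum_add_distrib, Finset.sum_add_distrib, ← e3] at green
  rw [hdivForm, e1, e2, Finset.sum_sub_distrib, hlift]
  simp only [avgN] at green
  linear_combination green

end Mesh

end IPDG

/-! ### Cauchy–Schwarz estimates in the mesh-dependent norms. -/

namespace IPDG
open Measure Set
open scoped Classical
variable {d : ℕ}

/-! ### Cauchy–Schwarz inequalities -/

theorem norm_add_le_sqrt_mul_sqrt {z z' : ℂ} {a b a' b' : ℝ} (ha : 0 ≤ a) (hb : 0 ≤ b)
    (ha' : 0 ≤ a') (hb' : 0 ≤ b') (h : ‖z‖ ≤ √a * √b) (h' : ‖z'‖ ≤ √a' * √b') :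
    ‖z + z'‖ ≤ √(a + a') * √(b + b') := by
  refine (norm_add_le _ _).trans ((add_le_add h h').trans ?_)
  rw [← Real.sqrt_mul (add_nonneg ha ha')]
  refine Real.le_sqrt_of_sq_le ?_
  nlinarith [sq_nonneg (√a * √b' - √a' * √b), Real.sq_sqrt ha, Real.sq_sqrt hb, Real.sq_sqrt ha',
    Real.sq_sqrt hb', mul_nonneg ha hb, Real.sqrt_nonneg a, Real.sqrt_nonneg b]

theorem norm_sum_le_sqrt_mul_sqrt {ι : Type*} (s : Finset ι) {z : ι → ℂ} {a b : ι → ℝ}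
    (ha : ∀ i ∈ s, 0 ≤ a i) (hb : ∀ i ∈ s, 0 ≤ b i) (h : ∀ i ∈ s, ‖z i‖ ≤ √(a i) * √(b i)) :
    ‖∑ i ∈ s, z i‖ ≤ √(∑ i ∈ s, a i) * √(∑ i ∈ s, b i) := by
  induction s using Finset.induction_on with
  | empty => simp
  | insert i s hi ih =>
    rw [Finset.sum_insert hi, Finset.sum_insert hi, Finset.sum_insert hi]
    simp only [Finset.forall_mem_insert] at ha hb h
    exact norm_add_le_sqrt_mul_sqrt ha.1 hb.1 (Finset.sum_nonneg ha.2) (Finset.sum_nonneg hb.2) h.1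
      (ih ha.2 hb.2 h.2)

theorem norm_integral_mul_conj_le {α : Type*} [MeasurableSpace α] {ν : Measure α} {f g : α → ℂ}
    (hf : MemLp f 2 ν) (hg : MemLp g 2 ν) {a b : ℝ} (ha : 0 < a) (hb : 0 ≤ b) (hab : 1 ≤ a * b) :
    ‖∫ x, f x * conj (g x) ∂ν‖ ≤ √(a * ∫ x, ‖f x‖ ^ 2 ∂ν) * √(b * ∫ x, ‖g x‖ ^ 2 ∂ν) := by
  have h := norm_integral_inner_le hg hf
  simp only [RCLike.inner_apply] at h
  rw [Real.sqrt_mul ha.le, Real.sqrt_mul hb, mul_mul_mul_comm, ← Real.sqrt_mul ha.le]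
  rw [mul_comm] at h
  exact h.trans (le_mul_of_one_le_left (by positivity) (Real.one_le_sqrt.2 hab))

theorem re_integral_inner_self {α E : Type*} [MeasurableSpace α] {ν : Measure α}
    [NormedAddCommGroup E] [InnerProductSpace ℂ E] (f : α → E) :
    (∫ x, inner ℂ (f x) (f x) ∂ν).re = ∫ x, ‖f x‖ ^ 2 ∂ν := by
  have : ∀ x, (inner ℂ (f x) (f x) : ℂ) = ((‖f x‖ ^ 2 : ℝ) : ℂ) := fun x => by
    rw [inner_self_eq_norm_sq_to_K]; norm_cast
  simp only [this]
  rw [integral_complex_ofReal, Complex.ofReal_re]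

theorem diamS_pos {K : Finset (Vec d)} (hK : 1 < K.card) : 0 < diamS K := by
  obtain ⟨a, ha, b, hb, hab⟩ := Finset.one_lt_card.1 hK
  have hs := subset_convexHull ℝ (K : Set (Vec d))
  refine (dist_pos.2 hab).trans_le ?_
  exact Metric.dist_le_diam_of_mem (isCompact_hull K).isBounded (hs ha) (hs hb)

namespace Mesh

variable {S : HelmholtzData d} (M : Mesh S)

theorem diamK_pos (hd : 1 ≤ d) {K : Finset (Vec d)} (hK : K ∈ M.T) : 0 < diamS K :=
  diamS_pos (by rw [M.card_eq K hK]; omega)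

/-- A face has `d` vertices; in dimension one it would be a point of zero diameter and the Robin
weights would degenerate. -/
theorem diamF_pos (hd : 2 ≤ d) {F : Finset (Vec d)} (hF : F ∈ facesOf M.T) : 0 < diamS F :=
  diamS_pos (by rw [M.card_face hF]; omega)

/-- The weight of the mass term of `dagNorm`. -/
noncomputable def cellWeight (K : Finset (Vec d)) : ℝ :=
  max 1 (S.ω ^ 2 * diamS K ^ 2 / M.ϑK K ^ 2) * (M.αK K / diamS K ^ 2)

/-- The weight of the Robin term of `dagNorm`. -/
noncomputable def faceWeight (F : Finset (Vec d)) : ℝ :=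
  max 1 (S.ω * diamS F / M.ϑF F) * (M.αF F / diamS F)

theorem cellWeight_pos (hd : 1 ≤ d) {K : Finset (Vec d)} (hK : K ∈ M.T) : 0 < M.cellWeight K := by
  have := M.diamK_pos hd hK
  have := M.αK_pos hK
  have : 0 < max 1 (S.ω ^ 2 * diamS K ^ 2 / M.ϑK K ^ 2) := lt_max_of_lt_left one_pos
  unfold cellWeight
  positivity

theorem faceWeight_pos (hd : 2 ≤ d) {F : Finset (Vec d)} (hF : F ∈ facesOf M.T) :
    0 < M.faceWeight F := by
  have := M.diamF_pos hd hF
  have := M.αF_pos hF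
  have : 0 < max 1 (S.ω * diamS F / M.ϑF F) := lt_max_of_lt_left one_pos
  unfold faceWeight
  positivity

/-- The entry 1 of the maximum makes the mass weight dominate the inverse of the divergence weight,
which is what the duality of `dagNorm` and `dagDivNorm` needs. -/
theorem one_le_cellWeight_mul (hd : 1 ≤ d) {K : Finset (Vec d)} (hK : K ∈ M.T) :
    1 ≤ M.cellWeight K * (diamS K ^ 2 / M.αK K) := by
  have h1 := M.diamK_pos hd hK
  have h2 := M.αK_pos hK
  rw [cellWeight, mul_assoc, div_mul_div_cancel₀ (by positivity), div_self h2.ne', mul_one]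
  exact le_max_left _ _

theorem one_le_faceWeight_mul (hd : 2 ≤ d) {F : Finset (Vec d)} (hF : F ∈ facesOf M.T) :
    1 ≤ M.faceWeight F * (diamS F / M.αF F) := by
  have h1 := M.diamF_pos hd hF
  have h2 := M.αF_pos hF
  rw [faceWeight, mul_assoc, div_mul_div_cancel₀ h1.ne', div_self h2.ne', mul_one]
  exact le_max_left _ _

/-- The other entry of the maximum, times `α_K / h_K ^ 2`, is exactly `ω ^ 2 μ_K`; hence `dagNorm`
dominates the broken energy norm. -/
theorem le_cellWeight (hd : 1 ≤ d) {K : Finset (Vec d)} (hK : K ∈ M.T) :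
    S.ω ^ 2 * M.μK K ≤ M.cellWeight K := by
  have h1 := M.diamK_pos hd hK
  have h2 := M.αK_pos hK
  have h3 := M.μK_pos hK
  refine le_trans (le_of_eq ?_) (mul_le_mul_of_nonneg_right (le_max_right _ _) (by positivity))
  rw [ϑK, Real.sq_sqrt (by positivity)]
  field_simp

theorem le_faceWeight (hd : 2 ≤ d) {F : Finset (Vec d)} (hF : F ∈ M.facesR) :
    S.ω * M.γF F ≤ M.faceWeight F := by
  have h1 := M.diamF_pos hd (M.facesR_subset hF)
  have h2 := M.αF_pos (M.facesR_subset hF)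
  have h3 := M.γF_pos hF
  refine le_trans (le_of_eq ?_) (mul_le_mul_of_nonneg_right (le_max_right _ _) (by positivity))
  rw [ϑF]
  field_simp

variable {M}

theorem re_ipG (p : ℕ) (v : Vec d → ℂ) {K : Finset (Vec d)} (hK : K ∈ M.T) :
    (M.ipG p K v v).re
      = ∫ x in hull K, ‖matVec (S.rootP (M.pieceOf K)) (M.dgrad p K v x)‖ ^ 2 := by
  rw [← re_integral_inner_self, ipG]
  congr 1
  refine integral_congr_ae ?_
  filter_upwards [M.ae_A_eq hK] with x hx
  rw [hx, (S.rootP_spec (M.pieceOf_spec hK).1).2, sesq_transpose_mul]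

theorem re_ipG_nonneg (p : ℕ) (v : Vec d → ℂ) {K : Finset (Vec d)} (hK : K ∈ M.T) :
    0 ≤ (M.ipG p K v v).re := by
  rw [re_ipG p v hK]
  exact integral_nonneg fun x => sq_nonneg _

theorem re_sesq_inv (σ : Vec d → CVec d) {K : Finset (Vec d)} (hK : K ∈ M.T) :
    (∫ x in hull K, sesq (S.A x)⁻¹ (σ x) (σ x)).re
      = ∫ x in hull K, ‖matVec (S.rootP (M.pieceOf K))⁻¹.transpose (σ x)‖ ^ 2 := by
  rw [← re_integral_inner_self]
  congr 1
  refine integral_congr_ae ?_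
  filter_upwards [M.ae_A_eq hK] with x hx
  rw [hx, (S.rootP_spec (M.pieceOf_spec hK).1).2, sesq_inv]

theorem re_sesq_inv_nonneg (σ : Vec d → CVec d) {K : Finset (Vec d)} (hK : K ∈ M.T) :
    0 ≤ (∫ x in hull K, sesq (S.A x)⁻¹ (σ x) (σ x)).re := by
  rw [re_sesq_inv σ hK]
  exact integral_nonneg fun x => sq_nonneg _

theorem norm_integral_dgrad_le (p : ℕ) {v : Vec d → ℂ} (hv : M.Traced v) {σ : Vec d → CVec d}
    {K : Finset (Vec d)} (hK : K ∈ M.T) (hσ : MemLp σ 2 (volume.restrict (hull K))) :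
    ‖∫ x in hull K, ∑ i, M.dgrad p K v x i * conj (σ x i)‖
      ≤ √(M.ipG p K v v).re * √(∫ x in hull K, sesq (S.A x)⁻¹ (σ x) (σ x)).re := by
  have hB := (S.rootP_spec (M.pieceOf_spec hK).1).1
  have h := norm_integral_inner_le
    ((matVecL (S.rootP (M.pieceOf K))).comp_memLp' (hv.memLp_dgrad p hK))
    ((matVecL (S.rootP (M.pieceOf K))⁻¹.transpose).comp_memLp' hσ)
  rw [re_ipG p v hK, re_sesq_inv σ hK]
  refine le_trans (le_of_eq ?_) h
  rw [← RCLike.norm_conj, ← integral_conj]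
  congr 2
  ext x
  rw [Function.comp_apply, Function.comp_apply, matVecL_apply, matVecL_apply,
    ← inner_eq_inner_matVec hB, ← cinner_eq, inner_conj_symm]

/-! ### The mesh-dependent norms -/

/-- Cauchy–Schwarz on each element and Robin face, with mutually dual weights: function against
divergence, `A`-norm of the discrete gradient against `A⁻¹`-norm of the field, Robin trace against
normal trace. -/
theorem norm_hdivForm_le (hd : 2 ≤ d) (p : ℕ) {v : Vec d → ℂ} (hv : M.Traced v)
    {σ : Vec d → CVec d} (hσ : S.XdivN σ) :
    ‖M.hdivForm p v σ‖ ≤ M.dagNorm p v * M.dagDivNorm σ := by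
  have hd1 : 1 ≤ d := by omega
  have i1 := integrable_conj_mul hv.1 (XdivN.hasWeakDiv hσ).1
  have i2 := integrable_sum_conj_mul (hv.memLp_gradG (p := p)) hσ.1
  have nt := (XdivN.hasNormalTrace hσ).1
  have i3 := integrable_conj_mul (hv.memLp_trR hd1) nt
  have e1 : (∫ x in S.Ω, v x * conj (weakDiv S.Ω σ x))
        + (∫ x in S.Ω, ∑ i, M.gradG p v x i * conj (σ x i))
      = ∑ K ∈ M.T, ((∫ x in hull K, v x * conj (weakDiv S.Ω σ x))
        + ∫ x in hull K, ∑ i, M.dgrad p K v x i * conj (σ x i)) := by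
    have i1' := fun K hK => i1.mono_measure (M.restrict_hull_le (K := K) hK)
    have i2' := fun K hK => i2.mono_measure (M.restrict_hull_le (K := K) hK)
    rw [M.restrict_Ω, integral_finsetSum_measure i1', integral_finsetSum_measure i2',
      Finset.sum_add_distrib]
    congr 1
    refine Finset.sum_congr rfl fun K hK => integral_congr_ae ?_
    filter_upwards [M.gradG_ae_eq p v hK] with x hx
    rw [hx]
  have e3 : -∫ x in S.ΓR, M.trR v x * conj (S.normalTrace σ x) ∂(surf d)
      = ∑ F ∈ M.facesR,
        -∫ x in hull F, M.traceF F v x * conj (S.normalTrace σ x) ∂(surf d) := by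
    rw [M.restrict_ΓR hd1] at i3 ⊢
    rw [integral_finsetSum_measure, Finset.sum_neg_distrib]
    · congr 1
      refine Finset.sum_congr rfl fun F hF => integral_congr_ae ?_
      filter_upwards [M.trR_ae_eq v hF] with x hx
      rw [hx]
    · exact fun F hF => i3.mono_measure (Finset.single_le_sum
        (f := fun K => (surf d).restrict (hull K)) (fun _ _ => Measure.zero_le _) hF)
  have wK : ∀ K ∈ M.T, 0 ≤ M.cellWeight K * ∫ x in hull K, ‖v x‖ ^ 2 := fun K hK =>
    mul_nonneg (M.cellWeight_pos hd1 hK).le (integral_nonneg fun x => sq_nonneg _)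
  have wK' : ∀ K ∈ M.T, 0 ≤ diamS K ^ 2 / M.αK K * ∫ x in hull K, ‖weakDiv S.Ω σ x‖ ^ 2 :=
    fun K hK => mul_nonneg (div_nonneg (sq_nonneg _) (M.αK_pos hK).le)
      (integral_nonneg fun x => sq_nonneg _)
  have wF : ∀ F ∈ M.facesR,
      0 ≤ M.faceWeight F * ∫ x in hull F, ‖M.traceF F v x‖ ^ 2 ∂(surf d) := fun F hF =>
    mul_nonneg (M.faceWeight_pos hd (M.facesR_subset hF)).le (integral_nonneg fun x => sq_nonneg _)
  have wF' : ∀ F ∈ M.facesR,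
      0 ≤ diamS F / M.αF F * ∫ x in hull F, ‖S.normalTrace σ x‖ ^ 2 ∂(surf d) := fun F hF =>
    mul_nonneg (div_nonneg (M.diamF_pos hd (M.facesR_subset hF)).le
      (M.αF_pos (M.facesR_subset hF)).le) (integral_nonneg fun x => sq_nonneg _)
  rw [hdivForm, sub_eq_add_neg, e1, e3]
  refine norm_add_le_sqrt_mul_sqrt ?_ ?_ ?_ ?_ ?_ ?_
  · exact Finset.sum_nonneg fun K hK => add_nonneg (wK K hK) (re_ipG_nonneg p v hK)
  · exact Finset.sum_nonneg fun K hK => add_nonneg (re_sesq_inv_nonneg σ hK) (wK' K hK)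
  · exact Finset.sum_nonneg wF
  · exact Finset.sum_nonneg wF'
  · refine norm_sum_le_sqrt_mul_sqrt _ (fun K hK => add_nonneg (wK K hK) (re_ipG_nonneg p v hK))
      (fun K hK => add_nonneg (re_sesq_inv_nonneg σ hK) (wK' K hK)) fun K hK => ?_
    rw [add_comm (∫ x in hull K, sesq (S.A x)⁻¹ (σ x) (σ x)).re]
    refine norm_add_le_sqrt_mul_sqrt (wK K hK) (wK' K hK) (re_ipG_nonneg p v hK)
      (re_sesq_inv_nonneg σ hK) ?_ ?_
    · exact norm_integral_mul_conj_le (M.memLp_Ω_iff.1 hv.1 K hK)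
        (M.memLp_Ω_iff.1 (XdivN.hasWeakDiv hσ).1 K hK) (M.cellWeight_pos hd1 hK)
        (div_nonneg (sq_nonneg _) (M.αK_pos hK).le) (M.one_le_cellWeight_mul hd1 hK)
    · exact norm_integral_dgrad_le p hv hK (M.memLp_Ω_iff.1 hσ.1 K hK)
  · refine norm_sum_le_sqrt_mul_sqrt _ wF wF' fun F hF => ?_
    have hF' := M.facesR_subset hF
    rw [norm_neg]
    exact norm_integral_mul_conj_le (hv.memLp_traceF hF')
      ((M.memLp_ΓR_iff hd1).1 nt F hF) (M.faceWeight_pos hd hF')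
      (div_nonneg (M.diamF_pos hd hF').le (M.αF_pos hF').le) (M.one_le_faceWeight_mul hd hF')

theorem re_ipμ_eq {v : Vec d → ℂ} (hv : MemLp v 2 (volume.restrict S.Ω)) :
    (S.ipμ v v).re = ∑ K ∈ M.T, M.μK K * ∫ x in hull K, ‖v x‖ ^ 2 := by
  have hi : Integrable (fun x => (S.μ x : ℂ) * v x * conj (v x)) (volume.restrict S.Ω) :=
    integrable_conj_mul (M.memLp_μ id hv) hv
  have hi' := fun K hK => hi.mono_measure (M.restrict_hull_le (K := K) hK)
  rw [HelmholtzData.ipμ, M.restrict_Ω, integral_finsetSum_measure hi', Complex.re_sum]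
  refine Finset.sum_congr rfl fun K hK => ?_
  rw [← integral_const_mul, ← Complex.ofReal_re (∫ x in hull K, _), ← integral_complex_ofReal]
  congr 1
  refine integral_congr_ae ?_
  filter_upwards [M.ae_μ_eq hK] with x hx
  rw [hx, mul_assoc, Complex.mul_conj, Complex.normSq_eq_norm_sq, ← Complex.ofReal_mul]

theorem re_ipγ_eq (v : Vec d → ℂ) : (M.ipγ v v).re
    = ∑ F ∈ M.facesR, M.γF F * ∫ x in hull F, ‖M.traceF F v x‖ ^ 2 ∂(surf d) := by
  rw [ipγ, Complex.re_sum]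
  refine Finset.sum_congr rfl fun F hF => ?_
  rw [← integral_const_mul, ← Complex.ofReal_re (∫ x in hull F, _ ∂(surf d)),
    ← integral_complex_ofReal]
  congr 1
  refine integral_congr_ae ?_
  filter_upwards [M.ae_γ_eq hF] with x hx
  rw [hx, mul_assoc, Complex.mul_conj, Complex.normSq_eq_norm_sq, ← Complex.ofReal_mul]

theorem Traced.energyNorm_le_dagNorm (hd : 2 ≤ d) (p : ℕ) {v : Vec d → ℂ} (hv : M.Traced v) :
    M.energyNorm p v ≤ M.dagNorm p v := by
  refine Real.sqrt_le_sqrt ?_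
  rw [re_ipμ_eq hv.1, re_ipγ_eq, Finset.sum_add_distrib, Finset.mul_sum, Finset.mul_sum]
  have h1 : ∑ K ∈ M.T, S.ω ^ 2 * (M.μK K * ∫ x in hull K, ‖v x‖ ^ 2)
      ≤ ∑ K ∈ M.T, M.cellWeight K * ∫ x in hull K, ‖v x‖ ^ 2 := by
    refine Finset.sum_le_sum fun K hK => ?_
    rw [← mul_assoc]
    exact mul_le_mul_of_nonneg_right (M.le_cellWeight (by omega) hK)
      (integral_nonneg fun x => sq_nonneg _)
  have h2 : ∑ F ∈ M.facesR, S.ω * (M.γF F * ∫ x in hull F, ‖M.traceF F v x‖ ^ 2 ∂(surf d))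
      ≤ ∑ F ∈ M.facesR, M.faceWeight F * ∫ x in hull F, ‖M.traceF F v x‖ ^ 2 ∂(surf d) := by
    refine Finset.sum_le_sum fun F hF => ?_
    rw [← mul_assoc]
    exact mul_le_mul_of_nonneg_right (M.le_faceWeight hd hF)
      (integral_nonneg fun x => sq_nonneg _)
  exact (add_le_add (add_le_add h1 h2) le_rfl).trans_eq (add_right_comm _ _ _)

theorem Traced.norm_gradL2_le (hd : 1 ≤ d) (p : ℕ) {v : Vec d → ℂ} (hv : M.Traced v) :
    ‖S.gradL2 (M.gradG p v)‖ ≤ M.energyNorm p v := by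
  rw [hv.energyNorm_eq hd, ← sq_le_sq₀ (norm_nonneg _) (norm_nonneg _), embed,
    WithLp.prod_norm_sq_eq_of_L2, WithLp.prod_norm_sq_eq_of_L2]
  simp only [WithLp.toLp_fst, WithLp.toLp_snd]
  nlinarith [sq_nonneg ‖S.massL2 v‖, sq_nonneg ‖S.robinL2 (M.trR v)‖]

/-! ### Adjoint fluxes -/

theorem Traced.helmForm_embed (hd : 1 ≤ d) {p : ℕ} {v w : Vec d → ℂ} (hv : M.Traced v)
    (hw : M.Traced w) : helmForm (M.embed p v) (M.embed p w)
      = -(S.ω : ℂ) ^ 2 * S.ipμ v w - Complex.I * S.ω * S.ipγ (M.trR v) (M.trR w)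
        + S.ipA (M.gradG p v) (M.gradG p w) := by
  simp only [helmForm, embed, WithLp.toLp_fst, WithLp.toLp_snd]
  rw [inner_massL2 M hw.1 hv.1, inner_robinL2 M hd (hw.memLp_trR hd) (hv.memLp_trR hd),
    inner_gradL2 M hw.memLp_gradG hv.memLp_gradG]
  ring

theorem sum_mul_conj_matVec {B : Matrix (Fin d) (Fin d) ℝ} (hB : B.IsSymm) (w z : CVec d) :
    ∑ i, w i * conj (matVec B z i) = sesq B w z := by
  rw [← Complex.conj_conj (sesq B w z), sesq_conj_symm hB, _root_.map_sum]
  refine Finset.sum_congr rfl fun i _ => ?_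
  rw [map_mul, Complex.conj_conj, mul_comm]

/-- Testing the flux of an adjoint solution with a nonconforming function. -/
theorem Traced.hdivForm_flux (hd : 1 ≤ d) (p : ℕ) {v : Vec d → ℂ} (hv : M.Traced v)
    {ξ F0 F1 : Vec d → ℂ} (hξ : S.H1D ξ)
    (hF0 : MemLp F0 2 (volume.restrict S.Ω)) (hF1 : MemLp F1 2 ((surf d).restrict S.ΓR))
    (h : ∀ w, S.H1D w → S.b w ξ = (∫ x in S.Ω, w x * conj (F0 x))
      + ∫ x in S.ΓR, trace S.Ω w x * conj (F1 x) ∂(surf d)) :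
    M.hdivForm p v (S.flux ξ) = helmForm (M.embed p v) (M.embed p ξ)
      - ((∫ x in S.Ω, v x * conj (F0 x))
        + ∫ x in S.ΓR, M.trR v x * conj (F1 x) ∂(surf d)) := by
  obtain ⟨-, hD, hN⟩ := flux_spec M hd hξ hF0 hF1 h
  have htξ := M.memLp_trace hd hξ
  have hμξ : MemLp (fun x => (S.ω : ℂ) ^ 2 * ((S.μ x : ℂ) * ξ x)) 2 (volume.restrict S.Ω) :=
    (M.memLp_μ id hξ.1.1).const_mul _
  have hγξ : MemLp (fun x => Complex.I * S.ω * ((S.γ x : ℂ) * trace S.Ω ξ x)) 2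
      ((surf d).restrict S.ΓR) := (M.memLp_γ hd id htξ).const_mul _
  have e1 : ∫ x in S.Ω, v x * conj (weakDiv S.Ω (S.flux ξ) x)
      = -(∫ x in S.Ω, v x * conj (F0 x)) - (S.ω : ℂ) ^ 2 * S.ipμ v ξ := by
    have i0 : Integrable (fun x => v x * conj (F0 x)) (volume.restrict S.Ω) :=
      integrable_conj_mul hv.1 hF0
    have i1 : Integrable (fun x => (S.ω : ℂ) ^ 2 * ((S.μ x : ℂ) * v x * conj (ξ x)))
        (volume.restrict S.Ω) :=
      (integrable_conj_mul (M.memLp_μ id hv.1) hξ.1.1).const_mul _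
    rw [HelmholtzData.ipμ, ← integral_const_mul, ← neg_add', ← integral_add i0 i1, ← integral_neg]
    refine integral_congr_ae ?_
    filter_upwards [hD] with x hx
    simp only [hx, map_neg, map_add, map_mul, map_pow, Complex.conj_ofReal]
    ring
  have e2 : ∫ x in S.Ω, ∑ i, M.gradG p v x i * conj (S.flux ξ x i)
      = S.ipA (M.gradG p v) (M.gradG p ξ) := by
    refine integral_congr_ae ?_
    filter_upwards [M.ae_A_symm, gradG_conforming (M := M) hd p hξ] with x h1 h2
    rw [h2]
    exact sum_mul_conj_matVec h1 _ _
  have e3 : ∫ x in S.ΓR, M.trR v x * conj (S.normalTrace (S.flux ξ) x) ∂(surf d)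
      = (∫ x in S.ΓR, M.trR v x * conj (F1 x) ∂(surf d))
        + Complex.I * S.ω * S.ipγ (M.trR v) (M.trR ξ) := by
    have i0 : Integrable (fun x => M.trR v x * conj (F1 x)) ((surf d).restrict S.ΓR) :=
      integrable_conj_mul (hv.memLp_trR hd) hF1
    have i1 : Integrable (fun x => Complex.I * S.ω * ((S.γ x : ℂ) * M.trR v x * conj (M.trR ξ x)))
        ((surf d).restrict S.ΓR) :=
      (integrable_conj_mul (M.memLp_γ hd id (hv.memLp_trR hd))
        ((M.traced_of_H1D hd hξ).memLp_trR hd)).const_mul _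
    rw [HelmholtzData.ipγ, ← integral_const_mul, ← integral_add i0 i1]
    refine integral_congr_ae ?_
    filter_upwards [hN, trR_conforming (M := M) hd hξ] with x h1 h2
    simp only [h1, h2, map_sub, map_mul, Complex.conj_I, Complex.conj_ofReal]
    ring
  rw [hdivForm, e1, e2, e3, hv.helmForm_embed hd (M.traced_of_H1D hd hξ)]
  ring

end Mesh

end IPDG

/-! ### The residual, the projections and the duality argument. -/

namespace IPDG
open Measure Set
open scoped Classical
variable {d : ℕ}

namespace Mesh

variable {S : HelmholtzData d}

/-! ### Linearity -/

theorem helmForm_add_right (x y z : EnergySpace S) :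
    helmForm x (y + z) = helmForm x y + helmForm x z := by
  simp only [← inner_helmOp, inner_add_left]

theorem helmForm_sub_right (x y z : EnergySpace S) :
    helmForm x (y - z) = helmForm x y - helmForm x z := by
  simp only [← inner_helmOp, inner_sub_left]

theorem helmForm_sub_left (x y z : EnergySpace S) :
    helmForm (x - y) z = helmForm x z - helmForm y z := by
  simp only [← inner_helmOp, map_sub, inner_sub_right]

theorem helmForm_smul_right (c : ℂ) (x y : EnergySpace S) :
    helmForm x (c • y) = conj c * helmForm x y := by
  simp only [← inner_helmOp, inner_smul_left]

variable {M : Mesh S}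

theorem Traced.sub {v w : Vec d → ℂ} (hv : M.Traced v) (hw : M.Traced w) : M.Traced (v - w) := by
  have := hv.add (hw.smul (-1))
  rwa [neg_one_smul, ← sub_eq_add_neg] at this

theorem Traced.embed_sub (hd : 1 ≤ d) {p : ℕ} {v w : Vec d → ℂ} (hv : M.Traced v)
    (hw : M.Traced w) : M.embed p (v - w) = M.embed p v - M.embed p w := by
  have h := (hv.sub hw).embed_add hd (p := p) hw
  rw [sub_add_cancel] at h
  rw [h, add_sub_cancel_right]

theorem Traced.bh_conforming (hd : 1 ≤ d) {p : ℕ} (st : Stabilization M) {v w : Vec d → ℂ}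
    (hv : M.Traced v) (hw : S.H1D w) : bh p st v w = helmForm (M.embed p v) (M.embed p w) := by
  rw [hv.bh_eq hd st (M.traced_of_H1D hd hw), st.conforming_right v w hv.brokenH1 hw, add_zero]

/-! ### The residual -/

/-- A bump function with support in `Ω` has nonzero gradient: otherwise it would be constant on the
whole space, although it is 1 at a point of `Ω` and 0 outside the bounded set `Ω`. The supremum in
`Rr` therefore has competitors. -/
theorem exists_gradL2_ne_zero (M : Mesh S) (hd : 1 ≤ d) (p : ℕ) :
    ∃ v, S.H1D v ∧ S.gradL2 (M.gradG p v) ≠ 0 := by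
  obtain ⟨x₀, hx₀⟩ := S.lipschitz.2.1.nonempty
  obtain ⟨η, h1, h2, h3, -, h5⟩ := exists_contDiff_tsupport_subset (n := ⊤)
    (S.lipschitz.1.mem_nhds hx₀)
  have hη : IsTest S.Ω η := ⟨h3, h2, h1⟩
  have hzero : ∀ x ∈ S.ΓD, (η x : ℂ) = 0 := fun x hx => by
    have hx' := S.ΓD_subset hx
    rw [S.lipschitz.1.frontier_eq] at hx'
    rw [hη.eq_zero hx'.2, Complex.ofReal_zero]
  obtain ⟨c1, c2, -⟩ := M.smooth_conforming hd (contDiff_ofReal_comp h3) hzero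
  refine ⟨_, c1, fun h0 => ?_⟩
  have hg : classicalGrad (fun x => (η x : ℂ)) =ᵐ[volume.restrict S.Ω] 0 := by
    obtain ⟨C, hC⟩ := M.exists_le_grad
    have hc := coeFn_toL2 (M.memLp_rootA ((M.traced_of_H1D hd c1).memLp_gradG (p := p)))
    rw [HelmholtzData.gradL2] at h0
    rw [h0] at hc
    filter_upwards [hC, hc, Lp.coeFn_zero (CVec d) 2 (volume.restrict S.Ω),
      gradG_conforming (M := M) hd p c1, c2] with x h1 h2 h3 h4 h5
    have := h1 (M.gradG p (fun x => (η x : ℂ)) x)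
    rw [← h2, h3, Pi.zero_apply, norm_zero, mul_zero] at this
    rw [← h5, ← h4, Pi.zero_apply]
    exact norm_le_zero_iff.1 this
  have hdiff : Differentiable ℝ η := h3.differentiable (by simp)
  have hcg : Continuous (classicalGrad fun x => (η x : ℂ)) :=
    continuous_classicalGrad ((contDiff_ofReal_comp h3).of_le (by simp))
  have he := eqOn_open_of_ae_eq hg S.lipschitz.1 hcg.continuousOn continuousOn_const
  have hp : ∀ x i, pderiv η i x = 0 := fun x i => by
    by_cases hx : x ∈ S.Ω
    · have h := congrArg (fun w : CVec d => w i) (he hx)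
      simp only [classicalGrad_ofReal hdiff] at h
      exact Complex.ofReal_eq_zero.1 h
    · exact hη.pderiv_eq_zero i hx
  have hf : ∀ x, fderiv ℝ η x = 0 := fun x => by
    ext w
    rw [fderiv_apply_eq_sum]
    simp [hp]
  have : Nonempty (Fin d) := ⟨⟨0, hd⟩⟩
  obtain ⟨y, hy⟩ : ∃ y, y ∉ S.Ω := by
    by_contra! h
    exact NormedSpace.unbounded_univ ℝ (Vec d)
      (S.lipschitz.2.2.1.subset fun x _ => h x)
  have := is_const_of_fderiv_eq_zero hdiff hf x₀ y
  rw [h5, hη.eq_zero hy] at this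
  exact one_ne_zero this

theorem ipA_weakGrad_self (hd : 1 ≤ d) (p : ℕ) {w : Vec d → ℂ} (hw : S.H1D w) :
    S.ipA (weakGrad S.Ω w) (weakGrad S.Ω w) = ((‖(M.embed p w).snd.snd‖ ^ 2 : ℝ) : ℂ) := by
  have ht := M.traced_of_H1D hd hw
  rw [M.ipA_conforming hd p hw hw, ← inner_gradL2 M ht.memLp_gradG ht.memLp_gradG,
    inner_self_eq_norm_sq_to_K]
  norm_cast

/-- The residual of conforming functions is controlled by their gradient. -/
theorem norm_residual_le (hd : 1 ≤ d) {p : ℕ} {st : Stabilization M} {u uh : Vec d → ℂ}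
    (he : M.Traced (u - uh)) (hr : Rr p st u uh ≠ ⊤) {w : Vec d → ℂ} (hw : S.H1D w) :
    ‖helmForm (M.embed p (u - uh)) (M.embed p w)‖
      ≤ (Rr p st u uh).toReal * ‖(M.embed p w).snd.snd‖ := by
  set x := M.embed p (u - uh)
  set r := (Rr p st u uh).toReal
  have unit : ∀ v, S.H1D v → ‖(M.embed p v).snd.snd‖ = 1 → ‖helmForm x (M.embed p v)‖ ≤ r := by
    intro v hv hn
    have h1 : S.ipA (weakGrad S.Ω v) (weakGrad S.Ω v) = 1 := by
      rw [ipA_weakGrad_self (M := M) hd p hv, hn]; norm_num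
    have h2 : ENNReal.ofReal ‖bh p st (u - uh) v‖ ≤ Rr p st u uh :=
      le_iSup₂ (f := fun v (_ : S.H1D v ∧ S.ipA (weakGrad S.Ω v) (weakGrad S.Ω v) = 1) =>
        ENNReal.ofReal ‖bh p st (u - uh) v‖) v ⟨hv, h1⟩
    rw [he.bh_conforming hd st hv] at h2
    exact (ENNReal.ofReal_le_iff_le_toReal hr).1 h2
  have pos : ∀ v, S.H1D v → (M.embed p v).snd.snd ≠ 0 → ∃ v', S.H1D v' ∧
      M.embed p v' = ((‖(M.embed p v).snd.snd‖⁻¹ : ℝ) : ℂ) • M.embed p v ∧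
      ‖(M.embed p v').snd.snd‖ = 1 := by
    intro v hv h0
    have e := (M.traced_of_H1D hd hv).embed_smul hd (p := p)
      ((‖(M.embed p v).snd.snd‖⁻¹ : ℝ) : ℂ)
    refine ⟨_, hv.smul _, e, ?_⟩
    rw [e, WithLp.smul_snd, WithLp.smul_snd, norm_smul, Complex.norm_real, norm_inv, norm_norm]
    exact inv_mul_cancel₀ (norm_ne_zero_iff.2 h0)
  -- A gradient-free `w`, such as a constant when `ΓD` is empty, cannot be normalised. Adding
  -- multiples `n • w` to a competitor `v'` of unit gradient keeps it a competitor, so `n` times the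
  -- residual at `w` is bounded in `n`, and the residual at `w` is zero.
  by_cases h0 : (M.embed p w).snd.snd = 0
  · rw [h0, norm_zero, mul_zero]
    obtain ⟨v, hv, hv0⟩ := M.exists_gradL2_ne_zero hd p
    obtain ⟨v', hv', -, hn⟩ := pos v hv hv0
    have key : ∀ n : ℕ, n * ‖helmForm x (M.embed p w)‖ ≤ r + ‖helmForm x (M.embed p v')‖ := by
      intro n
      have e : M.embed p (v' + (n : ℂ) • w) = M.embed p v' + (n : ℂ) • M.embed p w := by
        rw [(M.traced_of_H1D hd hv').embed_add hd ((M.traced_of_H1D hd hw).smul _),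
          (M.traced_of_H1D hd hw).embed_smul hd]
      have h := unit _ (hv'.add (hw.smul (n : ℂ))) (by
        rw [e, WithLp.add_snd, WithLp.add_snd, WithLp.smul_snd, WithLp.smul_snd, h0, smul_zero,
          add_zero, hn])
      rw [e, helmForm_add_right, helmForm_smul_right] at h
      have h2 := norm_le_add_norm_add (conj (n : ℂ) * helmForm x (M.embed p w))
        (helmForm x (M.embed p v'))
      rw [norm_mul, RCLike.norm_conj, Complex.norm_natCast, add_comm (_ * _)] at h2
      linarith
    by_contra! hlt
    obtain ⟨n, hn⟩ := exists_nat_gt ((r + ‖helmForm x (M.embed p v')‖)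
      / ‖helmForm x (M.embed p w)‖)
    rw [div_lt_iff₀ hlt] at hn
    exact absurd (key n) (not_le.2 hn)
  · obtain ⟨v, hv, e, hn⟩ := pos w hw h0
    have h := unit v hv hn
    rw [e, helmForm_smul_right, norm_mul, RCLike.norm_conj, Complex.norm_real, norm_inv,
      norm_norm, inv_mul_le_iff₀ (norm_pos_iff.2 h0)] at h
    linarith

/-! ### Projections -/

/-- The estimate uses only that the projections belong to their spaces, never their minimality. The
default value 0 belongs to them too, so existence of minimisers plays no role. -/
theorem argmin_mem {X : Type*} [Zero X] {V : X → Prop} (J : X → ℝ) (h0 : V 0) :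
    V (argmin V J) := by
  unfold argmin
  split_ifs with h
  exacts [h.choose_spec.1, h0]

theorem πg_mem (M : Mesh S) (p : ℕ) (v : Vec d → ℂ) : S.H1D (M.πg p v) :=
  argmin_mem _ S.H1D_zero

theorem πhg_mem (M : Mesh S) (p : ℕ) (v : Vec d → ℂ) :
    M.IsDiscrete p (M.πhg p v) ∧ S.H1D (M.πhg p v) :=
  argmin_mem (V := fun vh => M.IsDiscrete p vh ∧ S.H1D vh) _
    ⟨fun K _ => ⟨0, by simp, Eventually.of_forall fun x => by simp [evalP_zero]⟩, S.H1D_zero⟩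

theorem πhd_mem (M : Mesh S) (p : ℕ) (w : Vec d → CVec d) :
    M.IsDiscreteVec p (M.πhd p w) ∧ S.XdivN (M.πhd p w) :=
  argmin_mem (V := fun wh => M.IsDiscreteVec p wh ∧ S.XdivN wh) _
    ⟨fun K _ => ⟨0, by simp, Eventually.of_forall fun x => by
      ext i; simp [evalV_apply, evalP_zero]⟩, XdivN_zero S⟩

/-! ### Duality -/

/-- The functional `(v, F₀) + (v, F₁)`, with the second product over the Robin boundary. -/
noncomputable def dataForm (M : Mesh S) (F0 F1 v : Vec d → ℂ) : ℂ :=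
  (∫ x in S.Ω, v x * conj (F0 x)) + ∫ x in S.ΓR, M.trR v x * conj (F1 x) ∂(surf d)

theorem Traced.dataForm_add (hd : 1 ≤ d) {F0 F1 v w : Vec d → ℂ} (hv : M.Traced v)
    (hw : M.Traced w) (hF0 : MemLp F0 2 (volume.restrict S.Ω))
    (hF1 : MemLp F1 2 ((surf d).restrict S.ΓR)) :
    M.dataForm F0 F1 (v + w) = M.dataForm F0 F1 v + M.dataForm F0 F1 w := by
  have e0 : ∫ x in S.Ω, (v + w) x * conj (F0 x)
      = (∫ x in S.Ω, v x * conj (F0 x)) + ∫ x in S.Ω, w x * conj (F0 x) := by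
    rw [← integral_add (integrable_conj_mul hv.1 hF0) (integrable_conj_mul hw.1 hF0)]
    simp only [Pi.add_apply, add_mul]
  have e1 : ∫ x in S.ΓR, M.trR (v + w) x * conj (F1 x) ∂(surf d)
      = (∫ x in S.ΓR, M.trR v x * conj (F1 x) ∂(surf d))
        + ∫ x in S.ΓR, M.trR w x * conj (F1 x) ∂(surf d) := by
    rw [← integral_add (integrable_conj_mul (hv.memLp_trR hd) hF1)
      (integrable_conj_mul (hw.memLp_trR hd) hF1)]
    refine integral_congr_ae ?_
    filter_upwards [hv.trR_add hd hw] with x hx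
    rw [hx, Pi.add_apply, add_mul]
  rw [dataForm, e0, e1, dataForm, dataForm]
  ring

theorem dataForm_conforming (hd : 1 ≤ d) (F0 F1 : Vec d → ℂ) {w : Vec d → ℂ} (hw : S.H1D w) :
    M.dataForm F0 F1 w = (∫ x in S.Ω, w x * conj (F0 x))
      + ∫ x in S.ΓR, trace S.Ω w x * conj (F1 x) ∂(surf d) := by
  rw [dataForm]
  congr 1
  refine integral_congr_ae ?_
  filter_upwards [trR_conforming (M := M) hd hw] with x hx
  rw [hx]

/-- Duality estimate for the error of the scheme. -/
theorem norm_dataForm_le (hd : 2 ≤ d) {p : ℕ} {st : Stabilization M} {f u uh : Vec d → ℂ}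
    (hu : S.H1D u) (hu_eq : ∀ v, S.H1D v → S.b u v = ∫ x in S.Ω, f x * conj (v x))
    (huh : M.IsDiscrete p uh)
    (huh_eq : ∀ vh, M.IsDiscrete p vh → bh p st uh vh = ∫ x in S.Ω, f x * conj (vh x))
    (hr : Rr p st u uh ≠ ⊤) {ξ F0 F1 : Vec d → ℂ} (hξ : S.H1D ξ)
    (hF0 : MemLp F0 2 (volume.restrict S.Ω)) (hF1 : MemLp F1 2 ((surf d).restrict S.ΓR))
    (h : ∀ w, S.H1D w → S.b w ξ = (∫ x in S.Ω, w x * conj (F0 x))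
      + ∫ x in S.ΓR, trace S.Ω w x * conj (F1 x) ∂(surf d)) :
    ‖M.dataForm F0 F1 (u - uh)‖
      ≤ (Rr p st u uh).toReal * M.dagNorm p (ξ - M.πhg p ξ)
        + M.Rc p uh * M.dagDivNorm (S.flux ξ - M.πhd p (S.flux ξ)) := by
  have hd1 : 1 ≤ d := by omega
  have tu := M.traced_of_H1D hd1 hu
  have tuh := M.traced_of_isDiscrete hd1 huh
  have te := tu.sub tuh
  have hg := M.πg_mem p uh
  have tg := M.traced_of_H1D hd1 hg
  have tn := tuh.sub tg
  have tξ := M.traced_of_H1D hd1 hξ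
  obtain ⟨hhd, hhg⟩ := M.πhg_mem p ξ
  obtain ⟨hdd, hdg⟩ := M.πhd_mem p (S.flux ξ)
  have thg := M.traced_of_H1D hd1 hhg
  set e := u - uh with he
  set en := uh - M.πg p uh with hen
  -- The adjoint equation may only be tested with conforming functions, so the error is completed to
  -- one by the nonconforming part `en` of `uh`.
  have hsum : e + en = u - M.πg p uh := by rw [he, hen]; abel
  have hc : S.H1D (u - M.πg p uh) := hu.sub hg
  have ℓc : M.dataForm F0 F1 (u - M.πg p uh)
      = helmForm (M.embed p (u - M.πg p uh)) (M.embed p ξ) := by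
    rw [dataForm_conforming hd1 F0 F1 hc, ← h _ hc, M.b_eq hd1 p hc hξ]
  have flux := tn.hdivForm_flux hd1 p hξ hF0 hF1 h
  have hX := (flux_spec M hd1 hξ hF0 hF1 h).1
  have hsub := tn.hdivForm_sub hd1 p hX hdg
  rw [tn.hdivForm_discrete hd1 hdg hdd, sub_zero] at hsub
  -- Galerkin orthogonality against discrete conforming functions, for which the stabilisation
  -- vanishes.
  have galerkin : helmForm (M.embed p e) (M.embed p (M.πhg p ξ)) = 0 := by
    rw [he, tu.embed_sub hd1 tuh, helmForm_sub_left, ← M.b_eq hd1 p hu hhg,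
      ← tuh.bh_conforming hd1 st hhg, hu_eq _ hhg, huh_eq _ hhd, sub_self]
  -- The residual part tolerates subtraction of the conforming interpolant. The consistency defect
  -- of `en` is `hdivForm` at the flux of `ξ`, which tolerates subtraction of a discrete `H(div)`
  -- field.
  have split : M.dataForm F0 F1 e = helmForm (M.embed p e) (M.embed p (ξ - M.πhg p ξ))
      + M.hdivForm p en (S.flux ξ - M.πhd p (S.flux ξ)) := by
    have h1 := te.dataForm_add hd1 tn hF0 hF1
    rw [hsum, ℓc, ← hsum, te.embed_add hd1 tn] at h1
    rw [hsub, flux, tξ.embed_sub hd1 thg, helmForm_sub_right, galerkin, sub_zero]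
    have h2 : helmForm (M.embed p e + M.embed p en) (M.embed p ξ)
        = helmForm (M.embed p e) (M.embed p ξ) + helmForm (M.embed p en) (M.embed p ξ) := by
      simp only [← inner_helmOp, map_add, inner_add_right]
    rw [h2] at h1
    change _ = _ + (_ - M.dataForm F0 F1 en)
    linear_combination -h1
  rw [split]
  have r1 := norm_residual_le hd1 (st := st) te hr (hξ.sub hhg)
  have tξ' := M.traced_of_H1D hd1 (hξ.sub hhg)
  have r2 : ‖(M.embed p (ξ - M.πhg p ξ)).snd.snd‖ ≤ M.dagNorm p (ξ - M.πhg p ξ) :=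
    (tξ'.norm_gradL2_le hd1 p).trans (tξ'.energyNorm_le_dagNorm hd p)
  have r3 := norm_hdivForm_le hd p tn (XdivN.sub_spec M hd1 hX hdg).1
  exact (norm_add_le _ _).trans (add_le_add (r1.trans (mul_le_mul_of_nonneg_left r2
    ENNReal.toReal_nonneg)) r3)

end Mesh

end IPDG

/-! ### Approximation factors and the error estimate. -/

namespace IPDG
open Measure Set
open scoped Classical
variable {d : ℕ}

namespace Mesh

variable {S : HelmholtzData d} {M : Mesh S}

/-! ### The approximation factors -/

theorem ofReal_le_add_mul {a r x c y : ℝ} {g g' : ℝ≥0∞} (hr : 0 ≤ r) (hc : 0 ≤ c)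
    (h : a ≤ r * x + c * y) (hg : ENNReal.ofReal x ≤ g) (hg' : ENNReal.ofReal y ≤ g') :
    ENNReal.ofReal a ≤ ENNReal.ofReal r * g + ENNReal.ofReal c * g' :=
  calc ENNReal.ofReal a ≤ ENNReal.ofReal (r * x + c * y) := ENNReal.ofReal_le_ofReal h
    _ ≤ ENNReal.ofReal (r * x) + ENNReal.ofReal (c * y) := ENNReal.ofReal_add_le
    _ = ENNReal.ofReal r * ENNReal.ofReal x + ENNReal.ofReal c * ENNReal.ofReal y := by
      rw [ENNReal.ofReal_mul hr, ENNReal.ofReal_mul hc]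
    _ ≤ _ := by gcongr

/-- The dual datum is `e` itself divided by its `μ`-norm, that is `(ω / a) e` with `a = ω ‖e‖_μ`. It
is a competitor in the suprema, and the dual functional evaluated at `e` returns exactly `a`. -/
theorem ofReal_massL2_le (hd : 1 ≤ d) (hS : S.WellPosed) {p : ℕ} {e : Vec d → ℂ}
    (he : M.Traced e) {r c : ℝ} (hr : 0 ≤ r) (hc : 0 ≤ c)
    (H : ∀ ξ F0 F1 : Vec d → ℂ, S.H1D ξ → MemLp F0 2 (volume.restrict S.Ω) →
      MemLp F1 2 ((surf d).restrict S.ΓR) →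
      (∀ w, S.H1D w → S.b w ξ = (∫ x in S.Ω, w x * conj (F0 x))
        + ∫ x in S.ΓR, trace S.Ω w x * conj (F1 x) ∂(surf d)) →
      ‖M.dataForm F0 F1 e‖ ≤ r * M.dagNorm p (ξ - M.πhg p ξ)
        + c * M.dagDivNorm (S.flux ξ - M.πhd p (S.flux ξ))) :
    ENNReal.ofReal ‖S.massL2 e‖ ≤ ENNReal.ofReal r * M.gaΩg p + ENNReal.ofReal c * M.gaΩd p := by
  set a := ‖S.massL2 e‖ with ha
  by_cases h0 : a = 0
  · simp [h0]
  have hω : (S.ω : ℂ) ≠ 0 := Complex.ofReal_ne_zero.2 S.ω_pos.ne'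
  have haC : (a : ℂ) ≠ 0 := Complex.ofReal_ne_zero.2 h0
  have hself : inner ℂ (S.massL2 e) (S.massL2 e) = (a : ℂ) ^ 2 := inner_self_eq_norm_sq_to_K _
  set ψ : Vec d → ℂ := ((S.ω / a : ℝ) : ℂ) • e with hψ
  have hψm : MemLp ψ 2 (volume.restrict S.Ω) := he.1.const_smul _
  have e1 : S.ipμ ψ ψ = 1 := by
    have h := inner_massL2 M hψm hψm
    rw [hψ, massL2_smul M _ he.1, inner_smul_left, inner_smul_right, hself, Complex.conj_ofReal] at h
    refine mul_left_cancel₀ (pow_ne_zero 2 hω) (h.symm.trans ?_)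
    push_cast
    field_simp
  have e2 : (S.ω : ℂ) * S.ipμ e ψ = a := by
    have h := inner_massL2 M hψm he.1
    rw [hψ, massL2_smul M _ he.1, inner_smul_left, hself, Complex.conj_ofReal] at h
    refine mul_left_cancel₀ hω ?_
    rw [← mul_assoc, ← sq, ← h]
    push_cast
    field_simp
  obtain ⟨hξ, hb⟩ := uStar_spec M hd hS hψm
  have hF : ∀ w : Vec d → ℂ, ∫ x in S.Ω, w x * conj ((S.ω : ℂ) * ((S.μ x : ℂ) * ψ x))
      = S.ω * S.ipμ w ψ := fun w => by
    rw [HelmholtzData.ipμ, ← integral_const_mul]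
    refine integral_congr_ae (Eventually.of_forall fun x => ?_)
    simp only [map_mul, Complex.conj_ofReal]
    ring
  have h := H (S.uStar ψ) (fun x => (S.ω : ℂ) * ((S.μ x : ℂ) * ψ x)) 0 hξ
    ((M.memLp_μ id hψm).const_mul _) MemLp.zero fun w hw => by
      rw [hb w hw, hF]
      simp
  have hd : M.dataForm (fun x => (S.ω : ℂ) * ((S.μ x : ℂ) * ψ x)) 0 e = a := by
    rw [dataForm, hF, e2]
    simp
  rw [hd, Complex.norm_real, Real.norm_of_nonneg (norm_nonneg _)] at h
  exact ofReal_le_add_mul hr hc h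
    (le_iSup₂ (f := fun ψ (_ : M.UnitΩ ψ) =>
      ENNReal.ofReal (M.dagNorm p (S.uStar ψ - M.πhg p (S.uStar ψ)))) ψ ⟨hψm, e1⟩)
    (le_iSup₂ (f := fun ψ (_ : M.UnitΩ ψ) => ENNReal.ofReal
      (M.dagDivNorm (S.flux (S.uStar ψ) - M.πhd p (S.flux (S.uStar ψ))))) ψ ⟨hψm, e1⟩)

/-- The same argument on the Robin boundary, where `a = √ω ‖e‖_γ` and the normalised datum is `(√ω /
a)` times the trace of `e`. -/
theorem ofReal_robinL2_le (hd : 1 ≤ d) (hS : S.WellPosed) {p : ℕ} {e : Vec d → ℂ}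
    (he : M.Traced e) {r c : ℝ} (hr : 0 ≤ r) (hc : 0 ≤ c)
    (H : ∀ ξ F0 F1 : Vec d → ℂ, S.H1D ξ → MemLp F0 2 (volume.restrict S.Ω) →
      MemLp F1 2 ((surf d).restrict S.ΓR) →
      (∀ w, S.H1D w → S.b w ξ = (∫ x in S.Ω, w x * conj (F0 x))
        + ∫ x in S.ΓR, trace S.Ω w x * conj (F1 x) ∂(surf d)) →
      ‖M.dataForm F0 F1 e‖ ≤ r * M.dagNorm p (ξ - M.πhg p ξ)
        + c * M.dagDivNorm (S.flux ξ - M.πhd p (S.flux ξ))) :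
    ENNReal.ofReal ‖S.robinL2 (M.trR e)‖
      ≤ ENNReal.ofReal r * M.gaRg p + ENNReal.ofReal c * M.gaRd p := by
  set a := ‖S.robinL2 (M.trR e)‖ with ha
  by_cases h0 : a = 0
  · simp [h0]
  have hω : ((√S.ω : ℝ) : ℂ) ≠ 0 := Complex.ofReal_ne_zero.2 (Real.sqrt_pos.2 S.ω_pos).ne'
  have hωω : (S.ω : ℂ) = ((√S.ω : ℝ) : ℂ) * ((√S.ω : ℝ) : ℂ) := by
    rw [← Complex.ofReal_mul, Real.mul_self_sqrt S.ω_pos.le]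
  have haC : (a : ℂ) ≠ 0 := Complex.ofReal_ne_zero.2 h0
  have hte := he.memLp_trR hd
  have hself : inner ℂ (S.robinL2 (M.trR e)) (S.robinL2 (M.trR e)) = (a : ℂ) ^ 2 :=
    inner_self_eq_norm_sq_to_K _
  set Ψ : Vec d → ℂ := ((√S.ω / a : ℝ) : ℂ) • M.trR e with hΨ
  have hΨm : MemLp Ψ 2 ((surf d).restrict S.ΓR) := hte.const_smul _
  have e1 : S.ipγ Ψ Ψ = 1 := by
    have h := inner_robinL2 M hd hΨm hΨm
    rw [hΨ, robinL2_smul M hd _ hte, inner_smul_left, inner_smul_right, hself,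
      Complex.conj_ofReal, hωω] at h
    refine mul_left_cancel₀ (mul_ne_zero hω hω) (h.symm.trans ?_)
    push_cast
    field_simp
  have e2 : ((√S.ω : ℝ) : ℂ) * S.ipγ (M.trR e) Ψ = a := by
    have h := inner_robinL2 M hd hΨm hte
    rw [hΨ, robinL2_smul M hd _ hte, inner_smul_left, hself, Complex.conj_ofReal, hωω] at h
    refine mul_left_cancel₀ hω ?_
    rw [← mul_assoc, ← h]
    push_cast
    field_simp
  obtain ⟨hξ, hb⟩ := UStar_spec M hd hS hΨm
  have hF : ∀ w : Vec d → ℂ,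
      ∫ x in S.ΓR, w x * conj (((√S.ω : ℝ) : ℂ) * ((S.γ x : ℂ) * Ψ x)) ∂(surf d)
      = ((√S.ω : ℝ) : ℂ) * S.ipγ w Ψ := fun w => by
    rw [HelmholtzData.ipγ, ← integral_const_mul]
    refine integral_congr_ae (Eventually.of_forall fun x => ?_)
    simp only [map_mul, Complex.conj_ofReal]
    ring
  have h := H (S.UStar Ψ) 0 (fun x => ((√S.ω : ℝ) : ℂ) * ((S.γ x : ℂ) * Ψ x)) hξ
    MemLp.zero ((M.memLp_γ hd id hΨm).const_mul _) fun w hw => by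
      rw [hb w hw, hF]
      simp
  have hd : M.dataForm 0 (fun x => ((√S.ω : ℝ) : ℂ) * ((S.γ x : ℂ) * Ψ x)) e = a := by
    rw [dataForm, hF, e2]
    simp
  rw [hd, Complex.norm_real, Real.norm_of_nonneg (norm_nonneg _)] at h
  exact ofReal_le_add_mul hr hc h
    (le_iSup₂ (f := fun Ψ (_ : M.UnitR Ψ) =>
      ENNReal.ofReal (M.dagNorm p (S.UStar Ψ - M.πhg p (S.UStar Ψ)))) Ψ ⟨hΨm, e1⟩)
    (le_iSup₂ (f := fun Ψ (_ : M.UnitR Ψ) => ENNReal.ofReal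
      (M.dagDivNorm (S.flux (S.UStar Ψ) - M.πhd p (S.flux (S.UStar Ψ))))) Ψ ⟨hΨm, e1⟩)

/-! ### The error estimate -/

/-- Expanding `‖x - y‖²` leaves `2 D ‖y‖ - ‖y‖²`, which is at most `D²`. Compared with a triangle
inequality, this keeps the constant 1 in front of both contributions. -/
theorem norm_sq_le_of_inner_le {H : Type*} [NormedAddCommGroup H] [InnerProductSpace ℂ H]
    {x y : H} {D : ℝ} (h : ‖(inner ℂ y x : ℂ)‖ ≤ D * ‖y‖) : ‖x‖ ^ 2 ≤ ‖x - y‖ ^ 2 + D ^ 2 := by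
  have h1 := norm_sub_sq (𝕜 := ℂ) x y
  have h2 : RCLike.re (inner ℂ x y : ℂ) ≤ D * ‖y‖ := by
    rw [← norm_inner_symm] at h
    exact (RCLike.re_le_norm _).trans h
  nlinarith [sq_nonneg (D - ‖y‖)]

/-- Restoring positive signs in `helmForm` costs 2 times the mass product and `1 + i` times the
Robin product. The moduli 2 and `√2` are squared by the Cauchy–Schwarz inequality in three
components, whence the constants 4 and 2. -/
theorem norm_inner_le_of_helmForm_le {x y : EnergySpace S} {r : ℝ}
    (h : ‖helmForm x y‖ ≤ r * ‖y.snd.snd‖) :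
    ‖(inner ℂ y x : ℂ)‖ ≤ √(r ^ 2 + 4 * ‖x.fst‖ ^ 2 + 2 * ‖x.snd.fst‖ ^ 2) * ‖y‖ := by
  have e : (inner ℂ y x : ℂ) = helmForm x y + 2 * inner ℂ y.fst x.fst
      + (1 + Complex.I) * inner ℂ y.snd.fst x.snd.fst := by
    rw [WithLp.prod_inner_apply, WithLp.prod_inner_apply, helmForm]
    simp only [WithLp.ofLp_fst, WithLp.ofLp_snd]
    ring
  have hI : ‖(1 + Complex.I : ℂ)‖ = √2 := by
    rw [Complex.norm_def]
    congr 1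
    simp [Complex.normSq_apply]
    norm_num
  have h1 := norm_inner_le_norm (𝕜 := ℂ) y.fst x.fst
  have h2 := norm_inner_le_norm (𝕜 := ℂ) y.snd.fst x.snd.fst
  have hb : ‖(inner ℂ y x : ℂ)‖ ≤ r * ‖y.snd.snd‖ + 2 * ‖x.fst‖ * ‖y.fst‖
      + √2 * ‖x.snd.fst‖ * ‖y.snd.fst‖ := by
    rw [e]
    refine (norm_add_le _ _).trans (add_le_add ((norm_add_le _ _).trans (add_le_add h ?_)) ?_)
    · rw [norm_mul, Complex.norm_ofNat]
      nlinarith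
    · rw [norm_mul, hI]
      nlinarith [Real.sqrt_nonneg 2]
  have hy : ‖y‖ = √(‖y.fst‖ ^ 2 + (‖y.snd.fst‖ ^ 2 + ‖y.snd.snd‖ ^ 2)) := by
    rw [← WithLp.prod_norm_sq_eq_of_L2, ← WithLp.prod_norm_sq_eq_of_L2,
      Real.sqrt_sq (norm_nonneg _)]
  have hq : √2 ^ 2 = 2 := Real.sq_sqrt (by norm_num)
  rw [hy, ← Real.sqrt_mul (by positivity)]
  refine hb.trans (Real.le_sqrt_of_sq_le ?_)
  have h4 : 2 * ‖x.snd.fst‖ ^ 2 = (√2 * ‖x.snd.fst‖) ^ 2 := by rw [mul_pow, hq]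
  rw [h4]
  nlinarith [sq_nonneg (r * ‖y.fst‖ - 2 * ‖x.fst‖ * ‖y.snd.snd‖),
    sq_nonneg (r * ‖y.snd.fst‖ - √2 * ‖x.snd.fst‖ * ‖y.snd.snd‖),
    sq_nonneg (2 * ‖x.fst‖ * ‖y.snd.fst‖ - √2 * ‖x.snd.fst‖ * ‖y.fst‖)]

/-- The approximation factors may be infinite, so the Cauchy–Schwarz inequality is proved in `[0,
∞]`, through an arithmetic–geometric mean inequality that avoids subtraction. -/
theorem add_mul_sq_le (x y z w : ℝ≥0∞) :
    (x * y + z * w) ^ 2 ≤ (x ^ 2 + z ^ 2) * (y ^ 2 + w ^ 2) := by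
  have amgm : ∀ a b : ℝ≥0∞, 2 * a * b ≤ a ^ 2 + b ^ 2 := by
    intro a b
    by_cases ha : a = ⊤
    · simp [ha]
    by_cases hb : b = ⊤
    · simp [hb]
    lift a to ℝ≥0 using ha
    lift b to ℝ≥0 using hb
    exact_mod_cast two_mul_le_add_sq a b
  calc (x * y + z * w) ^ 2 = x ^ 2 * y ^ 2 + z ^ 2 * w ^ 2 + 2 * (x * w) * (z * y) := by ring
    _ ≤ x ^ 2 * y ^ 2 + z ^ 2 * w ^ 2 + ((x * w) ^ 2 + (z * y) ^ 2) := by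
      gcongr
      exact amgm _ _
    _ = _ := by ring

/-- Reliability, for finite residuals. -/
theorem ofReal_energyNorm_sq_le (hd : 2 ≤ d) (hS : S.WellPosed) {p : ℕ} {st : Stabilization M}
    {f u uh : Vec d → ℂ} (hu : S.H1D u)
    (hu_eq : ∀ v, S.H1D v → S.b u v = ∫ x in S.Ω, f x * conj (v x))
    (huh : M.IsDiscrete p uh)
    (huh_eq : ∀ vh, M.IsDiscrete p vh → bh p st uh vh = ∫ x in S.Ω, f x * conj (vh x))
    (hr : Rr p st u uh ≠ ⊤) :
    ENNReal.ofReal (M.energyNorm p (u - uh)) ^ 2 ≤ (1 + M.γbaSq p) * RSq p st u uh := by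
  have hd1 : 1 ≤ d := by omega
  have tu := M.traced_of_H1D hd1 hu
  have tuh := M.traced_of_isDiscrete hd1 huh
  have te := tu.sub tuh
  have hg := M.πg_mem p uh
  have tg := M.traced_of_H1D hd1 hg
  have tn := tuh.sub tg
  have hc : S.H1D (u - M.πg p uh) := hu.sub hg
  have hc0 : 0 ≤ M.Rc p uh := Real.sqrt_nonneg _
  have hr0 : 0 ≤ (Rr p st u uh).toReal := ENNReal.toReal_nonneg
  have H := fun ξ F0 F1 (h1 : S.H1D ξ) h2 h3 h4 =>
    norm_dataForm_le hd (st := st) (F0 := F0) (F1 := F1) hu hu_eq huh huh_eq hr h1 h2 h3 h4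
  have hA := ofReal_massL2_le hd1 hS te hr0 hc0 H
  have hT := ofReal_robinL2_le hd1 hS te hr0 hc0 H
  -- The comparison function is `u - πg uh`: being conforming, it is admissible in the residual, and
  -- its distance to the error is the nonconformity of `uh`.
  have hin := norm_inner_le_of_helmForm_le (norm_residual_le hd1 te hr hc)
  have hsq := norm_sq_le_of_inner_le hin
  have hdiff : M.embed p (u - uh) - M.embed p (u - M.πg p uh) = -M.embed p (uh - M.πg p uh) := by
    rw [tu.embed_sub hd1 tuh, tu.embed_sub hd1 tg, tuh.embed_sub hd1 tg]
    abel
  have hn : ‖M.embed p (uh - M.πg p uh)‖ ≤ M.Rc p uh := by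
    rw [← tn.energyNorm_eq hd1]
    exact tn.energyNorm_le_dagNorm hd p
  rw [hdiff, norm_neg, Real.sq_sqrt (by positivity), ← te.energyNorm_eq hd1] at hsq
  have hE : 0 ≤ M.energyNorm p (u - uh) := Real.sqrt_nonneg _
  have hbound : M.energyNorm p (u - uh) ^ 2 ≤ M.Rc p uh ^ 2 + ((Rr p st u uh).toReal ^ 2
      + 4 * ‖S.massL2 (u - uh)‖ ^ 2 + 2 * ‖S.robinL2 (M.trR (u - uh))‖ ^ 2) :=
    hsq.trans (add_le_add (pow_le_pow_left₀ (norm_nonneg _) hn 2) le_rfl)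
  have hE2 : ENNReal.ofReal (M.energyNorm p (u - uh)) ^ 2 ≤ ENNReal.ofReal (M.Rc p uh) ^ 2
      + (Rr p st u uh ^ 2 + 4 * ENNReal.ofReal ‖S.massL2 (u - uh)‖ ^ 2
        + 2 * ENNReal.ofReal ‖S.robinL2 (M.trR (u - uh))‖ ^ 2) := by
    rw [← ENNReal.ofReal_pow hE]
    refine (ENNReal.ofReal_le_ofReal hbound).trans_eq ?_
    rw [ENNReal.ofReal_add (by positivity) (by positivity), ENNReal.ofReal_add (by positivity)
      (by positivity), ENNReal.ofReal_add (by positivity) (by positivity),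
      ENNReal.ofReal_mul (by norm_num), ENNReal.ofReal_mul (by norm_num),
      ENNReal.ofReal_pow hc0, ENNReal.ofReal_pow hr0, ENNReal.ofReal_pow (norm_nonneg _),
      ENNReal.ofReal_pow (norm_nonneg _), ENNReal.ofReal_toReal hr, ENNReal.ofReal_ofNat,
      ENNReal.ofReal_ofNat]
  rw [ENNReal.ofReal_toReal hr] at hA hT
  set R := Rr p st u uh
  set C := ENNReal.ofReal (M.Rc p uh)
  calc ENNReal.ofReal (M.energyNorm p (u - uh)) ^ 2
      ≤ C ^ 2 + (R ^ 2 + 4 * ENNReal.ofReal ‖S.massL2 (u - uh)‖ ^ 2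
        + 2 * ENNReal.ofReal ‖S.robinL2 (M.trR (u - uh))‖ ^ 2) := hE2
    _ ≤ C ^ 2 + (R ^ 2 + 4 * ((R ^ 2 + C ^ 2) * (M.gaΩg p ^ 2 + M.gaΩd p ^ 2))
        + 2 * ((R ^ 2 + C ^ 2) * (M.gaRg p ^ 2 + M.gaRd p ^ 2))) := by
      gcongr
      · exact (pow_le_pow_left₀ zero_le hA 2).trans (add_mul_sq_le _ _ _ _)
      · exact (pow_le_pow_left₀ zero_le hT 2).trans (add_mul_sq_le _ _ _ _)
    _ = (1 + M.γbaSq p) * RSq p st u uh := by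
      rw [γbaSq, RSq]
      ring

end Mesh

end IPDG

/-! ### Abstract reliability. -/

theorem theorem5p2 {d : ℕ} (hd : d = 2 ∨ d = 3)
    (S : IPDG.HelmholtzData d) (hS : S.WellPosed)
    (M : IPDG.Mesh S) (p : ℕ) (hp : 1 ≤ p) (st : IPDG.Mesh.Stabilization M)
    (f : IPDG.Vec d → ℂ) (hf : MemLp f 2 (volume.restrict S.Ω))
    (u : IPDG.Vec d → ℂ) (hu : S.H1D u)
    (hu_eq : ∀ v, S.H1D v → S.b u v = ∫ x in S.Ω, f x * conj (v x))
    (uh : IPDG.Vec d → ℂ) (huh : M.IsDiscrete p uh)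
    (huh_eq : ∀ vh, M.IsDiscrete p vh →
      IPDG.Mesh.bh p st uh vh = ∫ x in S.Ω, f x * conj (vh x)) :
    ENNReal.ofReal (M.energyNorm p (u - uh)) ≤
      (1 + M.γbaSq p) ^ (1 / 2 : ℝ) * IPDG.Mesh.RSq p st u uh ^ (1 / 2 : ℝ) := by
  have hd2 : 2 ≤ d := by omega
  -- An infinite residual makes the right-hand side infinite, because the factor `1 + M.γbaSq p` is
  -- never zero.
  by_cases hr : IPDG.Mesh.Rr p st u uh = ⊤
  · have h1 : IPDG.Mesh.RSq p st u uh = ⊤ := by simp [IPDG.Mesh.RSq, hr]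
    have h2 : (1 + M.γbaSq p) ^ (1 / 2 : ℝ) ≠ 0 := by simp
    rw [h1, ENNReal.top_rpow_of_pos (by norm_num), ENNReal.mul_top h2]
    exact le_top
  · have h := IPDG.Mesh.ofReal_energyNorm_sq_le hd2 hS hu hu_eq huh huh_eq hr
    rw [← ENNReal.mul_rpow_of_nonneg _ _ (by norm_num)]
    refine le_trans (le_of_eq ?_) (ENNReal.rpow_le_rpow h (by norm_num))
    rw [← ENNReal.rpow_natCast, ← ENNReal.rpow_mul]
    norm_num
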